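/- Let $\mathbb K$ be a field of characteristic $0$ (for instance a subfield of $\mathbb C$). For integers $b\ge 2$, $r\ge 1$ and polynomials $\ell_0,\dots,\ell_r\in\mathbb K[x]$ with $\ell_0\ne0$, $\ell_r\neq 0$, consider the linear Mahler equation $$Ly=\ell_r(x)\,y(x^{b^r})+\dots+\ell_1(x)\,y(x^b)+\ell_0(x)\,y(x)=0 .\qquad(\ast)$$ Write $Mp(x)=p(x^b)$, and let $Gp=\operatorname{Res}_y(y^b-x,p(y))$. **Algorithm (Rational solutions).** Input: $b$ and $(\ast)$, with polynomials in dense representation. 1. Set $\delta=\max_k\deg \ell_k$. If $\delta<b^{r-1}$, return $(1)$ if $L(1)=0$ and $()$ otherwise. 2. Set $\ell:=\ell_r$. For $k=1,2,\dots$: write $\ell=\sum_{0\le i<b^r}x^iM^rf_i$, set $u_k:=\gcd_i f_i$ and $\ell:=(\ell/M^ru_k)\cdot\operatorname{lcm}_{0\le i<r}M^iu_k$, until $\deg u_k=0$; set $t=k-1$. Write the last $\ell$ as $\sum_{0\le i<b^{r-1}}x^iM^{r-1}f_i$, set $\tilde u:=\gcd_i f_i$ and $q^\star:=u_1\cdots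 u_t\,(G\tilde u)$ (the denominator bound, up to a power of $x$). Set $\bar v=\lfloor \delta/(b^r-b^{r-1})\rfloor$. 3. For $0\le k\le r$ set $e_k=\lfloor b\delta/(b-1)\rfloor-b^k\bar v$ and $\tilde\ell_k=x^{e_k}\ell_k\prod_{0\le i\le r,\,i\ne k}M^iq^\star$; set $\tilde L=\sum_k\tilde\ell_kM^k$ and $w=\deg q^\star+2\bar v+1$. 4. Compute a basis $(p_1,\dots,p_\sigma)$ of the polynomial solutions of $\tilde Lp=0$ of degree less than $w$, as follows. Let $v_k$ and $d_k$ be the valuation and the degree of $\tilde\ell_k$. If $\max_{k\ge1}(v_0-v_k)/(b^k-1)<0$, the basis is empty. Otherwise let $R$ be the matrix whose $m$-th row expresses the coefficient of $x^m$ in $\tilde L\bigl(\sum_n y_nx^n\bigr)$ in terms of the $y_n$. Find by backward substitution a basis of the kernel of the upper triangular $w\times w$ submatrix with rows of index $\max_k(d_k+nb^k)$, $0\le n<w$, and columns of index $<w$. Apply $\tilde L$ modulo $x^h$, with $h=\max_kd_k+(w-1)b^r+1$, to the corresponding polynomials. Compute the kernel of the resulting matrix of coefficients, and recombine. 5. Return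 $\bigl(p_k/(x^{\bar v}q^\star)\bigr)_{1\le k\le\sigma}$. The algorithm calls subroutines for polynomial multiplication, gcd, exact division, the operator $G$ (in radix $b$), and the kernel of a matrix. Cost is measured in *ops*: arithmetic operations and zero tests in $\mathbb K$. **Correctness.** With any correct subroutines, the algorithm terminates and returns a $\mathbb K$-basis of the space of solutions $y\in\mathbb K(x)$ of $(\ast)$. **Complexity.** Suppose given an algorithm that multiplies two polynomials of degree at most $n$ in at most $\mathsf M(n)$ ops, where $\mathsf M(n)=O(n^2)$ and $n\mapsto\mathsf M(n)/n$ is nondecreasing on $n\ge1$. Then the subroutines can be chosen, correct and independent of $b$, $r$ and the equation, so that for each fixed $b$ the following bounds hold for all $r\ge1$, all $d\ge b^{r-1}$ and all equations $(\ast)$ with $\deg\ell_k\le d$ for every $k$. The algorithm runs in $$\tilde O\bigl(d\,\mathsf M(d)+2^rd^2+\mathsf M(2^rd)\bigr)\ \text{ops if } b=2,\qquad \tilde O\bigl(b^{-r}d\,\mathsf M(d)\bigr)\ \text{ops if } b\ge3 .$$ If moreover $\mathsf M(n)=\tilde O(n)$, it runs in $\tilde O(2^rd^2)$, hence in $\tilde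 O(d^3)$, ops if $b=2$, and in $\tilde O(b^{-r}d^2)$ ops if $b\ge3$. Here $\tilde O(g)$ means: at most $C\,g\,(\log(3+g))^{e}$ for constants $C,e$ that do not depend on $r$, $d$ or the equation. -/

import Mathlib

open scoped Polynomial

namespace MahlerEq

/-! ## Programs over a field, and the number of their operations

A program works on a memory of field elements.  It sees elements only through the addresses of the
registers that hold them (natural numbers): it can append a constant or the result of an arithmetic
operation to the memory, and branch on whether a register is zero.  Bookkeeping with integers,
addresses and lists is free; every arithmetic operation and every zero test costs one unit ("op").
-/

/-- The four arithmetic operations. -/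
inductive Arith where
  | add | sub | mul | div

/-- The result of an arithmetic operation; dividing by zero has no result. -/
def Arith.eval {K : Type*} [Field K] [DecidableEq K] : Arith → K → K → Option K
  | .add, x, y => some (x + y)
  | .sub, x, y => some (x - y)
  | .mul, x, y => some (x * y)
  | .div, x, y => if y = 0 then none else some (x / y)

/-- Programs over `K` that return a value of type `α` (typically made of register addresses). -/
inductive Prog (K : Type*) (α : Type) where
  /-- stop with a result -/
  | ret (a : α) : Prog K α
  /-- abort -/
  | fail : Prog K α
  /-- append the constant `c` to the memory and go on with its address -/
  | const (c : K) (k : ℕ → Prog K α) : Prog K α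
  /-- append the result of an operation on registers `i`, `j` and go on with its address -/
  | arith (o : Arith) (i j : ℕ) (k : ℕ → Prog K α) : Prog K α
  /-- test whether register `i` holds zero -/
  | isZero (i : ℕ) (k : Bool → Prog K α) : Prog K α

namespace Prog

variable {K : Type*} {α β : Type}

/-- Sequential composition. -/
def bind : Prog K α → (α → Prog K β) → Prog K β
  | ret a, f => f a
  | fail, _ => fail
  | const c k, f => const c fun i => (k i).bind f
  | arith o i j k, f => arith o i j fun l => (k l).bind f
  | isZero i k, f => isZero i fun t => (k t).bind f

instance : Monad (Prog K) where
  pure := ret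
  bind := bind

/-- Execute a program on a memory.  The result consists of the returned value, the final memory
and the number of ops performed; it is `none` if the program aborts, divides by zero, or reads a
register that does not exist. -/
def run [Field K] [DecidableEq K] : Prog K α → List K → Option (α × List K × ℕ)
  | ret a, m => some (a, m, 0)
  | fail, _ => none
  | const c k, m => (k m.length).run (m ++ [c])
  | arith o i j k, m =>
      m[i]?.bind fun x => m[j]?.bind fun y => (o.eval x y).bind fun z =>
        ((k m.length).run (m ++ [z])).map fun s => (s.1, s.2.1, s.2.2 + 1)
  | isZero i k, m =>
      m[i]?.bind fun x => ((k (decide (x = 0))).run m).map fun s => (s.1, s.2.1, s.2.2 + 1)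

/-- On the memory `m`, the program `P` terminates normally, with a returned value, a final memory
and a number of ops that satisfy `Q`. -/
def Yields [Field K] [DecidableEq K] (P : Prog K α) (m : List K) (Q : α → List K → ℕ → Prop) :
    Prop :=
  ∃ a m' c, P.run m = some (a, m', c) ∧ Q a m' c

/-- The constant `c`. -/
def lit (c : K) : Prog K ℕ := const c ret

/-- One arithmetic operation. -/
def op (o : Arith) (i j : ℕ) : Prog K ℕ := arith o i j ret

/-- One zero test. -/
def test (i : ℕ) : Prog K Bool := isZero i ret

end Prog

/-! ## Representation of the data -/

/-- The registers in `a` hold the entries of `v`. -/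
def HoldsVec {K : Type*} (m : List K) (a : List ℕ) (v : List K) : Prop :=
  a.map (fun i => m[i]?) = v.map some

/-- The registers in `a` hold the dense representation of `p`: the coefficients of
`1, x, …, x ^ deg p`, so `deg p + 1` registers if `p ≠ 0` and none if `p = 0`. -/
def HoldsPoly {K : Type*} [Field K] (m : List K) (a : List ℕ) (p : K[X]) : Prop :=
  HoldsVec m a ((List.range p.degree.succ).map p.coeff)

/-- The pair `a` of dense polynomials (numerator, denominator) holds the rational function `y`. -/
def HoldsFrac {K : Type*} [Field K] (m : List K) (a : List ℕ × List ℕ) (y : RatFunc K) : Prop :=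
  ∃ p q : K[X], HoldsPoly m a.1 p ∧ HoldsPoly m a.2 q ∧ q ≠ 0 ∧
    y = algebraMap K[X] (RatFunc K) p / algebraMap K[X] (RatFunc K) q

/-! ## Subroutines -/

/-- The Graeffe operator `p ↦ Res_y (y ^ b - x, p (y))`. -/
noncomputable def graeffe {K : Type*} [Field K] (b : ℕ) (p : K[X]) : K[X] :=
  Polynomial.resultant ((Polynomial.X : K[X][X]) ^ b - Polynomial.C Polynomial.X)
    (p.map Polynomial.C)

/-- The standard subroutines of computer algebra that the solving algorithm calls: multiplication,
gcd and exact division of polynomials, the Graeffe operator of a given radix, and the kernel of a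
matrix (given by the list of its columns; a basis of the kernel is returned). -/
structure Subroutines (K : Type*) where
  mul : List ℕ → List ℕ → Prog K (List ℕ)
  gcd : List ℕ → List ℕ → Prog K (List ℕ)
  div : List ℕ → List ℕ → Prog K (List ℕ)
  graeffe : ℕ → List ℕ → Prog K (List ℕ)
  kernel : List (List ℕ) → Prog K (List (List ℕ))

/-- The subroutines compute what they are meant to compute. -/
structure Subroutines.Correct {K : Type*} [Field K] [DecidableEq K] (S : Subroutines K) :
    Prop where
  mul : ∀ (p q : K[X]) (m : List K) (a b : List ℕ), HoldsPoly m a p → HoldsPoly m b q →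
    (S.mul a b).Yields m fun s m' _ => HoldsPoly m' s (p * q)
  gcd : ∀ (p q : K[X]) (m : List K) (a b : List ℕ), HoldsPoly m a p → HoldsPoly m b q →
    (S.gcd a b).Yields m fun s m' _ => ∃ g, HoldsPoly m' s g ∧ ∀ h, h ∣ g ↔ h ∣ p ∧ h ∣ q
  div : ∀ (p q : K[X]) (m : List K) (a b : List ℕ), q ≠ 0 →
    HoldsPoly m a (p * q) → HoldsPoly m b q →
    (S.div a b).Yields m fun s m' _ => HoldsPoly m' s p
  graeffe : ∀ (b : ℕ) (p : K[X]) (m : List K) (a : List ℕ), 2 ≤ b → p ≠ 0 → HoldsPoly m a p →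
    (S.graeffe b a).Yields m fun s m' _ => HoldsPoly m' s (MahlerEq.graeffe b p)
  kernel : ∀ (h n : ℕ) (A : Matrix (Fin h) (Fin n) K) (m : List K) (a : List (List ℕ)),
    List.Forall₂ (HoldsVec m) a (List.ofFn fun j => List.ofFn fun i => A i j) →
    (S.kernel a).Yields m fun s m' _ => ∃ (k : ℕ) (v : Fin k → Fin n → K),
      List.Forall₂ (HoldsVec m') s (List.ofFn fun j => List.ofFn (v j)) ∧
      LinearIndependent K v ∧ Submodule.span K (Set.range v) = LinearMap.ker A.mulVecLin

/-- `mul` is a program that multiplies two polynomials of degree at most `n` in at most `M n`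
ops. -/
def MultipliesIn {K : Type*} [Field K] [DecidableEq K] (mul : List ℕ → List ℕ → Prog K (List ℕ))
    (M : ℕ → ℝ) : Prop :=
  ∀ (n : ℕ) (p q : K[X]) (m : List K) (a b : List ℕ), p.natDegree ≤ n → q.natDegree ≤ n →
    HoldsPoly m a p → HoldsPoly m b q →
    (mul a b).Yields m fun s m' c => HoldsPoly m' s (p * q) ∧ (c : ℝ) ≤ M n

/-! ## Elementary steps on vectors and dense polynomials -/

section Steps

variable {K : Type*} [Field K]

/-- Remove leading zeros. -/
def dropZeros : List ℕ → Prog K (List ℕ)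
  | [] => pure []
  | c :: a => do
      if ← Prog.test c then dropZeros a else pure (c :: a)

/-- The dense representation of the polynomial with given coefficients: the zeros in highest
degrees are removed. -/
def trim (a : List ℕ) : Prog K (List ℕ) := do
  return (← dropZeros a.reverse).reverse

/-- Coefficientwise sum of two polynomials, not trimmed. -/
def addCoeffs : List ℕ → List ℕ → Prog K (List ℕ)
  | [], b => pure b
  | a, [] => pure a
  | i :: a, j :: b => do
      let s ← Prog.op .add i j
      return s :: (← addCoeffs a b)

/-- Sum of a list of polynomials. -/
def sumPoly (as : List (List ℕ)) : Prog K (List ℕ) := do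
  trim (← as.foldlM addCoeffs [])

/-- Product of a list of polynomials. -/
def prodPoly (S : Subroutines K) (as : List (List ℕ)) : Prog K (List ℕ) := do
  as.foldlM S.mul [← Prog.lit 1]

/-- `x ^ e * p`. -/
def shift (e : ℕ) (a : List ℕ) : Prog K (List ℕ) := do
  let z ← Prog.lit 0
  return if a.isEmpty then [] else List.replicate e z ++ a

/-- `p (x ^ n)`, for `n ≥ 1`. -/
def dilate (n : ℕ) : List ℕ → Prog K (List ℕ)
  | [] => pure []
  | i :: a => do
      let z ← Prog.lit 0
      return i :: a.flatMap fun j => List.replicate (n - 1) z ++ [j]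

/-- The polynomial `f i` in the decomposition of `p` as the sum of the `x ^ i * (f i) (x ^ n)` for
`0 ≤ i < n`. -/
def slice (n i : ℕ) (a : List ℕ) : Prog K (List ℕ) :=
  trim ((a.zipIdx.filter fun c => c.2 % n = i).map Prod.fst)

/-- A polynomial `u` of maximal degree such that `u (x ^ n)` divides `p`: the gcd of the slices. -/
def dilatedFactor (S : Subroutines K) (n : ℕ) (a : List ℕ) : Prog K (List ℕ) :=
  (List.range n).foldlM (fun g i => do S.gcd g (← slice n i a)) []

/-- Least common multiple of nonzero polynomials. -/
def lcm (S : Subroutines K) (a b : List ℕ) : Prog K (List ℕ) := do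
  S.mul a (← S.div b (← S.gcd a b))

/-- The lcm of the `u (x ^ (b ^ i))` for `0 ≤ i < r`. -/
def lcmDilates (S : Subroutines K) (b r : ℕ) (u : List ℕ) : Prog K (List ℕ) := do
  (List.range r).foldlM (fun t i => do lcm S t (← dilate (b ^ i) u)) [← Prog.lit 1]

/-- `Lp`, where `L` is the operator with coefficients `l 0, …, l r`. -/
def applyOp (S : Subroutines K) (b : ℕ) (l : List (List ℕ)) (p : List ℕ) : Prog K (List ℕ) := do
  sumPoly (← l.zipIdx.mapM fun c => do S.mul c.1 (← dilate (b ^ c.2) p))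

/-- The coefficients of `1, x, …, x ^ (h - 1)` in a polynomial. -/
def truncate (h : ℕ) (a : List ℕ) : Prog K (List ℕ) := do
  let z ← Prog.lit 0
  return (List.range h).map fun i => a.getD i z

/-- The number of zero coefficients before the first nonzero one: the valuation of a nonzero
polynomial, and `none` (infinity) for the zero polynomial. -/
def valuation : List ℕ → Prog K (Option ℕ)
  | [] => pure none
  | i :: a => do
      if ← Prog.test i then return (← valuation a).map (· + 1) else return some 0

end Steps

/-! ## Denominator bound -/

section DenominatorBound

variable {K : Type*} [Field K]

/-- The loop of the denominator bound: repeatedly take `u` of maximal degree such that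
`M ^ r u ∣ l`, replace `l` by `(l / M ^ r u) * lcm (u, M u, …, M ^ (r - 1) u)`, until `u` is
constant.  The final `l` and the list `us` of nonconstant `u` are returned.  The first argument
bounds the number of passes; the program aborts if this bound is not sufficient. -/
def denomLoop (S : Subroutines K) (b r : ℕ) :
    ℕ → List ℕ → List (List ℕ) → Prog K (List ℕ × List (List ℕ))
  | 0, _, _ => Prog.fail
  | fuel + 1, l, us => do
      let u ← dilatedFactor S (b ^ r) l
      let l' ← S.mul (← S.div l (← dilate (b ^ r) u)) (← lcmDilates S b r u)
      if u.length ≤ 1 then return (l', us) else denomLoop S b r fuel l' (us ++ [u])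

/-- A denominator bound from the leading coefficient `l` of the equation; `1 + deg l` passes
through the loop are allowed. -/
def denomBound (S : Subroutines K) (b r : ℕ) (l : List ℕ) : Prog K (List ℕ) := do
  let s ← denomLoop S b r l.length l []
  let u ← dilatedFactor S (b ^ (r - 1)) s.1
  prodPoly S (s.2 ++ [← S.graeffe b u])

end DenominatorBound

/-! ## Polynomial solutions of bounded degree

The coefficient of `x ^ i` in `Ly`, for `y = ∑ n, y n * x ^ n`, is `∑ n, R i n * y n`, where `R` is
an infinite matrix with `R i n = ∑ k, (l k).coeff (i - b ^ k * n)`.  Its rows are stored in sparse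
form, as lists of pairs (column index, register). -/

section PolynomialSolutions

variable {K : Type*} [Field K]

/-- Add register `c` to the entry of index `n` of a sparse row. -/
def addEntry (n c : ℕ) : List (ℕ × ℕ) → Prog K (List (ℕ × ℕ))
  | [] => pure [(n, c)]
  | e :: row => do
      if e.1 = n then return (n, ← Prog.op .add e.2 c) :: row
      else return e :: (← addEntry n c row)

/-- The first `w` entries of the row of index `i` of the matrix `R`. -/
def buildRow (b : ℕ) (l : List (List ℕ)) (w i : ℕ) : Prog K (List (ℕ × ℕ)) :=
  (l.zipIdx.flatMap fun a => a.1.zipIdx.filterMap fun c =>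
      if c.2 ≤ i ∧ c.2 % b ^ a.2 = i % b ^ a.2 ∧ i < c.2 + b ^ a.2 * w then
        some ((i - c.2) / b ^ a.2, c.1)
      else none).foldlM (fun row e => addEntry e.1 e.2 row) []

/-- `∑ n, (row n) * (g (n - s))` over the entries of index `n ≥ s` of a sparse row. -/
def dotRow (row : List (ℕ × ℕ)) (s : ℕ) (g : List ℕ) : Prog K ℕ := do
  (row.filter fun e => s ≤ e.1).foldlM (fun acc e => do
      match g[e.1 - s]? with
      | none => Prog.fail
      | some j => Prog.op .add acc (← Prog.op .mul e.2 j)) (← Prog.lit 0)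

/-- From vectors `g` with values `v` (pairs `(g, v)`) of a linear form, a basis of the kernel of
the form on the span of the vectors. -/
def eliminate : List (List ℕ × ℕ) → Prog K (List (List ℕ))
  | [] => pure []
  | (g, v) :: gs => do
      if ← Prog.test v then return g :: (← eliminate gs)
      else gs.mapM fun e => do
        let q ← Prog.op .div e.2 v
        (e.1.zip g).mapM fun c => do Prog.op .sub c.1 (← Prog.op .mul q c.2)

/-- Backward substitution: a basis of the kernel of an upper triangular matrix, given by the list
of its sparse rows.  The list passed is that of the rows of index `≥ i`, and the vectors returned
have the coordinates of index `≥ i`. -/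
def backSubst : ℕ → List (List (ℕ × ℕ)) → Prog K (List (List ℕ))
  | _, [] => pure []
  | i, row :: rows => do
      let G ← backSubst (i + 1) rows
      let z ← Prog.lit 0
      let vals ← G.mapM (dotRow row (i + 1))
      let diag := (row.find? fun e => e.1 = i).elim z Prod.snd
      if ← Prog.test diag then
        let one ← Prog.lit 1
        return (one :: List.replicate rows.length z) ::
          (← eliminate (G.zip vals)).map (fun g => z :: g)
      else
        (G.zip vals).mapM fun e => do
          return (← Prog.op .div (← Prog.op .sub z e.2) diag) :: e.1

/-- The linear combination, with coefficients `c`, of vectors `G` of length `w`. -/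
def combine (w : ℕ) (G : List (List ℕ)) (c : List ℕ) : Prog K (List ℕ) := do
  (c.zip G).foldlM (fun acc e => (acc.zip e.2).mapM fun x => do
      Prog.op .add x.1 (← Prog.op .mul e.1 x.2)) (List.replicate w (← Prog.lit 0))

/-- Solutions over prescribed monomial support: a basis of the kernel of the map induced by `L`
from polynomials of degree `< w` to polynomials modulo `x ^ h`, provided that the rows of `R` with
index in `E` form an upper triangular matrix. -/
def solvePrescribed (S : Subroutines K) (b : ℕ) (l : List (List ℕ)) (h w : ℕ) (E : List ℕ) :
    Prog K (List (List ℕ)) := do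
  let rows ← E.mapM (buildRow b l w)
  let G ← backSubst 0 rows
  let cols ← G.mapM fun g => do truncate h (← applyOp S b l (← trim g))
  let N ← S.kernel cols
  N.mapM fun c => do trim (← combine w G c)

/-- The number `ν`, the maximum of `(v 0 - v k) / (b ^ k - 1)` over `k ≥ 1`, from the valuations
of the coefficients (`none` for infinity, which does not contribute). -/
def nu (b : ℕ) (v : List (Option ℕ)) : WithBot ℚ :=
  match v with
  | some v0 :: vs => (vs.zipIdx.filterMap fun e =>
      e.1.map fun vk => ((v0 : ℚ) - vk) / ((b : ℚ) ^ (e.2 + 1) - 1)).maximum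
  | _ => ⊥

/-- The pairs `(k, d k)` for the nonzero coefficients of `L`, where `d k` is the degree. -/
def degrees (l : List (List ℕ)) : List (ℕ × ℕ) :=
  l.zipIdx.filterMap fun a => if a.1.isEmpty then none else some (a.2, a.1.length - 1)

/-- A basis of the polynomial solutions of degree `< w` of `Ly = 0`, for `L` of order `r`. -/
def polySolutions (S : Subroutines K) (b r : ℕ) (l : List (List ℕ)) (w : ℕ) :
    Prog K (List (List ℕ)) := do
  let v ← l.mapM valuation
  if nu b v < 0 then return []
  else
    let d := degrees l
    solvePrescribed S b l ((d.map Prod.snd).foldr max 0 + (w - 1) * b ^ r + 1) w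
      ((List.range w).map fun n => (d.map fun e => e.2 + n * b ^ e.1).foldr max 0)

end PolynomialSolutions

/-! ## Rational solutions -/

/-- The algorithm "Rational solutions" for the equation of order `r` in radix `b` with the
coefficients `l = [l 0, …, l r]`, each in dense representation.  It returns a list of fractions
(numerator, denominator). -/
def ratSolutions {K : Type*} [Field K] (S : Subroutines K) (b r : ℕ) (l : List (List ℕ)) :
    Prog K (List (List ℕ × List ℕ)) := do
  let δ := (l.map List.length).foldr max 0 - 1
  if δ < b ^ (r - 1) then
    let s ← sumPoly l
    let one ← Prog.lit 1
    return if s.isEmpty then [([one], [one])] else []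
  else
    let q ← denomBound S b r (l.getD r [])
    let vbar := δ / (b ^ r - b ^ (r - 1))
    let l' ← l.zipIdx.mapM fun a => do
      let c ← ((List.range (r + 1)).filter fun i => i ≠ a.2).foldlM
        (fun acc i => do S.mul acc (← dilate (b ^ i) q)) a.1
      shift (b * δ / (b - 1) - b ^ a.2 * vbar) c
    let ps ← polySolutions S b r l' ((q.length - 1) + 2 * vbar + 1)
    let den ← shift vbar q
    return ps.map fun p => (p, den)

/-- `y` is a solution of `l r (x) y (x ^ (b ^ r)) + ⋯ + l 1 (x) y (x ^ b) + l 0 (x) y (x) = 0`. -/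
def IsSolution {K : Type*} [Field K] (b : ℕ) {r : ℕ} (l : Fin (r + 1) → K[X]) (y : RatFunc K) :
    Prop :=
  ∑ k, algebraMap K[X] (RatFunc K) (l k) * y.eval RatFunc.C (RatFunc.X ^ b ^ (k : ℕ)) = 0

/-- The fractions held by `out` form a basis over `K` of the space of rational solutions. -/
def HoldsSolutionBasis {K : Type*} [Field K] (b : ℕ) {r : ℕ} (l : Fin (r + 1) → K[X]) (m : List K)
    (out : List (List ℕ × List ℕ)) : Prop :=
  ∃ (n : ℕ) (y : Fin n → RatFunc K), List.Forall₂ (HoldsFrac m) out (List.ofFn y) ∧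
    LinearIndependent K y ∧
    (Submodule.span K (Set.range y) : Set (RatFunc K)) = {f | IsSolution b l f}

/-- The bound `C * g * (log (3 + g)) ^ e`, which is `Õ(g)` when `C` and `e` are constants. -/
noncomputable def soft (C : ℝ) (e : ℕ) (g : ℝ) : ℝ := C * g * Real.log (3 + g) ^ e

/-- In radix `b`, with the subroutines `S`, the algorithm runs in `Õ(g r d)` ops on the equations
of order `r ≥ 1` with coefficients of degree at most `d`, where `d ≥ b ^ (r - 1)`. -/
def RunsInSoftO {K : Type*} [Field K] [DecidableEq K] (S : Subroutines K) (b : ℕ)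
    (g : ℕ → ℕ → ℝ) : Prop :=
  ∃ (C : ℝ) (e : ℕ), ∀ (r d : ℕ) (l : Fin (r + 1) → K[X]) (m : List K) (a : Fin (r + 1) → List ℕ),
    1 ≤ r → l 0 ≠ 0 → l (Fin.last r) ≠ 0 → (∀ k, (l k).natDegree ≤ d) → b ^ (r - 1) ≤ d →
    (∀ k, HoldsPoly m (a k) (l k)) →
    (ratSolutions S b r (List.ofFn a)).Yields m fun _ _ c => (c : ℝ) ≤ soft C e (g r d)

end MahlerEq

/-!
Correctness and cost are proved by one and the same analysis of the programs: `Spec φ P m B Q` says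
that `P`, started on the memory `m`, ends with a result that satisfies `Q`, and does so in at most
`B` ops if `φ` holds.  For arbitrary correct subroutines this is used with `φ = False`, for fast
subroutines with `φ = True`.

**Denominators.**  Let `P / Q` be a rational solution in lowest terms.  The pole of highest order
in the term `ℓ_r y(x ^ (b ^ r))` must be compensated by the other terms or by a zero of `ℓ_r`
(`mult_expand_le`).  At `0` and at infinity this bounds the order of the pole and the degree
(`mult_zero_le`, `natDegree_le_of_solution`).  At the other points it is the inequality `PoleBound`
between the pole orders and the multiplicities of the roots of `ℓ_r`.  A pass through the loop,
which extracts a factor `u` with `u(x ^ (b ^ r)) ∣ ℓ`, preserves this inequality once the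
multiplicities of `u` are subtracted from the pole orders (`LoopStep.poleBound`), and it lowers the
degree of `ℓ` whenever `u` is not constant (`LoopStep.natDegree_add_le`), whence termination.  When
the loop ends, every nonzero point has a `b ^ r`-th root at which `ℓ` does not vanish, so every pole
that is left has a pole behind it on its backward orbit under `z ↦ z ^ b`; as poles are finite in
number, they are all periodic.  A pole has at least two `b`-th roots and one of them is not periodic;
going back from there no pole is met, and `PoleBound` says that `ℓ` vanishes to the order of the
pole at all the `b ^ (r - 1)`-th roots of this root (`PoleBound.exists_pow_eq`).  It is therefore a
root of `ũ`, to that order, and the Graeffe operator sends it to the pole (`le_mult_graeffe`).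
Hence `denom_dvd`: the denominator divides `x ^ v̄ q⋆`.

**Numerators.**  The prescribed rows form an upper triangular matrix (`rowEntry_eq_zero`).  A
diagonal entry can vanish only where the maximum of `r + 1` lines with increasing slopes is attained
twice, hence at most `r` times (`card_diag_eq_zero_le`).  So the kernel found by backward
substitution has dimension at most `r`; it contains all polynomial solutions of degree less than
`w`, and these are recovered from the kernel of one more matrix, with at most `r` columns
(`basis_recombine`).  All this is put together in `spec_ratSolutions`, where the cost is expressed
in terms of a factorization `b ^ r = V * W`: every pass through the loop lowers the degree by at
least `V`, so that `V * deg q⋆ ≤ d`, and all polynomials that occur have degree `O(W * d)`.  For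
`b = 2` one takes `V = 1`, and for `b ≥ 3` one takes `V = b ^ (r - 1)`, since then
`1 + b + ⋯ + b ^ (r - 1) ≤ b ^ r - b ^ (r - 1)`.

**Subroutines.**  Given a multiplication in `M(n)` ops, division is done by Newton iteration
(`spec_exactDiv`), the gcd by a divide and conquer version of division steps, which treat the low
order coefficients first (`spec_fastGcd`), the Graeffe operator as the determinant of a `b × b`
matrix (`det_graeffeMatrix`), and kernels by imposing one equation after the other
(`spec_kernelProg`).  The recursions need a cost function that is at most multiplied by a constant
when its argument is doubled, which is not assumed of `M`.  This is achieved by cutting polynomials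
into blocks whose length minimizes the total cost (`blockCost`, `spec_blockMul`).  Lower bounds of
the form `n ≤ M(n)` are needed to absorb the linear time operations; they follow from `1 ≤ M(1)`,
which holds because a program without ops ignores the contents of its memory
(`MultipliesIn.one_le`).
-/

set_option linter.unusedSectionVars false

namespace MahlerEq

/-! ### Dense polynomials -/

section DensePolynomials

variable {K : Type*} [Field K]

/-- The polynomial with given coefficients, in the order of increasing degrees. -/
noncomputable def ofCoeffs (v : List K) : K[X] :=
  ∑ i ∈ Finset.range v.length, Polynomial.monomial i (v.getD i 0)

@[simp]
theorem coeff_ofCoeffs (v : List K) (i : ℕ) : (ofCoeffs v).coeff i = v.getD i 0 := by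
  simp only [ofCoeffs, Polynomial.finsetSum_coeff, Polynomial.coeff_monomial]
  rw [Finset.sum_ite_eq' (Finset.range v.length) i fun j => v.getD j 0]
  split_ifs with h
  · rfl
  · rw [Finset.mem_range, not_lt] at h
    simp [h]

/-- The number of coefficients in the dense representation of a polynomial. -/
noncomputable def size (p : K[X]) : ℕ := p.degree.succ

theorem size_zero : size (0 : K[X]) = 0 := by simp [size]

theorem size_of_ne_zero {p : K[X]} (hp : p ≠ 0) : size p = p.natDegree + 1 := by
  rw [size, Polynomial.degree_eq_natDegree hp]; rfl

theorem size_eq_zero {p : K[X]} : size p = 0 ↔ p = 0 := by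
  by_cases hp : p = 0
  · simp [hp, size_zero]
  · simp [size_of_ne_zero hp, hp]

theorem size_le_iff {p : K[X]} {n : ℕ} : size p ≤ n ↔ ∀ i, n ≤ i → p.coeff i = 0 := by
  rw [← Polynomial.degree_lt_iff_coeff_zero]
  by_cases hp : p = 0
  · simp [hp, size_zero]
  · rw [size_of_ne_zero hp, Polynomial.degree_eq_natDegree hp, Nat.succ_le_iff, Nat.cast_lt]

theorem natDegree_eq_size_sub_one (p : K[X]) : p.natDegree = size p - 1 := by
  by_cases hp : p = 0
  · simp [hp, size_zero]
  · rw [size_of_ne_zero hp]; rfl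

theorem ofCoeffs_range_map (p : K[X]) {n : ℕ} (hn : size p ≤ n) :
    ofCoeffs ((List.range n).map p.coeff) = p := by
  ext i
  rw [coeff_ofCoeffs]
  by_cases h : i < n
  · simp [h]
  · rw [size_le_iff.mp hn i (not_lt.mp h)]
    simp [h]

theorem size_ofCoeffs_le (v : List K) : size (ofCoeffs v) ≤ v.length := by
  rw [size_le_iff]
  intro i hi
  simp [hi]

theorem ofCoeffs_append_replicate (v : List K) (n : ℕ) :
    ofCoeffs (v ++ List.replicate n 0) = ofCoeffs v := by
  ext i
  simp only [coeff_ofCoeffs, List.getD_eq_getElem?_getD, List.getElem?_append,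
    List.getElem?_replicate]
  split_ifs with h h'
  · rfl
  · simp [not_lt.mp h]
  · simp [not_lt.mp h]

end DensePolynomials

/-! ### Running programs -/

variable {K : Type*} {α β γ : Type}

instance : LawfulMonad (Prog K) := by
  have hid : ∀ {α : Type} (x : Prog K α), x.bind Prog.ret = x := by
    intro α x
    induction x with
    | ret a => rfl
    | fail => rfl
    | const c k ih => simp only [Prog.bind]; congr 1; funext i; exact ih i
    | arith o i j k ih => simp only [Prog.bind]; congr 1; funext i; exact ih i
    | isZero i k ih => simp only [Prog.bind]; congr 1; funext i; exact ih i
  have hassoc : ∀ {α β γ : Type} (x : Prog K α) (f : α → Prog K β) (g : β → Prog K γ),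
      (x.bind f).bind g = x.bind fun a => (f a).bind g := by
    intro α β γ x f g
    induction x with
    | ret a => rfl
    | fail => rfl
    | const c k ih => simp only [Prog.bind]; congr 1; funext i; exact ih i
    | arith o i j k ih => simp only [Prog.bind]; congr 1; funext i; exact ih i
    | isZero i k ih => simp only [Prog.bind]; congr 1; funext i; exact ih i
  exact LawfulMonad.mk' (Prog K) (fun x => hid x) (fun _ _ => rfl)
    (fun x f g => hassoc x f g)

variable [Field K] [DecidableEq K]

theorem Prog.run_bind (P : Prog K α) (f : α → Prog K β) (m : List K) :
    (P >>= f).run m = (P.run m).bind fun s =>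
      ((f s.1).run s.2.1).map fun t => (t.1, t.2.1, s.2.2 + t.2.2) := by
  change (P.bind f).run m = _
  induction P generalizing m with
  | ret a => simp [Prog.bind, Prog.run]
  | fail => simp [Prog.bind, Prog.run]
  | const c k ih => simp [Prog.bind, Prog.run, ih]
  | arith o i j k ih =>
    simp only [Prog.bind, Prog.run, ih]
    rcases m[i]? with _ | x <;> rcases m[j]? with _ | y <;> simp
    rcases o.eval x y with _ | z <;> simp
    rcases (k m.length).run (m ++ [z]) with _ | s <;> simp
    rcases (f s.1).run s.2.1 with _ | t <;> simp [add_right_comm]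
  | isZero i k ih =>
    simp only [Prog.bind, Prog.run, ih]
    rcases m[i]? with _ | x <;> simp
    rcases (k (decide (x = 0))).run m with _ | s <;> simp
    rcases (f s.1).run s.2.1 with _ | t <;> simp [add_right_comm]

/-- Programs only append to the memory. -/
theorem Prog.prefix_of_run {P : Prog K α} {m m' : List K} {a : α} {c : ℕ}
    (h : P.run m = some (a, m', c)) : m <+: m' := by
  induction P generalizing m c with
  | ret a => simp [Prog.run] at h; simp [h]
  | fail => simp [Prog.run] at h
  | const x k ih => exact (List.prefix_append m [x]).trans (ih _ (by simpa [Prog.run] using h))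
  | arith o i j k ih =>
    simp only [Prog.run, Option.bind_eq_some_iff, Option.map_eq_some_iff] at h
    obtain ⟨x, -, y, -, z, -, s, hs, h⟩ := h
    simp only [Prod.mk.injEq] at h
    obtain ⟨s1, s2, s3⟩ := s
    simp only at h
    obtain ⟨rfl, rfl, rfl⟩ := h
    exact (List.prefix_append m [z]).trans (ih _ hs)
  | isZero i k ih =>
    simp only [Prog.run, Option.bind_eq_some_iff, Option.map_eq_some_iff] at h
    obtain ⟨x, -, s, hs, h⟩ := h
    simp only [Prod.mk.injEq] at h
    obtain ⟨s1, s2, s3⟩ := s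
    simp only at h
    obtain ⟨rfl, rfl, rfl⟩ := h
    exact ih _ hs

/-- On the memory `m`, the program `P` terminates normally with a returned value and a final memory
that satisfy `Q`; if moreover `φ` holds, it performs at most `B` ops.  With `φ = False` this is
plain correctness, and with `φ = True` correctness together with a cost bound, so that both can be
proved at once. -/
def Spec (φ : Prop) (P : Prog K α) (m : List K) (B : ℕ) (Q : α → List K → Prop) : Prop :=
  ∃ a m' c, P.run m = some (a, m', c) ∧ m <+: m' ∧ Q a m' ∧ (φ → c ≤ B)

variable {φ : Prop} {m m' : List K}

theorem Prog.Yields.spec {P : Prog K α} {Q : α → List K → ℕ → Prop} {Q' : α → List K → Prop}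
    {B : ℕ} (h : P.Yields m Q) (h' : ∀ a m' c, Q a m' c → Q' a m' ∧ (φ → c ≤ B)) :
    Spec φ P m B Q' := by
  obtain ⟨a, m', c, hr, hQ⟩ := h
  exact ⟨a, m', c, hr, Prog.prefix_of_run hr, (h' _ _ _ hQ).1, (h' _ _ _ hQ).2⟩

theorem Spec.yields {P : Prog K α} {Q : α → List K → Prop} {B : ℕ} (h : Spec φ P m B Q) :
    P.Yields m fun a m' c => Q a m' ∧ (φ → c ≤ B) := by
  obtain ⟨a, m', c, hr, _, hQ, hc⟩ := h
  exact ⟨a, m', c, hr, hQ, hc⟩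

theorem Spec.pure {a : α} {Q : α → List K → Prop} (h : Q a m) :
    Spec φ (Pure.pure a) m 0 Q :=
  ⟨a, m, 0, rfl, List.prefix_rfl, h, fun _ => le_rfl⟩

theorem Spec.bind {P : Prog K α} {f : α → Prog K β} {B₁ B₂ : ℕ} {Q₁ : α → List K → Prop}
    {Q₂ : β → List K → Prop} (h : Spec φ P m B₁ Q₁)
    (h' : ∀ a m', m <+: m' → Q₁ a m' → Spec φ (f a) m' B₂ Q₂) :
    Spec φ (P >>= f) m (B₁ + B₂) Q₂ := by
  obtain ⟨a, m', c, hr, hp, hQ, hc⟩ := h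
  obtain ⟨a', m'', c', hr', hp', hQ', hc'⟩ := h' a m' hp hQ
  refine ⟨a', m'', c + c', ?_, hp.trans hp', hQ', fun h => add_le_add (hc h) (hc' h)⟩
  rw [Prog.run_bind, hr]
  simp [hr']

theorem Spec.mono {P : Prog K α} {B B' : ℕ} {Q Q' : α → List K → Prop} (h : Spec φ P m B Q)
    (hB : B ≤ B') (hQ : ∀ a m', m <+: m' → Q a m' → Q' a m') : Spec φ P m B' Q' := by
  obtain ⟨a, m', c, hr, hp, h, hc⟩ := h
  exact ⟨a, m', c, hr, hp, hQ _ _ hp h, fun h => (hc h).trans hB⟩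

theorem Spec.le {P : Prog K α} {B B' : ℕ} {Q : α → List K → Prop} (h : Spec φ P m B Q)
    (hB : B ≤ B') : Spec φ P m B' Q := h.mono hB fun _ _ _ h => h

theorem Spec.imp {P : Prog K α} {B : ℕ} {Q Q' : α → List K → Prop} (h : Spec φ P m B Q)
    (hQ : ∀ a m', m <+: m' → Q a m' → Q' a m') : Spec φ P m B Q' := h.mono le_rfl hQ

theorem Spec.bind_le {P : Prog K α} {f : α → Prog K β} {B₁ B₂ B : ℕ} {Q₁ : α → List K → Prop}
    {Q₂ : β → List K → Prop} (h : Spec φ P m B₁ Q₁)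
    (h' : ∀ a m', m <+: m' → Q₁ a m' → Spec φ (f a) m' B₂ Q₂) (hB : B₁ + B₂ ≤ B) :
    Spec φ (P >>= f) m B Q₂ := (h.bind h').le hB

/-- The cost of a map of a returned value is zero. -/
theorem Spec.map {P : Prog K α} {f : α → β} {B : ℕ} {Q : β → List K → Prop}
    (h : Spec φ P m B fun a m' => Q (f a) m') : Spec φ (P >>= fun a => Pure.pure (f a)) m B Q :=
  h.bind fun _ _ _ h => Spec.pure h

theorem Spec.lit (c : K) : Spec φ (Prog.lit c) m 0 fun i m' => m'[i]? = some c := by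
  refine ⟨m.length, m ++ [c], 0, rfl, List.prefix_append m [c], by simp, fun _ => le_rfl⟩

theorem Spec.op {o : Arith} {i j : ℕ} {x y z : K} (hi : m[i]? = some x) (hj : m[j]? = some y)
    (h : o.eval x y = some z) : Spec φ (Prog.op o i j) m 1 fun l m' => m'[l]? = some z := by
  refine ⟨m.length, m ++ [z], 1, ?_, List.prefix_append m [z], by simp, fun _ => le_rfl⟩
  simp [Prog.op, Prog.run, hi, hj, h]

theorem Spec.test {i : ℕ} {x : K} (hi : m[i]? = some x) :
    Spec φ (Prog.test i : Prog K Bool) m 1 fun t _ => t = decide (x = 0) := by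
  refine ⟨decide (x = 0), m, 1, ?_, List.prefix_rfl, rfl, fun _ => le_rfl⟩
  simp [Prog.test, Prog.run, hi]

/-- A zero test followed by a branch. -/
theorem Spec.ite_test {i : ℕ} {x : K} {P₁ P₂ : Prog K β} {B : ℕ} {Q : β → List K → Prop}
    (hi : m[i]? = some x)
    (h₁ : x = 0 → ∀ m', m <+: m' → Spec φ P₁ m' B Q)
    (h₂ : x ≠ 0 → ∀ m', m <+: m' → Spec φ P₂ m' B Q) :
    Spec φ (Prog.test i >>= fun t => if t then P₁ else P₂) m (1 + B) Q := by
  refine (Spec.test hi).bind fun t m' hm ht => ?_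
  subst ht
  by_cases hx : x = 0
  · simpa [hx] using h₁ hx m' hm
  · simpa [hx] using h₂ hx m' hm

theorem Spec.mapM {f : α → Prog K β} {B : α → ℕ} {R : α → β → List K → Prop} (xs : List α)
    (hR : ∀ x y m₁ m₂, m₁ <+: m₂ → R x y m₁ → R x y m₂)
    (h : ∀ x ∈ xs, ∀ m', m <+: m' → Spec φ (f x) m' (B x) (R x)) :
    Spec φ (xs.mapM f) m (xs.map B).sum fun ys m' => List.Forall₂ (fun x y => R x y m') xs ys := by
  induction xs generalizing m with
  | nil => exact Spec.pure .nil
  | cons x xs ih =>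
    rw [List.mapM_cons, List.map_cons, List.sum_cons]
    refine (h x (by simp) m List.prefix_rfl).bind fun y m₁ h₁ hy => ?_
    refine Spec.map ((ih fun x hx m' hm => h x (by simp [hx]) m' (h₁.trans hm)).imp ?_)
    exact fun ys m₂ h₂ hys => .cons (hR _ _ _ _ h₂ hy) hys

theorem Spec.mapM_le {f : α → Prog K β} {B : ℕ} {R : α → β → List K → Prop} (xs : List α)
    (hR : ∀ x y m₁ m₂, m₁ <+: m₂ → R x y m₁ → R x y m₂)
    (h : ∀ x ∈ xs, ∀ m', m <+: m' → Spec φ (f x) m' B (R x)) :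
    Spec φ (xs.mapM f) m (xs.length * B)
      fun ys m' => List.Forall₂ (fun x y => R x y m') xs ys := by
  have := Spec.mapM (B := fun _ => B) xs hR h
  simpa using this

/-- Loop rule: the invariant `I` depends on the list of the elements processed so far. -/
theorem Spec.foldlM {f : β → α → Prog K β} {B : α → ℕ} (I : List α → β → List K → Prop)
    (xs : List α) (b : β) (h₀ : I [] b m)
    (h : ∀ l₁ x l₂, xs = l₁ ++ x :: l₂ → ∀ b' m', m <+: m' → I l₁ b' m' →
      Spec φ (f b' x) m' (B x) (I (l₁ ++ [x]))) :
    Spec φ (xs.foldlM f b) m (xs.map B).sum (I xs) := by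
  suffices H : ∀ (l₁ l₂ : List α) (b' : β) (m' : List K), xs = l₁ ++ l₂ → m <+: m' → I l₁ b' m' →
      Spec φ (l₂.foldlM f b') m' (l₂.map B).sum (I xs) from H [] xs b m rfl List.prefix_rfl h₀
  intro l₁ l₂
  induction l₂ generalizing l₁ with
  | nil =>
    intro b' m' hx _ hI
    rw [List.append_nil] at hx
    subst hx
    exact Spec.pure hI
  | cons x l₂ ih =>
    intro b' m' hx hm hI
    rw [List.foldlM_cons, List.map_cons, List.sum_cons]
    refine (h l₁ x l₂ hx b' m' hm hI).bind fun b'' m'' hm' hI' => ?_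
    exact ih (l₁ ++ [x]) b'' m'' (by simp [hx]) (hm.trans hm') hI'

theorem Spec.foldlM_le {f : β → α → Prog K β} {B : ℕ} (I : List α → β → List K → Prop)
    (xs : List α) (b : β) (h₀ : I [] b m)
    (h : ∀ l₁ x l₂, xs = l₁ ++ x :: l₂ → ∀ b' m', m <+: m' → I l₁ b' m' →
      Spec φ (f b' x) m' B (I (l₁ ++ [x]))) :
    Spec φ (xs.foldlM f b) m (xs.length * B) (I xs) := by
  have := Spec.foldlM (B := fun _ => B) I xs b h₀ h
  simpa using this

/-! ### Vectors and dense polynomials in memory -/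

theorem getElem?_of_prefix {i : ℕ} {x : K} (h : m <+: m') (hi : m[i]? = some x) :
    m'[i]? = some x := by
  obtain ⟨t, rfl⟩ := h
  rw [List.getElem?_append_left (List.getElem?_eq_some_iff.mp hi).1, hi]

theorem holdsVec_iff {a : List ℕ} {v : List K} :
    HoldsVec m a v ↔ List.Forall₂ (fun i x => m[i]? = some x) a v := by
  unfold HoldsVec
  induction a generalizing v with
  | nil => cases v <;> simp
  | cons i a ih => cases v <;> simp [ih]

theorem HoldsVec.mono {a : List ℕ} {v : List K} (h : HoldsVec m a v) (hm : m <+: m') :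
    HoldsVec m' a v := by
  rw [holdsVec_iff] at *
  exact h.imp fun _ _ => getElem?_of_prefix hm

theorem HoldsPoly.mono {a : List ℕ} {p : K[X]} (h : HoldsPoly m a p) (hm : m <+: m') :
    HoldsPoly m' a p := HoldsVec.mono h hm

theorem HoldsVec.length_eq {a : List ℕ} {v : List K} (h : HoldsVec m a v) :
    a.length = v.length := (holdsVec_iff.mp h).length_eq

theorem HoldsVec.nil : HoldsVec m [] [] := rfl

theorem HoldsVec.cons {i : ℕ} {x : K} {a : List ℕ} {v : List K} (hi : m[i]? = some x)
    (h : HoldsVec m a v) : HoldsVec m (i :: a) (x :: v) := by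
  rw [holdsVec_iff] at *; exact .cons hi h

theorem HoldsVec.reverse {a : List ℕ} {v : List K} (h : HoldsVec m a v) :
    HoldsVec m a.reverse v.reverse := by
  simp only [HoldsVec, List.map_reverse] at *; rw [h]

theorem HoldsVec.replicate {i : ℕ} {x : K} (n : ℕ) (hi : m[i]? = some x) :
    HoldsVec m (List.replicate n i) (List.replicate n x) := by
  simp only [HoldsVec, List.map_replicate, hi]

theorem holdsPoly_iff {a : List ℕ} {p : K[X]} :
    HoldsPoly m a p ↔ HoldsVec m a ((List.range (size p)).map p.coeff) := Iff.rfl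

theorem HoldsPoly.length_eq {a : List ℕ} {p : K[X]} (h : HoldsPoly m a p) :
    a.length = size p := by
  rw [HoldsVec.length_eq h, List.length_map, List.length_range]; rfl

/-- The coefficients of `p` in memory. -/
theorem HoldsPoly.getElem? {a : List ℕ} {p : K[X]} (h : HoldsPoly m a p) {n i : ℕ}
    (hi : a[n]? = some i) : m[i]? = some (p.coeff n) := by
  have h' : ∀ k : ℕ, (a.map fun i => m[i]?)[k]? = (((List.range (size p)).map p.coeff).map some)[k]? :=
    fun k => by rw [show a.map _ = _ from h]; rfl
  have := h' n
  have hn : n < size p := by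
    rw [← h.length_eq]; exact (List.getElem?_eq_some_iff.mp hi).1
  simpa [hi, hn] using this

theorem HoldsVec.getElem? {a : List ℕ} {v : List K} (h : HoldsVec m a v) {n i : ℕ}
    (hi : a[n]? = some i) : ∃ x, v[n]? = some x ∧ m[i]? = some x := by
  have h' : ∀ k : ℕ, (a.map fun i => m[i]?)[k]? = (v.map some)[k]? :=
    fun k => by rw [show a.map _ = _ from h]
  have := h' n
  simp only [List.getElem?_map, hi, Option.map_some] at this
  rcases hv : v[n]? with _ | x
  · simp [hv] at this
  · exact ⟨x, rfl, by simpa [hv] using this⟩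

theorem HoldsPoly.eq_nil_iff {a : List ℕ} {p : K[X]} (h : HoldsPoly m a p) : a = [] ↔ p = 0 := by
  rw [← List.length_eq_zero_iff, h.length_eq, size_eq_zero]

theorem holdsPoly_zero : HoldsPoly m [] (0 : K[X]) := by
  simp [holdsPoly_iff, size_zero, HoldsVec.nil]

theorem holdsPoly_C {i : ℕ} {c : K} (hc : c ≠ 0) (hi : m[i]? = some c) :
    HoldsPoly m [i] (Polynomial.C c) := by
  rw [holdsPoly_iff, size_of_ne_zero (by simpa using hc)]
  simpa using HoldsVec.nil.cons hi

theorem holdsPoly_one {i : ℕ} (hi : m[i]? = some (1 : K)) : HoldsPoly m [i] (1 : K[X]) :=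
  holdsPoly_C one_ne_zero hi

theorem HoldsPoly.ofCoeffs_eq {a : List ℕ} {p : K[X]} {v : List K} (h : HoldsPoly m a p)
    (hv : HoldsVec m a v) : ofCoeffs v = p := by
  have : v = (List.range (size p)).map p.coeff := by
    have h' : v.map some = ((List.range (size p)).map p.coeff).map some := hv.symm.trans h
    exact List.map_injective_iff.mpr (Option.some_injective K) h'
  rw [this, ofCoeffs_range_map p le_rfl]

/-- A vector without leading zero holds a polynomial in dense representation. -/
theorem HoldsVec.holdsPoly {a : List ℕ} {v : List K} (h : HoldsVec m a v)
    (hv : v.length ≤ size (ofCoeffs v)) : HoldsPoly m a (ofCoeffs v) := by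
  rw [holdsPoly_iff]
  convert h
  have := le_antisymm hv (size_ofCoeffs_le v)
  apply List.ext_getElem
  · simp [this]
  · intro i h₁ h₂
    simp [h₂]

theorem spec_dropZeros {a : List ℕ} {v : List K} (h : HoldsVec m a v) :
    Spec φ (dropZeros a) m a.length fun s m' => HoldsVec m' s (v.dropWhile fun x => x = 0) := by
  induction a generalizing v m with
  | nil =>
    cases v with
    | nil => exact Spec.pure .nil
    | cons => simp [HoldsVec] at h
  | cons i a ih =>
    cases v with
    | nil => simp [HoldsVec] at h
    | cons x v =>
      rw [holdsVec_iff, List.forall₂_cons] at h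
      rw [List.length_cons, add_comm]
      refine Spec.ite_test h.1 (fun hx m' hm => ?_) (fun hx m' hm => ?_)
      · simpa [hx] using ih ((holdsVec_iff.mpr h.2).mono hm)
      · refine (Spec.pure ?_).le (Nat.zero_le _)
        simpa [hx] using ((holdsVec_iff.mpr h.2).mono hm).cons (getElem?_of_prefix hm h.1)

theorem spec_trim_vec {a : List ℕ} {v : List K} (h : HoldsVec m a v) :
    Spec φ (trim a) m a.length fun s m' => HoldsPoly m' s (ofCoeffs v) := by
  have h₁ := spec_dropZeros (φ := φ) h.reverse
  rw [List.length_reverse] at h₁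
  refine Spec.map (h₁.imp fun s m' _ hs => ?_)
  have hs' := hs.reverse
  set u := v.reverse.dropWhile fun x => x = 0 with hu
  obtain ⟨n, hn⟩ : ∃ n, v = u.reverse ++ List.replicate n 0 := by
    refine ⟨(v.reverse.takeWhile fun x => x = 0).length, ?_⟩
    have h₂ := List.takeWhile_append_dropWhile (p := fun x : K => x = 0) (l := v.reverse)
    have h₃ : v.reverse.takeWhile (fun x => x = 0)
        = List.replicate (v.reverse.takeWhile fun x => x = 0).length 0 := by
      rw [List.eq_replicate_iff]
      exact ⟨rfl, fun b hb => by simpa using List.mem_takeWhile_imp hb⟩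
    rw [h₃, ← hu] at h₂
    have := congrArg List.reverse h₂
    simpa using this.symm
  rw [hn, ofCoeffs_append_replicate]
  refine hs'.holdsPoly ?_
  rcases hcase : u with _ | ⟨x, t⟩
  · simp
  · have hx : x ≠ 0 := by
      have := List.head_dropWhile_not (fun x : K => decide (x = 0)) (l := v.reverse)
        (by rw [← hu, hcase]; simp)
      simp only [← hu, hcase] at this
      exact of_decide_eq_false this
    by_contra hlt
    rw [not_le] at hlt
    have := size_le_iff.mp (Nat.le_sub_one_of_lt hlt) t.length (by simp)
    simp at this
    exact hx this

/-! ### Coefficient lists, with or without leading zeros -/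

section DensePolynomials

variable {K : Type*} [Field K]

open Polynomial

@[simp]
theorem ofCoeffs_nil : ofCoeffs ([] : List K) = 0 := by simp [ofCoeffs]

theorem ofCoeffs_cons (x : K) (v : List K) : ofCoeffs (x :: v) = C x + X * ofCoeffs v := by
  ext i
  rcases i with _ | i <;> simp [coeff_C]

/-- The polynomial `p` without its terms of degree `≥ n`. -/
noncomputable def low (n : ℕ) (p : K[X]) : K[X] := ofCoeffs ((List.range n).map p.coeff)

theorem coeff_low (n : ℕ) (p : K[X]) (i : ℕ) : (low n p).coeff i = if i < n then p.coeff i else 0 := by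
  simp only [low, coeff_ofCoeffs]
  split_ifs with h <;> simp [h]

theorem size_low_le (n : ℕ) (p : K[X]) : size (low n p) ≤ n := by
  rw [size_le_iff]
  intro i hi
  simp [coeff_low, not_lt.mpr hi]

/-- The polynomial `p` divided by `X ^ n`, forgetting its terms of degree `< n`. -/
noncomputable def high (n : ℕ) (p : K[X]) : K[X] := divX^[n] p

theorem coeff_high (n : ℕ) (p : K[X]) (i : ℕ) : (high n p).coeff i = p.coeff (i + n) := by
  induction n generalizing p with
  | zero => rfl
  | succ n ih => rw [high, Function.iterate_succ_apply, ← high, ih, coeff_divX, add_assoc]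

theorem high_X_pow_mul (n : ℕ) (p : K[X]) : high n (X ^ n * p) = p := by
  ext i
  rw [coeff_high, coeff_X_pow_mul]

theorem size_mul {p q : K[X]} (hp : p ≠ 0) (hq : q ≠ 0) : size (p * q) + 1 = size p + size q := by
  rw [size_of_ne_zero hp, size_of_ne_zero hq, size_of_ne_zero (mul_ne_zero hp hq),
    natDegree_mul hp hq]
  omega

theorem size_mul_le (p q : K[X]) : size (p * q) ≤ size p + size q - 1 := by
  by_cases hp : p = 0
  · simp [hp, size_zero]
  by_cases hq : q = 0
  · simp [hq, size_zero]
  have := size_mul hp hq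
  omega

theorem size_add_le {p q : K[X]} {n : ℕ} (hp : size p ≤ n) (hq : size q ≤ n) :
    size (p + q) ≤ n := by
  rw [size_le_iff] at *
  intro i hi
  rw [coeff_add, hp i hi, hq i hi, add_zero]

theorem size_le_of_dvd {p q : K[X]} (h : p ∣ q) (hq : q ≠ 0) : size p ≤ size q := by
  rw [size_of_ne_zero hq, size_of_ne_zero (ne_zero_of_dvd_ne_zero hq h)]
  exact Nat.succ_le_succ (natDegree_le_of_dvd h hq)

theorem size_X_pow_mul {p : K[X]} (hp : p ≠ 0) (e : ℕ) : size (X ^ e * p) = e + size p := by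
  rw [size_of_ne_zero hp, size_of_ne_zero (mul_ne_zero (pow_ne_zero _ X_ne_zero) hp),
    natDegree_mul (pow_ne_zero _ X_ne_zero) hp, natDegree_X_pow, add_assoc]

theorem size_expand {p : K[X]} (hp : p ≠ 0) {n : ℕ} (hn : 0 < n) :
    size (expand K n p) = n * (size p - 1) + 1 := by
  rw [size_of_ne_zero hp, size_of_ne_zero ((expand_ne_zero hn).mpr hp), natDegree_expand]
  simp [mul_comm]

end DensePolynomials

section Memory

variable {K : Type*} [Field K] [DecidableEq K]

open Polynomial

/-- The registers in `a` hold the coefficients of `p`, possibly followed by zeros. -/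
def Holds (m : List K) (a : List ℕ) (p : K[X]) : Prop := ∃ v, HoldsVec m a v ∧ ofCoeffs v = p

variable {m m' : List K}

theorem Holds.mono {a : List ℕ} {p : K[X]} (h : Holds m a p) (hm : m <+: m') : Holds m' a p := by
  obtain ⟨v, hv, rfl⟩ := h
  refine ⟨v, ?_, rfl⟩
  rw [holdsVec_iff] at *
  refine hv.imp fun i x hi => ?_
  obtain ⟨t, rfl⟩ := hm
  rw [List.getElem?_append_left (List.getElem?_eq_some_iff.mp hi).1, hi]

theorem Holds.nil : Holds m [] 0 := ⟨[], rfl, ofCoeffs_nil⟩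

theorem Holds.cons {i : ℕ} {c : K} {a : List ℕ} {p : K[X]} (hi : m[i]? = some c)
    (h : Holds m a p) : Holds m (i :: a) (C c + X * p) := by
  obtain ⟨v, hv, rfl⟩ := h
  exact ⟨c :: v, by rw [holdsVec_iff] at *; exact .cons hi hv, ofCoeffs_cons c v⟩

theorem Holds.eq_zero {p : K[X]} (h : Holds m [] p) : p = 0 := by
  obtain ⟨v, hv, rfl⟩ := h
  rw [holdsVec_iff, List.forall₂_nil_left_iff] at hv
  simp [hv]

theorem Holds.of_cons {i : ℕ} {a : List ℕ} {p : K[X]} (h : Holds m (i :: a) p) :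
    ∃ c q, m[i]? = some c ∧ Holds m a q ∧ p = C c + X * q := by
  obtain ⟨v, hv, rfl⟩ := h
  rw [holdsVec_iff, List.forall₂_cons_left_iff] at hv
  obtain ⟨c, v, hi, hv, rfl⟩ := hv
  exact ⟨c, ofCoeffs v, hi, ⟨v, holdsVec_iff.mpr hv, rfl⟩, ofCoeffs_cons c v⟩

theorem Holds.size_le {a : List ℕ} {p : K[X]} (h : Holds m a p) : size p ≤ a.length := by
  obtain ⟨v, hv, rfl⟩ := h
  rw [(holdsVec_iff.mp hv).length_eq]
  exact size_ofCoeffs_le v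

theorem HoldsPoly.holds {a : List ℕ} {p : K[X]} (h : HoldsPoly m a p) : Holds m a p :=
  ⟨_, h, ofCoeffs_range_map p le_rfl⟩

theorem Holds.holdsPoly {a : List ℕ} {p : K[X]} (h : Holds m a p) (ha : a.length ≤ size p) :
    HoldsPoly m a p := by
  obtain ⟨v, hv, rfl⟩ := h
  have hl : v.length = size (ofCoeffs v) :=
    le_antisymm ((holdsVec_iff.mp hv).length_eq ▸ ha) (size_ofCoeffs_le v)
  rw [holdsPoly_iff, ← hl]
  convert hv
  apply List.ext_getElem
  · simp
  · intro i h₁ h₂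
    simp [h₂]

theorem Holds.zeros_append {z : ℕ} (hz : m[z]? = some 0) {a : List ℕ} {p : K[X]}
    (h : Holds m a p) (e : ℕ) : Holds m (List.replicate e z ++ a) (X ^ e * p) := by
  induction e with
  | zero => simpa using h
  | succ e ih =>
    have := ih.cons hz
    rw [List.replicate_succ, List.cons_append]
    convert this using 1
    rw [C_0]
    ring

theorem Holds.drop {a : List ℕ} {p : K[X]} (h : Holds m a p) (n : ℕ) :
    Holds m (a.drop n) (high n p) := by
  induction n generalizing a p with
  | zero => exact h
  | succ n ih =>
    cases a with
    | nil =>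
      rw [h.eq_zero]
      have : high (n + 1) (0 : K[X]) = 0 := by ext; simp [coeff_high]
      simpa [this] using Holds.nil (m := m)
    | cons i a =>
      obtain ⟨c, q, _, hq, rfl⟩ := h.of_cons
      rw [high, Function.iterate_succ_apply, ← high]
      have : divX (C c + X * q) = q := by ext; simp [coeff_divX]
      rw [this]
      exact ih hq

theorem Holds.take {a : List ℕ} {p : K[X]} (h : Holds m a p) (n : ℕ) :
    Holds m (a.take n) (low n p) := by
  induction n generalizing a p with
  | zero => simpa [low] using Holds.nil (m := m)
  | succ n ih =>
    cases a with
    | nil =>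
      rw [h.eq_zero]
      have : low (n + 1) (0 : K[X]) = 0 := by ext; simp [coeff_low]
      simpa [this] using Holds.nil (m := m)
    | cons i a =>
      obtain ⟨c, q, hc, hq, rfl⟩ := h.of_cons
      have : low (n + 1) (C c + X * q) = C c + X * low n q := by
        ext i
        rcases i with _ | i <;> simp [coeff_low, coeff_C]
      rw [this]
      exact (ih hq).cons hc

theorem Holds.getElem? {a : List ℕ} {p : K[X]} (h : Holds m a p) {n i : ℕ}
    (hi : a[n]? = some i) : m[i]? = some (p.coeff n) := by
  induction a generalizing n p with
  | nil => simp at hi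
  | cons j a ih =>
    obtain ⟨c, q, hc, hq, rfl⟩ := h.of_cons
    rcases n with _ | n
    · simp at hi; subst hi; simpa using hc
    · simpa [coeff_C] using ih hq (by simpa using hi)

theorem HoldsPoly.drop {a : List ℕ} {p : K[X]} (h : HoldsPoly m a p) (n : ℕ) :
    HoldsPoly m (a.drop n) (high n p) := by
  refine (h.holds.drop n).holdsPoly ?_
  have hl : a.length = size p := by
    have := (holdsVec_iff.mp (holdsPoly_iff.mp h)).length_eq
    simpa using this
  rw [List.length_drop, hl]
  by_contra hlt
  rw [not_le] at hlt
  have h₁ : size p ≤ size p - 1 := by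
    rw [size_le_iff]
    intro i hi
    have h₂ := size_le_iff.mp (Nat.le_sub_one_of_lt hlt) (i - n) (by omega)
    rwa [coeff_high, Nat.sub_add_cancel (by omega)] at h₂
  omega

end Memory

section DensePolynomials

variable {K : Type*} [Field K]

open Polynomial

/-- The polynomial `f i` in the decomposition of `p` as the sum of the `X ^ i * (f i) (X ^ n)` for
`0 ≤ i < n`. -/
noncomputable def slicePoly (n i : ℕ) (p : K[X]) : K[X] := contract n (high i p)

theorem coeff_slicePoly {n : ℕ} (hn : n ≠ 0) (i : ℕ) (p : K[X]) (j : ℕ) :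
    (slicePoly n i p).coeff j = p.coeff (i + n * j) := by
  rw [slicePoly, coeff_contract hn, coeff_high]
  congr 1
  ring

theorem coeff_sum_X_pow_mul_expand {n : ℕ} (hn : 0 < n) (d : ℕ → K[X]) (N : ℕ) :
    (∑ k ∈ Finset.range n, X ^ k * expand K n (d k)).coeff N = (d (N % n)).coeff (N / n) := by
  rw [finsetSum_coeff, Finset.sum_eq_single (N % n)]
  · have h : N = n * (N / n) + N % n := (Nat.div_add_mod N n).symm
    conv_lhs => rw [h]
    rw [coeff_X_pow_mul', if_pos (by simp), Nat.mul_add_mod_self_left, Nat.mod_mod,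
      Nat.add_sub_cancel, coeff_expand_mul' hn]
  · intro k hk hkN
    rw [Finset.mem_range] at hk
    rw [coeff_X_pow_mul']
    split_ifs with h
    · rw [coeff_expand hn, if_neg]
      rintro ⟨t, ht⟩
      have : N = k + n * t := by omega
      rw [this, Nat.add_mul_mod_self_left, Nat.mod_eq_of_lt hk] at hkN
      exact hkN rfl
    · rfl
  · intro h
    exact absurd (Finset.mem_range.mpr (Nat.mod_lt _ hn)) h

theorem sum_slicePoly {n : ℕ} (hn : 0 < n) (p : K[X]) :
    ∑ k ∈ Finset.range n, X ^ k * expand K n (slicePoly n k p) = p := by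
  ext N
  rw [coeff_sum_X_pow_mul_expand hn, coeff_slicePoly hn.ne', Nat.mod_add_div]

theorem slicePoly_sum {n i : ℕ} (hi : i < n) (d : ℕ → K[X]) :
    slicePoly n i (∑ k ∈ Finset.range n, X ^ k * expand K n (d k)) = d i := by
  ext j
  have hn : 0 < n := by omega
  rw [coeff_slicePoly hn.ne', coeff_sum_X_pow_mul_expand hn, Nat.add_mul_mod_self_left,
    Nat.mod_eq_of_lt hi, Nat.add_mul_div_left _ _ hn, Nat.div_eq_of_lt hi, zero_add]

/-- The dilate of `h` divides `p` if and only if `h` divides all the slices of `p`. -/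
theorem expand_dvd_iff {n : ℕ} (hn : 0 < n) {h p : K[X]} :
    expand K n h ∣ p ↔ ∀ i < n, h ∣ slicePoly n i p := by
  constructor
  · rintro ⟨c, rfl⟩ i hi
    rw [← sum_slicePoly hn c, Finset.mul_sum]
    have : ∀ k ∈ Finset.range n, expand K n h * (X ^ k * expand K n (slicePoly n k c)) =
        X ^ k * expand K n (h * slicePoly n k c) := fun k _ => by rw [map_mul]; ring
    rw [Finset.sum_congr rfl this, slicePoly_sum hi]
    exact dvd_mul_right _ _
  · intro H
    rw [← sum_slicePoly hn p]
    exact Finset.dvd_sum fun k hk => Dvd.dvd.mul_left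
      (map_dvd (expand K n) (H k (Finset.mem_range.mp hk))) _

theorem sum_zipIdx {M : Type*} [AddCommMonoid M] {α : Type*} (l : List α) (f : ℕ → M) :
    (l.zipIdx.map fun x => f x.2).sum = ∑ k ∈ Finset.range l.length, f k := by
  have h : l.zipIdx.map (fun x => f x.2) = (List.range l.length).map f := by
    apply List.ext_getElem <;> simp
  rw [h]
  induction l.length with
  | zero => simp
  | succ n ih => rw [List.range_succ, List.map_append, List.sum_append, ih, Finset.sum_range_succ]; simp

end DensePolynomials

/-! ### Elementary programs -/

section Steps

variable {K : Type*} [Field K] [DecidableEq K] {φ : Prop} {m m' : List K}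

open Polynomial

theorem spec_trim {a : List ℕ} {p : K[X]} (h : Holds m a p) :
    Spec φ (trim a) m a.length fun s m' => HoldsPoly m' s p := by
  obtain ⟨v, hv, rfl⟩ := h
  exact spec_trim_vec hv

theorem spec_addCoeffs {a b : List ℕ} {p q : K[X]} (ha : Holds m a p) (hb : Holds m b q) :
    Spec φ (addCoeffs a b) m b.length fun s m' =>
      Holds m' s (p + q) ∧ s.length ≤ max a.length b.length := by
  induction a generalizing b p q m with
  | nil =>
    rw [ha.eq_zero, zero_add]
    have : MahlerEq.addCoeffs (K := K) [] b = Pure.pure b := by cases b <;> rfl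
    rw [this]
    exact (Spec.pure ⟨hb, by simp⟩).le (Nat.zero_le _)
  | cons i a ih =>
    cases b with
    | nil =>
      rw [hb.eq_zero, add_zero]
      exact (Spec.pure ⟨ha, by simp⟩).le (Nat.zero_le _)
    | cons j b =>
      obtain ⟨c, p, hc, hp, rfl⟩ := ha.of_cons
      obtain ⟨d, q, hd, hq, rfl⟩ := hb.of_cons
      rw [List.length_cons, add_comm]
      refine (Spec.op (z := c + d) hc hd rfl).bind fun s m₁ h₁ hs => ?_
      refine Spec.map ((ih (hp.mono h₁) (hq.mono h₁)).imp fun t m₂ h₂ ht => ⟨?_, ?_⟩)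
      · convert ht.1.cons (getElem?_of_prefix h₂ hs) using 1
        rw [C_add]; ring
      · have := ht.2
        simp only [List.length_cons]
        omega

theorem spec_sumPoly {as : List (List ℕ)} {ps : List K[X]} {n : ℕ}
    (h : List.Forall₂ (Holds m) as ps) (hn : ∀ a ∈ as, a.length ≤ n) :
    Spec φ (sumPoly as) m ((as.length + 1) * n) fun s m' => HoldsPoly m' s ps.sum := by
  have key : ∀ (as : List (List ℕ)) (ps : List K[X]) (m : List K) (b : List ℕ) (q : K[X]),
      List.Forall₂ (Holds m) as ps → (∀ a ∈ as, a.length ≤ n) → Holds m b q → b.length ≤ n →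
      Spec φ (as.foldlM MahlerEq.addCoeffs b) m (as.length * n) fun s m' =>
        Holds m' s (q + ps.sum) ∧ s.length ≤ n := by
    intro as
    induction as with
    | nil =>
      intro ps m b q h _ hb hbn
      rw [List.forall₂_nil_left_iff.mp h]
      exact (Spec.pure ⟨by simpa using hb, hbn⟩).le (Nat.zero_le _)
    | cons a as ih =>
      intro ps m b q h hn hb hbn
      obtain ⟨p, ps, hp, hps, rfl⟩ := List.forall₂_cons_left_iff.mp h
      rw [List.foldlM_cons, List.length_cons, add_mul, one_mul, add_comm]
      have han := hn a (by simp)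
      refine ((spec_addCoeffs hb hp).le han).bind fun s m₁ h₁ hs => ?_
      refine (ih ps m₁ s (q + p) (hps.imp fun _ _ h => h.mono h₁)
        (fun a ha => hn a (by simp [ha])) hs.1 (by have := hs.2; omega)).imp fun t m₂ _ ht => ?_
      rw [List.sum_cons, ← add_assoc]
      exact ht
  rw [add_mul, one_mul]
  refine (key as ps m [] 0 h hn Holds.nil (Nat.zero_le _)).bind fun s m₁ h₁ hs => ?_
  rw [zero_add] at hs
  exact (spec_trim hs.1).le hs.2

/-- The sum of two polynomials. -/
theorem spec_sumPoly_pair {a b : List ℕ} {p q : K[X]} {n : ℕ} (ha : HoldsPoly m a p)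
    (hb : HoldsPoly m b q) (hp : size p ≤ n) (hq : size q ≤ n) :
    Spec φ (MahlerEq.sumPoly [a, b]) m (3 * n) fun s m' => HoldsPoly m' s (p + q) := by
  have := spec_sumPoly (φ := φ) (as := [a, b]) (ps := [p, q]) (n := n) (m := m)
    (.cons ha.holds (.cons hb.holds .nil)) (by
      intro c hc
      simp only [List.mem_cons, List.not_mem_nil, or_false] at hc
      rcases hc with rfl | rfl
      · rwa [ha.length_eq]
      · rwa [hb.length_eq])
  simpa using this

theorem spec_shift {a : List ℕ} {p : K[X]} (h : HoldsPoly m a p) (e : ℕ) :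
    Spec φ (shift e a) m 0 fun s m' => HoldsPoly m' s (X ^ e * p) := by
  refine Spec.bind (B₁ := 0) (B₂ := 0) (Spec.lit 0) fun z m₁ h₁ hz => Spec.pure ?_
  by_cases hp : p = 0
  · simp [h.eq_nil_iff.mpr hp, hp, holdsPoly_zero]
  · have ha : a ≠ [] := fun h' => hp (h.eq_nil_iff.mp h')
    simp only [List.isEmpty_iff, ha, if_false]
    refine ((h.mono h₁).holds.zeros_append hz e).holdsPoly ?_
    rw [size_X_pow_mul hp, List.length_append, List.length_replicate, h.length_eq]

theorem spec_dilate {a : List ℕ} {p : K[X]} (h : HoldsPoly m a p) {n : ℕ} (hn : 0 < n) :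
    Spec φ (dilate n a) m 0 fun s m' => HoldsPoly m' s (expand K n p) := by
  cases a with
  | nil =>
    rw [h.holds.eq_zero, map_zero]
    exact Spec.pure holdsPoly_zero
  | cons i a =>
    have hp : p ≠ 0 := fun hp => by simpa using h.eq_nil_iff.mpr hp
    refine Spec.bind (B₁ := 0) (B₂ := 0) (Spec.lit 0) fun z m₁ h₁ hz => Spec.pure ?_
    have hX : (X : K[X]) ^ n = X * X ^ (n - 1) := by
      rw [← pow_succ', Nat.sub_add_cancel hn]
    have key : ∀ (a : List ℕ) (q : K[X]), Holds m₁ a q →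
        Holds m₁ (a.flatMap fun j => List.replicate (n - 1) z ++ [j])
          (X ^ (n - 1) * expand K n q) := by
      intro a
      induction a with
      | nil => intro q hq; simpa [hq.eq_zero] using Holds.nil (m := m₁)
      | cons j a ih =>
        intro q hq
        obtain ⟨c, q', hc, hq', rfl⟩ := hq.of_cons
        rw [List.flatMap_cons, List.append_assoc, List.singleton_append]
        convert ((ih q' hq').cons hc).zeros_append hz (n - 1) using 1
        rw [map_add, map_mul, expand_C, expand_X]
        rw [hX]
        ring
    have hlen : (i :: a.flatMap fun j => List.replicate (n - 1) z ++ [j]).length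
        = n * a.length + 1 := by
      rw [List.length_cons, List.length_flatMap]
      simp [Nat.sub_add_cancel hn, mul_comm]
    refine Holds.holdsPoly ?_ ?_
    · obtain ⟨c, q, hc, hq, rfl⟩ := (h.mono h₁).holds.of_cons
      convert (key a q hq).cons hc using 1
      rw [map_add, map_mul, expand_C, expand_X]
      rw [hX]
      ring
    · rw [hlen, size_expand hp hn, ← h.length_eq, List.length_cons, Nat.add_sub_cancel]

theorem spec_truncate {a : List ℕ} {p : K[X]} (h : Holds m a p) (n : ℕ) :
    Spec φ (truncate n a) m 0 fun s m' => HoldsVec m' s ((List.range n).map p.coeff) := by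
  refine Spec.bind (B₁ := 0) (B₂ := 0) (Spec.lit 0) fun z m₁ h₁ hz => Spec.pure ?_
  rw [holdsVec_iff, List.forall₂_map_left_iff, List.forall₂_map_right_iff,
    List.forall₂_same]
  intro i _
  rcases hi : a[i]? with _ | j
  · have : p.coeff i = 0 :=
      size_le_iff.mp h.size_le i (List.getElem?_eq_none_iff.mp hi)
    simp [List.getD_eq_getElem?_getD, hi, this, hz]
  · simpa [List.getD_eq_getElem?_getD, hi] using (h.mono h₁).getElem? hi

/-- `o` is the valuation of `p` at `0`, where `none` stands for infinity. -/
def IsValuation (p : K[X]) : Option ℕ → Prop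
  | none => p = 0
  | some v => p.coeff v ≠ 0 ∧ ∀ i < v, p.coeff i = 0

theorem spec_valuation {a : List ℕ} {p : K[X]} (h : Holds m a p) :
    Spec φ (valuation a) m a.length fun o _ => IsValuation p o := by
  induction a generalizing p m with
  | nil => exact Spec.pure h.eq_zero
  | cons i a ih =>
    obtain ⟨c, q, hc, hq, rfl⟩ := h.of_cons
    rw [List.length_cons, add_comm]
    refine Spec.ite_test hc (fun h0 m₁ h₁ => ?_) (fun h0 m₁ h₁ => ?_)
    · refine Spec.map ((ih (hq.mono h₁)).imp fun o _ _ ho => ?_)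
      subst h0
      cases o with
      | none => simp [IsValuation] at ho ⊢; exact ho
      | some v =>
        refine ⟨by simpa using ho.1, fun j hj => ?_⟩
        rcases j with _ | j
        · simp
        · simpa using ho.2 j (Nat.lt_of_succ_lt_succ hj)
    · refine (Spec.pure ?_).le (Nat.zero_le _)
      exact ⟨by simpa using h0, fun i hi => absurd hi (Nat.not_lt_zero _)⟩

theorem spec_slice {a : List ℕ} {p : K[X]} (h : HoldsPoly m a p) {n i k : ℕ} (hi : i < n)
    (hk : size p ≤ n * k) :
    Spec φ (slice n i a) m k fun s m' =>
      HoldsPoly m' s (slicePoly n i p) ∧ size (slicePoly n i p) ≤ k := by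
  have hn : 0 < n := by omega
  have key : ∀ (a : List ℕ) (p : K[X]) (k s : ℕ), Holds m a p → s < n → (k + s) % n = i →
      (∃ q, Holds m (((a.zipIdx k).filter fun c => c.2 % n = i).map Prod.fst) q ∧
        ∀ j, q.coeff j = p.coeff (s + n * j)) ∧
      n * (((a.zipIdx k).filter fun c => c.2 % n = i).map Prod.fst).length + s < a.length + n := by
    intro a
    induction a with
    | nil =>
      intro p k s hp hs _
      rw [hp.eq_zero]
      exact ⟨⟨0, by simpa using Holds.nil, by simp⟩, by simpa using hs⟩
    | cons x a ih =>
      intro p k s hp hs hks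
      obtain ⟨c, q, hc, hq, rfl⟩ := hp.of_cons
      by_cases hk : k % n = i
      · have hs0 : s = 0 := by
          rw [Nat.add_mod, hk, Nat.mod_eq_of_lt hs] at hks
          by_contra h0
          rcases lt_or_ge (i + s) n with h | h
          · rw [Nat.mod_eq_of_lt h] at hks; omega
          · rw [Nat.mod_eq_sub_mod h, Nat.mod_eq_of_lt (by omega)] at hks; omega
        subst hs0
        obtain ⟨⟨q', hq', hcoeff⟩, hlen⟩ := ih q (k + 1) (n - 1) hq (by omega) (by
          rw [show k + 1 + (n - 1) = k + n by omega, Nat.add_mod_right, hk])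
        simp only [List.zipIdx_cons, List.filter_cons, hk, decide_true, if_true, List.map_cons]
        refine ⟨⟨C c + X * q', hq'.cons hc, fun j => ?_⟩, ?_⟩
        · rcases j with _ | j
          · simp
          · rw [show 0 + n * (j + 1) = (n - 1 + n * j) + 1 by rw [mul_add]; omega]
            simp [hcoeff]
        · simp only [List.length_cons, List.length_map, mul_add] at hlen ⊢
          omega
      · have hs0 : s ≠ 0 := by
          rintro rfl
          exact hk (by simpa using hks)
        obtain ⟨⟨q', hq', hcoeff⟩, hlen⟩ := ih q (k + 1) (s - 1) hq (by omega) (by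
          rw [show k + 1 + (s - 1) = k + s by omega, hks])
        simp only [List.zipIdx_cons, List.filter_cons, hk, decide_false, if_false,
          Bool.false_eq_true]
        refine ⟨⟨q', hq', fun j => ?_⟩, ?_⟩
        · rw [show s + n * j = (s - 1 + n * j) + 1 by omega, hcoeff]
          simp
        · simp only [List.length_cons] at hlen ⊢
          omega
  obtain ⟨⟨q, hq, hcoeff⟩, hlen⟩ := key a p 0 i h.holds hi (by simp [Nat.mod_eq_of_lt hi])
  have hqs : q = slicePoly n i p := by
    ext j
    rw [hcoeff, coeff_slicePoly hn.ne']
  rw [h.length_eq] at hlen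
  have hle : (((a.zipIdx 0).filter fun c => c.2 % n = i).map Prod.fst).length ≤ k := by
    by_contra hlt
    rw [not_le] at hlt
    have := Nat.mul_le_mul_left n (Nat.succ_le_of_lt hlt)
    rw [Nat.mul_succ] at this
    omega
  have hsz := hq.size_le.trans hle
  subst hqs
  exact (spec_trim hq).mono hle fun s m' _ hs => ⟨hs, hsz⟩

end Steps

/-! ### Subroutines with costs -/

/-- A cost function: superadditive, at least the identity, and at most multiplied by a constant
when its argument is doubled. -/
structure IsCost (U : ℕ → ℕ) : Prop where
  add_le : ∀ a b, U a + U b ≤ U (a + b)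
  le : ∀ n, n ≤ U n
  double : ∃ c, ∀ n, U (2 * n) ≤ c * U n

theorem IsCost.mono {U : ℕ → ℕ} (hU : IsCost U) : Monotone U := fun a b h => by
  have := hU.add_le a (b - a)
  rw [Nat.add_sub_cancel' h] at this
  omega

theorem IsCost.mul_le {U : ℕ → ℕ} (hU : IsCost U) (k n : ℕ) : k * U n ≤ U (k * n) := by
  induction k with
  | zero => simp
  | succ k ih =>
    rw [add_mul, one_mul, add_mul, one_mul]
    exact (Nat.add_le_add_right ih _).trans (hU.add_le _ _)

theorem IsCost.exists_mul_le {U : ℕ → ℕ} (hU : IsCost U) (k : ℕ) : ∃ c, ∀ n, U (k * n) ≤ c * U n := by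
  obtain ⟨c, hc⟩ := hU.double
  have h2 : ∀ j, ∃ c, ∀ n, U (2 ^ j * n) ≤ c * U n := by
    intro j
    induction j with
    | zero => exact ⟨1, by simp⟩
    | succ j ih =>
      obtain ⟨c', hc'⟩ := ih
      refine ⟨c * c', fun n => ?_⟩
      rw [pow_succ', mul_assoc, mul_assoc]
      exact (hc _).trans (Nat.mul_le_mul_left _ (hc' n))
  obtain ⟨c', hc'⟩ := h2 k
  exact ⟨c', fun n => (hU.mono (Nat.mul_le_mul_right n Nat.lt_two_pow_self.le)).trans (hc' n)⟩

section SubSpec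

variable {K : Type*} [Field K] [DecidableEq K]

open Polynomial

/-- The subroutines are correct; if `φ` holds, then on inputs of size at most `n` the number of ops
is at most `U n` for multiplication, gcd and exact division, and `G b * U n` for the Graeffe
operator of radix `b`, while the kernel of an `h × n` matrix takes at most
`8 * (h + 1) * (n + 1) ^ 2` ops. -/
structure SubSpec (φ : Prop) (S : Subroutines K) (U G : ℕ → ℕ) : Prop where
  mul : ∀ {p q : K[X]} {m : List K} {a b : List ℕ} {n : ℕ}, HoldsPoly m a p → HoldsPoly m b q →
    size p ≤ n → size q ≤ n → Spec φ (S.mul a b) m (U n) fun s m' => HoldsPoly m' s (p * q)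
  gcd : ∀ {p q : K[X]} {m : List K} {a b : List ℕ} {n : ℕ}, HoldsPoly m a p → HoldsPoly m b q →
    size p ≤ n → size q ≤ n →
    Spec φ (S.gcd a b) m (U n) fun s m' => ∃ g, HoldsPoly m' s g ∧ ∀ h, h ∣ g ↔ h ∣ p ∧ h ∣ q
  div : ∀ {p q : K[X]} {m : List K} {a b : List ℕ} {n : ℕ}, q ≠ 0 → HoldsPoly m a (p * q) →
    HoldsPoly m b q → size (p * q) ≤ n → Spec φ (S.div a b) m (U n) fun s m' => HoldsPoly m' s p
  graeffe : ∀ {b : ℕ} {p : K[X]} {m : List K} {a : List ℕ} {n : ℕ}, 2 ≤ b → p ≠ 0 →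
    HoldsPoly m a p → size p ≤ n →
    Spec φ (S.graeffe b a) m (G b * U n) fun s m' => HoldsPoly m' s (MahlerEq.graeffe b p)
  kernel : ∀ {h n : ℕ} {A : Matrix (Fin h) (Fin n) K} {m : List K} {a : List (List ℕ)},
    List.Forall₂ (HoldsVec m) a (List.ofFn fun j => List.ofFn fun i => A i j) →
    Spec φ (S.kernel a) m (8 * (h + 1) * (n + 1) ^ 2) fun s m' =>
      ∃ (k : ℕ) (v : Fin k → Fin n → K),
        List.Forall₂ (HoldsVec m') s (List.ofFn fun j => List.ofFn (v j)) ∧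
        LinearIndependent K v ∧ Submodule.span K (Set.range v) = LinearMap.ker A.mulVecLin

/-- Arbitrary correct subroutines satisfy the specification in which no bound is claimed for the
cost. -/
theorem Subroutines.Correct.subSpec {S : Subroutines K} (hS : S.Correct) (U G : ℕ → ℕ) :
    SubSpec False S U G where
  mul ha hb _ _ := (hS.mul _ _ _ _ _ ha hb).spec fun _ _ _ h => ⟨h, False.elim⟩
  gcd ha hb _ _ := (hS.gcd _ _ _ _ _ ha hb).spec fun _ _ _ h => ⟨h, False.elim⟩
  div hq ha hb _ := (hS.div _ _ _ _ _ hq ha hb).spec fun _ _ _ h => ⟨h, False.elim⟩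
  graeffe hb hp ha _ := (hS.graeffe _ _ _ _ hb hp ha).spec fun _ _ _ h => ⟨h, False.elim⟩
  kernel ha := (hS.kernel _ _ _ _ _ ha).spec fun _ _ _ h => ⟨h, False.elim⟩

theorem Prog.Yields.imp {α : Type} {P : Prog K α} {m : List K} {Q Q' : α → List K → ℕ → Prop}
    (h : P.Yields m Q) (h' : ∀ a m' c, Q a m' c → Q' a m' c) : P.Yields m Q' := by
  obtain ⟨a, m', c, hr, hQ⟩ := h
  exact ⟨a, m', c, hr, h' _ _ _ hQ⟩

theorem SubSpec.correct {φ : Prop} {S : Subroutines K} {U G : ℕ → ℕ} (hS : SubSpec φ S U G) :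
    S.Correct where
  mul p q _ _ _ ha hb := (hS.mul (n := max (size p) (size q)) ha hb (le_max_left _ _)
    (le_max_right _ _)).yields.imp fun _ _ _ h => h.1
  gcd p q _ _ _ ha hb := (hS.gcd (n := max (size p) (size q)) ha hb (le_max_left _ _)
    (le_max_right _ _)).yields.imp fun _ _ _ h => h.1
  div _ _ _ _ _ hq ha hb := (hS.div hq ha hb le_rfl).yields.imp fun _ _ _ h => h.1
  graeffe _ _ _ _ hb hp ha := (hS.graeffe hb hp ha le_rfl).yields.imp fun _ _ _ h => h.1
  kernel _ _ _ _ _ ha := (hS.kernel ha).yields.imp fun _ _ _ h => h.1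

variable {φ : Prop} {m m' : List K} {S : Subroutines K} {U G : ℕ → ℕ}

theorem forall₂_holdsPoly_mono {as : List (List ℕ)} {ps : List K[X]}
    (h : List.Forall₂ (HoldsPoly m) as ps) (hm : m <+: m') : List.Forall₂ (HoldsPoly m') as ps :=
  h.imp fun _ _ h => h.mono hm

theorem spec_prodPoly (hS : SubSpec φ S U G) {as : List (List ℕ)} {ps : List K[X]} {n : ℕ}
    (h : List.Forall₂ (HoldsPoly m) as ps) (h0 : ps.prod ≠ 0) (hn : size ps.prod ≤ n) :
    Spec φ (prodPoly S as) m (as.length * U n) fun s m' => HoldsPoly m' s ps.prod := by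
  refine Spec.bind_le (B₁ := 0) (B₂ := as.length * U n) (Spec.lit 1) ?_ (by simp)
  intro i m₁ h₁ hi
  have key : ∀ (as : List (List ℕ)) (ps : List K[X]) (m : List K) (b : List ℕ) (q : K[X]),
      List.Forall₂ (HoldsPoly m) as ps → HoldsPoly m b q → q * ps.prod ≠ 0 →
      size (q * ps.prod) ≤ n →
      Spec φ (as.foldlM S.mul b) m (as.length * U n) fun s m' => HoldsPoly m' s (q * ps.prod) := by
    intro as
    induction as with
    | nil =>
      intro ps m b q h hb _ _
      rw [List.forall₂_nil_left_iff.mp h]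
      exact (Spec.pure (by simpa using hb)).le (Nat.zero_le _)
    | cons a as ih =>
      intro ps m b q h hb h0 hn
      obtain ⟨p, ps, hp, hps, rfl⟩ := List.forall₂_cons_left_iff.mp h
      rw [List.prod_cons] at h0 hn ⊢
      rw [List.foldlM_cons, List.length_cons, add_mul, one_mul, add_comm]
      refine (hS.mul hb hp ((size_le_of_dvd (dvd_mul_right _ _) h0).trans hn)
        ((size_le_of_dvd ((dvd_mul_right _ _).mul_left _) h0).trans hn)).bind fun s m₁ h₁ hs => ?_
      rw [← mul_assoc] at h0 hn ⊢
      exact ih ps m₁ s (q * p) (forall₂_holdsPoly_mono hps h₁) hs h0 hn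
  have := key as ps m₁ [i] 1 (forall₂_holdsPoly_mono h h₁) (holdsPoly_one hi)
    (by simpa using h0) (by simpa using hn)
  simpa using this

/-- `dilatedFactor` returns the largest `g` such that `g (x ^ n)` divides `p`. -/
theorem spec_dilatedFactor (hS : SubSpec φ S U G) {a : List ℕ} {p : K[X]} {n k : ℕ} (hn : 0 < n)
    (h : HoldsPoly m a p) (hk : size p ≤ n * k) :
    Spec φ (dilatedFactor S n a) m (n * (k + U k)) fun s m' =>
      ∃ g, HoldsPoly m' s g ∧ ∀ h, h ∣ g ↔ expand K n h ∣ p := by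
  have := Spec.foldlM_le (φ := φ) (m := m) (B := k + U k)
    (f := fun g i => do S.gcd g (← slice n i a))
    (fun l s m' => ∃ g, HoldsPoly m' s g ∧ (∀ h, h ∣ g ↔ ∀ i ∈ l, h ∣ slicePoly n i p) ∧
      size g ≤ k) (List.range n) [] ⟨0, holdsPoly_zero, by simp, by simp [size_zero]⟩ (by
      rintro l₁ i l₂ hl b m₁ h₁ ⟨g, hg, hgl, hgk⟩
      have hi : i < n := by
        rw [← List.mem_range, hl]; simp
      refine Spec.bind (spec_slice (h.mono h₁) hi hk) fun s m₂ h₂ hs => ?_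
      refine (hS.gcd (hg.mono h₂) hs.1 hgk hs.2).imp ?_
      rintro t m₃ h₃ ⟨g', hg', hdvd⟩
      refine ⟨g', hg', fun h => ?_, ?_⟩
      · rw [hdvd, hgl]
        simp [or_imp, forall_and]
      · obtain ⟨hd1, hd2⟩ := (hdvd g').mp dvd_rfl
        by_cases hg0 : g = 0
        · by_cases hs0 : slicePoly n i p = 0
          · have : g' = 0 := zero_dvd_iff.mp ((hdvd 0).mpr (by simp [hg0, hs0]))
            simp [this, size_zero]
          · exact (size_le_of_dvd hd2 hs0).trans hs.2
        · exact (size_le_of_dvd hd1 hg0).trans hgk)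
  rw [List.length_range] at this
  refine this.imp ?_
  rintro s m' _ ⟨g, hg, hdvd, _⟩
  refine ⟨g, hg, fun h => ?_⟩
  rw [hdvd, expand_dvd_iff hn]
  simp

theorem spec_lcm (hS : SubSpec φ S U G) {a b : List ℕ} {p q : K[X]} {n : ℕ}
    (ha : HoldsPoly m a p) (hb : HoldsPoly m b q) (hp : p ≠ 0) (hq : q ≠ 0)
    (hn : p.natDegree + q.natDegree < n) :
    Spec φ (lcm S a b) m (3 * U n) fun s m' => ∃ t, HoldsPoly m' s t ∧ t ≠ 0 ∧ p ∣ t ∧ q ∣ t ∧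
      t.natDegree ≤ p.natDegree + q.natDegree := by
  have hpn : size p ≤ n := by rw [size_of_ne_zero hp]; omega
  have hqn : size q ≤ n := by rw [size_of_ne_zero hq]; omega
  refine Spec.bind_le (hS.gcd ha hb hpn hqn) (B₂ := U n + U n) ?_ (by omega)
  rintro s m₁ h₁ ⟨g, hg, hdvd⟩
  obtain ⟨⟨c, hc⟩, ⟨d, hd⟩⟩ := (hdvd g).mp dvd_rfl
  have hg0 : g ≠ 0 := by rintro rfl; simp at hc; exact hp hc
  have hd0 : d ≠ 0 := by rintro rfl; simp at hd; exact hq hd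
  rw [mul_comm] at hd
  rw [hd] at hb hqn
  have hdle : d.natDegree ≤ q.natDegree := by
    rw [hd, natDegree_mul hd0 hg0]; omega
  refine (hS.div hg0 (hb.mono h₁) hg hqn).bind fun t m₂ h₂ ht => ?_
  refine (hS.mul (ha.mono (h₁.trans h₂)) ht hpn
    (by rw [size_of_ne_zero hd0]; omega)).imp fun e m₃ h₃ he => ?_
  refine ⟨p * d, he, mul_ne_zero hp hd0, dvd_mul_right _ _, ?_, ?_⟩
  · rw [hd, mul_comm, hc, mul_assoc]
    exact mul_dvd_mul_left g (dvd_mul_left _ _)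
  · rw [natDegree_mul hp hd0]; omega

theorem spec_lcmDilates (hS : SubSpec φ S U G) {a : List ℕ} {u : K[X]} {b r n : ℕ} (hb : 0 < b)
    (ha : HoldsPoly m a u) (hu : u ≠ 0) (hn : (∑ i ∈ Finset.range r, b ^ i) * u.natDegree < n) :
    Spec φ (lcmDilates S b r a) m (r * (3 * U n)) fun s m' => ∃ t, HoldsPoly m' s t ∧ t ≠ 0 ∧
      (∀ i < r, expand K (b ^ i) u ∣ t) ∧
      t.natDegree ≤ (∑ i ∈ Finset.range r, b ^ i) * u.natDegree := by
  refine Spec.bind_le (B₁ := 0) (B₂ := r * (3 * U n)) (Spec.lit 1) ?_ (by simp)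
  intro one m₁ h₁ hone
  have := Spec.foldlM_le (φ := φ) (m := m₁) (B := 3 * U n)
    (f := fun t i => do lcm S t (← dilate (b ^ i) a))
    (fun l s m' => ∃ t, HoldsPoly m' s t ∧ t ≠ 0 ∧ (∀ i ∈ l, expand K (b ^ i) u ∣ t) ∧
      t.natDegree ≤ (∑ i ∈ Finset.range l.length, b ^ i) * u.natDegree) (List.range r) [one]
    ⟨1, holdsPoly_one hone, one_ne_zero, by simp, by simp⟩ (by
      rintro l₁ i l₂ hl s m₂ h₂ ⟨t, ht, ht0, hdvd, hdeg⟩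
      have hi : i = l₁.length ∧ i < r := by
        have h1 := congrArg List.length hl
        have h2 : (List.range r)[l₁.length]? = some i := by rw [hl]; simp
        rw [List.getElem?_eq_some_iff] at h2
        obtain ⟨h3, h4⟩ := h2
        simp only [List.getElem_range] at h4
        simp at h3
        omega
      rw [← hi.1] at hdeg
      have hle : ∑ j ∈ Finset.range (i + 1), b ^ j ≤ ∑ j ∈ Finset.range r, b ^ j :=
        Finset.sum_le_sum_of_subset (by simpa using hi.2)
      have hle' := Nat.mul_le_mul_right u.natDegree hle
      rw [Finset.sum_range_succ, add_mul] at hle'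
      have hbi : 0 < b ^ i := pow_pos hb i
      refine Spec.bind_le (spec_dilate ((ha.mono h₁).mono h₂) hbi)
        (fun d m₃ h₃ hd => ?_) (zero_add _).le
      refine (spec_lcm hS (ht.mono h₃) hd ht0 ((expand_ne_zero hbi).mpr hu) ?_).imp ?_
      · rw [natDegree_expand, mul_comm u.natDegree]; omega
      · rintro s' m₄ h₄ ⟨t', ht', ht0', hd1, hd2, hdeg'⟩
        refine ⟨t', ht', ht0', ?_, ?_⟩
        · intro j hj
          rw [List.mem_append, List.mem_singleton] at hj
          rcases hj with hj | rfl
          · exact (hdvd j hj).trans hd1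
          · exact hd2
        · rw [List.length_append, ← hi.1, List.length_singleton, Finset.sum_range_succ, add_mul]
          rw [natDegree_expand, mul_comm u.natDegree] at hdeg'
          omega)
  rw [List.length_range] at this
  refine this.imp ?_
  rintro s m' _ ⟨t, ht, ht0, hdvd, hdeg⟩
  exact ⟨t, ht, ht0, fun i hi => hdvd i (List.mem_range.mpr hi), hdeg⟩

/-- The registers in `l` hold the coefficients `L 0, …, L r` of an operator of order `r`. -/
def HoldsOp (m : List K) (r : ℕ) (l : List (List ℕ)) (L : ℕ → K[X]) : Prop :=
  List.Forall₂ (HoldsPoly m) l ((List.range (r + 1)).map L)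

theorem HoldsOp.mono {r : ℕ} {l : List (List ℕ)} {L : ℕ → K[X]} (h : HoldsOp m r l L)
    (hm : m <+: m') : HoldsOp m' r l L := forall₂_holdsPoly_mono h hm

theorem HoldsOp.length_eq {r : ℕ} {l : List (List ℕ)} {L : ℕ → K[X]} (h : HoldsOp m r l L) :
    l.length = r + 1 := by simpa using List.Forall₂.length_eq h

theorem HoldsOp.holdsPoly {r : ℕ} {l : List (List ℕ)} {L : ℕ → K[X]} (h : HoldsOp m r l L)
    {k : ℕ} {a : List ℕ} (hk : l[k]? = some a) : HoldsPoly m a (L k) := by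
  obtain ⟨hk', rfl⟩ := List.getElem?_eq_some_iff.mp hk
  have := List.Forall₂.get h hk' (by simpa [h.length_eq] using hk')
  simpa using this

/-- The operator `L 0 + L 1 * M + ⋯ + L r * M ^ r`, where `M p (x) = p (x ^ b)`. -/
noncomputable def mahlerOp (b r : ℕ) (L : ℕ → K[X]) (p : K[X]) : K[X] :=
  ∑ k ∈ Finset.range (r + 1), L k * expand K (b ^ k) p

theorem spec_applyOp (hS : SubSpec φ S U G) {l : List (List ℕ)} {L : ℕ → K[X]} {a : List ℕ}
    {p : K[X]} {b r n : ℕ} (hb : 0 < b) (hl : HoldsOp m r l L) (ha : HoldsPoly m a p)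
    (hL : ∀ k ≤ r, size (L k) ≤ n) (hp : ∀ k ≤ r, size (expand K (b ^ k) p) ≤ n) :
    Spec φ (applyOp S b l a) m ((r + 1) * U n + (r + 2) * (2 * n)) fun s m' =>
      HoldsPoly m' s (mahlerOp b r L p) := by
  have hmem : ∀ x ∈ l.zipIdx, l[x.2]? = some x.1 ∧ x.2 ≤ r := by
    intro x hx
    have := List.mem_zipIdx_iff_getElem?.mp hx
    refine ⟨this, ?_⟩
    have := (List.getElem?_eq_some_iff.mp this).1
    rw [hl.length_eq] at this
    omega
  have h₁ := Spec.mapM_le (φ := φ) (m := m) (f := fun c : List ℕ × ℕ => do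
      S.mul c.1 (← dilate (b ^ c.2) a)) (B := U n)
    (R := fun c s m' => HoldsPoly m' s (L c.2 * expand K (b ^ c.2) p)) l.zipIdx
    (fun _ _ _ _ hm h => h.mono hm) (by
      rintro ⟨c, k⟩ hc m₁ h₁
      obtain ⟨hk, hkr⟩ := hmem _ hc
      refine Spec.bind_le (spec_dilate (ha.mono h₁) (pow_pos hb k)) (fun d m₂ h₂ hd => ?_)
        (zero_add _).le
      exact hS.mul ((hl.holdsPoly hk).mono (h₁.trans h₂)) hd (hL k hkr) (hp k hkr))
  rw [List.length_zipIdx, hl.length_eq] at h₁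
  refine h₁.bind fun as m₁ hm₁ has => ?_
  have h₂ : List.Forall₂ (HoldsPoly m₁) as
      (l.zipIdx.map fun c => L c.2 * expand K (b ^ c.2) p) := by
    rw [List.forall₂_map_right_iff]
    exact has.flip
  have hlen : as.length = r + 1 := by
    rw [← has.length_eq, List.length_zipIdx, hl.length_eq]
  have h₃ := spec_sumPoly (φ := φ) (n := 2 * n) (h₂.imp fun _ _ h => h.holds) (by
    intro a' ha'
    obtain ⟨i, hi, rfl⟩ := List.getElem_of_mem ha'
    have h4 := List.Forall₂.get h₂ hi (by rw [← h₂.length_eq]; exact hi)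
    have hi' : i ≤ r := by omega
    simp only [List.get_eq_getElem, List.getElem_map, List.getElem_zipIdx, zero_add] at h4
    rw [h4.length_eq]
    have h5 := size_mul_le (L i) (expand K (b ^ i) p)
    have h6 := hL i hi'
    have h7 := hp i hi'
    omega)
  rw [hlen] at h₃
  refine h₃.imp fun s m₂ _ hs => ?_
  rw [sum_zipIdx l fun k => L k * expand K (b ^ k) p, hl.length_eq] at hs
  exact hs

end SubSpec

/-! ### The denominator bound: the loop -/

section DenominatorLoop

variable {K : Type*} [Field K]

open Polynomial

/-- One pass through the loop of the denominator bound turns `p` into `p'`, where `u` is the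
largest polynomial such that `u (x ^ (b ^ r))` divides `p`.  The factor that replaces
`u (x ^ (b ^ r))` is only known to be a common multiple of the `u (x ^ (b ^ i))`, `i < r`, of
degree at most the sum of theirs. -/
def LoopStep (b r : ℕ) (p u p' : K[X]) : Prop :=
  (∀ h, h ∣ u ↔ expand K (b ^ r) h ∣ p) ∧
  ∃ c L, p = c * expand K (b ^ r) u ∧ p' = c * L ∧ L ≠ 0 ∧ (∀ i < r, expand K (b ^ i) u ∣ L) ∧
    L.natDegree ≤ (∑ i ∈ Finset.range r, b ^ i) * u.natDegree

/-- The loop of the denominator bound turns `p` into `p'` and extracts the nonconstant polynomials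
`us`. -/
inductive LoopRun (b r : ℕ) : K[X] → List K[X] → K[X] → Prop
  | last {p u p' : K[X]} (h : LoopStep b r p u p') (hu : u.natDegree = 0) : LoopRun b r p [] p'
  | step {p u p₁ p' : K[X]} {us : List K[X]} (h : LoopStep b r p u p₁) (hu : u.natDegree ≠ 0)
      (h' : LoopRun b r p₁ us p') : LoopRun b r p (u :: us) p'

/-- The replacement of `u (x ^ (b ^ r))` by a polynomial of degree at most `(1 + ⋯ + b ^ (r - 1))
deg u` lowers the degree by at least `V deg u`. -/
theorem LoopStep.natDegree_add_le {b r : ℕ} (hb : 0 < b) {p u p' : K[X]} (hp : p ≠ 0)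
    (h : LoopStep b r p u p') {V : ℕ} (hV : V + ∑ i ∈ Finset.range r, b ^ i ≤ b ^ r) :
    p' ≠ 0 ∧ u ≠ 0 ∧ p'.natDegree + V * u.natDegree ≤ p.natDegree := by
  obtain ⟨-, c, L, rfl, rfl, hL, -, hdeg⟩ := h
  have hc : c ≠ 0 := left_ne_zero_of_mul hp
  have hu := right_ne_zero_of_mul hp
  refine ⟨mul_ne_zero hc hL, (expand_ne_zero (pow_pos hb r)).mp hu, ?_⟩
  rw [natDegree_mul hc hL, natDegree_mul hc hu, natDegree_expand, mul_comm u.natDegree]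
  have := Nat.mul_le_mul_right u.natDegree hV
  rw [add_mul] at this
  omega

/-- The drops of the degree add up over the passes; in particular the number of passes is bounded by
the degree. -/
theorem LoopRun.bounds {b r : ℕ} (hb : 0 < b) {p p' : K[X]} {us : List K[X]} (hp : p ≠ 0)
    (h : LoopRun b r p us p') {V : ℕ} (hV : V + ∑ i ∈ Finset.range r, b ^ i ≤ b ^ r) :
    p' ≠ 0 ∧ us.prod ≠ 0 ∧ p'.natDegree + V * us.prod.natDegree ≤ p.natDegree ∧
      us.length ≤ us.prod.natDegree := by
  induction h with
  | last h hu =>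
    obtain ⟨h₁, h₂, h₃⟩ := h.natDegree_add_le hb hp hV
    exact ⟨h₁, by simp, by simp; omega, by simp⟩
  | step h hu h' ih =>
    obtain ⟨h₁, h₂, h₃⟩ := h.natDegree_add_le hb hp hV
    obtain ⟨h₄, h₅, h₆, h₇⟩ := ih h₁
    refine ⟨h₄, by simpa using ⟨h₂, by simpa using h₅⟩, ?_, ?_⟩
    · rw [List.prod_cons, natDegree_mul h₂ h₅, mul_add]
      omega
    · rw [List.prod_cons, natDegree_mul h₂ h₅, List.length_cons]
      omega

theorem sum_range_pow_lt {b : ℕ} (hb : 2 ≤ b) (r : ℕ) : ∑ i ∈ Finset.range r, b ^ i < b ^ r := by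
  induction r with
  | zero => simp
  | succ r ih =>
    rw [Finset.sum_range_succ, pow_succ]
    have := Nat.mul_le_mul_left (b ^ r) hb
    omega

/-- `q` is a possible output of the denominator bound for the leading coefficient `p`. -/
def IsDenomBound (b r : ℕ) (p q : K[X]) : Prop :=
  ∃ ws p' u, LoopRun b r p ws p' ∧ (∀ h, h ∣ u ↔ expand K (b ^ (r - 1)) h ∣ p') ∧
    q = ws.prod * graeffe b u

/-- The degree of the denominator bound.  The hypothesis `hG` is provided by
`graeffe_ne_zero_and_natDegree`. -/
theorem IsDenomBound.bounds {b r : ℕ} (hb : 0 < b)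
    (hG : ∀ u : K[X], u ≠ 0 → graeffe b u ≠ 0 ∧ (graeffe b u).natDegree ≤ u.natDegree)
    {p q : K[X]} (hp : p ≠ 0) (h : IsDenomBound b r p q) {V : ℕ}
    (hV : V + ∑ i ∈ Finset.range r, b ^ i ≤ b ^ r) (hV' : V ≤ b ^ (r - 1)) :
    q ≠ 0 ∧ V * q.natDegree ≤ p.natDegree := by
  obtain ⟨ws, p', u, hrun, hu, rfl⟩ := h
  obtain ⟨h₁, h₂, h₃, -⟩ := hrun.bounds hb hp hV
  have hu0 : u ≠ 0 := by
    rintro rfl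
    have := (hu 0).mp dvd_rfl
    simp at this
    exact h₁ this
  obtain ⟨hg0, hgd⟩ := hG u hu0
  refine ⟨mul_ne_zero h₂ hg0, ?_⟩
  have h₄ := natDegree_le_of_dvd ((hu u).mp dvd_rfl) h₁
  rw [natDegree_expand] at h₄
  rw [natDegree_mul h₂ hg0, mul_add]
  have h₅ : V * (graeffe b u).natDegree ≤ b ^ (r - 1) * u.natDegree := Nat.mul_le_mul hV' hgd
  rw [mul_comm] at h₄
  omega

end DenominatorLoop

section DenominatorProgram

variable {K : Type*} [Field K] [DecidableEq K]

open Polynomial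

variable {φ : Prop} {m m' : List K} {S : Subroutines K} {U G : ℕ → ℕ}

/-- A bound for the number of ops of one pass through the loop of the denominator bound, for
polynomials of size at most `N ≤ b ^ r * k`. -/
def passCost (U : ℕ → ℕ) (b r N k : ℕ) : ℕ := b ^ r * (k + U k) + (3 * r + 2) * U N

/-- The loop terminates before the fuel is exhausted, since every pass but the last lowers the
degree by at least `V`; this also bounds the number of passes. -/
theorem spec_denomLoop (hS : SubSpec φ S U G) {b r N k V : ℕ} (hb : 2 ≤ b)
    (hN : N ≤ b ^ r * k) (hV0 : 0 < V) (hV : V + ∑ i ∈ Finset.range r, b ^ i ≤ b ^ r)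
    (fuel : ℕ) {l : List ℕ} {p : K[X]} (us : List (List ℕ)) (hp : p ≠ 0)
    (hl : HoldsPoly m l p) (hpN : size p ≤ N) (hf : p.natDegree < fuel) :
    Spec φ (denomLoop S b r fuel l us) m ((p.natDegree / V + 1) * passCost U b r N k) fun s m' =>
      ∃ p' vs ws, HoldsPoly m' s.1 p' ∧ s.2 = us ++ vs ∧ List.Forall₂ (HoldsPoly m') vs ws ∧
        LoopRun b r p ws p' := by
  have hb0 : 0 < b := by omega
  induction fuel generalizing l p us m with
  | zero => omega
  | succ fuel ih =>
    have hsz := size_of_ne_zero hp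
    -- it suffices to treat what remains once the factor and the new polynomial have been computed
    suffices H : ∀ B, (∀ u p' l' v (m₁ : List K), LoopStep b r p u p' → HoldsPoly m₁ l' p' →
        HoldsPoly m₁ v u → m <+: m₁ →
        Spec φ (if v.length ≤ 1 then Pure.pure (l', us)
          else denomLoop S b r fuel l' (us ++ [v])) m₁ B (fun s m' =>
            ∃ p' vs ws, HoldsPoly m' s.1 p' ∧ s.2 = us ++ vs ∧ List.Forall₂ (HoldsPoly m') vs ws ∧
        LoopRun b r p ws p')) → Spec φ (denomLoop S b r (fuel + 1) l us) m
          (B + passCost U b r N k) (fun s m' =>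
      ∃ p' vs ws, HoldsPoly m' s.1 p' ∧ s.2 = us ++ vs ∧ List.Forall₂ (HoldsPoly m') vs ws ∧
        LoopRun b r p ws p') by
      refine (H (p.natDegree / V * passCost U b r N k) ?_).le (by rw [add_mul, one_mul])
      intro u p' l' v m₁ hstep hl' hv hm₁
      obtain ⟨hp', hu, hdeg⟩ := hstep.natDegree_add_le hb0 hp hV
      have hlen : v.length ≤ 1 ↔ u.natDegree = 0 := by
        rw [hv.length_eq, size_of_ne_zero hu]; omega
      simp only [hlen]
      split_ifs with hu1
      · exact (Spec.pure ⟨p', [], [], hl', by simp, .nil, .last hstep hu1⟩).le (Nat.zero_le _)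
      · have hVu : V ≤ V * u.natDegree := Nat.le_mul_of_pos_right _ (Nat.pos_of_ne_zero hu1)
        -- a nonconstant factor lowers the degree by at least `V`, which pays for one pass
        have hdiv : p'.natDegree / V + 1 ≤ p.natDegree / V := by
          rw [← Nat.add_div_right _ hV0]
          exact Nat.div_le_div_right (by omega)
        have hsz' := size_of_ne_zero hp'
        refine (ih (us ++ [v]) hp' hl' (by omega) (by omega)).mono
          (Nat.mul_le_mul_right _ hdiv) ?_
        rintro s m₂ hm₂ ⟨p'', vs, ws, h₁, h₂, h₃, h₄⟩
        exact ⟨p'', v :: vs, u :: ws, h₁, by simp [h₂], .cons (hv.mono hm₂) h₃, .step hstep hu1 h₄⟩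
    intro B HB
    refine Spec.bind_le (spec_dilatedFactor hS (pow_pos hb0 r) hl (hpN.trans hN))
      (B₂ := U N + (r * (3 * U N) + (U N + B))) ?_ (by rw [passCost]; ring_nf; rfl)
    rintro v m₁ h₁ ⟨u, hv, hu⟩
    obtain ⟨c, hc⟩ := (hu u).mp dvd_rfl
    rw [mul_comm] at hc
    have hc0 : c ≠ 0 := by rintro rfl; exact hp (by simpa using hc)
    have hu0' : expand K (b ^ r) u ≠ 0 := fun h0 => hp (by rw [hc, h0, mul_zero])
    have hu0 : u ≠ 0 := (expand_ne_zero (pow_pos hb0 r)).mp hu0'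
    have hdegp : p.natDegree = c.natDegree + b ^ r * u.natDegree := by
      rw [hc, natDegree_mul hc0 hu0', natDegree_expand, mul_comm u.natDegree]
    have hSu : (∑ i ∈ Finset.range r, b ^ i) * u.natDegree ≤ b ^ r * u.natDegree :=
      Nat.mul_le_mul_right _ (by omega)
    have hlc := hl
    rw [hc] at hlc
    refine Spec.bind_le (B₁ := 0) (spec_dilate hv (pow_pos hb0 r)) (fun v' m₂ h₂ hv' => ?_)
      (zero_add _).le
    refine (hS.div hu0' (hlc.mono (h₁.trans h₂)) hv' (hc ▸ hpN)).bind fun d m₃ h₃ hd => ?_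
    refine (spec_lcmDilates hS (n := N) hb0 (hv.mono (h₂.trans h₃)) hu0 (by omega)).bind ?_
    rintro t m₄ h₄ ⟨L, ht, hL0, hLdvd, hLdeg⟩
    refine (hS.mul (hd.mono h₄) ht (n := N) (by rw [size_of_ne_zero hc0]; omega)
      (by rw [size_of_ne_zero hL0]; omega)).bind fun l' m₅ h₅ hl' => ?_
    exact HB u (c * L) l' v m₅ ⟨hu, c, L, hc, rfl, hL0, hLdvd, hLdeg⟩ hl'
      (hv.mono (h₂.trans (h₃.trans (h₄.trans h₅)))) (h₁.trans (h₂.trans (h₃.trans (h₄.trans h₅))))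

theorem spec_denomBound (hS : SubSpec φ S U G) {b r N k V : ℕ} (hb : 2 ≤ b)
    (hG : ∀ u : K[X], u ≠ 0 → graeffe b u ≠ 0 ∧ (graeffe b u).natDegree ≤ u.natDegree)
    (hN : N ≤ b ^ (r - 1) * k) (hV0 : 0 < V)
    (hV : V + ∑ i ∈ Finset.range r, b ^ i ≤ b ^ r) (hV' : V ≤ b ^ (r - 1)) {l : List ℕ} {p : K[X]}
    (hp : p ≠ 0) (hl : HoldsPoly m l p) (hpN : size p ≤ N) :
    Spec φ (denomBound S b r l) m
      ((p.natDegree / V + 1) * (passCost U b r N k + U N) + (b ^ (r - 1) * (k + U k) + G b * U N))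
      fun s m' => ∃ q, HoldsPoly m' s q ∧ IsDenomBound b r p q := by
  have hb0 : 0 < b := by omega
  have hN' : N ≤ b ^ r * k :=
    hN.trans (Nat.mul_le_mul_right _ (Nat.pow_le_pow_right hb0 (Nat.sub_le r 1)))
  have hsz := size_of_ne_zero hp
  refine Spec.bind_le (spec_denomLoop hS hb hN' hV0 hV l.length [] hp hl hpN
    (by rw [hl.length_eq]; omega))
    (B₂ := b ^ (r - 1) * (k + U k) + (G b * U N + (p.natDegree / V + 1) * U N)) ?_ (by
      rw [mul_add ((p.natDegree / V + 1) : ℕ)]; omega)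
  rintro s m₁ h₁ ⟨p', vs, ws, hp', hs, hvs, hrun⟩
  obtain ⟨hp0, hw0, hdeg, hlen⟩ := hrun.bounds hb0 hp hV
  have hsz' := size_of_ne_zero hp0
  refine (spec_dilatedFactor hS (pow_pos hb0 _) hp' (by omega)).bind ?_
  rintro v m₂ h₂ ⟨u, hv, hu⟩
  have hu0 : u ≠ 0 := by
    rintro rfl
    have := (hu 0).mp dvd_rfl
    simp at this
    exact hp0 this
  have hu1 := natDegree_le_of_dvd ((hu u).mp dvd_rfl) hp0
  rw [natDegree_expand] at hu1
  have hu2 : u.natDegree ≤ u.natDegree * b ^ (r - 1) :=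
    Nat.le_mul_of_pos_right _ (pow_pos hb0 _)
  refine (hS.graeffe hb hu0 hv (n := N) (by rw [size_of_ne_zero hu0]; omega)).bind ?_
  intro g m₃ h₃ hg
  have hbound : IsDenomBound b r p (ws.prod * graeffe b u) := ⟨ws, p', u, hrun, hu, rfl⟩
  obtain ⟨hq0, hqd⟩ := hbound.bounds hb0 hG hp hV hV'
  have hqd' : (ws.prod * graeffe b u).natDegree ≤ V * (ws.prod * graeffe b u).natDegree :=
    Nat.le_mul_of_pos_left _ hV0
  have hprod : (ws ++ [graeffe b u]).prod = ws.prod * graeffe b u := by simp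
  have := spec_prodPoly hS (m := m₃) (as := s.2 ++ [g]) (ps := ws ++ [graeffe b u]) (n := N) (by
      rw [hs, List.nil_append]
      exact List.rel_append (forall₂_holdsPoly_mono hvs (h₂.trans h₃)) (.cons hg .nil))
      (by rwa [hprod]) (by rw [hprod, size_of_ne_zero hq0]; omega)
  refine this.mono ?_ ?_
  · refine Nat.mul_le_mul_right _ ?_
    rw [hs, List.nil_append, List.length_append, List.length_singleton, hvs.length_eq]
    refine Nat.succ_le_succ (hlen.trans ?_)
    rw [Nat.le_div_iff_mul_le hV0, mul_comm]
    omega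
  · intro t m₄ _ ht
    rw [hprod] at ht
    exact ⟨_, ht, hbound⟩

end DenominatorProgram

/-! ### Root multiplicities over an algebraically closed field -/

section Multiplicities

open Polynomial

variable {F : Type*} [Field F]

/-- Away from `0`, and in characteristic zero, the map `β ↦ β ^ n` is unramified. -/
theorem rootMultiplicity_expand_eq [CharZero F] {p : F[X]} (hp : p ≠ 0) {n : ℕ} (hn : 0 < n) {β : F}
    (hβ : β ≠ 0) : rootMultiplicity β (expand F n p) = rootMultiplicity (β ^ n) p := by
  obtain ⟨q, hq, hdvd⟩ := exists_eq_pow_rootMultiplicity_mul_and_not_dvd p hp (β ^ n)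
  set s := rootMultiplicity (β ^ n) p
  obtain ⟨h, hh⟩ := dvd_iff_isRoot.mpr (show IsRoot (X ^ n - C (β ^ n)) β by simp)
  -- the derivative of `x ^ n - β ^ n` does not vanish at `β`
  have hh0 : h.eval β ≠ 0 := by
    have h1 := congrArg (fun f => (derivative f).eval β) hh
    simp only [derivative_sub, derivative_X_pow, derivative_C, derivative_mul, derivative_X,
      eval_sub, eval_add, eval_mul, eval_pow, eval_X, eval_C,
      sub_self, sub_zero, zero_mul, add_zero, one_mul] at h1
    rw [← h1]
    exact mul_ne_zero (Nat.cast_ne_zero.mpr hn.ne') (pow_ne_zero _ hβ)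
  have hq0 : (expand F n q).eval β ≠ 0 := by
    rw [expand_eval]
    exact fun h0 => hdvd (dvd_iff_isRoot.mpr h0)
  have hexp : expand F n p = (X - C β) ^ s * (h ^ s * expand F n q) := by
    rw [hq, map_mul, map_pow, map_sub, expand_X, expand_C, hh, mul_pow, mul_assoc]
  rw [hexp, rootMultiplicity_mul (by
    rw [← hexp]; exact (expand_ne_zero hn).mpr hp), rootMultiplicity_X_sub_C_pow,
    rootMultiplicity_eq_zero, add_zero]
  rw [IsRoot, eval_mul, eval_pow]
  exact mul_ne_zero (pow_ne_zero _ hh0) hq0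

/-- The roots of `x ^ n - γ` are simple, so the divisibility by its powers can be checked root by
root. -/
theorem expand_X_sub_C_pow_dvd [IsAlgClosed F] [CharZero F] {p : F[X]} (hp : p ≠ 0) {n : ℕ}
    (hn : 0 < n) {γ : F} (hγ : γ ≠ 0) {s : ℕ}
    (h : ∀ β, β ^ n = γ → s ≤ rootMultiplicity β p) : expand F n ((X - C γ) ^ s) ∣ p := by
  classical
  have h0 : ((X - C γ) ^ s : F[X]) ≠ 0 := pow_ne_zero _ (X_sub_C_ne_zero γ)
  rw [IsAlgClosed.dvd_iff_roots_le_roots ((expand_ne_zero hn).mpr h0) hp, Multiset.le_iff_count]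
  intro β
  rw [count_roots, count_roots]
  by_cases hβ : β = 0
  · rw [rootMultiplicity_eq_zero]
    · exact Nat.zero_le _
    · simp [hβ, hn.ne', hγ]
  rw [rootMultiplicity_expand_eq h0 hn hβ]
  by_cases hβn : β ^ n = γ
  · rw [hβn, rootMultiplicity_X_sub_C_pow]
    exact h β hβn
  · rw [rootMultiplicity_eq_zero]
    · exact Nat.zero_le _
    · simp [sub_eq_zero, hβn]

variable {K : Type*} [Field K] [Algebra K F]

variable (F) in
/-- The multiplicity of `α` as a root of `p` in an extension of the base field. -/
noncomputable def mult (p : K[X]) (α : F) : ℕ := rootMultiplicity α (p.map (algebraMap K F))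

theorem map_ne_zero' {p : K[X]} (hp : p ≠ 0) : p.map (algebraMap K F) ≠ 0 :=
  (Polynomial.map_ne_zero_iff (algebraMap K F).injective).mpr hp

theorem mult_mul {p q : K[X]} (h : p * q ≠ 0) (α : F) :
    mult F (p * q) α = mult F p α + mult F q α := by
  unfold mult
  rw [Polynomial.map_mul, rootMultiplicity_mul]
  rw [← Polynomial.map_mul]
  exact map_ne_zero' h

theorem mult_expand [CharZero F] {p : K[X]} (hp : p ≠ 0) {n : ℕ} (hn : 0 < n) {β : F}
    (hβ : β ≠ 0) : mult F (expand K n p) β = mult F p (β ^ n) := by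
  unfold mult
  rw [map_expand, rootMultiplicity_expand_eq (map_ne_zero' hp) hn hβ]

theorem mult_le_of_dvd {p q : K[X]} (h : p ∣ q) (hq : q ≠ 0) (α : F) : mult F p α ≤ mult F q α := by
  obtain ⟨c, rfl⟩ := h
  rw [mult_mul hq]
  exact Nat.le_add_right _ _

theorem map_slicePoly {n : ℕ} (hn : n ≠ 0) (i : ℕ) (p : K[X]) :
    (slicePoly n i p).map (algebraMap K F) = slicePoly n i (p.map (algebraMap K F)) := by
  ext j
  simp [coeff_slicePoly hn]

/-- The largest `u` such that `u (x ^ n)` divides `p` remains so over a larger field. -/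
theorem dvd_map_of_expand_dvd_map {n : ℕ} (hn : 0 < n) {p u : K[X]}
    (hu : ∀ h, h ∣ u ↔ expand K n h ∣ p) {H : F[X]}
    (hH : expand F n H ∣ p.map (algebraMap K F)) : H ∣ u.map (algebraMap K F) := by
  let I : Ideal K[X] := Ideal.span (Set.range fun i : Fin n => slicePoly n i p)
  obtain ⟨g, hg⟩ := (IsPrincipalIdealRing.principal I).principal
  -- `u` is the gcd of the slices of `p`, and as such a combination of them; this survives extension
  have hgu : g ∣ u := by
    rw [hu, expand_dvd_iff hn]
    intro i hi
    have : slicePoly n i p ∈ I := Ideal.subset_span ⟨⟨i, hi⟩, rfl⟩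
    rw [hg] at this
    exact Ideal.mem_span_singleton.mp this
  have hui : u ∈ I := by
    rw [hg]
    exact Ideal.mem_span_singleton.mpr hgu
  obtain ⟨c, hc⟩ := Ideal.mem_span_range_iff_exists_fun.mp hui
  rw [← hc, Polynomial.map_sum]
  refine Finset.dvd_sum fun i _ => ?_
  rw [Polynomial.map_mul, map_slicePoly hn.ne']
  exact ((expand_dvd_iff hn).mp hH i i.2).mul_left _

end Multiplicities

/-! ### The denominator bound: poles outside `0` -/

section Poles

open Polynomial

variable {F : Type*} [Field F]

/-- The pole orders `m` of a solution at the nonzero points satisfy this inequality, where `n` is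
the vanishing order of the leading coefficient of the equation. -/
def PoleBound (b r : ℕ) (n m : F → ℕ) : Prop :=
  ∀ β, β ≠ 0 → m (β ^ b ^ r) ≤ n β + (Finset.range r).sup fun i => m (β ^ b ^ i)

variable {K : Type*} [Field K] [Algebra K F]

/-- A pass through the loop preserves the inequality for the pole orders, once the multiplicities of
the extracted factor have been subtracted: at the left, `u (x ^ (b ^ r))` accounts for the loss, and
at the right the common multiple of the `u (x ^ (b ^ i))` makes up for it. -/
theorem LoopStep.poleBound [CharZero F] {b r : ℕ} (hb : 0 < b) {p u p' : K[X]} (hp : p ≠ 0)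
    (h : LoopStep b r p u p') {m : F → ℕ} (hm : PoleBound b r (mult F p) m) :
    PoleBound b r (mult F p') fun α => m α - mult F u α := by
  obtain ⟨-, c, L, rfl, rfl, hL, hdvd, -⟩ := h
  intro β hβ
  have hm' := hm β hβ
  have hc : c ≠ 0 := left_ne_zero_of_mul hp
  have hu : u ≠ 0 := (expand_ne_zero (pow_pos hb r)).mp (right_ne_zero_of_mul hp)
  rw [mult_mul hp, mult_expand hu (pow_pos hb r) hβ] at hm'
  rw [mult_mul (mul_ne_zero hc hL)]
  have hsup : ((Finset.range r).sup fun i => m (β ^ b ^ i)) ≤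
      mult F L β + (Finset.range r).sup fun i => m (β ^ b ^ i) - mult F u (β ^ b ^ i) := by
    refine Finset.sup_le fun i hi => ?_
    have h₁ := mult_le_of_dvd (F := F) (hdvd i (Finset.mem_range.mp hi)) hL β
    rw [mult_expand hu (pow_pos hb i) hβ] at h₁
    have h₂ := Finset.le_sup (f := fun i => m (β ^ b ^ i) - mult F u (β ^ b ^ i)) hi
    omega
  dsimp only
  omega

theorem LoopRun.poleBound [CharZero F] {b r : ℕ} (hb : 2 ≤ b) {p p' : K[X]} {us : List K[X]}
    (hp : p ≠ 0) (h : LoopRun b r p us p') {m : F → ℕ} (hm : PoleBound b r (mult F p) m) :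
    PoleBound b r (mult F p') fun α => m α - mult F us.prod α := by
  have hV : 0 + ∑ i ∈ Finset.range r, b ^ i ≤ b ^ r := by
    rw [zero_add]; exact (sum_range_pow_lt hb r).le
  induction h generalizing m with
  | last h hu =>
    have hu0 := (h.natDegree_add_le (by omega) hp hV).2.1
    convert h.poleBound (by omega) hp hm using 3 with α
    rw [List.prod_nil]
    obtain ⟨c, rfl⟩ := natDegree_eq_zero.mp hu
    simp [mult, ← C_1, -map_one]
  | step h hu h' ih =>
    have h₁ := h.natDegree_add_le (by omega) hp hV
    have h₂ := h'.bounds (by omega) h₁.1 hV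
    have := ih h₁.1 (h.poleBound (by omega) hp hm)
    refine (congrArg _ (funext fun α => ?_)).mp this
    rw [List.prod_cons, mult_mul (mul_ne_zero h₁.2.1 h₂.2.1), Nat.sub_sub]

/-- After the loop, the polynomial has no nonconstant factor of the form `u (x ^ (b ^ r))`, so it
does not vanish at all the `b ^ r`-th roots of a nonzero point. -/
theorem LoopRun.exists_mult_eq_zero [IsAlgClosed F] [CharZero F] {b r : ℕ} (hb : 2 ≤ b)
    {p p' : K[X]} {us : List K[X]} (hp : p ≠ 0) (h : LoopRun b r p us p') {α : F} (hα : α ≠ 0) :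
    ∃ β, β ^ b ^ r = α ∧ mult F p' β = 0 := by
  have hV : 0 + ∑ i ∈ Finset.range r, b ^ i ≤ b ^ r := by
    rw [zero_add]; exact (sum_range_pow_lt hb r).le
  have hbr : 0 < b ^ r := pow_pos (by omega) r
  induction h with
  | @last p u p' h hu =>
    have hu0 := (h.natDegree_add_le (by omega) hp hV).2.1
    obtain ⟨hdvd, c, L, hpc, hpc', hL0, -, hL⟩ := h
    rw [hu, mul_zero, Nat.le_zero, natDegree_eq_zero] at hL
    obtain ⟨d, rfl⟩ := hL
    obtain ⟨e, rfl⟩ := natDegree_eq_zero.mp hu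
    have hd : d ≠ 0 := by simpa using hL0
    have he : e ≠ 0 := by simpa using hu0
    rw [expand_C] at hpc
    have hc0 : c ≠ 0 := by rintro rfl; exact hp (by simpa using hpc)
    -- in the last pass only constants are exchanged
    have hmult : ∀ β : F, mult F p' β = mult F p β := by
      intro β
      rw [hpc, hpc', mult_mul (by simp [hc0, hd]), mult_mul (by simp [hc0, he])]
      simp [mult]
    by_contra hcon
    push Not at hcon
    have hdvd' : expand F (b ^ r) ((X - C α) ^ 1) ∣ p.map (algebraMap K F) :=
      expand_X_sub_C_pow_dvd (map_ne_zero' hp) hbr hα fun β hβ => by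
        have := hcon β hβ
        rw [hmult] at this
        exact Nat.one_le_iff_ne_zero.mpr this
    have := dvd_map_of_expand_dvd_map hbr hdvd hdvd'
    rw [pow_one, dvd_iff_isRoot] at this
    simp [he] at this
  | step h hu h' ih =>
    exact ih (h.natDegree_add_le (by omega) hp hV).1

/-- A nonzero element has at least two distinct `b`-th roots. -/
theorem exists_pow_eq_ne [IsAlgClosed F] [CharZero F] {b : ℕ} (hb : 2 ≤ b) {α : F} (hα : α ≠ 0) :
    ∃ γ γ' : F, γ ^ b = α ∧ γ' ^ b = α ∧ γ ≠ γ' := by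
  obtain ⟨γ, hγ⟩ := IsAlgClosed.exists_pow_nat_eq α (show 0 < b by omega)
  have hγ0 : γ ≠ 0 := by
    rintro rfl
    rw [zero_pow (by omega)] at hγ
    exact hα hγ.symm
  have : NeZero (b : F) := ⟨Nat.cast_ne_zero.mpr (by omega)⟩
  obtain ⟨ζ, hζ⟩ := HasEnoughRootsOfUnity.exists_primitiveRoot F b
  refine ⟨γ, ζ * γ, hγ, by rw [mul_pow, hζ.pow_eq_one, one_mul, hγ], fun h => ?_⟩
  have : ζ = 1 := by
    have h' : 1 * γ = ζ * γ := by rwa [one_mul]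
    exact (mul_right_cancel₀ hγ0 h').symm
  exact hζ.ne_one (by omega) this

/-- Under the condition `hn`, which holds after the loop, all poles are periodic under `z ↦ z ^ b`.
One of the `b`-th roots of a pole is not periodic.  Neither this root `γ` nor any point that is sent
to it by an iterate is a pole, so that the order of the pole is bounded by the vanishing order of
the leading coefficient at all the `b ^ (r - 1)`-th roots of `γ`. -/
theorem PoleBound.exists_pow_eq [IsAlgClosed F] [CharZero F] {b r : ℕ} (hb : 2 ≤ b) (hr : 1 ≤ r)
    {n m : F → ℕ} (hm : PoleBound b r n m) (hfin : {α | m α ≠ 0}.Finite)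
    (hn : ∀ α, α ≠ 0 → ∃ β, β ^ b ^ r = α ∧ n β = 0) {α : F} (hα : α ≠ 0) :
    ∃ γ, γ ^ b = α ∧ ∀ β, β ^ b ^ (r - 1) = γ → m α ≤ n β := by
  have hb0 : 0 < b := by omega
  set f : F → F := fun z => z ^ b with hf
  have hit : ∀ k z, f^[k] z = z ^ b ^ k := by
    intro k
    induction k with
    | zero => simp
    | succ k ih => intro z; rw [Function.iterate_succ_apply, ih, hf, ← pow_mul, pow_succ']
  -- every pole is an iterated image of a pole
  have hback : ∀ α, α ≠ 0 → m α ≠ 0 → ∃ β, β ≠ 0 ∧ m β ≠ 0 ∧ ∃ j, 1 ≤ j ∧ f^[j] β = α := by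
    intro α hα hmα
    obtain ⟨β, hβ, hnβ⟩ := hn α hα
    have hβ0 : β ≠ 0 := by
      rintro rfl
      rw [zero_pow (pow_pos hb0 r).ne'] at hβ
      exact hα hβ.symm
    have h₁ := hm β hβ0
    rw [hβ, hnβ, zero_add] at h₁
    obtain ⟨i, hi, hlt⟩ := (Finset.lt_sup_iff (a := 0)).mp (lt_of_lt_of_le (Nat.pos_of_ne_zero hmα) h₁)
    rw [Finset.mem_range] at hi
    refine ⟨β ^ b ^ i, pow_ne_zero _ hβ0, hlt.ne', r - i, by omega, ?_⟩
    rw [hit, ← pow_mul, ← pow_add, Nat.add_sub_cancel' hi.le, hβ]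
  -- a backward chain of poles must return to a point where it has been, as poles are finite in
  -- number
  have hper : ∀ α, α ≠ 0 → m α ≠ 0 → α ∈ Function.periodicPts f := by
    intro α hα hmα
    let S := {α : F // α ≠ 0 ∧ m α ≠ 0}
    have : Finite S := (hfin.subset fun x (hx : x ≠ 0 ∧ m x ≠ 0) => hx.2)
    choose g hg using fun s : S => hback s s.2.1 s.2.2
    let g' : S → S := fun s => ⟨g s, (hg s).1, (hg s).2.1⟩
    have hg' : ∀ k (s : S), ∃ j, k ≤ j ∧ f^[j] (g'^[k] s : F) = s := by
      intro k
      induction k with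
      | zero => intro s; exact ⟨0, le_rfl, rfl⟩
      | succ k ih =>
        intro s
        obtain ⟨j, hj, hs⟩ := ih (g' s)
        obtain ⟨j', hj', hs'⟩ := (hg s).2.2
        refine ⟨j' + j, by omega, ?_⟩
        rw [Function.iterate_add_apply, Function.iterate_succ_apply, hs]
        exact hs'
    obtain ⟨k, l, hkl, hgkl⟩ := Finite.exists_ne_map_eq_of_infinite fun k : ℕ => g'^[k] ⟨α, hα, hmα⟩
    wlog hlt : k < l generalizing k l
    · exact this l k hkl.symm hgkl.symm (by omega)
    obtain ⟨j, hj, hs⟩ := hg' (l - k) (g'^[k] ⟨α, hα, hmα⟩)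
    rw [← Function.iterate_add_apply, Nat.sub_add_cancel hlt.le] at hs
    rw [← hgkl] at hs
    obtain ⟨j', -, hs'⟩ := hg' k ⟨α, hα, hmα⟩
    dsimp only at hs'
    refine ⟨j, by omega, ?_⟩
    change f^[j] α = α
    rw [← hs', ← Function.iterate_add_apply, add_comm, Function.iterate_add_apply, hs]
  by_cases hmα : m α = 0
  · obtain ⟨γ, -, hγ, -⟩ := exists_pow_eq_ne hb hα
    exact ⟨γ, hγ, fun β _ => by omega⟩
  -- `f` is injective on its periodic points
  have hinj : ∀ x y, x ∈ Function.periodicPts f → y ∈ Function.periodicPts f → f x = f y →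
      x = y := by
    intro x y hx hy hxy
    exact (Function.bijOn_periodicPts f).injOn hx hy hxy
  -- of two distinct `b`-th roots of the pole, at most one is periodic
  obtain ⟨γ, hγ, hγper⟩ : ∃ γ, γ ^ b = α ∧ γ ∉ Function.periodicPts f := by
    obtain ⟨γ, γ', h₁, h₂, h₃⟩ := exists_pow_eq_ne hb hα
    by_contra hcon
    push Not at hcon
    exact h₃ (hinj γ γ' (hcon γ h₁) (hcon γ' h₂) (h₁.trans h₂.symm))
  refine ⟨γ, hγ, fun β hβ => ?_⟩
  have hβ0 : β ≠ 0 := by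
    rintro rfl
    rw [zero_pow (pow_pos hb0 _).ne'] at hβ
    rw [← hβ, zero_pow (by omega)] at hγ
    exact hα hγ.symm
  have h₁ := hm β hβ0
  have hβr : β ^ b ^ r = α := by
    rw [← hγ, ← hβ, ← pow_mul, ← pow_succ, Nat.sub_add_cancel hr]
  -- a pole among the powers of `β` would be periodic, and so would be its image `γ`
  have hsup : ((Finset.range r).sup fun i => m (β ^ b ^ i)) ≤ 0 := by
    refine Finset.sup_le fun i hi => ?_
    rw [Finset.mem_range] at hi
    by_contra hne
    have hpi := hper (β ^ b ^ i) (pow_ne_zero _ hβ0) (by omega)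
    apply hγper
    have h₂ : f^[r - 1 - i] (β ^ b ^ i) = γ := by
      rw [hit, ← pow_mul, ← pow_add, Nat.add_sub_cancel' (by omega), hβ]
    rw [← h₂]
    exact (Function.bijOn_periodicPts f).mapsTo.iterate _ hpi
  rw [hβr] at h₁
  omega

end Poles

/-! ### The Graeffe operator -/

section Graeffe

open Polynomial

variable {K : Type*} [Field K]

theorem graeffe_mul {b : ℕ} {p q : K[X]} (hp : p ≠ 0) (hq : q ≠ 0) :
    graeffe b (p * q) = graeffe b p * graeffe b q := by
  have hC : Function.Injective (C : K →+* K[X]) := C_injective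
  unfold graeffe
  rw [Polynomial.map_mul, natDegree_mul ((Polynomial.map_ne_zero_iff hC).mpr hp)
    ((Polynomial.map_ne_zero_iff hC).mpr hq)]
  exact resultant_mul_right _ _ _ _ le_rfl

theorem graeffe_C (b : ℕ) (c : K) : graeffe b (C c) = C (c ^ b) := by
  unfold graeffe
  rw [map_C, natDegree_C, resultant_C_zero_right, natDegree_X_pow_sub_C, C_pow]

theorem graeffe_X_sub_C (b : ℕ) (γ : K) :
    graeffe b (X - C γ) = (-1) ^ b * (C (γ ^ b) - X) := by
  unfold graeffe
  rw [Polynomial.map_sub, map_X, map_C, natDegree_X_sub_C, resultant_X_sub_C_right _ _ _ le_rfl,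
    natDegree_X_pow_sub_C]
  simp

theorem graeffe_map {F : Type*} [Field F] (f : K →+* F) (b : ℕ) (p : K[X]) :
    (graeffe b p).map f = graeffe b (p.map f) := by
  have h := resultant_map_map ((X : K[X][X]) ^ b - C X) (p.map C)
    ((X : K[X][X]) ^ b - C X).natDegree (p.map C).natDegree (mapRingHom f)
  rw [coe_mapRingHom] at h
  unfold graeffe
  rw [← h]
  have h₁ : ((X : K[X][X]) ^ b - C X).map (mapRingHom f) = X ^ b - C X := by simp
  have h₂ : (p.map C).map (mapRingHom f) = (p.map f).map C := by
    rw [Polynomial.map_map, Polynomial.map_map]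
    congr 1
    ext; simp
  rw [h₁, h₂]
  congr 1
  · rw [natDegree_X_pow_sub_C, natDegree_X_pow_sub_C]
  · rw [natDegree_map_eq_of_injective C_injective, natDegree_map_eq_of_injective C_injective,
      natDegree_map_eq_of_injective f.injective]

/-- Induction on the linear factors of a polynomial over an algebraically closed field. -/
theorem induction_linear_factors {F : Type*} [Field F] [IsAlgClosed F] {P : F[X] → Prop}
    (h₁ : ∀ c, c ≠ 0 → P (C c)) (h₂ : ∀ γ q, q ≠ 0 → P q → P ((X - C γ) * q)) {p : F[X]}
    (hp : p ≠ 0) : P p := by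
  induction hn : p.natDegree generalizing p with
  | zero =>
    obtain ⟨c, rfl⟩ := natDegree_eq_zero.mp hn
    exact h₁ c (by simpa using hp)
  | succ n ih =>
    obtain ⟨γ, hγ⟩ := IsAlgClosed.exists_root p (by
      rw [degree_eq_natDegree hp, hn]
      exact Nat.cast_ne_zero.mpr (Nat.succ_ne_zero n))
    obtain ⟨q, rfl⟩ := dvd_iff_isRoot.mpr hγ
    have hq : q ≠ 0 := right_ne_zero_of_mul hp
    refine h₂ γ q hq (ih hq ?_)
    rw [natDegree_mul (X_sub_C_ne_zero γ) hq, natDegree_X_sub_C] at hn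
    omega

/-- Over an algebraic closure, the Graeffe operator sends a product of factors `x - γ` to the
product of the factors `x - γ ^ b`, up to sign. -/
theorem graeffe_ne_zero_and_natDegree (b : ℕ) {p : K[X]} (hp : p ≠ 0) :
    graeffe b p ≠ 0 ∧ (graeffe b p).natDegree ≤ p.natDegree := by
  have key : ∀ p : (AlgebraicClosure K)[X], p ≠ 0 → graeffe b p ≠ 0 ∧
      (graeffe b p).natDegree ≤ p.natDegree := by
    intro p hp
    refine induction_linear_factors (P := fun p => graeffe b p ≠ 0 ∧
      (graeffe b p).natDegree ≤ p.natDegree) ?_ ?_ hp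
    · intro c hc
      rw [graeffe_C]
      simp [hc]
    · rintro γ q hq ⟨ih₁, ih₂⟩
      have hX : (X : (AlgebraicClosure K)[X]) - C (γ ^ b) ≠ 0 := X_sub_C_ne_zero _
      have h₁ : graeffe b (X - C γ) = C ((-1) ^ (b + 1)) * (X - C (γ ^ b)) := by
        rw [graeffe_X_sub_C, pow_succ]; simp; ring
      have h₂ : (C ((-1) ^ (b + 1)) : (AlgebraicClosure K)[X]) ≠ 0 := by simp
      rw [graeffe_mul (X_sub_C_ne_zero γ) hq, h₁]
      refine ⟨mul_ne_zero (mul_ne_zero h₂ hX) ih₁, ?_⟩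
      rw [natDegree_mul (mul_ne_zero h₂ hX) ih₁, natDegree_mul h₂ hX, natDegree_C,
        natDegree_X_sub_C, natDegree_mul (X_sub_C_ne_zero γ) hq, natDegree_X_sub_C]
      omega
  have hmap : p.map (algebraMap K (AlgebraicClosure K)) ≠ 0 := map_ne_zero' hp
  obtain ⟨h₁, h₂⟩ := key _ hmap
  rw [← graeffe_map] at h₁ h₂
  rw [natDegree_map, natDegree_map] at h₂
  exact ⟨fun h => h₁ (by rw [h, Polynomial.map_zero]), h₂⟩

/-- If `γ` is a root of `p`, then `γ ^ b` is a root of the Graeffe transform of `p`, with at least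
the same multiplicity. -/
theorem le_mult_graeffe {F : Type*} [Field F] [Algebra K F] (b : ℕ) {p : K[X]}
    (hp : p ≠ 0) {γ : F} {s : ℕ} (h : (X - C γ) ^ s ∣ p.map (algebraMap K F)) :
    s ≤ mult F (graeffe b p) (γ ^ b) := by
  unfold mult
  obtain ⟨hg, -⟩ := graeffe_ne_zero_and_natDegree b hp
  rw [le_rootMultiplicity_iff (map_ne_zero' hg), graeffe_map]
  have hp' : p.map (algebraMap K F) ≠ 0 := map_ne_zero' hp
  obtain ⟨q, hq⟩ := h
  rw [hq] at hp' ⊢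
  rw [graeffe_mul (left_ne_zero_of_mul hp') (right_ne_zero_of_mul hp')]
  refine Dvd.dvd.mul_right ?_ _
  clear hq hp'
  induction s with
  | zero => simp
  | succ s ih =>
    rw [pow_succ, pow_succ, graeffe_mul (pow_ne_zero _ (X_sub_C_ne_zero γ)) (X_sub_C_ne_zero γ),
      graeffe_X_sub_C]
    refine mul_dvd_mul ih (Dvd.dvd.mul_left ?_ _)
    rw [← neg_sub, neg_dvd]

/-- The matrix of the multiplication by `p (y)` in the basis `1, y, …, y ^ (b - 1)` of the ring
`K[x][y] / (y ^ b - x)`. -/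
noncomputable def graeffeMatrix (b : ℕ) (p : K[X]) : Matrix (Fin b) (Fin b) K[X] :=
  .of fun i j => if j ≤ i then slicePoly b (i - j) p else X * slicePoly b (b + i - j) p

theorem slicePoly_C_mul {b : ℕ} (hb : b ≠ 0) (i : ℕ) (c : K) (p : K[X]) :
    slicePoly b i (C c * p) = C c * slicePoly b i p := by
  ext j; simp [coeff_slicePoly hb]

theorem slicePoly_sub {b : ℕ} (hb : b ≠ 0) (i : ℕ) (p q : K[X]) :
    slicePoly b i (p - q) = slicePoly b i p - slicePoly b i q := by
  ext j; simp [coeff_slicePoly hb]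

theorem slicePoly_succ_X_mul {b : ℕ} (hb : b ≠ 0) (i : ℕ) (p : K[X]) :
    slicePoly b (i + 1) (X * p) = slicePoly b i p := by
  ext j
  rw [coeff_slicePoly hb, coeff_slicePoly hb, show i + 1 + b * j = i + b * j + 1 by ring,
    coeff_X_mul]

theorem slicePoly_zero_X_mul {n : ℕ} (p : K[X]) :
    slicePoly (n + 1) 0 (X * p) = X * slicePoly (n + 1) n p := by
  ext j
  rw [coeff_slicePoly (Nat.succ_ne_zero n)]
  rcases j with _ | j
  · simp
  · rw [coeff_X_mul, coeff_slicePoly (Nat.succ_ne_zero n),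
      show 0 + (n + 1) * (j + 1) = n + (n + 1) * j + 1 by ring, coeff_X_mul]

/-- The matrix of the multiplication by `y - γ`. -/
noncomputable def shiftMatrix (n : ℕ) (γ : K) : Matrix (Fin (n + 1)) (Fin (n + 1)) K[X] :=
  .of fun i j => (if (i : ℕ) = j + 1 then 1 else 0) - (if i = j then C γ else 0) +
    if (i : ℕ) = 0 ∧ (j : ℕ) = n then X else 0

theorem graeffeMatrix_X_mul_apply (n : ℕ) (q : K[X]) (i j : Fin (n + 1)) :
    graeffeMatrix (n + 1) (X * q) i j =
      if h : (i : ℕ) = 0 then X * graeffeMatrix (n + 1) q (Fin.last n) j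
      else graeffeMatrix (n + 1) q ⟨i - 1, by omega⟩ j := by
  have hb := Nat.succ_ne_zero n
  simp only [graeffeMatrix, Matrix.of_apply, Fin.le_def, Fin.val_last]
  have hj := j.2
  have hi := i.2
  by_cases hi0 : (i : ℕ) = 0
  · rw [dif_pos hi0, hi0, if_pos (by omega : (j : ℕ) ≤ n)]
    by_cases hj0 : (j : ℕ) ≤ 0
    · rw [if_pos hj0, Nat.zero_sub, slicePoly_zero_X_mul]
      congr 2; omega
    · rw [if_neg hj0, show n + 1 + 0 - (j : ℕ) = (n - j) + 1 by omega, slicePoly_succ_X_mul hb]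
  · rw [dif_neg hi0]
    by_cases hji : (j : ℕ) ≤ i - 1
    · rw [if_pos hji, if_pos (by omega), show (i : ℕ) - j = (i - 1 - j) + 1 by omega,
        slicePoly_succ_X_mul hb]
    · rw [if_neg hji]
      by_cases hji' : (j : ℕ) ≤ i
      · rw [if_pos hji', show (i : ℕ) - j = 0 by omega, slicePoly_zero_X_mul]
        congr 2; omega
      · rw [if_neg hji', show n + 1 + (i : ℕ) - j = (n + 1 + (i - 1) - j) + 1 by omega,
          slicePoly_succ_X_mul hb]

/-- Multiplication by `(y - γ) q (y)` is multiplication by `q (y)` followed by that by `y - γ`. -/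
theorem graeffeMatrix_X_sub_C_mul (n : ℕ) (γ : K) (q : K[X]) :
    graeffeMatrix (n + 1) ((X - C γ) * q) = shiftMatrix n γ * graeffeMatrix (n + 1) q := by
  have hb := Nat.succ_ne_zero n
  ext1 i j
  have h₁ : graeffeMatrix (n + 1) ((X - C γ) * q) i j =
      graeffeMatrix (n + 1) (X * q) i j - C γ * graeffeMatrix (n + 1) q i j := by
    simp only [graeffeMatrix, Matrix.of_apply, sub_mul, slicePoly_sub hb, slicePoly_C_mul hb]
    split_ifs <;> ring
  rw [h₁, graeffeMatrix_X_mul_apply, Matrix.mul_apply]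
  simp only [shiftMatrix, Matrix.of_apply, add_mul, sub_mul, ite_mul, one_mul, zero_mul,
    Finset.sum_add_distrib, Finset.sum_sub_distrib, Finset.sum_ite_eq, Finset.mem_univ, if_true]
  by_cases hi : (i : ℕ) = 0
  · rw [dif_pos hi, Finset.sum_eq_zero, Finset.sum_eq_single (Fin.last n)]
    · simp [hi]; ring
    · intro k _ hk
      rw [if_neg]
      rintro ⟨-, h⟩
      exact hk (Fin.ext h)
    · simp
    · intro k _
      rw [if_neg (by omega)]
  · rw [dif_neg hi, Finset.sum_eq_single ⟨i - 1, by omega⟩,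
      Finset.sum_eq_zero (s := Finset.univ) (f := fun k : Fin (n + 1) => if (i : ℕ) = 0 ∧ _ then _ else _)]
    · rw [if_pos (by simp only; omega), add_zero]
    · intro k _
      rw [if_neg (fun h => hi h.1)]
    · intro k _ hk
      rw [if_neg]
      intro h
      exact hk (Fin.ext (by simp only; omega))
    · simp

/-- Expansion along the last column, where only the first and the last entry do not vanish. -/
theorem det_shiftMatrix (n : ℕ) (hn : n ≠ 0) (γ : K) :
    (shiftMatrix n γ).det = (-1) ^ (n + 1) * (C (γ ^ (n + 1)) - X) := by
  have hX : ((shiftMatrix n γ).submatrix (Fin.succAbove 0) (Fin.last n).succAbove).det = 1 := by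
    rw [Matrix.det_of_isUpperTriangular]
    · refine Finset.prod_eq_one fun i _ => ?_
      have := i.2
      simp only [shiftMatrix, Matrix.submatrix_apply, Matrix.of_apply, Fin.succAbove_zero,
        Fin.succAbove_last, Fin.val_succ, Fin.val_castSucc, Fin.ext_iff]
      rw [if_pos trivial, if_neg (by omega), if_neg (by omega)]
      simp
    · intro i j hij
      simp only [id, Fin.lt_def] at hij
      simp only [shiftMatrix, Matrix.submatrix_apply, Matrix.of_apply, Fin.succAbove_zero,
        Fin.succAbove_last, Fin.val_succ, Fin.val_castSucc, Fin.ext_iff]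
      rw [if_neg (by omega), if_neg (by omega), if_neg (by omega)]
      simp
  have hC : ((shiftMatrix n γ).submatrix (Fin.last n).succAbove (Fin.last n).succAbove).det =
      (-C γ) ^ n := by
    rw [Matrix.det_of_isLowerTriangular]
    · rw [Finset.prod_congr rfl (g := fun _ => -C γ), Finset.prod_const, Finset.card_univ,
        Fintype.card_fin]
      intro i _
      have := i.2
      simp only [shiftMatrix, Matrix.submatrix_apply, Matrix.of_apply, Fin.succAbove_last,
        Fin.val_castSucc]
      rw [if_neg (by omega), if_pos trivial, if_neg (by omega)]
      simp
    · intro i j hij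
      have := i.2
      have := j.2
      simp only [OrderDual.toDual_lt_toDual, Fin.lt_def] at hij
      simp only [shiftMatrix, Matrix.submatrix_apply, Matrix.of_apply, Fin.succAbove_last,
        Fin.val_castSucc, Fin.ext_iff]
      rw [if_neg (by omega), if_neg (by omega), if_neg (by omega)]
      simp
  rw [Matrix.det_succ_column _ (Fin.last n)]
  have hne : (0 : Fin (n + 1)) ≠ Fin.last n := by
    intro h
    have := congrArg Fin.val h
    simp at this
    exact hn this.symm
  rw [Finset.sum_eq_add (0 : Fin (n + 1)) (Fin.last n) hne, hX, hC]
  · have e₁ : shiftMatrix n γ 0 (Fin.last n) = X := by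
      simp [shiftMatrix, hne]
    have e₂ : shiftMatrix n γ (Fin.last n) (Fin.last n) = -C γ := by
      simp [shiftMatrix, hn]
    rw [e₁, e₂, Fin.val_zero, Fin.val_last, neg_pow (C γ) n]
    have : (-1 : K[X]) ^ (n + n) = 1 := by rw [← two_mul, pow_mul]; simp
    rw [this, C_pow, pow_succ, pow_succ]
    ring
  · rintro i - ⟨h0, hl⟩
    have h1 : (i : ℕ) ≠ 0 := fun h => h0 (Fin.ext h)
    have := i.2
    simp only [shiftMatrix, Matrix.of_apply, Fin.val_last, if_neg hl]
    rw [if_neg (by omega), if_neg (by omega)]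
    simp
  · simp
  · simp

/-- The resultant of `y ^ b - x` and `p (y)` is the norm of `p (y)` in `K[x][y] / (y ^ b - x)`.
Both sides are multiplicative, so that over an algebraic closure linear factors suffice. -/
theorem det_graeffeMatrix {b : ℕ} (hb : 2 ≤ b) {p : K[X]} (hp : p ≠ 0) :
    (graeffeMatrix b p).det = graeffe b p := by
  obtain ⟨n, rfl⟩ : ∃ n, b = n + 1 := ⟨b - 1, by omega⟩
  have key : ∀ p : (AlgebraicClosure K)[X], p ≠ 0 →
      (graeffeMatrix (n + 1) p).det = graeffe (n + 1) p := by
    intro p hp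
    refine induction_linear_factors (P := fun p => (graeffeMatrix (n + 1) p).det =
      graeffe (n + 1) p) ?_ ?_ hp
    · intro c hc
      have : graeffeMatrix (n + 1) (C c) = Matrix.diagonal fun _ => C c := by
        ext1 i j
        have hslice : ∀ k, slicePoly (n + 1) k (C c) = if k = 0 then C c else 0 := by
          intro k
          ext j
          rw [coeff_slicePoly (Nat.succ_ne_zero n), coeff_C]
          split_ifs with h₁ h₂ h₂
          · have : j = 0 := by by_contra h0; have := Nat.pos_of_ne_zero h0; simp at h₁; omega
            simp [this]
          · exfalso; omega
          · have : j ≠ 0 := by rintro rfl; simp at h₁; omega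
            simp [coeff_C, this]
          · simp
        have := j.2
        simp only [graeffeMatrix, Matrix.of_apply, hslice, Matrix.diagonal_apply, Fin.le_def,
          Fin.ext_iff]
        split_ifs <;> first | rfl | omega | simp
      rw [this, Matrix.det_diagonal, graeffe_C]
      simp
    · intro γ q hq ih
      rw [graeffeMatrix_X_sub_C_mul, Matrix.det_mul, ih, det_shiftMatrix n (by omega),
        graeffe_mul (X_sub_C_ne_zero γ) hq, graeffe_X_sub_C]
  have hmap := key _ (map_ne_zero' (F := AlgebraicClosure K) hp)
  rw [← graeffe_map] at hmap
  apply map_injective _ (algebraMap K (AlgebraicClosure K)).injective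
  rw [← hmap, ← coe_mapRingHom, RingHom.map_det]
  congr 1
  ext1 i j
  simp only [RingHom.mapMatrix_apply, Matrix.map_apply, graeffeMatrix, Matrix.of_apply]
  split_ifs <;> simp [map_slicePoly]

end Graeffe

/-! ### Poles and degrees of rational solutions -/

section RationalSolutions

open Polynomial

variable {K : Type*} [Field K]

theorem eval₂_X_pow_eq_algebraMap_expand (n : ℕ) (p : K[X]) :
    p.eval₂ RatFunc.C (RatFunc.X ^ n : RatFunc K) =
      algebraMap K[X] (RatFunc K) (expand K n p) := by
  rw [← RatFunc.algebraMap_X, ← map_pow, ← RatFunc.algebraMap_comp_C, ← hom_eval₂]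
  rfl

theorem ratFunc_eval_div (n : ℕ) (hn : 0 < n) (P Q : K[X]) (hQ : Q ≠ 0) :
    (algebraMap K[X] (RatFunc K) P / algebraMap K[X] (RatFunc K) Q).eval RatFunc.C
      (RatFunc.X ^ n) =
      algebraMap K[X] (RatFunc K) (expand K n P) / algebraMap K[X] (RatFunc K) (expand K n Q) := by
  set y := algebraMap K[X] (RatFunc K) P / algebraMap K[X] (RatFunc K) Q with hy
  rw [RatFunc.eval, eval₂_X_pow_eq_algebraMap_expand, eval₂_X_pow_eq_algebraMap_expand]
  have hinj := RatFunc.algebraMap_injective K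
  have hne : ∀ p : K[X], p ≠ 0 → algebraMap K[X] (RatFunc K) p ≠ 0 := fun p hp h =>
    hp (hinj (by rw [h, map_zero]))
  have hd := y.denom_ne_zero
  rw [div_eq_div_iff (hne _ ((expand_ne_zero hn).mpr hd)) (hne _ ((expand_ne_zero hn).mpr hQ)),
    ← map_mul, ← map_mul, ← map_mul, ← map_mul]
  congr 2
  apply hinj
  have := y.num_div_denom
  rw [hy, div_eq_div_iff (hne _ hd) (hne _ hQ)] at this
  rw [map_mul, map_mul]
  exact this

/-- The term of index `k` in the equation for `P / Q`, after multiplication by the product of the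
`Q (x ^ (b ^ j))`. -/
noncomputable def clearedTerm (b r : ℕ) (L : ℕ → K[X]) (P Q : K[X]) (k : ℕ) : K[X] :=
  L k * expand K (b ^ k) P * ∏ j ∈ (Finset.range (r + 1)).erase k, expand K (b ^ j) Q

/-- The equation with coefficients indexed by the natural numbers. -/
theorem isSolution_iff {b r : ℕ} {l : Fin (r + 1) → K[X]} {L : ℕ → K[X]}
    (hL : ∀ k : Fin (r + 1), L k = l k) (y : RatFunc K) : IsSolution b l y ↔
      ∑ k ∈ Finset.range (r + 1), algebraMap K[X] (RatFunc K) (L k) *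
        y.eval RatFunc.C (RatFunc.X ^ b ^ k) = 0 := by
  rw [IsSolution, Finset.sum_range]
  simp only [hL]

/-- The equation for `P / Q`, multiplied by the product of all `Q (x ^ (b ^ j))`. -/
theorem isSolution_div_iff {b r : ℕ} (hb : 0 < b) {l : Fin (r + 1) → K[X]} {L : ℕ → K[X]}
    (hL : ∀ k : Fin (r + 1), L k = l k) {P Q : K[X]} (hQ : Q ≠ 0) :
    IsSolution b l (algebraMap K[X] (RatFunc K) P / algebraMap K[X] (RatFunc K) Q) ↔
      ∑ k ∈ Finset.range (r + 1), clearedTerm b r L P Q k = 0 := by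
  have hinj := RatFunc.algebraMap_injective K
  have hQk : ∀ k, algebraMap K[X] (RatFunc K) (expand K (b ^ k) Q) ≠ 0 := fun k h =>
    (expand_ne_zero (pow_pos hb k)).mpr hQ (hinj (by rw [h, map_zero]))
  have hne : ∏ j ∈ Finset.range (r + 1), algebraMap K[X] (RatFunc K) (expand K (b ^ j) Q) ≠ 0 :=
    Finset.prod_ne_zero_iff.mpr fun k _ => hQk k
  rw [isSolution_iff hL, ← mul_right_inj' hne, mul_zero, ← map_eq_zero_iff _ hinj, map_sum,
    Finset.mul_sum]
  refine Eq.congr (Finset.sum_congr rfl fun k hk => ?_) rfl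
  rw [ratFunc_eval_div _ (pow_pos hb k) _ _ hQ, clearedTerm, map_mul, map_mul, map_prod,
    ← Finset.mul_prod_erase _ _ hk]
  field_simp [hQk k]

theorem expand_ne_zero' {b : ℕ} (hb : 0 < b) (k : ℕ) {Q : K[X]} (hQ : Q ≠ 0) :
    expand K (b ^ k) Q ≠ 0 := (expand_ne_zero (pow_pos hb k)).mpr hQ

section Pole

variable {F : Type*} [Field F] [Algebra K F]

theorem mult_prod {ι : Type*} (s : Finset ι) (f : ι → K[X]) (hf : ∀ i ∈ s, f i ≠ 0) (β : F) :
    mult F (∏ i ∈ s, f i) β = ∑ i ∈ s, mult F (f i) β := by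
  classical
  induction s using Finset.induction_on with
  | empty => simp [mult, ← C_1, -map_one]
  | insert a s ha ih =>
    rw [Finset.prod_insert ha, Finset.sum_insert ha, mult_mul, ih fun i hi => hf i (by simp [hi])]
    exact mul_ne_zero (hf a (by simp)) (Finset.prod_ne_zero_iff.mpr fun i hi => hf i (by simp [hi]))

/-- In the equation for `P / Q` in lowest terms, the poles of the term of highest order must be
compensated by those of the other terms. -/
theorem mult_expand_le {b r : ℕ} (hb : 0 < b) {L : ℕ → K[X]} {P Q : K[X]} (hP : P ≠ 0)
    (hQ : Q ≠ 0) (hcop : IsCoprime P Q) (hr : L r ≠ 0)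
    (h : ∑ k ∈ Finset.range (r + 1), clearedTerm b r L P Q k = 0) (β : F) :
    mult F (expand K (b ^ r) Q) β ≤
      mult F (L r) β + (Finset.range r).sup fun i => mult F (expand K (b ^ i) Q) β := by
  set a : ℕ → ℕ := fun i => mult F (expand K (b ^ i) Q) β with ha
  set s := (Finset.range r).sup a with hs
  by_cases hQβ : a r = 0
  · change a r ≤ _
    omega
  -- `P (x ^ (b ^ r))` does not vanish at `β`, since `Q (x ^ (b ^ r))` does
  have hPβ : mult F (expand K (b ^ r) P) β = 0 := by
    by_contra hne
    have h₁ := hcop.map (expand K (b ^ r)).toRingHom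
    obtain ⟨u, v, huv⟩ := h₁.map (mapRingHom (algebraMap K F))
    have r₁ : IsRoot ((expand K (b ^ r) P).map (algebraMap K F)) β :=
      (rootMultiplicity_pos (map_ne_zero' (expand_ne_zero' hb r hP))).mp (Nat.pos_of_ne_zero hne)
    have r₂ : IsRoot ((expand K (b ^ r) Q).map (algebraMap K F)) β :=
      (rootMultiplicity_pos (map_ne_zero' (expand_ne_zero' hb r hQ))).mp (Nat.pos_of_ne_zero hQβ)
    have := congrArg (eval β) huv
    simp only [coe_mapRingHom, eval_add, eval_mul, eval_one] at this
    change eval β u * eval β ((expand K (b ^ r) P).map (algebraMap K F)) +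
      eval β v * eval β ((expand K (b ^ r) Q).map (algebraMap K F)) = 1 at this
    rw [r₁.eq_zero, r₂.eq_zero] at this
    simp at this
  -- the denominators together vanish to the order `A`; all terms but the last vanish to the order
  -- `A - s` at least, hence so does the last one, in which only `L r` can help the denominators
  set A := ∑ j ∈ Finset.range (r + 1), a j with hA
  have hprod : ∀ k ∈ Finset.range (r + 1), a k +
      mult F (∏ j ∈ (Finset.range (r + 1)).erase k, expand K (b ^ j) Q) β = A := by
    intro k hk
    rw [mult_prod _ _ fun j _ => expand_ne_zero' hb j hQ, hA]
    exact Finset.add_sum_erase _ a hk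
  have hprod0 : ∀ k, ∏ j ∈ (Finset.range (r + 1)).erase k, expand K (b ^ j) Q ≠ 0 := fun k =>
    Finset.prod_ne_zero_iff.mpr fun j _ => expand_ne_zero' hb j hQ
  have hdvd : ∀ k < r, (X - C β) ^ (A - s) ∣
      (clearedTerm b r L P Q k).map (algebraMap K F) := by
    intro k hk
    rw [clearedTerm, Polynomial.map_mul]
    refine Dvd.dvd.mul_left ?_ _
    rw [← le_rootMultiplicity_iff (map_ne_zero' (hprod0 k))]
    change _ ≤ mult F _ β
    have h₁ := hprod k (Finset.mem_range.mpr (by omega))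
    have h₂ : a k ≤ s := Finset.le_sup (f := a) (Finset.mem_range.mpr hk)
    omega
  have hTr : (X - C β) ^ (A - s) ∣ (clearedTerm b r L P Q r).map (algebraMap K F) := by
    rw [Finset.sum_range_succ] at h
    rw [eq_neg_iff_add_eq_zero.mpr ((add_comm _ _).trans h), Polynomial.map_neg,
      Polynomial.map_sum]
    exact (dvd_neg.mpr (Finset.dvd_sum fun k hk => hdvd k (Finset.mem_range.mp hk)))
  have hT0 : clearedTerm b r L P Q r ≠ 0 :=
    mul_ne_zero (mul_ne_zero hr (expand_ne_zero' hb r hP)) (hprod0 r)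
  rw [← le_rootMultiplicity_iff (map_ne_zero' hT0)] at hTr
  change _ ≤ mult F _ β at hTr
  rw [clearedTerm, mult_mul hT0, mult_mul (left_ne_zero_of_mul hT0), hPβ] at hTr
  have h₁ := hprod r (Finset.mem_range.mpr (by omega))
  change a r ≤ _
  omega

/-- Away from `0`, the multiplicity of `β` in `Q (x ^ (b ^ k))` is that of `β ^ (b ^ k)` in `Q`. -/
theorem poleBound_of_solution [CharZero F] {b r : ℕ} (hb : 0 < b) {L : ℕ → K[X]} {P Q : K[X]}
    (hP : P ≠ 0) (hQ : Q ≠ 0) (hcop : IsCoprime P Q) (hr : L r ≠ 0)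
    (h : ∑ k ∈ Finset.range (r + 1), clearedTerm b r L P Q k = 0) :
    PoleBound b r (mult F (L r)) (mult F Q) := by
  intro β hβ
  have := mult_expand_le hb hP hQ hcop hr h β
  simpa only [mult_expand hQ (pow_pos hb _) hβ] using this

theorem mult_expand_zero {Q : K[X]} (hQ : Q ≠ 0) {n : ℕ} (hn : 0 < n) :
    mult F (expand K n Q) 0 = n * mult F Q 0 := by
  unfold mult
  rw [map_expand]
  have hQ' : Q.map (algebraMap K F) ≠ 0 := map_ne_zero' hQ
  obtain ⟨q, hq, hdvd⟩ := exists_eq_pow_rootMultiplicity_mul_and_not_dvd _ hQ' 0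
  set s := rootMultiplicity 0 (Q.map (algebraMap K F))
  have hexp : expand F n (Q.map (algebraMap K F)) = (X - C 0) ^ (n * s) * expand F n q := by
    rw [hq, map_mul, map_pow, map_sub, expand_X, expand_C, C_0, sub_zero, sub_zero, pow_mul]
  rw [hexp, rootMultiplicity_mul, rootMultiplicity_X_sub_C_pow, rootMultiplicity_eq_zero, add_zero]
  · rw [IsRoot, expand_eval, zero_pow hn.ne']
    exact fun h0 => hdvd (dvd_iff_isRoot.mpr h0)
  · rw [← hexp]
    exact (expand_ne_zero hn).mpr hQ'

end Pole

/-- The order of the pole at `0` of a rational solution. -/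
theorem mult_zero_le {F : Type*} [Field F] [Algebra K F] {b r δ : ℕ} (hb : 2 ≤ b) (hr1 : 1 ≤ r)
    {L : ℕ → K[X]} {P Q : K[X]} (hP : P ≠ 0) (hQ : Q ≠ 0) (hcop : IsCoprime P Q) (hr : L r ≠ 0)
    (hδ : (L r).natDegree ≤ δ)
    (h : ∑ k ∈ Finset.range (r + 1), clearedTerm b r L P Q k = 0) :
    mult F Q 0 ≤ δ / (b ^ r - b ^ (r - 1)) := by
  have hb0 : 0 < b := by omega
  have h₁ := mult_expand_le hb0 hP hQ hcop hr h (0 : F)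
  simp only [mult_expand_zero hQ (pow_pos hb0 _)] at h₁
  have h₂ : ((Finset.range r).sup fun i => b ^ i * mult F Q 0) ≤ b ^ (r - 1) * mult F Q 0 := by
    refine Finset.sup_le fun i hi => Nat.mul_le_mul_right _ (Nat.pow_le_pow_right hb0 ?_)
    have := Finset.mem_range.mp hi
    omega
  have h₃ : mult F (L r) 0 ≤ δ := by
    classical
    rw [mult, ← count_roots]
    refine (Multiset.count_le_card _ _).trans ((card_roots' _).trans ?_)
    rwa [natDegree_map]
  have hlt : b ^ (r - 1) < b ^ r := Nat.pow_lt_pow_right (by omega) (by omega)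
  rw [Nat.le_div_iff_mul_le (by omega), mul_comm, Nat.sub_mul]
  omega

/-- The degree of a rational solution. -/
theorem natDegree_le_of_solution {b r δ : ℕ} (hb : 2 ≤ b) (hr1 : 1 ≤ r)
    {L : ℕ → K[X]} {P Q : K[X]} (hP : P ≠ 0) (hQ : Q ≠ 0) (hr : L r ≠ 0)
    (hδ : ∀ k ≤ r, (L k).natDegree ≤ δ)
    (h : ∑ k ∈ Finset.range (r + 1), clearedTerm b r L P Q k = 0) :
    P.natDegree ≤ Q.natDegree + δ / (b ^ r - b ^ (r - 1)) := by
  have hb0 : 0 < b := by omega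
  by_cases hPQ : P.natDegree ≤ Q.natDegree
  · exact hPQ.trans (Nat.le_add_right _ _)
  -- the degree of the last term is at most that of the others, which are bounded by means of
  -- `D = deg P - deg Q`
  obtain ⟨D, hD⟩ : ∃ D, P.natDegree = Q.natDegree + D := ⟨P.natDegree - Q.natDegree, by omega⟩
  set B := ∑ j ∈ Finset.range (r + 1), Q.natDegree * b ^ j with hB
  have hprod0 : ∀ k, ∏ j ∈ (Finset.range (r + 1)).erase k, expand K (b ^ j) Q ≠ 0 := fun k =>
    Finset.prod_ne_zero_iff.mpr fun j _ => expand_ne_zero' hb0 j hQ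
  have hprod : ∀ k ∈ Finset.range (r + 1), Q.natDegree * b ^ k +
      (∏ j ∈ (Finset.range (r + 1)).erase k, expand K (b ^ j) Q).natDegree = B := by
    intro k hk
    rw [natDegree_prod _ _ fun j _ => expand_ne_zero' hb0 j hQ]
    simp only [natDegree_expand]
    exact Finset.add_sum_erase _ (fun j => Q.natDegree * b ^ j) hk
  have hlow : ∀ k ∈ Finset.range r,
      (clearedTerm b r L P Q k).natDegree ≤ δ + D * b ^ (r - 1) + B := by
    intro k hk
    rw [Finset.mem_range] at hk
    have h₁ := hprod k (Finset.mem_range.mpr (by omega))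
    have h₂ := natDegree_mul_le (p := L k * expand K (b ^ k) P)
      (q := ∏ j ∈ (Finset.range (r + 1)).erase k, expand K (b ^ j) Q)
    have h₃ := natDegree_mul_le (p := L k) (q := expand K (b ^ k) P)
    rw [natDegree_expand, hD, add_mul] at h₃
    have h₄ : D * b ^ k ≤ D * b ^ (r - 1) :=
      Nat.mul_le_mul_left _ (Nat.pow_le_pow_right hb0 (by omega))
    have h₅ := hδ k hk.le
    rw [clearedTerm]
    omega
  have hTr : (clearedTerm b r L P Q r).natDegree ≤ δ + D * b ^ (r - 1) + B := by
    rw [Finset.sum_range_succ] at h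
    rw [eq_neg_iff_add_eq_zero.mpr ((add_comm _ _).trans h), natDegree_neg]
    exact natDegree_sum_le_of_forall_le _ _ hlow
  rw [clearedTerm, natDegree_mul (mul_ne_zero hr (expand_ne_zero' hb0 r hP)) (hprod0 r),
    natDegree_mul hr (expand_ne_zero' hb0 r hP), natDegree_expand, hD, add_mul] at hTr
  have h₁ := hprod r (Finset.mem_range.mpr (by omega))
  have hlt : b ^ (r - 1) < b ^ r := Nat.pow_lt_pow_right (by omega) (by omega)
  rw [hD, Nat.add_le_add_iff_left, Nat.le_div_iff_mul_le (by omega), Nat.mul_sub]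
  omega

/-- The poles of a rational solution outside `0` are those of the denominator bound. -/
theorem IsDenomBound.mult_le {F : Type*} [Field F] [Algebra K F] [IsAlgClosed F] [CharZero F]
    {b r : ℕ} (hb : 2 ≤ b) (hr1 : 1 ≤ r) {p q Q : K[X]} (hp : p ≠ 0)
    (h : IsDenomBound b r p q) (hm : PoleBound b r (mult F p) (mult F Q)) {α : F} (hα : α ≠ 0) :
    mult F Q α ≤ mult F q α := by
  have hb0 : 0 < b := by omega
  have hV : 0 + ∑ i ∈ Finset.range r, b ^ i ≤ b ^ r := by
    rw [zero_add]; exact (sum_range_pow_lt hb r).le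
  have hq0 := (h.bounds hb0 (fun u hu => graeffe_ne_zero_and_natDegree b hu) hp hV
    (Nat.zero_le _)).1
  obtain ⟨ws, p', u, hrun, hu, rfl⟩ := h
  obtain ⟨hp', hws, -, -⟩ := hrun.bounds hb0 hp hV
  have hm' := hrun.poleBound hb hp hm
  have hfin : {α | mult F Q α - mult F ws.prod α ≠ 0}.Finite := by
    classical
    refine (Q.map (algebraMap K F)).roots.toFinset.finite_toSet.subset fun α hα => ?_
    have hα' : mult F Q α ≠ 0 := fun h0 => hα (by rw [h0, Nat.zero_sub])
    rw [Finset.mem_coe, Multiset.mem_toFinset, ← Multiset.count_pos, count_roots]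
    exact Nat.pos_of_ne_zero hα'
  obtain ⟨γ, hγ, hle⟩ := hm'.exists_pow_eq hb hr1 hfin
    (fun α hα => hrun.exists_mult_eq_zero hb hp hα) hα
  have hγ0 : γ ≠ 0 := by
    rintro rfl
    rw [zero_pow (by omega)] at hγ
    exact hα hγ.symm
  have hu0 : u ≠ 0 := by
    rintro rfl
    have := (hu 0).mp dvd_rfl
    simp at this
    exact hp' this
  -- `γ` is a root of `u` of at least the order of the remaining pole at `α = γ ^ b`
  have hdvd := dvd_map_of_expand_dvd_map (pow_pos hb0 (r - 1)) hu
    (expand_X_sub_C_pow_dvd (map_ne_zero' hp') (pow_pos hb0 (r - 1)) hγ0 hle)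
  have hfinal := le_mult_graeffe b hu0 hdvd
  rw [hγ] at hfinal
  rw [mult_mul hq0]
  omega

/-- The denominator of a rational solution divides `X ^ v * q`, where `q` is the denominator
bound. -/
theorem denom_dvd [CharZero K] {b r δ : ℕ} (hb : 2 ≤ b) (hr1 : 1 ≤ r) {L : ℕ → K[X]}
    {P Q q : K[X]} (hP : P ≠ 0) (hQ : Q ≠ 0) (hcop : IsCoprime P Q) (hr : L r ≠ 0)
    (hδ : (L r).natDegree ≤ δ) (hq : IsDenomBound b r (L r) q)
    (h : ∑ k ∈ Finset.range (r + 1), clearedTerm b r L P Q k = 0) :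
    Q ∣ X ^ (δ / (b ^ r - b ^ (r - 1))) * q := by
  classical
  have hb0 : 0 < b := by omega
  have hV : 0 + ∑ i ∈ Finset.range r, b ^ i ≤ b ^ r := by
    rw [zero_add]; exact (sum_range_pow_lt hb r).le
  have hq0 := (hq.bounds hb0 (fun u hu => graeffe_ne_zero_and_natDegree b hu) hr hV
    (Nat.zero_le _)).1
  let F := AlgebraicClosure K
  have : CharZero F := charZero_of_injective_algebraMap (algebraMap K F).injective
  have h0 : X ^ (δ / (b ^ r - b ^ (r - 1))) * q ≠ 0 := mul_ne_zero (pow_ne_zero _ X_ne_zero) hq0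
  rw [← map_dvd_map' (algebraMap K F), IsAlgClosed.dvd_iff_roots_le_roots (map_ne_zero' hQ)
    (map_ne_zero' h0), Multiset.le_iff_count]
  intro α
  rw [count_roots, count_roots]
  change mult F Q α ≤ mult F _ α
  rw [mult_mul h0]
  by_cases hα : α = 0
  · subst hα
    refine (mult_zero_le hb hr1 hP hQ hcop hr hδ h).trans (le_trans ?_ (Nat.le_add_right _ _))
    rw [mult, Polynomial.map_pow, map_X]
    have := rootMultiplicity_X_sub_C_pow (0 : F) (δ / (b ^ r - b ^ (r - 1)))
    rw [C_0, sub_zero] at this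
    exact this.ge
  · exact (hq.mult_le hb hr1 hr (poleBound_of_solution hb0 hP hQ hcop hr h) hα).trans
      (Nat.le_add_left _ _)

end RationalSolutions

/-! ### Kernels of linear forms on the span of a list of vectors -/

section Elimination

variable {K E E' : Type*} [Field K] [AddCommGroup E] [Module K E] [AddCommGroup E'] [Module K E']

/-- The span of a list of vectors. -/
def listSpan (K : Type*) {E : Type*} [Field K] [AddCommGroup E] [Module K E] (ps : List E) :
    Submodule K E := Submodule.span K {x | x ∈ ps}

/-- Linear independence of a list of vectors. -/
def ListIndep (K : Type*) {E : Type*} [Field K] [AddCommGroup E] [Module K E] : List E → Prop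
  | [] => True
  | p :: ps => p ∉ listSpan K ps ∧ ListIndep K ps

@[simp]
theorem listSpan_nil : listSpan K ([] : List E) = ⊥ := by simp [listSpan]

theorem listSpan_cons (p : E) (ps : List E) :
    listSpan K (p :: ps) = K ∙ p ⊔ listSpan K ps := by
  have : {x | x ∈ p :: ps} = insert p {x | x ∈ ps} := by ext x; simp
  rw [listSpan, this, Submodule.span_insert, listSpan]

theorem listSpan_map (f : E →ₗ[K] E') (ps : List E) :
    listSpan K (ps.map f) = (listSpan K ps).map f := by
  induction ps with
  | nil => simp
  | cons p ps ih => rw [List.map_cons, listSpan_cons, listSpan_cons, ih, Submodule.map_sup,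
      Submodule.map_span, Set.image_singleton]

theorem ListIndep.map (f : E →ₗ[K] E') {ps : List E} (h : ListIndep K ps)
    (hf : ∀ x ∈ listSpan K ps, f x = 0 → x = 0) : ListIndep K (ps.map f) := by
  induction ps with
  | nil => trivial
  | cons p ps ih =>
    rw [listSpan_cons] at hf
    refine ⟨fun hp => h.1 ?_, ih h.2 fun x hx => hf x (Submodule.mem_sup_right hx)⟩
    rw [listSpan_map] at hp
    obtain ⟨x, hx, hxp⟩ := hp
    have : x - p = 0 := hf _ (Submodule.sub_mem _ (Submodule.mem_sup_right hx)
      (Submodule.mem_sup_left (Submodule.mem_span_singleton_self p))) (by rw [map_sub, hxp, sub_self])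
    rw [sub_eq_zero] at this
    rwa [← this]

theorem listSpan_ofFn {n : ℕ} (v : Fin n → E) :
    listSpan K (List.ofFn v) = Submodule.span K (Set.range v) := by
  rw [listSpan]
  congr 1
  ext x
  simp [List.mem_ofFn]

theorem listIndep_ofFn {n : ℕ} (v : Fin n → E) :
    ListIndep K (List.ofFn v) ↔ LinearIndependent K v := by
  induction n with
  | zero => simp [ListIndep]
  | succ n ih =>
    have hv : v = Fin.cons (v 0) (fun i => v i.succ) := (Fin.cons_self_tail v).symm
    rw [List.ofFn_succ, ListIndep, ih, listSpan_ofFn, hv, linearIndependent_finCons]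
    simp [and_comm]

open Classical in
/-- From a list of linearly independent vectors, a basis of the kernel of a linear form on their
span. -/
noncomputable def elimList (f : E →ₗ[K] K) : List E → List E
  | [] => []
  | g :: gs => if f g = 0 then g :: elimList f gs else gs.map fun e => e - (f e / f g) • g

/-- The projection onto the kernel of `f` along `g`. -/
noncomputable def projKer (f : E →ₗ[K] K) (g : E) : E →ₗ[K] E :=
  LinearMap.id - ((f g)⁻¹ • f).smulRight g

theorem projKer_apply (f : E →ₗ[K] K) (g e : E) : projKer f g e = e - (f e / f g) • g := by
  simp [projKer, div_eq_inv_mul]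

/-- If `g` is the first vector with `f g ≠ 0`, the vectors before it are in the kernel of `f`, and
the others are projected onto it along `g`. -/
theorem elimList_spec (f : E →ₗ[K] K) {ps : List E} (h : ListIndep K ps) :
    ListIndep K (elimList f ps) ∧ listSpan K (elimList f ps) = listSpan K ps ⊓ LinearMap.ker f := by
  induction ps with
  | nil => simp [elimList, ListIndep]
  | cons g gs ih =>
    obtain ⟨h₁, h₂⟩ := ih h.2
    by_cases hg : f g = 0
    · rw [elimList, if_pos hg]
      refine ⟨⟨fun hmem => h.1 ?_, h₁⟩, ?_⟩
      · rw [h₂] at hmem; exact hmem.1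
      · rw [listSpan_cons, listSpan_cons, h₂, sup_inf_assoc_of_le]
        rw [Submodule.span_singleton_le_iff_mem]
        exact hg
    · rw [elimList, if_neg hg]
      have hmap : (gs.map fun e => e - (f e / f g) • g) = gs.map (projKer f g) :=
        List.map_congr_left fun e _ => (projKer_apply f g e).symm
      rw [hmap]
      constructor
      · refine h.2.map _ fun x hx hx0 => ?_
        rw [projKer_apply, sub_eq_zero] at hx0
        by_cases hfx : f x / f g = 0
        · rw [hx0, hfx, zero_smul]
        · refine absurd ?_ h.1
          have : g = (f x / f g)⁻¹ • x := by
            conv_rhs => rw [hx0]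
            rw [map_smul, smul_smul, smul_eq_mul, div_mul_cancel₀ _ hg, inv_mul_cancel₀ hfx,
              one_smul]
          rw [this]
          exact Submodule.smul_mem _ _ hx
      · rw [listSpan_map, listSpan_cons]
        apply le_antisymm
        · rintro _ ⟨x, hx, rfl⟩
          rw [projKer_apply]
          refine ⟨Submodule.sub_mem _ (Submodule.mem_sup_right hx) (Submodule.mem_sup_left
            (Submodule.smul_mem _ _ (Submodule.mem_span_singleton_self g))), ?_⟩
          simp [hg]
        · rintro y ⟨hy, hfy⟩
          obtain ⟨z, hz, x, hx, rfl⟩ := Submodule.mem_sup.mp hy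
          obtain ⟨c, rfl⟩ := Submodule.mem_span_singleton.mp hz
          refine ⟨x, hx, ?_⟩
          have : f x = -(c * f g) := by
            simp only [SetLike.mem_coe, LinearMap.mem_ker, map_add, map_smul, smul_eq_mul] at hfy
            linear_combination hfy
          rw [projKer_apply, this, neg_div, mul_div_cancel_right₀ _ hg, neg_smul, sub_neg_eq_add,
            add_comm]

theorem length_elimList_le (f : E →ₗ[K] K) (ps : List E) :
    (elimList f ps).length ≤ ps.length := by
  induction ps with
  | nil => simp [elimList]
  | cons g gs ih =>
    rw [elimList]
    split_ifs
    · simpa using ih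
    · simp

theorem length_elimList_cons_le (f : E →ₗ[K] K) {g : E} (hg : f g ≠ 0) (gs : List E) :
    (elimList f (g :: gs)).length ≤ gs.length := by
  rw [elimList, if_neg hg, List.length_map]

end Elimination

section EliminationProgram

variable {K : Type*} [Field K] [DecidableEq K] {E : Type*} [AddCommGroup E] [Module K E]
  {φ : Prop} {m m' : List K}

theorem forall₂_mono {α β : Type*} {R : List K → α → β → Prop}
    (hR : ∀ x y m₁ m₂, m₁ <+: m₂ → R m₁ x y → R m₂ x y) {xs : List α} {ys : List β}
    (h : List.Forall₂ (R m) xs ys) (hm : m <+: m') : List.Forall₂ (R m') xs ys :=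
  h.imp fun _ _ => hR _ _ _ _ hm

/-- The coordinates of a vector of `E` with indices `i, …, i + n - 1`, where the coordinate of
index `j` is given by `x j`. -/
def coords (x : ℕ → E →ₗ[K] K) (i n : ℕ) (p : E) : List K := (List.range n).map fun t => x (i + t) p

/-- Maps over two vectors in memory, coordinate by coordinate. -/
theorem spec_mapM_zip {f : ℕ × ℕ → Prog K ℕ} {B : ℕ} {h : K → K → K} {a a' : List ℕ} {v v' : List K}
    (hf : ∀ i j x y m', m <+: m' → m'[i]? = some x → m'[j]? = some y →
      Spec φ (f (i, j)) m' B fun k m'' => m''[k]? = some (h x y))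
    (ha : HoldsVec m a v) (ha' : HoldsVec m a' v') :
    Spec φ ((a.zip a').mapM f) m (a.length * B) fun s m' => HoldsVec m' s (v.zipWith h v') := by
  have h₁ := Spec.mapM_le (φ := φ) (m := m) (f := f) (B := B)
    (R := fun c k m'' => ∀ x y, m[c.1]? = some x → m[c.2]? = some y → m''[k]? = some (h x y))
    (a.zip a') (fun c k m₁ m₂ hm hR x y hx hy => getElem?_of_prefix hm (hR x y hx hy)) (by
      rintro ⟨i, j⟩ hc m₁ h₁
      have hi := (List.of_mem_zip hc).1
      have hj := (List.of_mem_zip hc).2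
      obtain ⟨n, hn⟩ := List.mem_iff_getElem?.mp hi
      obtain ⟨n', hn'⟩ := List.mem_iff_getElem?.mp hj
      obtain ⟨x, -, hx⟩ := ha.getElem? hn
      obtain ⟨y, -, hy⟩ := ha'.getElem? hn'
      refine (hf i j x y m₁ h₁ (getElem?_of_prefix h₁ hx) (getElem?_of_prefix h₁ hy)).imp ?_
      rintro k m₂ - hk x' y' hx' hy'
      rw [hx] at hx'
      rw [hy] at hy'
      simp only [Option.some.injEq] at hx' hy'
      rw [← hx', ← hy']
      exact hk)
  refine h₁.mono (Nat.mul_le_mul_right _ (by simp)) fun s m₁ hm₁ hs => ?_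
  rw [holdsVec_iff] at *
  clear h₁ hf
  induction ha generalizing a' v' s with
  | nil =>
    rw [List.zip_nil_left, List.forall₂_nil_left_iff] at hs
    simp [hs]
  | @cons i x a v hi _ ih =>
    cases ha' with
    | nil =>
      rw [List.zip_nil_right, List.forall₂_nil_left_iff] at hs
      simp [hs]
    | @cons j y a' v' hj hav' =>
      rw [List.zip_cons_cons, List.forall₂_cons_left_iff] at hs
      obtain ⟨k, s, hk, hs, rfl⟩ := hs
      exact .cons (hk x y hi hj) (ih hav' s hs)

theorem spec_eliminate (x : ℕ → E →ₗ[K] K) (i n : ℕ) (f : E →ₗ[K] K) {G : List (List ℕ × ℕ)}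
    {ps : List E}
    (h : List.Forall₂ (fun g p => HoldsVec m g.1 (coords x i n p) ∧ m[g.2]? = some (f p)) G ps) :
    Spec φ (eliminate G) m (G.length * (2 + 2 * n)) fun s m' =>
      List.Forall₂ (fun g p => HoldsVec m' g (coords x i n p)) s (elimList f ps) := by
  induction G generalizing ps m with
  | nil =>
    rw [List.forall₂_nil_left_iff.mp h]
    exact (Spec.pure .nil).le (Nat.zero_le _)
  | cons e gs ih =>
    obtain ⟨p, ps, ⟨hp, hv⟩, hps, rfl⟩ := List.forall₂_cons_left_iff.mp h
    obtain ⟨g, v⟩ := e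
    rw [List.length_cons]
    refine (Spec.ite_test (B := gs.length * (2 + 2 * n)) hv ?_ ?_).le (by rw [add_mul]; omega)
    · intro h0 m₁ h₁
      rw [elimList, if_pos h0]
      refine Spec.map ((ih (hps.imp fun _ _ h => ⟨h.1.mono h₁, getElem?_of_prefix h₁ h.2⟩)).imp
        fun s m₂ h₂ hs => .cons ((hp.mono h₁).mono h₂) hs)
    · intro h0 m₁ h₁
      rw [elimList, if_neg h0]
      have key := Spec.mapM_le (φ := φ) (m := m₁) (B := 1 + 2 * n)
        (f := fun e : List ℕ × ℕ => do
          let q ← Prog.op .div e.2 v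
          (e.1.zip g).mapM fun c => do Prog.op .sub c.1 (← Prog.op .mul q c.2))
        (R := fun e s m' => ∀ p', HoldsVec m e.1 (coords x i n p') → m[e.2]? = some (f p') →
          HoldsVec m' s (coords x i n (p' - (f p' / f p) • p))) gs
        (fun c k m₁ m₂ hm hR x y hx => (hR x y hx).mono hm) (by
          rintro ⟨a, w⟩ ha m₂ h₂
          obtain ⟨j, hj⟩ := List.mem_iff_getElem?.mp ha
          obtain ⟨hj', hja⟩ := List.getElem?_eq_some_iff.mp hj
          have hget := List.Forall₂.get hps hj' (by rw [← hps.length_eq]; exact hj')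
          simp only [List.get_eq_getElem, hja] at hget
          set p₁ := ps[j]'(by rw [← hps.length_eq]; exact hj')
          obtain ⟨ha₁, hw⟩ := hget
          have hm₂ := h₁.trans h₂
          refine Spec.bind (Spec.op (z := f p₁ / f p) (getElem?_of_prefix hm₂ hw)
            (getElem?_of_prefix hm₂ hv) (by simp [Arith.eval, h0])) fun q m₃ h₃ hq => ?_
          have hm₃ := hm₂.trans h₃
          refine (spec_mapM_zip (φ := φ) (B := 2) (h := fun x y => x - f p₁ / f p * y) ?_
            (ha₁.mono hm₃) (hp.mono hm₃)).mono ?_ ?_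
          · intro i j x y m₄ h₄ hi hj
            refine Spec.bind_le (B₁ := 1) (B₂ := 1) (Spec.op (z := f p₁ / f p * y)
              (getElem?_of_prefix h₄ hq) hj rfl) (fun k m₅ h₅ hk => ?_) le_rfl
            exact Spec.op (getElem?_of_prefix h₅ hi) hk rfl
          · rw [ha₁.length_eq]
            simp [coords, mul_comm]
          · intro s m₄ h₄ hs p' hp' hwp'
            rw [hw] at hwp'
            simp only [Option.some.injEq] at hwp'
            have hco : coords x i n p' = coords x i n p₁ := by
              have : (coords x i n p').map some = (coords x i n p₁).map some := hp'.symm.trans ha₁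
              exact List.map_injective_iff.mpr (Option.some_injective K) this
            convert hs using 1
            rw [← hco, ← hwp']
            simp [coords, List.zipWith_map, List.zipWith_self])
      refine key.mono (Nat.mul_le_mul_left _ (by omega)) fun s m₂ h₂ hs => ?_
      rw [List.forall₂_map_right_iff]
      rw [List.forall₂_iff_get] at hs hps ⊢
      refine ⟨hs.1.symm.trans hps.1, fun j hj₁ hj₂ => ?_⟩
      have hj : j < gs.length := by rw [hps.1]; exact hj₂
      exact hs.2 j hj hj₁ _ (hps.2 j hj hj₂).1 (hps.2 j hj hj₂).2

end EliminationProgram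

/-! ### Sparse rows and backward substitution -/

section Rows

variable {K : Type*} [Field K] [DecidableEq K] {φ : Prop} {m m' : List K}

open Polynomial

/-- The sparse row `row` holds the values of `f` at indices less than `w`, and `f` vanishes at the
indices that do not occur in `row`. -/
structure HoldsRow (m : List K) (w : ℕ) (row : List (ℕ × ℕ)) (f : ℕ → K) : Prop where
  nodup : (row.map Prod.fst).Nodup
  lt : ∀ e ∈ row, e.1 < w
  get : ∀ e ∈ row, m[e.2]? = some (f e.1)
  eq_zero : ∀ n, n ∉ row.map Prod.fst → f n = 0

theorem HoldsRow.mono {w : ℕ} {row : List (ℕ × ℕ)} {f : ℕ → K} (h : HoldsRow m w row f)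
    (hm : m <+: m') : HoldsRow m' w row f :=
  ⟨h.nodup, h.lt, fun e he => getElem?_of_prefix hm (h.get e he), h.eq_zero⟩

theorem spec_addEntry {w n c : ℕ} {x : K} {row : List (ℕ × ℕ)} {f : ℕ → K}
    (h : HoldsRow m w row f) (hn : n < w) (hc : m[c]? = some x) :
    Spec φ (addEntry n c row) m 1 fun s m' =>
      HoldsRow m' w s (fun j => f j + if n = j then x else 0) ∧ s.length ≤ row.length + 1 ∧
      (∀ j, j ∈ s.map Prod.fst ↔ j = n ∨ j ∈ row.map Prod.fst) := by
  induction row generalizing f with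
  | nil =>
    refine (Spec.pure ⟨⟨by simp, by simpa using hn, ?_, ?_⟩, by simp, by simp⟩).le
      (Nat.zero_le _)
    · have := h.eq_zero n (by simp)
      simpa [this] using hc
    · intro j hj
      have h0 := h.eq_zero j (by simp)
      simp only [List.map_cons, List.map_nil, List.mem_singleton] at hj
      simp [h0, Ne.symm hj]
  | cons e row ih =>
    obtain ⟨j, d⟩ := e
    have hnd := h.nodup
    rw [List.map_cons, List.nodup_cons] at hnd
    have hd : m[d]? = some (f j) := h.get (j, d) (by simp)
    by_cases hj : j = n
    · subst hj
      have hrun : (addEntry j c ((j, d) :: row) : Prog K _) =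
          Prog.op .add d c >>= fun s => Pure.pure ((j, s) :: row) := by
        simp [addEntry]
      rw [hrun]
      refine Spec.map ((Spec.op hd hc rfl).imp fun s m₁ h₁ hs => ?_)
      refine ⟨⟨by simpa using h.nodup, ?_, ?_, ?_⟩, by simp, by simp⟩
      · intro e he
        rcases List.mem_cons.mp he with rfl | he
        · exact hn
        · exact h.lt e (by simp [he])
      · intro e he
        rcases List.mem_cons.mp he with rfl | he
        · simpa using hs
        · have hne : j ≠ e.1 := fun hje => hnd.1 (by simpa only [hje] using List.mem_map_of_mem (f := Prod.fst) he)
          simpa [hne] using getElem?_of_prefix h₁ (h.get e (by simp [he]))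
      · intro k hk
        simp only [List.map_cons, List.mem_cons, not_or] at hk
        rw [h.eq_zero k (by simpa [not_or] using hk)]
        simp [Ne.symm hk.1]
    · have hrun : (addEntry n c ((j, d) :: row) : Prog K _) =
          addEntry n c row >>= fun s => Pure.pure ((j, d) :: s) := by
        simp [addEntry, hj]
      rw [hrun]
      set f' : ℕ → K := fun k => if k = j then 0 else f k with hf'
      have h' : HoldsRow m w row f' := by
        refine ⟨hnd.2, fun e he => h.lt e (by simp [he]), fun e he => ?_, fun k hk => ?_⟩
        · have hne : e.1 ≠ j := fun hje => hnd.1 (by simpa only [hje] using List.mem_map_of_mem (f := Prod.fst) he)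
          simpa [hf', hne] using h.get e (by simp [he])
        · by_cases hkj : k = j
          · simp [hf', hkj]
          · simp only [hf', hkj, if_false]
            exact h.eq_zero k (by simp only [List.map_cons, List.mem_cons, not_or]; exact ⟨hkj, hk⟩)
      refine Spec.map ((ih h').imp fun s m₁ h₁ hs => ?_)
      obtain ⟨hs, hlen, hkeys⟩ := hs
      have hjs : j ∉ s.map Prod.fst := by
        rw [hkeys, not_or]
        exact ⟨hj, hnd.1⟩
      refine ⟨⟨?_, ?_, ?_, ?_⟩, by simpa using hlen, ?_⟩
      · rw [List.map_cons, List.nodup_cons]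
        exact ⟨hjs, hs.nodup⟩
      · intro e he
        rcases List.mem_cons.mp he with rfl | he
        · exact h.lt _ (by simp)
        · exact hs.lt e he
      · intro e he
        rcases List.mem_cons.mp he with rfl | he
        · simpa [Ne.symm hj] using getElem?_of_prefix h₁ hd
        · have hne : e.1 ≠ j := fun hje => hjs (by simpa only [hje] using List.mem_map_of_mem (f := Prod.fst) he)
          simpa [hf', hne] using hs.get e he
      · intro k hk
        simp only [List.map_cons, List.mem_cons, not_or] at hk
        have := hs.eq_zero k hk.2
        simpa [hf', hk.1] using this
      · intro k
        rw [List.map_cons, List.mem_cons, hkeys, List.map_cons, List.mem_cons]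
        tauto

theorem sum_map_filterMap {α β M : Type*} [AddCommMonoid M] (l : List α) (g : α → Option β)
    (h : β → M) : ((l.filterMap g).map h).sum = (l.map fun x => (g x).elim 0 h).sum := by
  induction l with
  | nil => simp
  | cons x l ih =>
    rw [List.filterMap_cons, List.map_cons, List.sum_cons, ← ih]
    rcases g x with _ | y <;> simp

theorem sum_map_flatMap {α β M : Type*} [AddCommMonoid M] (l : List α) (g : α → List β)
    (h : β → M) : ((l.flatMap g).map h).sum = (l.map fun x => ((g x).map h).sum).sum := by
  induction l with
  | nil => simp
  | cons x l ih => simp [List.flatMap_cons, ih]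

/-- The coefficient of `x ^ (b ^ k * n)` that the row of index `i` of the matrix of an operator
receives from the coefficient `p` of `M ^ k`. -/
noncomputable def rowTerm (b i k n : ℕ) (p : K[X]) : K :=
  if b ^ k * n ≤ i then p.coeff (i - b ^ k * n) else 0

/-- The entry of index `(i, n)` of the matrix of the operator with coefficients `L 0, …, L r`. -/
noncomputable def rowEntry (b r : ℕ) (L : ℕ → K[X]) (i n : ℕ) : K :=
  ∑ k ∈ Finset.range (r + 1), rowTerm b i k n (L k)

theorem coeff_mahlerOp (b r : ℕ) (L : ℕ → K[X]) {p : K[X]} {w : ℕ}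
    (hp : size p ≤ w) (i : ℕ) :
    (mahlerOp b r L p).coeff i = ∑ n ∈ Finset.range w, rowEntry b r L i n * p.coeff n := by
  have hp' : p = ∑ n ∈ Finset.range w, C (p.coeff n) * X ^ n := by
    ext j
    simp only [finsetSum_coeff, coeff_C_mul, coeff_X_pow, mul_ite, mul_one, mul_zero,
      Finset.sum_ite_eq, Finset.mem_range]
    split_ifs with h
    · rfl
    · exact size_le_iff.mp hp j (not_lt.mp h)
  simp only [rowEntry, mahlerOp, finsetSum_coeff, Finset.sum_mul]
  rw [Finset.sum_comm]
  refine Finset.sum_congr rfl fun k _ => ?_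
  conv_lhs => rw [hp', map_sum, Finset.mul_sum, finsetSum_coeff]
  refine Finset.sum_congr rfl fun n _ => ?_
  rw [map_mul, expand_C, map_pow, expand_X, ← pow_mul, mul_left_comm, coeff_C_mul, coeff_mul_X_pow',
    rowTerm, mul_comm]

/-- The row of index `i` of the matrix of an operator, restricted to columns of index less than
`w`, and the number of operations to build it. -/
theorem spec_buildRow {l : List (List ℕ)} {L : ℕ → K[X]} {b r : ℕ} (hb : 0 < b)
    (hl : HoldsOp m r l L) (w i : ℕ) :
    Spec φ (buildRow b l w i) m ((r + 1) * w) fun row m' =>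
      HoldsRow m' w row (fun n => if n < w then rowEntry b r L i n else 0) ∧
      row.length ≤ (r + 1) * w := by
  unfold buildRow
  set F : ℕ → ℕ × ℕ → Option (ℕ × ℕ) := fun k c =>
    if c.2 ≤ i ∧ c.2 % b ^ k = i % b ^ k ∧ i < c.2 + b ^ k * w then
        some ((i - c.2) / b ^ k, c.1) else none with hF
  have hcond : ∀ k c n, (c ≤ i ∧ c % b ^ k = i % b ^ k ∧ i < c + b ^ k * w) ∧ (i - c) / b ^ k = n ↔
      n < w ∧ b ^ k * n ≤ i ∧ c = i - b ^ k * n := by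
    intro k c n
    have hk : 0 < b ^ k := pow_pos hb k
    constructor
    · rintro ⟨⟨h1, h2, h3⟩, rfl⟩
      have hdvd : b ^ k ∣ i - c := (Nat.modEq_iff_dvd' h1).mp h2
      have h4 := Nat.mul_div_cancel' hdvd
      refine ⟨?_, by omega, by omega⟩
      rw [Nat.div_lt_iff_lt_mul hk, mul_comm]
      omega
    · rintro ⟨h1, h2, rfl⟩
      have h3 : i - (i - b ^ k * n) = b ^ k * n := by omega
      have h4 : b ^ k * n < b ^ k * w := Nat.mul_lt_mul_of_pos_left h1 hk
      refine ⟨⟨by omega, ?_, by omega⟩, ?_⟩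
      · exact (Nat.modEq_iff_dvd' (by omega)).mpr (by rw [h3]; exact dvd_mul_right _ _)
      · rw [h3, Nat.mul_div_cancel_left _ hk]
  have hmem : ∀ x ∈ l.zipIdx, l[x.2]? = some x.1 :=
    fun x hx => List.mem_zipIdx_iff_getElem?.mp hx
  set es := l.zipIdx.flatMap fun a => a.1.zipIdx.filterMap (F a.2) with hes
  -- for each `k`, the column indices of the entries are distinct and less than `w`
  have hlen : es.length ≤ (r + 1) * w := by
    rw [hes, List.length_flatMap, ← hl.length_eq]
    refine (List.sum_le_card_nsmul _ w ?_).trans (by simp)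
    intro t ht
    obtain ⟨a, -, rfl⟩ := List.mem_map.mp ht
    set G : ℕ → Option ℕ := fun c =>
      if c ≤ i ∧ c % b ^ a.2 = i % b ^ a.2 ∧ i < c + b ^ a.2 * w then
        some ((i - c) / b ^ a.2) else none with hG
    have h1 : (a.1.zipIdx.filterMap (F a.2)).map Prod.fst = (List.range a.1.length).filterMap G := by
      rw [List.map_filterMap]
      have h2 : List.range a.1.length = a.1.zipIdx.map Prod.snd := by
        rw [List.zipIdx_map_snd, List.range_eq_range']
      rw [h2, List.filterMap_map]
      congr 1
      funext c
      simp only [hF, hG, Function.comp]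
      split_ifs <;> simp
    have h3 : ∀ c n, G c = some n → n < w ∧ b ^ a.2 * n ≤ i ∧ c = i - b ^ a.2 * n := by
      intro c n h
      rw [← hcond]
      simp only [hG] at h
      split_ifs at h with h4
      simp only [Option.some.injEq] at h
      exact ⟨h4, h⟩
    have h4 : ((List.range a.1.length).filterMap G).Nodup := by
      refine List.Nodup.filterMap ?_ List.nodup_range
      intro c c' n hc hc'
      rw [(h3 c n hc).2.2, (h3 c' n hc').2.2]
    have h5 : (List.range a.1.length).filterMap G ⊆ List.range w := by
      intro n hn
      obtain ⟨c, -, hc⟩ := List.mem_filterMap.mp hn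
      exact List.mem_range.mpr (h3 c n hc).1
    have h6 := (List.subperm_of_subset h4 h5).length_le
    rw [← h1, List.length_map, List.length_range] at h6
    exact h6
  have hes_mem : ∀ e ∈ es, e.1 < w ∧ ∃ x, m[e.2]? = some x := by
    intro e he
    obtain ⟨a, ha, he⟩ := List.mem_flatMap.mp he
    obtain ⟨c, hc, he⟩ := List.mem_filterMap.mp he
    simp only [hF] at he
    split_ifs at he with h4
    simp only [Option.some.injEq] at he
    subst he
    exact ⟨((hcond _ _ _).mp ⟨h4, rfl⟩).1, _, (hl.holdsPoly (hmem a ha)).getElem?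
      (List.mem_zipIdx_iff_getElem?.mp hc)⟩
  have key := Spec.foldlM_le (φ := φ) (m := m) (B := 1)
    (f := fun row (e : ℕ × ℕ) => addEntry e.1 e.2 row)
    (fun l₁ row m' => HoldsRow m' w row (fun n =>
        (l₁.map fun e => if e.1 = n then (m[e.2]?).getD 0 else 0).sum) ∧ row.length ≤ l₁.length) es []
    ⟨⟨by simp, by simp, by simp, by simp⟩, by simp⟩ (by
      rintro l₁ e l₂ hl' row m₁ h₁ ⟨hrow, hlen'⟩
      obtain ⟨he1, x, hx⟩ := hes_mem e (by rw [hl']; simp)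
      refine (spec_addEntry hrow he1 (getElem?_of_prefix h₁ hx)).imp ?_
      rintro s m₂ h₂ ⟨hs, hs', -⟩
      refine ⟨?_, by simp; omega⟩
      convert hs using 2 with n
      simp [hx])
  refine key.mono (by simpa using hlen) fun row m₁ h₁ hrow => ⟨?_, hrow.2.trans hlen⟩
  convert hrow.1 using 2 with n
  rw [hes, sum_map_flatMap]
  have hinner : ∀ a ∈ l.zipIdx, ((a.1.zipIdx.filterMap (F a.2)).map fun e =>
      if e.1 = n then (m[e.2]?).getD 0 else 0).sum =
        if n < w then rowTerm b i a.2 n (L a.2) else 0 := by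
    intro a ha
    have hp := hl.holdsPoly (hmem a ha)
    rw [sum_map_filterMap]
    have : ∀ c ∈ a.1.zipIdx, ((F a.2 c).elim 0 fun e => if e.1 = n then (m[e.2]?).getD 0 else 0) =
        if n < w ∧ b ^ a.2 * n ≤ i ∧ c.2 = i - b ^ a.2 * n then (L a.2).coeff c.2 else 0 := by
      intro c hc
      have hc' := hp.getElem? (List.mem_zipIdx_iff_getElem?.mp hc)
      have h1 := hcond a.2 c.2 n
      simp only [hF]
      split_ifs with h2 h3 h3
      · simp [(h1.mpr h3).2, hc']
      · have : (i - c.2) / b ^ a.2 ≠ n := fun h => h3 (h1.mp ⟨h2, h⟩)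
        simp [this]
      · exact absurd (h1.mpr h3).1 h2
      · rfl
    rw [List.map_congr_left this, sum_zipIdx a.1 fun c =>
      if n < w ∧ b ^ a.2 * n ≤ i ∧ c = i - b ^ a.2 * n then (L a.2).coeff c else 0]
    by_cases hnw : n < w
    · by_cases hbn : b ^ a.2 * n ≤ i
      · simp only [hnw, hbn, true_and, if_true, rowTerm, Finset.sum_ite_eq', Finset.mem_range]
        split_ifs with h
        · rfl
        · rw [hp.length_eq] at h
          exact (size_le_iff.mp le_rfl _ (not_lt.mp h)).symm
      · simp [hbn, rowTerm]
    · simp [hnw]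
  rw [List.map_congr_left hinner, sum_zipIdx l fun k =>
    if n < w then rowTerm b i k n (L k) else 0, hl.length_eq]
  split_ifs with h <;> simp [rowEntry]

/-- The linear form `p ↦ ∑ f n * (coefficient of x ^ n in p)`, the sum being over `s ≤ n < w`. -/
noncomputable def rowForm (f : ℕ → K) (s w : ℕ) : K[X] →ₗ[K] K :=
  ∑ n ∈ Finset.Ico s w, f n • lcoeff K n

theorem rowForm_apply (f : ℕ → K) (s w : ℕ) (p : K[X]) :
    rowForm f s w p = ∑ n ∈ Finset.Ico s w, f n * p.coeff n := by
  simp [rowForm]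

theorem spec_dotRow {w s : ℕ} {row : List (ℕ × ℕ)} {f : ℕ → K} {g : List ℕ} {p : K[X]}
    (h : HoldsRow m w row f) (hg : HoldsVec m g (coords (lcoeff K) s (w - s) p)) :
    Spec φ (dotRow row s g) m (row.length * 2) fun v m' => m'[v]? = some (rowForm f s w p) := by
  refine Spec.bind_le (B₁ := 0) (B₂ := row.length * 2) (Spec.lit 0) ?_ (by simp)
  intro z m₁ h₁ hz
  set row' := row.filter fun e => decide (s ≤ e.1) with hrow'
  have key := Spec.foldlM_le (φ := φ) (m := m₁) (B := 2)
    (f := fun acc (e : ℕ × ℕ) => do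
      match g[e.1 - s]? with
      | none => Prog.fail
      | some j => Prog.op .add acc (← Prog.op .mul e.2 j))
    (fun l₁ v m' => m'[v]? = some (l₁.map fun e => f e.1 * p.coeff e.1).sum) row' z
    (by simpa using hz) (by
      rintro l₁ e l₂ hl v m₂ h₂ hv
      have he : e ∈ row' := by rw [hl]; simp
      obtain ⟨he1, he2⟩ := List.mem_filter.mp he
      have he2 : s ≤ e.1 := by simpa using he2
      have hlt := h.lt e he1
      obtain ⟨j, hj⟩ : ∃ j, g[e.1 - s]? = some j := by
        refine ⟨_, List.getElem?_eq_getElem ?_⟩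
        rw [hg.length_eq]
        simp [coords]
        omega
      obtain ⟨x, hx, hjx⟩ := hg.getElem? hj
      have hx' : x = p.coeff e.1 := by
        have h3 : e.1 - s < w - s := by omega
        simpa [coords, h3, Nat.add_sub_cancel' he2, eq_comm] using hx
      subst hx'
      rw [hj]
      have hm₂ := h₁.trans h₂
      refine Spec.bind_le (B₁ := 1) (B₂ := 1) (Spec.op (getElem?_of_prefix hm₂ (h.get e he1))
        (getElem?_of_prefix hm₂ hjx) rfl) (fun k m₃ h₃ hk => ?_) le_rfl
      refine (Spec.op (getElem?_of_prefix h₃ hv) hk rfl).imp fun k' m₄ _ hk' => ?_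
      simpa using hk')
  refine key.mono (Nat.mul_le_mul_right _ (List.length_filter_le _ _)) fun v m₂ _ hv => ?_
  rw [hv, rowForm_apply]
  congr 1
  have hnd : (row'.map Prod.fst).Nodup :=
    (List.Sublist.map _ List.filter_sublist).nodup h.nodup
  have : (row'.map fun e => f e.1 * p.coeff e.1) =
      (row'.map Prod.fst).map fun n => f n * p.coeff n := by simp
  rw [this, ← List.sum_toFinset _ hnd]
  refine Finset.sum_subset ?_ ?_
  · intro n hn
    obtain ⟨e, he, rfl⟩ := List.mem_map.mp (List.mem_toFinset.mp hn)
    obtain ⟨he1, he2⟩ := List.mem_filter.mp he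
    exact Finset.mem_Ico.mpr ⟨by simpa using he2, h.lt e he1⟩
  · intro n hn hn'
    rw [h.eq_zero n, zero_mul]
    intro hmem
    obtain ⟨e, he, rfl⟩ := List.mem_map.mp hmem
    refine hn' (List.mem_toFinset.mpr (List.mem_map_of_mem (List.mem_filter.mpr ⟨he, ?_⟩)))
    simpa using (Finset.mem_Ico.mp hn).1

theorem HoldsRow.diag {w i z : ℕ} {row : List (ℕ × ℕ)} {f : ℕ → K} (h : HoldsRow m w row f)
    (hz : m[z]? = some 0) :
    m[(row.find? fun e => decide (e.1 = i)).elim z Prod.snd]? = some (f i) := by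
  rcases he : row.find? fun e => decide (e.1 = i) with _ | e
  · rw [he, h.eq_zero i]
    · simpa using hz
    · intro hi
      obtain ⟨e, he', rfl⟩ := List.mem_map.mp hi
      simpa using List.find?_eq_none.mp he e he'
  · have h1 := List.mem_of_find?_eq_some he
    have h2 : e.1 = i := by simpa using List.find?_some he
    have h3 := h.get e h1
    rw [h2] at h3
    rw [he]
    exact h3

end Rows

section BackwardSubstitution

variable {K : Type*} [Field K] [DecidableEq K] {φ : Prop} {m m' : List K}

open Polynomial

theorem coords_eq_cons (x : ℕ → K[X] →ₗ[K] K) (i n : ℕ) (p : K[X]) :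
    coords x i (n + 1) p = x i p :: coords x (i + 1) n p := by
  simp only [coords, List.range_succ_eq_map, List.map_cons, List.map_map]
  congr 1
  refine List.map_congr_left fun t _ => ?_
  simp [add_comm, add_left_comm]

/-- Membership in the kernel of the part of an upper triangular matrix with row and column indices
in `[i, w)`, for polynomials that are multiples of `x ^ i`. -/
def BackKernel (R : ℕ → ℕ → K) (w i : ℕ) (p : K[X]) : Prop :=
  (∀ j < i, p.coeff j = 0) ∧ size p ≤ w ∧ ∀ t, i ≤ t → t < w → rowForm (R t) t w p = 0

/-- One step of backward substitution: to a basis of the kernel of the rows of index greater than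
`i` one adds `x ^ i`, and imposes the equation of the row of index `i`. -/
theorem mem_listSpan_elimList {R : ℕ → ℕ → K} {w i : ℕ} {ps : List K[X]} (hi : i < w)
    (hs : ∀ p, p ∈ listSpan K ps ↔ BackKernel R w (i + 1) p) (hps : ListIndep K ps) :
    ListIndep K (elimList (rowForm (R i) i w) (X ^ i :: ps)) ∧
      ∀ p, p ∈ listSpan K (elimList (rowForm (R i) i w) (X ^ i :: ps)) ↔ BackKernel R w i p := by
  have hind : ListIndep K (X ^ i :: ps) := by
    refine ⟨fun h => ?_, hps⟩
    have := ((hs _).mp h).1 i (by omega)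
    simp at this
  obtain ⟨h₁, h₂⟩ := elimList_spec (rowForm (R i) i w) hind
  refine ⟨h₁, fun p => ?_⟩
  -- the rows of index greater than `i` do not see the coefficient of index `i`
  have hrow : ∀ (c : K) (q : K[X]) (t : ℕ), i < t →
      rowForm (R t) t w (c • X ^ i + q) = rowForm (R t) t w q := by
    intro c q t ht
    simp only [rowForm_apply]
    refine Finset.sum_congr rfl fun n hn => ?_
    have : i ≠ n := by have := (Finset.mem_Ico.mp hn).1; omega
    simp [coeff_X_pow, this.symm]
  rw [h₂, listSpan_cons, Submodule.mem_inf, Submodule.mem_sup, LinearMap.mem_ker]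
  constructor
  · rintro ⟨⟨y, hy, q, hq, rfl⟩, hp⟩
    obtain ⟨c, rfl⟩ := Submodule.mem_span_singleton.mp hy
    obtain ⟨hq1, hq2, hq3⟩ := (hs q).mp hq
    refine ⟨fun j hj => ?_, ?_, fun t ht htw => ?_⟩
    · have : j ≠ i := by omega
      simp [coeff_X_pow, this, hq1 j (by omega)]
    · rw [size_le_iff] at hq2 ⊢
      intro j hj
      have : j ≠ i := by omega
      simp [coeff_X_pow, this, hq2 j hj]
    · rcases ht.eq_or_lt with rfl | ht
      · exact hp
      · rw [hrow _ _ _ ht]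
        exact hq3 t ht htw
  · rintro ⟨hp1, hp2, hp3⟩
    have hdec : p = p.coeff i • X ^ i + (p - p.coeff i • X ^ i) := by abel
    refine ⟨⟨_, Submodule.smul_mem _ (p.coeff i) (Submodule.mem_span_singleton_self _),
      p - p.coeff i • X ^ i, ?_, hdec.symm⟩, hp3 i le_rfl hi⟩
    refine (hs _).mpr ⟨fun j hj => ?_, ?_, fun t ht htw => ?_⟩
    · rcases (Nat.lt_succ_iff.mp hj).eq_or_lt with rfl | hj
      · simp
      · have : j ≠ i := by omega
        simp [coeff_X_pow, this, hp1 j hj]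
    · rw [size_le_iff] at hp2 ⊢
      intro j hj
      have : j ≠ i := by omega
      simp [coeff_X_pow, this, hp2 j hj]
    · have := hp3 t (by omega) htw
      rw [hdec, hrow _ _ _ (by omega)] at this
      exact this

theorem rowForm_eq_add (f : ℕ → K) {i w : ℕ} (hi : i < w) (p : K[X]) :
    rowForm f i w p = f i * p.coeff i + rowForm f (i + 1) w p := by
  rw [rowForm_apply, rowForm_apply, Finset.sum_eq_sum_Ico_succ_bot hi]

theorem rowForm_X_pow (f : ℕ → K) {i w : ℕ} (hi : i < w) : rowForm f i w (X ^ i : K[X]) = f i := by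
  rw [rowForm_eq_add f hi, rowForm_apply, Finset.sum_eq_zero]
  · simp
  · intro n hn
    have : n ≠ i := by have := (Finset.mem_Ico.mp hn).1; omega
    simp [coeff_X_pow, this]

/-- Backward substitution returns a basis of the kernel, with at most as many elements as there are
zeros on the diagonal. -/
theorem spec_backSubst {R : ℕ → ℕ → K} {w ρ Z : ℕ} (rows : List (List (ℕ × ℕ))) (i : ℕ)
    (hi : i + rows.length = w)
    (h : ∀ j (hj : j < rows.length), HoldsRow m w rows[j] (R (i + j)) ∧ rows[j].length ≤ ρ)
    (hZ : ((Finset.Ico i w).filter fun t => R t t = 0).card ≤ Z) :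
    Spec φ (backSubst i rows) m (rows.length * (Z * (2 * ρ + 2 + 2 * w) + 1)) fun s m' =>
      ∃ ps : List K[X], List.Forall₂ (fun g p => HoldsVec m' g (coords (lcoeff K) i (w - i) p)) s ps ∧
        ListIndep K ps ∧ (∀ p, p ∈ listSpan K ps ↔ BackKernel R w i p) ∧
        ps.length ≤ ((Finset.Ico i w).filter fun t => R t t = 0).card := by
  induction rows generalizing i with
  | nil =>
    have hiw : i = w := by simpa using hi
    subst hiw
    refine (Spec.pure ⟨[], .nil, trivial, fun p => ?_, by simp⟩).le (Nat.zero_le _)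
    rw [listSpan_nil, Submodule.mem_bot]
    constructor
    · rintro rfl
      exact ⟨by simp, by simp [size_zero], fun t h1 h2 => by omega⟩
    · rintro ⟨h1, h2, -⟩
      ext j
      rcases lt_or_ge j i with hj | hj
      · simpa using h1 j hj
      · simpa using size_le_iff.mp h2 j hj
  | cons row rows ih =>
    rw [List.length_cons] at hi
    have hiw : i < w := by omega
    have hsub : (Finset.Ico i w).filter (fun t => R t t = 0) =
        if R i i = 0 then insert i ((Finset.Ico (i + 1) w).filter fun t => R t t = 0)
        else (Finset.Ico (i + 1) w).filter fun t => R t t = 0 := by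
      rw [← Finset.insert_Ico_add_one_left_eq_Ico hiw, Finset.filter_insert]
    have hcard : ((Finset.Ico i w).filter fun t => R t t = 0).card =
        ((Finset.Ico (i + 1) w).filter fun t => R t t = 0).card + if R i i = 0 then 1 else 0 := by
      rw [hsub]
      split_ifs with h0
      · rw [Finset.card_insert_of_notMem (by simp)]
      · rfl
    have h0 := h 0 (by simp)
    simp only [List.getElem_cons_zero, add_zero] at h0
    obtain ⟨hrow, hρ⟩ := h0
    have hwi : w - i = rows.length + 1 := by omega
    have hwi' : w - (i + 1) = rows.length := by omega
    have hih := ih (i + 1) (by omega) (fun j hj => by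
      have := h (j + 1) (by simpa using hj)
      simpa [add_assoc, add_comm 1 j] using this) (by omega)
    refine Spec.bind_le (B₂ := Z * (2 * ρ + 2 + 2 * w) + 1) hih ?_ (by
      rw [List.length_cons, add_mul, one_mul])
    rintro G m₁ h₁ ⟨ps, hG, hps, hspan, hlen⟩
    have hGl : G.length = ps.length := hG.length_eq
    have hGZ : G.length ≤ Z := by omega
    obtain ⟨hind', hspan'⟩ := mem_listSpan_elimList hiw hspan hps
    refine Spec.bind_le (B₁ := 0) (B₂ := Z * (2 * ρ + 2 + 2 * w) + 1) (Spec.lit 0) ?_ (by simp)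
    intro z m₂ h₂ hz
    -- the values of the row on the basis vectors
    have hval := Spec.mapM_le (φ := φ) (m := m₂) (f := dotRow row (i + 1)) (B := ρ * 2)
      (R := fun g v m' => ∀ p, HoldsVec m₁ g (coords (lcoeff K) (i + 1) (w - (i + 1)) p) →
        m'[v]? = some (rowForm (R i) (i + 1) w p)) G
      (fun _ _ _ _ hm h p hp => getElem?_of_prefix hm (h p hp)) (by
        intro g hg m₃ h₃
        obtain ⟨j, hj, rfl⟩ := List.getElem_of_mem hg
        have hget := List.Forall₂.get hG hj (by omega)
        simp only [List.get_eq_getElem] at hget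
        refine (spec_dotRow (hrow.mono (h₁.trans (h₂.trans h₃)))
          (hget.mono (h₂.trans h₃))).mono (Nat.mul_le_mul_right _ hρ) ?_
        intro v m₄ _ hv p hp
        rw [hv]
        simp only [rowForm_apply]
        congr 1
        refine Finset.sum_congr rfl fun n hn => ?_
        have hco : coords (lcoeff K) (i + 1) (w - (i + 1)) p =
            coords (lcoeff K) (i + 1) (w - (i + 1)) ps[j] := by
          have : (coords (lcoeff K) (i + 1) (w - (i + 1)) p).map some =
              (coords (lcoeff K) (i + 1) (w - (i + 1)) ps[j]).map some := hp.symm.trans hget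
          exact List.map_injective_iff.mpr (Option.some_injective K) this
        have hn' := Finset.mem_Ico.mp hn
        have := congrArg (fun l => l[n - (i + 1)]?) hco
        have h6 : n - (i + 1) < w - (i + 1) := by omega
        simp only [coords, List.getElem?_map, List.getElem?_range h6, Option.map_some,
          lcoeff_apply, Option.some.injEq, Nat.add_sub_cancel' hn'.1] at this
        rw [this])
    refine Spec.bind_le (B₁ := Z * (2 * ρ)) (B₂ := Z * (2 + 2 * w) + 1)
      (hval.le (by rw [mul_comm ρ]; exact Nat.mul_le_mul_right _ hGZ)) ?_ (by ring_nf; rfl)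
    intro vals m₃ h₃ hvals
    have hzip : List.Forall₂ (fun (g : List ℕ × ℕ) p =>
        HoldsVec m₃ g.1 (coords (lcoeff K) (i + 1) (w - (i + 1)) p) ∧
          m₃[g.2]? = some (rowForm (R i) i w p)) (G.zip vals) ps := by
      rw [List.forall₂_iff_get] at hG hvals ⊢
      refine ⟨by simp [hG.1, ← hvals.1], fun j hj₁ hj₂ => ?_⟩
      have hj₃ : j < G.length := by omega
      have hj₄ : j < vals.length := by rw [← hvals.1]; omega
      have h5 := hG.2 j hj₃ hj₂
      have h6 := hvals.2 j hj₃ hj₄ _ h5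
      simp only [List.get_eq_getElem, List.getElem_zip] at h5 h6 ⊢
      refine ⟨h5.mono (h₂.trans h₃), ?_⟩
      rw [h6, rowForm_eq_add _ hiw]
      have h7 : (ps[j]).coeff i = 0 :=
        ((hspan _).mp (Submodule.subset_span (List.getElem_mem hj₂))).1 i (by omega)
      rw [h7, mul_zero, zero_add]
    have hdiag := (hrow.mono (h₁.trans (h₂.trans h₃))).diag (i := i)
      (getElem?_of_prefix h₃ hz)
    have hlz : (G.zip vals).length ≤ Z := by rw [hzip.length_eq]; omega
    refine (Spec.ite_test (B := Z * (2 + 2 * w)) hdiag ?_ ?_).le (by omega)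
    -- a vanishing diagonal entry: `x ^ i` is added to the basis, and the other vectors, which have
    -- no coefficient of index `i`, are made to satisfy the equation of the row
    · intro h0 m₄ h₄
      refine Spec.bind_le (B₁ := 0) (B₂ := Z * (2 + 2 * w)) (Spec.lit 1) ?_ (by simp)
      intro one m₅ h₅ hone
      have h₄₅ := h₄.trans h₅
      have helim := spec_eliminate (φ := φ) (m := m₅) (lcoeff K) (i + 1) (w - (i + 1))
        (rowForm (R i) i w) (G := G.zip vals) (ps := ps)
        (hzip.imp fun _ _ h => ⟨h.1.mono h₄₅, getElem?_of_prefix h₄₅ h.2⟩)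
      refine Spec.bind_le (B₂ := 0) helim (fun s m₆ h₆ hs => Spec.pure ?_)
        (Nat.mul_le_mul hlz (by omega))
      have hz₆ : m₆[z]? = some 0 := getElem?_of_prefix (h₃.trans (h₄₅.trans h₆)) hz
      refine ⟨elimList (rowForm (R i) i w) (X ^ i :: ps), ?_, hind', hspan', ?_⟩
      · rw [elimList, if_pos (by rw [rowForm_X_pow _ hiw, h0])]
        refine .cons ?_ ?_
        · rw [hwi, coords_eq_cons]
          refine HoldsVec.cons (by simpa using getElem?_of_prefix h₆ hone) ?_
          have : coords (lcoeff K) (i + 1) rows.length (X ^ i : K[X]) =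
              List.replicate rows.length 0 := by
            rw [List.eq_replicate_iff]
            refine ⟨by simp [coords], fun x hx => ?_⟩
            obtain ⟨t, -, rfl⟩ := List.mem_map.mp hx
            have : i + 1 + t ≠ i := by omega
            simp [coeff_X_pow, this]
          rw [this]
          exact HoldsVec.replicate _ hz₆
        · rw [List.forall₂_map_left_iff]
          have hmem : ∀ p ∈ elimList (rowForm (R i) i w) ps, p.coeff i = 0 := by
            intro p hp
            have h7 : p ∈ listSpan K (elimList (rowForm (R i) i w) ps) := Submodule.subset_span hp
            rw [(elimList_spec _ hps).2] at h7
            exact ((hspan _).mp h7.1).1 i (by omega)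
          rw [List.forall₂_iff_get] at hs ⊢
          refine ⟨hs.1, fun j hj₁ hj₂ => ?_⟩
          rw [hwi, coords_eq_cons]
          have h7 := hs.2 j hj₁ hj₂
          rw [hwi'] at h7
          refine HoldsVec.cons ?_ h7
          rw [lcoeff_apply, hmem _ (List.get_mem _ _)]
          exact hz₆
      · rw [elimList, if_pos (by rw [rowForm_X_pow _ hiw, h0]), List.length_cons, hcard, if_pos h0]
        exact Nat.add_le_add_right ((length_elimList_le _ _).trans hlen) 1
    -- a nonzero diagonal entry: the coefficient of index `i` is determined by the others
    · intro h0 m₄ h₄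
      have hrho : rowForm (R i) i w (X ^ i : K[X]) = R i i := rowForm_X_pow _ hiw
      have hlast := Spec.mapM_le (φ := φ) (m := m₄) (B := 2) (f := fun e : List ℕ × ℕ => do
          return (← Prog.op .div (← Prog.op .sub z e.2)
            ((row.find? fun e => decide (e.1 = i)).elim z Prod.snd)) :: e.1)
        (R := fun e s m' => ∀ x, m₃[e.2]? = some x → ∃ k, s = k :: e.1 ∧
          m'[k]? = some ((0 - x) / R i i)) (G.zip vals)
        (fun _ _ _ _ hm h x hx => by
          obtain ⟨k, hk, hk'⟩ := h x hx
          exact ⟨k, hk, getElem?_of_prefix hm hk'⟩) (by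
          rintro ⟨g, v⟩ hgv m₅ h₅
          obtain ⟨j, hj, hj'⟩ := List.getElem_of_mem hgv
          have h7 := List.Forall₂.get hzip hj (by rw [← hzip.length_eq]; exact hj)
          simp only [List.get_eq_getElem, hj'] at h7
          have h₄₅ := h₄.trans h₅
          refine Spec.bind_le (B₁ := 1) (B₂ := 1) (Spec.op (getElem?_of_prefix (h₃.trans h₄₅) hz)
            (getElem?_of_prefix h₄₅ h7.2) rfl) (fun k m₆ h₆ hk => ?_) le_rfl
          refine Spec.map ((Spec.op
            (z := (0 - rowForm (R i) i w (ps[j]'(by rw [← hzip.length_eq]; exact hj))) / R i i) hk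
            (getElem?_of_prefix (h₄₅.trans h₆) hdiag)
            (by simp only [Arith.eval, h0, if_false])).imp fun k' m₇ h₇ hk' x hx => ?_)
          rw [h7.2, Option.some.injEq] at hx
          exact ⟨k', rfl, hx ▸ hk'⟩)
      refine hlast.mono (Nat.mul_le_mul hlz (by omega)) fun s m₅ h₅ hs => ?_
      refine ⟨elimList (rowForm (R i) i w) (X ^ i :: ps), ?_, hind', hspan', ?_⟩
      · rw [elimList, if_neg (by rwa [hrho]), List.forall₂_map_right_iff]
        rw [List.forall₂_iff_get] at hs hzip ⊢
        refine ⟨hs.1.symm.trans hzip.1, fun j hj₁ hj₂ => ?_⟩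
        have hj₃ : j < (G.zip vals).length := by rw [hzip.1]; exact hj₂
        obtain ⟨h7, h8⟩ := hzip.2 j hj₃ hj₂
        obtain ⟨k, hk, hk'⟩ := hs.2 j hj₃ hj₁ _ h8
        rw [hk, hwi, coords_eq_cons]
        have h9 : (ps.get ⟨j, hj₂⟩).coeff i = 0 :=
          ((hspan _).mp (Submodule.subset_span (List.get_mem _ _))).1 i (by omega)
        refine HoldsVec.cons ?_ ?_
        · rw [hk', hrho, lcoeff_apply, coeff_sub, h9]
          simp [neg_div]
        · rw [hwi'] at h7
          convert h7.mono (h₄.trans h₅) using 1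
          refine List.map_congr_left fun t _ => ?_
          have : i + 1 + t ≠ i := by omega
          simp [coeff_X_pow, this]
      · rw [hcard, if_neg h0, add_zero]
        exact (length_elimList_cons_le _ (by rwa [hrho]) _).trans hlen

end BackwardSubstitution

/-! ### Polynomial solutions of bounded degree -/

section PolynomialSolutions

variable {K : Type*} [Field K] [DecidableEq K] {φ : Prop} {m m' : List K}

open Polynomial

/-- The operator `mahlerOp` as a linear map. -/
noncomputable def mahlerLin (b r : ℕ) (L : ℕ → K[X]) : K[X] →ₗ[K] K[X] :=
  ∑ k ∈ Finset.range (r + 1), (LinearMap.mulLeft K (L k)).comp (expand K (b ^ k)).toLinearMap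

theorem mahlerLin_apply (b r : ℕ) (L : ℕ → K[X]) (p : K[X]) :
    mahlerLin b r L p = mahlerOp b r L p := by
  simp [mahlerLin, mahlerOp]

theorem le_foldr_max {l : List ℕ} {x : ℕ} (h : x ∈ l) : x ≤ l.foldr max 0 := by
  induction l with
  | nil => simp at h
  | cons y l ih =>
    rcases List.mem_cons.mp h with rfl | h
    · exact le_max_left _ _
    · exact (ih h).trans (le_max_right _ _)

theorem foldr_max_le {l : List ℕ} {B : ℕ} (h : ∀ x ∈ l, x ≤ B) : l.foldr max 0 ≤ B := by
  induction l with
  | nil => simp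
  | cons y l ih =>
    exact max_le (h y (by simp)) (ih fun x hx => h x (by simp [hx]))

theorem foldr_max_mem {l : List ℕ} (h : l ≠ []) : l.foldr max 0 ∈ l := by
  induction l with
  | nil => exact absurd rfl h
  | cons y l ih =>
    rw [List.foldr_cons]
    rcases max_choice y (l.foldr max 0) with h' | h'
    · rw [h']; simp
    · rw [h']
      rcases eq_or_ne l [] with rfl | hl
      · have : y = 0 := by simpa using h'
        simp [this]
      · exact List.mem_cons_of_mem _ (ih hl)

theorem mem_degrees {l : List (List ℕ)} {L : ℕ → K[X]} {r : ℕ} (hl : HoldsOp m r l L)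
    {e : ℕ × ℕ} : e ∈ degrees l ↔ e.1 ≤ r ∧ L e.1 ≠ 0 ∧ e.2 = (L e.1).natDegree := by
  obtain ⟨k, d⟩ := e
  simp only [degrees, List.mem_filterMap]
  constructor
  · rintro ⟨⟨a, j⟩, ha, h⟩
    have ha' := List.mem_zipIdx_iff_getElem?.mp ha
    have hp := hl.holdsPoly ha'
    dsimp only at h ha' hp
    split_ifs at h with h1
    simp only [Option.some.injEq, Prod.mk.injEq] at h
    obtain ⟨rfl, rfl⟩ := h
    have h2 := (List.getElem?_eq_some_iff.mp ha').1
    rw [hl.length_eq] at h2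
    refine ⟨by omega, fun h0 => h1 (by simpa using hp.eq_nil_iff.mpr h0), ?_⟩
    rw [hp.length_eq, natDegree_eq_size_sub_one]
  · rintro ⟨h1, h2, rfl⟩
    have hk : k < l.length := by rw [hl.length_eq]; exact Nat.lt_succ_of_le h1
    have hp := hl.holdsPoly (List.getElem?_eq_getElem hk)
    refine ⟨(l[k], k), List.mem_zipIdx_iff_getElem?.mpr (List.getElem?_eq_getElem hk), ?_⟩
    dsimp only
    rw [if_neg, hp.length_eq, natDegree_eq_size_sub_one]
    rw [List.isEmpty_iff, hp.eq_nil_iff]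
    exact h2

/-- The index of the row that is prescribed for the column `n`. -/
def pivotRow (b : ℕ) (d : List (ℕ × ℕ)) (n : ℕ) : ℕ :=
  (d.map fun e => e.2 + n * b ^ e.1).foldr max 0

variable {l : List (List ℕ)} {L : ℕ → K[X]} {b r : ℕ}

theorem le_pivotRow (hl : HoldsOp m r l L) {k : ℕ} (hk : k ≤ r) (h : L k ≠ 0) (n : ℕ) :
    (L k).natDegree + n * b ^ k ≤ pivotRow b (degrees l) n :=
  le_foldr_max (List.mem_map.mpr ⟨(k, (L k).natDegree), (mem_degrees hl).mpr ⟨hk, h, rfl⟩, rfl⟩)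

/-- The maximum that defines the row index is attained. -/
theorem exists_eq_pivotRow (hl : HoldsOp m r l L) {k₀ : ℕ} (hk₀ : k₀ ≤ r) (h₀ : L k₀ ≠ 0) (n : ℕ) :
    ∃ k ≤ r, L k ≠ 0 ∧ (L k).natDegree + n * b ^ k = pivotRow b (degrees l) n := by
  have hne : (degrees l).map (fun e => e.2 + n * b ^ e.1) ≠ [] := by
    intro h
    rw [List.map_eq_nil_iff] at h
    have := (mem_degrees hl (e := (k₀, (L k₀).natDegree))).mpr ⟨hk₀, h₀, rfl⟩
    rw [h] at this
    simp at this
  obtain ⟨e, he, h⟩ := List.mem_map.mp (foldr_max_mem hne)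
  obtain ⟨h1, h2, h3⟩ := (mem_degrees hl).mp he
  exact ⟨e.1, h1, h2, by rw [← h3]; exact h⟩

theorem rowTerm_eq_zero {k n t : ℕ}
    (h : L k ≠ 0 → (L k).natDegree + n * b ^ k < pivotRow b (degrees l) t) :
    rowTerm b (pivotRow b (degrees l) t) k n (L k) = 0 := by
  by_cases h0 : L k = 0
  · simp [rowTerm, h0]
  · have := h h0
    rw [rowTerm]
    split_ifs
    · refine coeff_eq_zero_of_natDegree_lt ?_
      rw [mul_comm] at this
      omega
    · rfl

/-- The prescribed rows form an upper triangular matrix. -/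
theorem rowEntry_eq_zero (hb : 0 < b) (hl : HoldsOp m r l L) {n t : ℕ} (hnt : n < t) :
    rowEntry b r L (pivotRow b (degrees l) t) n = 0 := by
  refine Finset.sum_eq_zero fun k hk => ?_
  have hk : k ≤ r := Nat.lt_succ_iff.mp (Finset.mem_range.mp hk)
  refine rowTerm_eq_zero fun h0 => lt_of_lt_of_le ?_ (le_pivotRow hl hk h0 t)
  have := Nat.mul_lt_mul_of_pos_right hnt (pow_pos hb k)
  omega

/-- Where a diagonal entry vanishes, the maximum that defines the row index is attained twice. -/
theorem exists_pair_of_diag_eq_zero (hl : HoldsOp m r l L) {k₀ : ℕ} (hk₀ : k₀ ≤ r) (h₀ : L k₀ ≠ 0)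
    {t : ℕ} (ht : rowEntry b r L (pivotRow b (degrees l) t) t = 0) :
    ∃ k₁ k₂, k₁ < k₂ ∧ k₂ ≤ r ∧ L k₁ ≠ 0 ∧ L k₂ ≠ 0 ∧
      (L k₁).natDegree + t * b ^ k₁ = pivotRow b (degrees l) t ∧
      (L k₂).natDegree + t * b ^ k₂ = pivotRow b (degrees l) t := by
  obtain ⟨k, hk, hk0, hkt⟩ := exists_eq_pivotRow (b := b) hl hk₀ h₀ t
  have hmain : ∃ k', k' ≤ r ∧ k' ≠ k ∧ L k' ≠ 0 ∧
      (L k').natDegree + t * b ^ k' = pivotRow b (degrees l) t := by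
    by_contra! hcon
    rw [rowEntry, Finset.sum_eq_single k] at ht
    · rw [rowTerm, ← hkt, mul_comm t, if_pos (Nat.le_add_left _ _), Nat.add_sub_cancel] at ht
      exact hk0 (leadingCoeff_eq_zero.mp ht)
    · intro j hj hjk
      have hj : j ≤ r := Nat.lt_succ_iff.mp (Finset.mem_range.mp hj)
      exact rowTerm_eq_zero fun h0 =>
        lt_of_le_of_ne (le_pivotRow hl hj h0 t) (hcon j hj hjk h0)
    · intro h
      exact absurd (Finset.mem_range.mpr (Nat.lt_succ_of_le hk)) h
  obtain ⟨k', hk', hne, hk'0, hk't⟩ := hmain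
  rcases lt_or_gt_of_ne hne with h | h
  · exact ⟨k', k, h, hk, hk'0, hk0, hk't, hkt⟩
  · exact ⟨k, k', h, hk', hk0, hk'0, hkt, hk't⟩

/-- The slopes of the lines that attain the maximum increase with the abscissa, so the maximum is
attained twice for at most `r` abscissas. -/
theorem card_diag_eq_zero_le (hb : 2 ≤ b) (hl : HoldsOp m r l L) {k₀ : ℕ} (hk₀ : k₀ ≤ r)
    (h₀ : L k₀ ≠ 0) (w : ℕ) :
    ((Finset.Ico 0 w).filter fun t =>
      rowEntry b r L (pivotRow b (degrees l) t) t = 0).card ≤ r := by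
  set s := (Finset.Ico 0 w).filter fun t => rowEntry b r L (pivotRow b (degrees l) t) t = 0
  have hex : ∀ t, ∃ k₁ k₂, t ∈ s → k₁ < k₂ ∧ k₂ ≤ r ∧ L k₁ ≠ 0 ∧ L k₂ ≠ 0 ∧
      (L k₁).natDegree + t * b ^ k₁ = pivotRow b (degrees l) t ∧
      (L k₂).natDegree + t * b ^ k₂ = pivotRow b (degrees l) t := by
    intro t
    by_cases ht : t ∈ s
    · obtain ⟨k₁, k₂, h⟩ := exists_pair_of_diag_eq_zero (b := b) hl hk₀ h₀ (Finset.mem_filter.mp ht).2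
      exact ⟨k₁, k₂, fun _ => h⟩
    · exact ⟨0, 0, fun h => absurd h ht⟩
  choose f g hfg using hex
  have hlt : ∀ t ∈ s, ∀ t' ∈ s, t < t' → g t < g t' := by
    intro t ht t' ht' htt'
    obtain ⟨h1, h2, h3, h4, h5, h6⟩ := hfg t ht
    obtain ⟨h1', h2', h3', h4', h5', h6'⟩ := hfg t' ht'
    refine lt_of_le_of_lt ?_ h1'
    -- otherwise the line of index `g t`, which attains the maximum at `t` and is the steeper one,
    -- would lie above the line of index `f t'` at `t'`
    by_contra! hcon
    have h7 := le_pivotRow (b := b) hl h2 h4 t'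
    have h8 := le_pivotRow (b := b) hl (by omega : f t' ≤ r) h3' t
    have h9 : b ^ f t' < b ^ g t := Nat.pow_lt_pow_right hb hcon
    obtain ⟨c, rfl⟩ := Nat.exists_eq_add_of_lt htt'
    rw [← h5'] at h7
    rw [← h6] at h8
    have h10 := Nat.mul_lt_mul_of_pos_left h9 (Nat.succ_pos c)
    nlinarith
  have hinj : Set.InjOn g s := by
    intro t ht t' ht' h
    rcases lt_trichotomy t t' with h1 | h1 | h1
    · exact absurd h (hlt t ht t' ht' h1).ne
    · exact h1
    · exact absurd h (hlt t' ht' t ht h1).ne'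
  have hmaps : Set.MapsTo g s (Finset.Icc 1 r) := by
    intro t ht
    obtain ⟨h1, h2, -⟩ := hfg t ht
    simp only [Finset.coe_Icc, Set.mem_Icc]
    omega
  simpa using Finset.card_le_card_of_injOn g hmaps hinj

theorem coords_zero (w : ℕ) (p : K[X]) : coords (lcoeff K) 0 w p = (List.range w).map p.coeff := by
  simp [coords]

theorem spec_combine {w n : ℕ} {G : List (List ℕ)} {ps : Fin n → K[X]} {a : List ℕ} {c : Fin n → K}
    (hG : List.Forall₂ (fun g p => HoldsVec m g (coords (lcoeff K) 0 w p)) G (List.ofFn ps))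
    (ha : HoldsVec m a (List.ofFn c)) :
    Spec φ (combine w G a) m (n * (w * 2)) fun s m' =>
      HoldsVec m' s (coords (lcoeff K) 0 w (∑ i, c i • ps i)) := by
  refine Spec.bind_le (B₁ := 0) (B₂ := n * (w * 2)) (Spec.lit 0) ?_ (by simp)
  intro z m₁ h₁ hz
  have key := Spec.foldlM_le (φ := φ) (m := m₁) (B := w * 2)
    (f := fun acc (e : ℕ × List ℕ) => (acc.zip e.2).mapM fun x => do
      Prog.op .add x.1 (← Prog.op .mul e.1 x.2))
    (fun l₁ s m' => HoldsVec m' s (coords (lcoeff K) 0 w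
      (((List.ofFn fun i => c i • ps i).take l₁.length).sum))) (a.zip G) (List.replicate w z)
    (by
      have := HoldsVec.replicate w hz
      convert this using 1
      rw [List.eq_replicate_iff]
      simp [coords]) (by
      rintro l₁ e l₂ hl s m₂ h₂ hs
      have hlen : a.length = n := by rw [ha.length_eq, List.length_ofFn]
      have hget : (a.zip G)[l₁.length]? = some e := by rw [hl]; simp
      obtain ⟨ha1, hG1⟩ := List.getElem?_zip_eq_some.mp hget
      have hlt : l₁.length < n := by rw [← hlen]; exact (List.getElem?_eq_some_iff.mp ha1).1
      obtain ⟨x, hx, hax⟩ := ha.getElem? ha1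
      rw [List.getElem?_ofFn, dif_pos hlt] at hx
      simp only [Option.some.injEq] at hx
      have hgp : HoldsVec m e.2 (coords (lcoeff K) 0 w (ps ⟨l₁.length, hlt⟩)) := by
        obtain ⟨h3, h4⟩ := List.getElem?_eq_some_iff.mp hG1
        have := List.Forall₂.get hG h3 (by simpa using hlt)
        simpa [h4] using this
      have hm₂ := h₁.trans h₂
      refine (spec_mapM_zip (φ := φ) (B := 2) (h := fun u v => u + x * v) ?_ hs
        (hgp.mono hm₂)).mono ?_ ?_
      · intro i j u v m₃ h₃ hi hj
        refine Spec.bind_le (B₁ := 1) (B₂ := 1) (Spec.op (getElem?_of_prefix (hm₂.trans h₃) hax) hj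
          rfl) (fun k m₄ h₄ hk => ?_) le_rfl
        exact Spec.op (getElem?_of_prefix h₄ hi) hk rfl
      · rw [hs.length_eq]
        simp [coords]
      · intro s' m₃ _ hs'
        convert hs' using 1
        rw [List.length_append, List.length_singleton, List.take_add_one, List.getElem?_ofFn,
          dif_pos hlt, Option.toList_some, List.sum_append, List.sum_singleton, hx]
        simp only [coords, List.zipWith_map, List.zipWith_self, map_add, map_smul, smul_eq_mul])
  have hlen : (a.zip G).length = n := by
    rw [List.length_zip, ha.length_eq, hG.length_eq]
    simp
  rw [hlen] at key
  refine key.imp fun s m₂ _ hs => ?_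
  rw [List.take_of_length_le (by simp), List.sum_ofFn] at hs
  exact hs

/-- Polynomials `q` in memory form a basis of the space of polynomials `p` of size at most `w` such
that `Lp = 0`. -/
def HoldsPolyBasis (b r : ℕ) (L : ℕ → K[X]) (w : ℕ) (m : List K) (s : List (List ℕ)) : Prop :=
  ∃ (k : ℕ) (q : Fin k → K[X]), List.Forall₂ (HoldsPoly m) s (List.ofFn q) ∧
    LinearIndependent K q ∧
    ∀ p, p ∈ Submodule.span K (Set.range q) ↔ size p ≤ w ∧ mahlerOp b r L p = 0

theorem size_mahlerOp_le {N : ℕ} {p : K[X]} (h : ∀ k ≤ r, L k ≠ 0 → p ≠ 0 →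
    (L k).natDegree + p.natDegree * b ^ k < N) : size (mahlerOp b r L p) ≤ N := by
  rw [size_le_iff]
  intro i hi
  rw [mahlerOp, finsetSum_coeff]
  refine Finset.sum_eq_zero fun k hk => ?_
  have hk : k ≤ r := Nat.lt_succ_iff.mp (Finset.mem_range.mp hk)
  by_cases h0 : L k = 0
  · simp [h0]
  by_cases hp : p = 0
  · simp [hp]
  refine coeff_eq_zero_of_natDegree_lt (lt_of_le_of_lt natDegree_mul_le ?_)
  rw [natDegree_expand]
  exact lt_of_lt_of_le (h k hk h0 hp) hi

/-- Polynomial solutions lie in the kernel computed by backward substitution. -/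
theorem pivotRow_backKernel (hb : 0 < b) (hl : HoldsOp m r l L) {w : ℕ} {p : K[X]}
    (hp : size p ≤ w) (hLp : mahlerOp b r L p = 0) :
    BackKernel (fun t n => if n < w then rowEntry b r L (pivotRow b (degrees l) t) n else 0) w 0
      p := by
  refine ⟨by simp, hp, fun t _ htw => ?_⟩
  have h1 : (mahlerOp b r L p).coeff (pivotRow b (degrees l) t) = 0 := by rw [hLp, coeff_zero]
  rw [coeff_mahlerOp b r L hp, Finset.range_eq_Ico, ← Finset.sum_Ico_consecutive _ (Nat.zero_le t)
    htw.le, Finset.sum_eq_zero (s := Finset.Ico 0 t), zero_add] at h1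
  · rw [rowForm_apply, ← h1]
    refine Finset.sum_congr rfl fun n hn => ?_
    dsimp only
    rw [if_pos (Finset.mem_Ico.mp hn).2]
  · intro n hn
    rw [rowEntry_eq_zero hb hl (Finset.mem_Ico.mp hn).2, zero_mul]

/-- If the valuation of `L 0` is less than that of the other coefficients, then `L` is injective. -/
theorem eq_zero_of_mahlerOp_eq_zero (hb : 0 < b) {v₀ : ℕ} (h0 : (L 0).coeff v₀ ≠ 0)
    (h0' : ∀ i < v₀, (L 0).coeff i = 0) (hk : ∀ k, 1 ≤ k → k ≤ r → ∀ i ≤ v₀, (L k).coeff i = 0)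
    {p : K[X]} (hp : mahlerOp b r L p = 0) : p = 0 := by
  by_contra hne
  set n := p.natTrailingDegree
  have hX : X ^ n ∣ p :=
    X_pow_dvd_iff.mpr fun i hi => coeff_eq_zero_of_lt_natTrailingDegree hi
  -- the term of index zero alone contributes to the lowest coefficient
  have hc : (mahlerOp b r L p).coeff (v₀ + n) = (L 0).coeff v₀ * p.coeff n := by
    rw [mahlerOp, finsetSum_coeff, Finset.sum_eq_single 0]
    · have h1 : X ^ v₀ ∣ L 0 := X_pow_dvd_iff.mpr h0'
      obtain ⟨u, hu⟩ := h1
      obtain ⟨v, hv⟩ := hX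
      have h2 : (L 0).coeff v₀ = u.coeff 0 := by
        rw [hu]; simpa using coeff_X_pow_mul u v₀ 0
      have h3 : p.coeff n = v.coeff 0 := by
        conv_lhs => rw [hv]
        simpa using coeff_X_pow_mul v n 0
      rw [h2, h3, pow_zero, expand_one, hu]
      conv_lhs => rw [hv]
      rw [show X ^ v₀ * u * (X ^ n * v) = X ^ (v₀ + n) * (u * v) by ring]
      have := coeff_X_pow_mul (u * v) (v₀ + n) 0
      rw [zero_add] at this
      rw [this, mul_coeff_zero]
    · intro k hkr hk0
      have hkr : k ≤ r := Nat.lt_succ_iff.mp (Finset.mem_range.mp hkr)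
      have h1 : X ^ (v₀ + 1) ∣ L k :=
        X_pow_dvd_iff.mpr fun i hi => hk k (by omega) hkr i (by omega)
      have h2 : X ^ n ∣ expand K (b ^ k) p := by
        have h4 := map_dvd (expand K (b ^ k)) hX
        rw [map_pow, expand_X, ← pow_mul] at h4
        exact (pow_dvd_pow X (Nat.le_mul_of_pos_left n (pow_pos hb k))).trans h4
      have h3 := mul_dvd_mul h1 h2
      rw [← pow_add] at h3
      exact X_pow_dvd_iff.mp h3 _ (by omega)
    · simp
  rw [hp, coeff_zero] at hc
  exact mul_ne_zero h0 (trailingCoeff_nonzero_iff_nonzero.mpr hne) hc.symm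

/-- The early exit is taken only if the valuation of `L 0` is less than all the others. -/
theorem lt_of_nu_lt_zero (hb : 2 ≤ b) {v₀ : ℕ} {vs : List (Option ℕ)}
    (h : nu b (some v₀ :: vs) < 0) {k vk : ℕ} (hk : vs[k]? = some (some vk)) : v₀ < vk := by
  have h1 : ((v₀ : ℚ) - vk) / ((b : ℚ) ^ (k + 1) - 1) ∈ vs.zipIdx.filterMap fun e =>
      e.1.map fun vk => ((v₀ : ℚ) - vk) / ((b : ℚ) ^ (e.2 + 1) - 1) := by
    rw [List.mem_filterMap]
    exact ⟨(some vk, k), List.mem_zipIdx_iff_getElem?.mpr hk, rfl⟩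
  have h2 := lt_of_le_of_lt (List.le_maximum_of_mem' h1) h
  have h3 : ((v₀ : ℚ) - vk) / ((b : ℚ) ^ (k + 1) - 1) < 0 := by exact_mod_cast h2
  have h4 : (0 : ℚ) < (b : ℚ) ^ (k + 1) - 1 := by
    rw [sub_pos]
    exact one_lt_pow₀ (by exact_mod_cast hb) (by omega)
  rw [div_lt_iff₀ h4, zero_mul, sub_lt_zero] at h3
  exact_mod_cast h3

end PolynomialSolutions

section PolySolutionsProgram

variable {K : Type*} [Field K] [DecidableEq K] {φ : Prop} {m m' : List K}
  {S : Subroutines K} {U G : ℕ → ℕ}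

open Polynomial

variable {l : List (List ℕ)} {L : ℕ → K[X]} {b r : ℕ}

theorem listIndep_iff_get {E : Type*} [AddCommGroup E] [Module K E] (ps : List E) :
    ListIndep K ps ↔ LinearIndependent K fun j : Fin ps.length => ps[j] := by
  rw [← listIndep_ofFn]
  simp

theorem listSpan_eq_range {E : Type*} [AddCommGroup E] [Module K E] (ps : List E) :
    listSpan K ps = Submodule.span K (Set.range fun j : Fin ps.length => ps[j]) := by
  rw [← listSpan_ofFn]
  simp

/-- Recombination: the combinations of independent `p j` with coefficients in a basis of the kernel
of the matrix of the `L (p j)` form a basis of the kernel of `L` in the span of the `p j`. -/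
theorem basis_recombine {b r h n k : ℕ} {L : ℕ → K[X]} {p : Fin n → K[X]}
    (hp : LinearIndependent K p)
    (hh : ∀ q ∈ Submodule.span K (Set.range p), size (mahlerOp b r L q) ≤ h)
    {v : Fin k → Fin n → K} (hv : LinearIndependent K v)
    (hker : Submodule.span K (Set.range v) = LinearMap.ker
      (Matrix.of fun (i : Fin h) (j : Fin n) => (mahlerOp b r L (p j)).coeff i).mulVecLin) :
    LinearIndependent K (fun i => ∑ j, v i j • p j) ∧
      ∀ q, q ∈ Submodule.span K (Set.range fun i => ∑ j, v i j • p j) ↔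
        q ∈ Submodule.span K (Set.range p) ∧ mahlerOp b r L q = 0 := by
  set Φ : (Fin n → K) →ₗ[K] K[X] := Fintype.linearCombination K p with hΦ
  have hΦi : Function.Injective Φ := hp.fintypeLinearCombination_injective
  have hΦv : (fun i => ∑ j, v i j • p j) = Φ ∘ v := by
    funext i
    simp [hΦ, Fintype.linearCombination_apply]
  have hrange : LinearMap.range Φ = Submodule.span K (Set.range p) :=
    Fintype.range_linearCombination K p
  have hmem : ∀ c, c ∈ Submodule.span K (Set.range v) ↔ mahlerOp b r L (Φ c) = 0 := by
    intro c
    have hc : ∀ i, (mahlerOp b r L (Φ c)).coeff i = ∑ j, (mahlerOp b r L (p j)).coeff i * c j := by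
      intro i
      rw [hΦ, Fintype.linearCombination_apply, ← mahlerLin_apply, map_sum, finsetSum_coeff]
      refine Finset.sum_congr rfl fun j _ => ?_
      rw [map_smul, coeff_smul, mahlerLin_apply, smul_eq_mul, mul_comm]
    rw [hker, LinearMap.mem_ker]
    constructor
    · intro h0
      ext i
      rcases lt_or_ge i h with hi | hi
      · have := congrFun h0 ⟨i, hi⟩
        rw [hc, coeff_zero]
        simpa [Matrix.mulVec, dotProduct] using this
      · exact size_le_iff.mp (hh (Φ c) (by rw [← hrange]; exact ⟨c, rfl⟩)) i hi
    · intro h0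
      funext i
      have := hc i
      rw [h0, coeff_zero] at this
      simpa [Matrix.mulVec, dotProduct] using this.symm
  rw [hΦv]
  refine ⟨hv.map' Φ (LinearMap.ker_eq_bot.mpr hΦi), fun q => ?_⟩
  rw [Set.range_comp, ← Submodule.map_span, ← hrange]
  constructor
  · rintro ⟨c, hc, rfl⟩
    exact ⟨⟨c, rfl⟩, (hmem c).mp hc⟩
  · rintro ⟨⟨c, rfl⟩, hq⟩
    exact ⟨c, (hmem c).mpr hq, rfl⟩

/-- The cost consists of `w` sparse rows with at most `(r + 1) w` entries, at most `r` products of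
size `N` for each of the `r + 1` terms of the operator, and linear algebra with at most `r`
unknowns. -/
theorem spec_polySolutions (hS : SubSpec φ S U G) (hU : ∀ n, n ≤ U n) (hb : 2 ≤ b)
    (hl : HoldsOp m r l L) (h₀ : L 0 ≠ 0) {w N : ℕ} (hw : 1 ≤ w) (hLN : ∀ k ≤ r, size (L k) ≤ N)
    (hwN : (w - 1) * b ^ r + 1 ≤ N) :
    Spec φ (polySolutions S b r l w) m (40 * (r + 1) ^ 3 * (U N + w ^ 2)) fun s m' =>
      HoldsPolyBasis b r L w m' s := by
  have hb0 : 0 < b := by omega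
  have hN : 1 ≤ N := by omega
  have hwN' : w ≤ N := by
    have := Nat.le_mul_of_pos_right (w - 1) (pow_pos hb0 r)
    omega
  set X₀ := U N + w ^ 2 with hX₀
  set R₀ := r + 1 with hR₀
  have hR1 : 1 ≤ R₀ := by omega
  have hUX : U N ≤ X₀ := Nat.le_add_right _ _
  have hNX : N ≤ X₀ := (hU N).trans hUX
  have hR2 : R₀ ^ 2 ≤ R₀ ^ 3 := Nat.pow_le_pow_right hR1 (by norm_num)
  have hR3 : R₀ ≤ R₀ ^ 3 := Nat.le_self_pow (by norm_num) R₀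
  have hwX : w ^ 2 ≤ X₀ := Nat.le_add_left _ _
  have hw1X : w ≤ X₀ := (Nat.le_self_pow (by norm_num) w).trans hwX
  set Y := R₀ ^ 3 * X₀ with hY
  have hterm : ∀ {x y : ℕ}, x ≤ R₀ ^ 3 → y ≤ X₀ → x * y ≤ Y := fun hx hy => Nat.mul_le_mul hx hy
  rw [show 40 * R₀ ^ 3 * X₀ = 40 * Y by rw [hY, mul_assoc]]
  -- valuations
  have hval := Spec.mapM_le (φ := φ) (m := m) (f := valuation) (B := N)
    (R := fun a o _ => ∀ k, l[k]? = some a → IsValuation (L k) o) l (fun _ _ _ _ _ h => h) (by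
      intro a ha m₁ h₁
      obtain ⟨k₀, hk₀⟩ := List.mem_iff_getElem?.mp ha
      have hp := hl.holdsPoly hk₀
      have hk₀r : k₀ ≤ r := by
        have := (List.getElem?_eq_some_iff.mp hk₀).1
        rw [hl.length_eq] at this
        omega
      refine (spec_valuation (hp.mono h₁).holds).mono (by rw [hp.length_eq]; exact hLN k₀ hk₀r) ?_
      intro o _ _ ho k hk
      have hpk := (hl.holdsPoly hk).ofCoeffs_eq hp
      have : L k = L k₀ := by
        rw [← hpk]
        exact ofCoeffs_range_map _ le_rfl
      rwa [this])
  rw [hl.length_eq] at hval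
  refine Spec.bind_le (B₁ := Y) (B₂ := 39 * Y) (hval.le (hterm hR3 hNX)) ?_ (by omega)
  intro v m₁ h₁ hv
  have hvk : ∀ k ≤ r, ∃ o, v[k]? = some o ∧ IsValuation (L k) o := by
    intro k hk
    have hkl : k < l.length := by rw [hl.length_eq]; omega
    have hkv : k < v.length := by rw [← hv.length_eq]; exact hkl
    exact ⟨v[k], List.getElem?_eq_getElem hkv,
      List.Forall₂.get hv hkl hkv k (List.getElem?_eq_getElem hkl)⟩
  split_ifs with hnu
  · refine (Spec.pure ⟨0, Fin.elim0, by simp, linearIndependent_empty_type, fun p => ?_⟩).le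
      (Nat.zero_le _)
    have hempty : Submodule.span K (Set.range (Fin.elim0 : Fin 0 → K[X])) = ⊥ := by
      rw [Set.range_eq_empty, Submodule.span_empty]
    rw [hempty, Submodule.mem_bot]
    constructor
    · rintro rfl
      exact ⟨by simp [size_zero], by simp [mahlerOp]⟩
    · rintro ⟨-, hp⟩
      obtain ⟨o, ho, hov⟩ := hvk 0 (Nat.zero_le r)
      rcases o with _ | v₀
      · exact absurd hov h₀
      rcases v with _ | ⟨o, vs⟩
      · simp at ho
      simp only [List.getElem?_cons_zero, Option.some.injEq] at ho
      subst ho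
      refine eq_zero_of_mahlerOp_eq_zero hb0 hov.1 hov.2 (fun k hk1 hkr i hi => ?_) hp
      obtain ⟨o, ho, hov'⟩ := hvk k hkr
      rcases o with _ | vk
      · rw [show L k = 0 from hov', coeff_zero]
      · obtain ⟨k, rfl⟩ := Nat.exists_eq_add_of_le' hk1
        rw [List.getElem?_cons_succ] at ho
        have := lt_of_nu_lt_zero hb hnu ho
        exact hov'.2 i (by omega)
  -- the linear system
  have hl₁ := hl.mono h₁
  set h := ((degrees l).map Prod.snd).foldr max 0 + (w - 1) * b ^ r + 1 with hh
  have hhN : h + 1 ≤ 2 * N := by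
    have : ((degrees l).map Prod.snd).foldr max 0 ≤ N - 1 := by
      refine foldr_max_le fun x hx => ?_
      obtain ⟨e, he, rfl⟩ := List.mem_map.mp hx
      obtain ⟨h2, h3, h4⟩ := (mem_degrees hl).mp he
      have := hLN e.1 h2
      rw [size_of_ne_zero h3] at this
      omega
    omega
  have hdeg : ∀ p, size p ≤ w → size (mahlerOp b r L p) ≤ h := by
    intro p hp
    refine size_mahlerOp_le fun k hk h0 hp0 => ?_
    have h2 : (L k).natDegree ≤ ((degrees l).map Prod.snd).foldr max 0 :=
      le_foldr_max (List.mem_map.mpr ⟨(k, _), (mem_degrees hl).mpr ⟨hk, h0, rfl⟩, rfl⟩)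
    rw [size_of_ne_zero hp0] at hp
    have h3 : p.natDegree * b ^ k ≤ (w - 1) * b ^ r :=
      Nat.mul_le_mul (by omega) (Nat.pow_le_pow_right hb0 hk)
    omega
  set Rf : ℕ → ℕ → K := fun t n =>
    if n < w then rowEntry b r L (pivotRow b (degrees l) t) n else 0 with hRf
  have hrows := Spec.mapM_le (φ := φ) (m := m₁) (f := buildRow b l w) (B := (r + 1) * w)
    (R := fun i row m' => HoldsRow m' w row (fun n => if n < w then rowEntry b r L i n else 0) ∧
      row.length ≤ (r + 1) * w) ((List.range w).map fun n => pivotRow b (degrees l) n)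
    (fun _ _ _ _ hm h => ⟨h.1.mono hm, h.2⟩)
    (fun i _ m₂ h₂ => spec_buildRow hb0 (hl₁.mono h₂) w i)
  rw [List.length_map, List.length_range] at hrows
  refine Spec.bind_le (B₁ := Y) (B₂ := 38 * Y) (hrows.le ?_) ?_ (by omega)
  · calc w * ((r + 1) * w) = R₀ * w ^ 2 := by rw [hR₀]; ring
      _ ≤ Y := hterm hR3 hwX
  intro rows m₂ h₂ hrowsP
  have hrl : rows.length = w := by rw [← hrowsP.length_eq]; simp
  have hback := spec_backSubst (φ := φ) (m := m₂) (R := Rf) (w := w) (ρ := (r + 1) * w) (Z := r)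
    rows 0 (by omega) (by
      intro j hj
      have := List.Forall₂.get hrowsP (i := j) (by simpa using (by omega : j < w)) hj
      simpa [hRf] using this) (by
      refine le_trans (Finset.card_le_card fun t ht => ?_)
        (card_diag_eq_zero_le hb hl (Nat.zero_le r) h₀ w)
      rw [Finset.mem_filter] at ht ⊢
      refine ⟨ht.1, ?_⟩
      have h3 := ht.2
      rw [hRf] at h3
      dsimp only at h3
      rwa [if_pos (Finset.mem_Ico.mp ht.1).2] at h3)
  rw [hrl] at hback
  refine Spec.bind_le (B₁ := 7 * Y) (B₂ := 31 * Y) (hback.le ?_) ?_ (by omega)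
  · have e : w * (r * (2 * ((r + 1) * w) + 2 + 2 * w) + 1) =
        2 * ((r * R₀) * w ^ 2) + 2 * (r * w) + 2 * (r * w ^ 2) + 1 * w := by rw [hR₀]; ring
    have h3 : r * R₀ ≤ R₀ ^ 3 := by
      refine le_trans ?_ hR2
      rw [pow_two]
      exact Nat.mul_le_mul_right _ (Nat.le_succ r)
    have h4 : r ≤ R₀ ^ 3 := (Nat.le_succ r).trans hR3
    rw [e]
    have := hterm h3 hwX
    have := hterm h4 hw1X
    have := hterm h4 hwX
    have := hterm (Nat.one_le_pow _ _ hR1 : 1 ≤ R₀ ^ 3) hw1X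
    omega
  rintro Gs m₃ h₃ ⟨ps, hGs, hind, hspan, hlen⟩
  have hn : ps.length ≤ r := by
    refine hlen.trans (le_trans (Finset.card_le_card fun t ht => ?_)
        (card_diag_eq_zero_le hb hl (Nat.zero_le r) h₀ w))
    rw [Finset.mem_filter] at ht ⊢
    refine ⟨ht.1, ?_⟩
    have h3 := ht.2
    rw [hRf] at h3
    dsimp only at h3
    rwa [if_pos (Finset.mem_Ico.mp ht.1).2] at h3
  have hGl : Gs.length = ps.length := hGs.length_eq
  have hpsize : ∀ p ∈ listSpan K ps, size p ≤ w := fun p hp => ((hspan p).mp hp).2.1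
  have hm₃ := h₁.trans (h₂.trans h₃)
  -- the images of the basis vectors
  have hcols := Spec.mapM_le (φ := φ) (m := m₃)
    (f := fun g => do truncate h (← applyOp S b l (← trim g)))
    (B := w + ((r + 1) * U N + (r + 2) * (2 * N)))
    (R := fun g s m' => ∀ p, size p ≤ w → HoldsVec m₃ g (coords (lcoeff K) 0 w p) →
      HoldsVec m' s ((List.range h).map (mahlerOp b r L p).coeff)) Gs
    (fun _ _ _ _ hm h p hp hg => (h p hp hg).mono hm) (by
      intro g hg m₄ h₄
      obtain ⟨j, hj, rfl⟩ := List.getElem_of_mem hg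
      have hget := List.Forall₂.get hGs hj (by omega)
      simp only [List.get_eq_getElem, Nat.sub_zero] at hget
      set p := ps[j]'(by omega) with hpdef
      have hpw : size p ≤ w := hpsize p (Submodule.subset_span (List.getElem_mem _))
      have hHolds : Holds m₄ Gs[j] p :=
        ⟨_, hget.mono h₄, by rw [coords_zero, ofCoeffs_range_map p hpw]⟩
      refine Spec.bind ((spec_trim hHolds).le (B' := w) ?_) fun s m₅ h₅ hs => ?_
      · rw [hget.length_eq]
        simp [coords]
      refine Spec.bind_le (B₂ := 0) (spec_applyOp (n := N) hS hb0 (hl.mono (hm₃.trans (h₄.trans h₅)))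
        hs hLN ?_) (fun s' m₆ h₆ hs' => ?_) le_rfl
      · intro k hk
        rcases eq_or_ne p 0 with hp0 | hp0
        · rw [hp0, map_zero, size_zero]
          exact Nat.zero_le _
        · rw [size_expand hp0 (pow_pos hb0 k)]
          have : b ^ k * (size p - 1) ≤ (w - 1) * b ^ r := by
            rw [mul_comm]
            exact Nat.mul_le_mul (by omega) (Nat.pow_le_pow_right hb0 hk)
          omega
      · refine (spec_truncate hs'.holds h).imp fun s'' m₇ _ hs'' q hq hqg => ?_
        have : q = p := by
          have h8 : (coords (lcoeff K) 0 w q).map some = (coords (lcoeff K) 0 w p).map some :=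
            hqg.symm.trans hget
          have h9 := List.map_injective_iff.mpr (Option.some_injective K) h8
          rw [coords_zero, coords_zero] at h9
          rw [← ofCoeffs_range_map q hq, h9, ofCoeffs_range_map p hpw]
        rwa [this])
  refine Spec.bind_le (B₁ := 7 * Y) (B₂ := 24 * Y) (hcols.le ?_) ?_ (by omega)
  · have h3 : Gs.length ≤ R₀ := by omega
    have h4 : r + 2 ≤ 2 * R₀ := by omega
    have h5 : R₀ * R₀ ≤ R₀ ^ 3 := by rw [← pow_two]; exact hR2
    calc Gs.length * (w + ((r + 1) * U N + (r + 2) * (2 * N)))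
        ≤ R₀ * (w + (R₀ * U N + 2 * R₀ * (2 * N))) := by gcongr
      _ = R₀ * w + (R₀ * R₀) * U N + 4 * ((R₀ * R₀) * N) := by ring
      _ ≤ 7 * Y := by
        have := hterm hR3 hw1X
        have := hterm h5 hUX
        have := hterm h5 hNX
        omega
  intro cols m₄ h₄ hcolsP
  set p : Fin ps.length → K[X] := fun j => ps[j] with hp
  have hcl : cols.length = ps.length := by rw [← hcolsP.length_eq, hGl]
  have hcols' : List.Forall₂ (HoldsVec m₄) cols (List.ofFn fun j : Fin ps.length =>
      List.ofFn fun i : Fin h =>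
        (Matrix.of fun (i : Fin h) (j : Fin ps.length) => (mahlerOp b r L (p j)).coeff i) i j) := by
    rw [List.forall₂_iff_get]
    refine ⟨by simp [hcl], fun j hj₁ hj₂ => ?_⟩
    have hj : j < ps.length := by omega
    have h5 := List.Forall₂.get hGs (i := j) (by omega) hj
    simp only [List.get_eq_getElem, Nat.sub_zero] at h5
    have h6 := List.Forall₂.get hcolsP (i := j) (by omega) hj₁ _
      (hpsize _ (Submodule.subset_span (List.getElem_mem hj))) h5
    convert h6 using 1
    simp only [List.get_eq_getElem, List.getElem_ofFn, Matrix.of_apply]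
    exact List.ext_getElem (by rw [List.length_ofFn, List.length_map, List.length_range])
      fun i h1 h2 => by rw [List.getElem_ofFn, List.getElem_map, List.getElem_range]; rfl
  refine Spec.bind_le (B₁ := 16 * Y) (B₂ := 8 * Y) ((hS.kernel hcols').le ?_) ?_ (by omega)
  · calc 8 * (h + 1) * (ps.length + 1) ^ 2 ≤ 8 * (2 * N) * R₀ ^ 2 := by
          gcongr
          omega
      _ = 16 * (R₀ ^ 2 * N) := by ring
      _ ≤ 16 * Y := Nat.mul_le_mul_left _ (hterm hR2 hNX)
  rintro Ns m₅ h₅ ⟨k, v', hNs, hv'ind, hker⟩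
  have hpind : LinearIndependent K p := (listIndep_iff_get ps).mp hind
  have hpspan : listSpan K ps = Submodule.span K (Set.range p) := listSpan_eq_range ps
  obtain ⟨hq1, hq2⟩ := basis_recombine (b := b) (r := r) (h := h) (L := L) hpind
    (fun q hq => hdeg q (hpsize q (by rw [hpspan]; exact hq))) hv'ind hker
  have hkr : k ≤ ps.length := by
    have := hv'ind.fintype_card_le_finrank
    simpa using this
  have hGs' : List.Forall₂ (fun g p => HoldsVec m₅ g (coords (lcoeff K) 0 w p)) Gs
      (List.ofFn p) := by
    have : List.ofFn p = ps := by simp [hp]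
    rw [this]
    exact hGs.imp fun _ _ h => by
      rw [Nat.sub_zero] at h
      exact h.mono (h₄.trans h₅)
  have hfin := Spec.mapM_le (φ := φ) (m := m₅)
    (f := fun c => do trim (← combine w Gs c)) (B := ps.length * (w * 2) + w)
    (R := fun c s m' => ∀ x : Fin ps.length → K, HoldsVec m₅ c (List.ofFn x) →
      HoldsPoly m' s (∑ j, x j • p j)) Ns
    (fun _ _ _ _ hm h x hx => (h x hx).mono hm) (by
      intro c hc m₆ h₆
      obtain ⟨j, hj, rfl⟩ := List.getElem_of_mem hc
      have hget := List.Forall₂.get hNs hj (by rw [← hNs.length_eq]; exact hj)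
      simp only [List.get_eq_getElem, List.getElem_ofFn] at hget
      set x₀ := v' ⟨j, by have := hNs.length_eq; rw [List.length_ofFn] at this; omega⟩
      refine Spec.bind (spec_combine (hGs'.imp fun _ _ h => h.mono h₆) (hget.mono h₆))
        fun s m₇ h₇ hs => ?_
      have hsz : size (∑ j, x₀ j • p j) ≤ w := by
        refine hpsize _ ?_
        rw [hpspan]
        exact Submodule.sum_mem _ fun j _ =>
          Submodule.smul_mem _ _ (Submodule.subset_span ⟨j, rfl⟩)
      have hHolds : Holds m₇ s (∑ j, x₀ j • p j) :=
        ⟨_, hs, by rw [coords_zero, ofCoeffs_range_map _ hsz]⟩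
      refine (spec_trim hHolds).mono ?_ ?_
      · rw [hs.length_eq]
        simp [coords]
      · intro s' m₈ _ hs' x hx
        have : x = x₀ := by
          have h8 : (List.ofFn x).map some = (List.ofFn x₀).map some := hx.symm.trans hget
          exact List.ofFn_injective (List.map_injective_iff.mpr (Option.some_injective K) h8)
        rwa [this])
  refine hfin.mono ?_ fun s m₆ h₆ hs => ?_
  · have h3 : Ns.length ≤ R₀ := by
      rw [hNs.length_eq, List.length_ofFn]
      omega
    have h5 : R₀ * R₀ ≤ R₀ ^ 3 := by rw [← pow_two]; exact hR2
    calc Ns.length * (ps.length * (w * 2) + w) ≤ R₀ * (R₀ * (w * 2) + w) := by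
          gcongr
          omega
      _ = 2 * ((R₀ * R₀) * w) + R₀ * w := by ring
      _ ≤ 8 * Y := by
        have := hterm h5 hw1X
        have := hterm hR3 hw1X
        omega
  refine ⟨k, fun i => ∑ j, v' i j • p j, ?_, hq1, fun q => ?_⟩
  · rw [List.forall₂_iff_get] at hs hNs ⊢
    have hNl : Ns.length = k := by simpa using hNs.1
    refine ⟨by rw [← hs.1, hNl, List.length_ofFn], fun j hj₁ hj₂ => ?_⟩
    have hj : j < k := by simpa using hj₂
    have h6 := hNs.2 j (by omega) (by simpa using hj)
    simp only [List.get_eq_getElem, List.getElem_ofFn] at h6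
    have h7 := hs.2 j (by omega) hj₁ _ h6
    simpa using h7
  · rw [hq2, ← hpspan]
    constructor
    · rintro ⟨h6, h7⟩
      exact ⟨hpsize q h6, h7⟩
    · rintro ⟨h6, h7⟩
      exact ⟨(hspan q).mpr (pivotRow_backKernel hb0 hl h6 h7), h7⟩

end PolySolutionsProgram

/-! ### The algorithm for rational solutions -/

section RatSolutions

variable {K : Type*} [Field K] [DecidableEq K]

open Polynomial

/-- The coefficients of the equation for `p`, where `y = p / (x ^ v * q)`. -/
noncomputable def numerCoeff (b r e v : ℕ) (L : ℕ → K[X]) (q : K[X]) (k : ℕ) : K[X] :=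
  X ^ (e - b ^ k * v) * (L k * ∏ j ∈ (Finset.range (r + 1)).erase k, expand K (b ^ j) q)

/-- The equation for `p / (x ^ v q)`, multiplied by `x ^ e` to clear the negative powers of `x`. -/
theorem isSolution_iff_mahlerOp {b r e v : ℕ} (hb : 0 < b) {l : Fin (r + 1) → K[X]} {L : ℕ → K[X]}
    (hL : ∀ k : Fin (r + 1), L k = l k) {q : K[X]} (hq : q ≠ 0) (he : ∀ k ≤ r, b ^ k * v ≤ e)
    (p : K[X]) :
    IsSolution b l (algebraMap K[X] (RatFunc K) p / algebraMap K[X] (RatFunc K) (X ^ v * q)) ↔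
      mahlerOp b r (numerCoeff b r e v L q) p = 0 := by
  rw [isSolution_div_iff hb hL (mul_ne_zero (pow_ne_zero _ X_ne_zero) hq)]
  set s := ∑ j ∈ Finset.range (r + 1), b ^ j * v with hs
  have key : X ^ e * ∑ k ∈ Finset.range (r + 1), clearedTerm b r L p (X ^ v * q) k =
      X ^ s * mahlerOp b r (numerCoeff b r e v L q) p := by
    rw [mahlerOp, Finset.mul_sum, Finset.mul_sum]
    refine Finset.sum_congr rfl fun k hk => ?_
    have hkr := he k (Nat.lt_succ_iff.mp (Finset.mem_range.mp hk))
    have h1 : ∏ j ∈ (Finset.range (r + 1)).erase k, expand K (b ^ j) (X ^ v * q) =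
        X ^ (∑ j ∈ (Finset.range (r + 1)).erase k, b ^ j * v) *
          ∏ j ∈ (Finset.range (r + 1)).erase k, expand K (b ^ j) q := by
      rw [← Finset.prod_pow_eq_pow_sum, ← Finset.prod_mul_distrib]
      refine Finset.prod_congr rfl fun j _ => ?_
      rw [map_mul, map_pow, expand_X, ← pow_mul]
    have h2 := Finset.add_sum_erase _ (fun j => b ^ j * v) hk
    rw [clearedTerm, h1, numerCoeff, hs, ← h2]
    have h3 : X ^ e = (X : K[X]) ^ (b ^ k * v) * X ^ (e - b ^ k * v) := by
      rw [← pow_add, Nat.add_sub_cancel' hkr]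
    rw [h3, pow_add]
    ring
  have hX : ∀ n, (X : K[X]) ^ n ≠ 0 := fun n => pow_ne_zero _ X_ne_zero
  constructor
  · intro h
    rw [h, mul_zero] at key
    exact (mul_eq_zero.mp key.symm).resolve_left (hX s)
  · intro h
    rw [h, mul_zero] at key
    exact (mul_eq_zero.mp key).resolve_left (hX e)

/-- Division by a fixed nonzero polynomial, as a linear map into the rational functions. -/
noncomputable def divLin (Q : K[X]) : K[X] →ₗ[K] RatFunc K :=
  (LinearMap.mulRight K (algebraMap K[X] (RatFunc K) Q)⁻¹).comp
    (IsScalarTower.toAlgHom K K[X] (RatFunc K)).toLinearMap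

theorem divLin_apply (Q p : K[X]) :
    divLin Q p = algebraMap K[X] (RatFunc K) p / algebraMap K[X] (RatFunc K) Q := by
  simp [divLin, div_eq_mul_inv]

theorem divLin_injective {Q : K[X]} (hQ : Q ≠ 0) : Function.Injective (divLin Q) := by
  intro p p' h
  have hQ' : algebraMap K[X] (RatFunc K) Q ≠ 0 := by
    rwa [Ne, map_eq_zero_iff _ (RatFunc.algebraMap_injective K)]
  rw [divLin_apply, divLin_apply, div_left_inj' hQ'] at h
  exact RatFunc.algebraMap_injective K h

theorem isSolution_zero {b r : ℕ} (l : Fin (r + 1) → K[X]) : IsSolution b l 0 := by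
  simp [IsSolution]

/-- A rational solution has the form `p / (x ^ v * q)` with a bound for the degree of `p`, where
`q` is the denominator bound. -/
theorem exists_numerator [CharZero K] {b r δ : ℕ} (hb : 2 ≤ b) (hr1 : 1 ≤ r) {l : Fin (r + 1) → K[X]}
    {L : ℕ → K[X]} (hL : ∀ k : Fin (r + 1), L k = l k) (hr : L r ≠ 0)
    (hδ : ∀ k ≤ r, (L k).natDegree ≤ δ) {q : K[X]} (hq0 : q ≠ 0) (hq : IsDenomBound b r (L r) q)
    {y : RatFunc K} (hy : IsSolution b l y) :
    ∃ p, size p ≤ q.natDegree + 2 * (δ / (b ^ r - b ^ (r - 1))) + 1 ∧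
      y = divLin (X ^ (δ / (b ^ r - b ^ (r - 1))) * q) p := by
  by_cases hy0 : y = 0
  · exact ⟨0, by simp [size_zero], by rw [hy0, map_zero]⟩
  set v := δ / (b ^ r - b ^ (r - 1)) with hv
  have hb0 : 0 < b := by omega
  have hP : y.num ≠ 0 := RatFunc.num_ne_zero hy0
  have hQ : y.denom ≠ 0 := y.denom_ne_zero
  have h := hy
  rw [← RatFunc.num_div_denom y, isSolution_div_iff hb0 hL hQ] at h
  obtain ⟨c, hc⟩ := denom_dvd hb hr1 hP hQ (RatFunc.isCoprime_num_denom y) hr (hδ r le_rfl) hq h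
  have hdeg := natDegree_le_of_solution hb hr1 hP hQ hr hδ h
  rw [← hv] at hc hdeg
  have hQ0 : X ^ v * q ≠ 0 := mul_ne_zero (pow_ne_zero _ X_ne_zero) hq0
  have hc0 : c ≠ 0 := by
    rintro rfl
    rw [mul_zero] at hc
    exact hQ0 hc
  refine ⟨y.num * c, ?_, ?_⟩
  · rw [size_of_ne_zero (mul_ne_zero hP hc0), natDegree_mul hP hc0]
    have := congrArg natDegree hc
    rw [natDegree_mul hQ hc0, natDegree_mul (pow_ne_zero _ X_ne_zero) hq0, natDegree_X_pow] at this
    omega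
  · have hinj := RatFunc.algebraMap_injective K
    have hc' : algebraMap K[X] (RatFunc K) c ≠ 0 := by rwa [Ne, map_eq_zero_iff _ hinj]
    rw [divLin_apply, hc, map_mul, map_mul, mul_div_mul_right _ _ hc', RatFunc.num_div_denom]

/-- If `p` has degree less than `b ^ (r - 1)`, then the denominator bound is trivial. -/
theorem isDenomBound_one {b r : ℕ} (hb : 2 ≤ b) {p : K[X]} (hp : p ≠ 0)
    (h : p.natDegree < b ^ (r - 1)) : IsDenomBound b r p 1 := by
  have hb0 : 0 < b := by omega
  have hdvd : ∀ n, r - 1 ≤ n → ∀ h : K[X], h ∣ 1 ↔ expand K (b ^ n) h ∣ p := by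
    intro n hn g
    constructor
    · intro hg
      have := map_dvd (expand K (b ^ n)) hg
      rw [map_one] at this
      exact this.trans (one_dvd p)
    · intro hg
      have hle := natDegree_le_of_dvd hg hp
      have hg0 : g ≠ 0 := by
        rintro rfl
        rw [map_zero, zero_dvd_iff] at hg
        exact hp hg
      have hpow : b ^ (r - 1) ≤ b ^ n := Nat.pow_le_pow_right hb0 hn
      rw [natDegree_expand] at hle
      rw [← isUnit_iff_dvd_one, isUnit_iff_degree_eq_zero, degree_eq_natDegree hg0]
      have : g.natDegree = 0 := by
        by_contra hne
        have := Nat.le_mul_of_pos_left (b ^ n) (Nat.pos_of_ne_zero hne)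
        omega
      rw [this]
      rfl
  refine ⟨[], p, 1, LoopRun.last (u := 1) ⟨hdvd r (by omega), p, 1, by simp, by simp, one_ne_zero,
    fun i _ => by simp, by simp⟩ (by simp), hdvd (r - 1) le_rfl, ?_⟩
  have := graeffe_C (K := K) b 1
  rw [C_1] at this
  simp [this]

variable {φ : Prop} {m m' : List K} {S : Subroutines K} {U G : ℕ → ℕ}

/-- The program for the coefficients of the equation for the numerators. -/
theorem spec_numerCoeff (hS : SubSpec φ S U G) {b r e v N k : ℕ} (hb : 0 < b) {L : ℕ → K[X]}
    {q : K[X]} {a c : List ℕ} (ha : HoldsPoly m a (L k)) (hc : HoldsPoly m c q)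
    (hq : q ≠ 0) (hN : ∀ j ≤ r, size (expand K (b ^ j) q) ≤ N)
    (hN' : L k ≠ 0 →
      size (L k * ∏ j ∈ (Finset.range (r + 1)).erase k, expand K (b ^ j) q) ≤ N) :
    Spec φ (do
      let c ← ((List.range (r + 1)).filter fun i => decide (i ≠ k)).foldlM
        (fun acc i => do S.mul acc (← dilate (b ^ i) c)) a
      shift (e - b ^ k * v) c) m ((r + 1) * U N)
      fun s m' => HoldsPoly m' s (numerCoeff b r e v L q k) := by
  set is := (List.range (r + 1)).filter fun i => decide (i ≠ k) with his
  have hprod : (is.map fun j => expand K (b ^ j) q).prod =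
      ∏ j ∈ (Finset.range (r + 1)).erase k, expand K (b ^ j) q := by
    rw [← List.prod_toFinset _ (List.Nodup.filter _ List.nodup_range)]
    refine Finset.prod_congr ?_ fun _ _ => rfl
    ext j
    simp [and_comm]
  have hloop := Spec.foldlM_le (φ := φ) (m := m) (B := U N)
    (f := fun acc i => do S.mul acc (← dilate (b ^ i) c))
    (fun l₁ s m' => HoldsPoly m' s (L k * (l₁.map fun j => expand K (b ^ j) q).prod)) is a
    (by simpa using ha) (by
      intro l₁ i l₂ hl s m₁ h₁ hs
      have hi : i ≤ r := by
        have : i ∈ is := by rw [hl]; simp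
        rw [his, List.mem_filter, List.mem_range] at this
        omega
      refine Spec.bind_le (spec_dilate (hc.mono h₁) (pow_pos hb i)) (fun d m₂ h₂ hd => ?_)
        (zero_add _).le
      refine (hS.mul (hs.mono h₂) hd ?_ (hN i hi)).imp fun t m₃ _ ht => ?_
      · by_cases h0 : L k = 0
        · rw [h0, zero_mul, size_zero]
          exact Nat.zero_le _
        · rw [← hprod] at hN'
          have hne : (is.map fun j => expand K (b ^ j) q).prod ≠ 0 := by
            rw [hprod]
            exact Finset.prod_ne_zero_iff.mpr fun j _ => expand_ne_zero' hb j hq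
          refine (size_le_of_dvd (mul_dvd_mul_left _ ?_) (mul_ne_zero h0 hne)).trans (hN' h0)
          rw [hl, List.map_append, List.prod_append]
          exact dvd_mul_right _ _
      · rw [List.map_append, List.prod_append, ← mul_assoc]
        simpa using ht)
  refine Spec.bind_le (B₁ := (r + 1) * U N) (B₂ := 0) (hloop.le (Nat.mul_le_mul_right _ ?_)) ?_ le_rfl
  · exact (List.length_filter_le _ _).trans (by simp)
  · intro s m₁ h₁ hs
    rw [hprod] at hs
    exact spec_shift hs _

/-- The algorithm returns a basis of the space of rational solutions; the bound for its cost is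
expressed in terms of a factorization `b ^ r = V * W` such that `V * deg q ≤ d` for the denominator
bound `q`. -/
theorem spec_ratSolutions [CharZero K] (hS : SubSpec φ S U G) (hU : IsCost U) {b r d V W : ℕ}
    (hb : 2 ≤ b) (hr1 : 1 ≤ r) (hV0 : 0 < V) (hV : V + ∑ i ∈ Finset.range r, b ^ i ≤ b ^ r)
    (hV' : V ≤ b ^ (r - 1)) (hVW : b ^ r = V * W) {l : Fin (r + 1) → K[X]}
    {a : Fin (r + 1) → List ℕ} (h0 : l 0 ≠ 0) (hlast : l (Fin.last r) ≠ 0)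
    (hd : ∀ k, (l k).natDegree ≤ d) (hbd : b ^ (r - 1) ≤ d) (ha : ∀ k, HoldsPoly m (a k) (l k)) :
    Spec φ (ratSolutions S b r (List.ofFn a)) m
      (700 * (r + 1) ^ 3 * ((d / V + G b) * U (2 * b * d) + U (6 * W * d) + (d / V) ^ 2))
      fun out m' => HoldsSolutionBasis b l m' out := by
  have hb0 : 0 < b := by omega
  set L : ℕ → K[X] := fun k => if h : k < r + 1 then l ⟨k, h⟩ else 0 with hLdef
  have hL : ∀ k : Fin (r + 1), L k = l k := fun k => by simp only [hLdef]; rw [dif_pos k.2]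
  have hL0 : L 0 ≠ 0 := by
    have := hL 0
    rw [Fin.val_zero] at this
    rwa [this]
  have hLr : L r ≠ 0 := by
    have := hL (Fin.last r)
    rw [Fin.val_last] at this
    rwa [this]
  have hl : HoldsOp m r (List.ofFn a) L := by
    rw [HoldsOp, List.forall₂_iff_get]
    refine ⟨by simp, fun j h₁ h₂ => ?_⟩
    have hj : j < r + 1 := by simpa using h₁
    have := ha ⟨j, hj⟩
    simpa only [List.get_eq_getElem, List.getElem_ofFn, List.getElem_map, List.getElem_range, hLdef,
      dif_pos hj] using this
  -- the degree of the equation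
  set δ := ((List.ofFn a).map List.length).foldr max 0 - 1 with hδ
  have hsize : ∀ k ≤ r, size (L k) ≤ δ + 1 := by
    intro k hk
    have hk' : k < (List.ofFn a).length := by rw [hl.length_eq]; omega
    have h1 := (hl.holdsPoly (List.getElem?_eq_getElem hk')).length_eq
    have h2 := le_foldr_max (List.mem_map_of_mem (f := List.length) (List.getElem_mem hk'))
    omega
  have hdeg : ∀ k ≤ r, (L k).natDegree ≤ δ := by
    intro k hk
    have := hsize k hk
    rw [natDegree_eq_size_sub_one]
    omega
  have hδd : δ ≤ d := by
    have : ((List.ofFn a).map List.length).foldr max 0 ≤ d + 1 := by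
      refine foldr_max_le fun x hx => ?_
      obtain ⟨c, hc, rfl⟩ := List.mem_map.mp hx
      obtain ⟨k, rfl⟩ := (List.mem_ofFn' a c).mp hc
      rw [(ha k).length_eq]
      have := hd k
      rw [natDegree_eq_size_sub_one] at this
      omega
    omega
  have hpow1 : 1 ≤ b ^ (r - 1) := Nat.one_le_pow _ _ hb0
  have hbr : b ^ r = b * b ^ (r - 1) := by
    rw [← pow_succ', Nat.sub_add_cancel hr1]
  -- `δ / (b ^ r - b ^ (r - 1))` vanishes if `δ < b ^ (r - 1)`, and is at most `d / V` in general
  have hgap : b ^ (r - 1) ≤ b ^ r - b ^ (r - 1) := by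
    have := Nat.mul_le_mul_right (b ^ (r - 1)) hb
    omega
  have hW : 2 ≤ W := by
    by_contra hcon
    have h1 : W ≤ 1 := by omega
    have h2 := Nat.mul_le_mul hV' h1
    have h3 := Nat.mul_le_mul_right (b ^ (r - 1)) hb
    omega
  have hWd : 2 * d ≤ W * d := Nat.mul_le_mul_right d hW
  have hR : 1 ≤ (r + 1) ^ 3 := Nat.one_le_pow _ _ (by omega)
  obtain ⟨R, hRdef⟩ : ∃ R, R = r + 1 := ⟨_, rfl⟩
  rw [← hRdef] at hR
  rw [show 700 * (r + 1) ^ 3 = 700 * R ^ 3 by rw [hRdef]]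
  have hR1 : 1 ≤ R := by omega
  have hRR : R ≤ R ^ 3 := Nat.le_self_pow (by norm_num) R
  have hRR2 : R * R ≤ R ^ 3 := by
    rw [← pow_two]
    exact Nat.pow_le_pow_right hR1 (by norm_num)
  set N := 6 * W * d with hNdef
  have hNd : N = 6 * (W * d) := by rw [hNdef, mul_assoc]
  set T := (d / V + G b) * U (2 * b * d) + U N + (d / V) ^ 2 with hT
  unfold ratSolutions
  dsimp only
  rw [← hδ]
  split_ifs with hcase
  · -- only constants can be solutions
    have hholds : List.Forall₂ (Holds m) (List.ofFn a) ((List.range (r + 1)).map L) :=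
      hl.imp fun _ _ h => h.holds
    have hsum := spec_sumPoly (φ := φ) (n := d + 1) hholds (by
      intro c hc
      obtain ⟨k, rfl⟩ := (List.mem_ofFn' a c).mp hc
      rw [(ha k).length_eq]
      have := hd k
      rw [natDegree_eq_size_sub_one] at this
      omega)
    rw [List.length_ofFn] at hsum
    have hsumL : ((List.range (r + 1)).map L).sum = ∑ k ∈ Finset.range (r + 1), L k := by
      rw [← List.sum_toFinset L List.nodup_range, List.toFinset_range]
    rw [hsumL] at hsum
    refine Spec.bind_le (B₁ := (r + 1 + 1) * (d + 1)) (B₂ := 0) hsum ?_ ?_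
    swap
    · calc (r + 1 + 1) * (d + 1) + 0 ≤ (2 * R) * N := by
            refine Nat.mul_le_mul (by omega) ?_
            omega
        _ = 2 * (R * N) := by ring
        _ ≤ 2 * (R ^ 3 * T) := by
            refine Nat.mul_le_mul_left _ (Nat.mul_le_mul hRR ?_)
            have := hU.le N
            omega
        _ ≤ 700 * R ^ 3 * T := by rw [mul_assoc]; exact Nat.mul_le_mul_right _ (by norm_num)
    intro s m₁ h₁ hs
    refine Spec.bind (B₁ := 0) (B₂ := 0) (Spec.lit 1) fun one m₂ h₂ hone => Spec.pure ?_
    have hconst : ∀ c : K, IsSolution b l (algebraMap K[X] (RatFunc K) (C c)) ↔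
        c = 0 ∨ ∑ k ∈ Finset.range (r + 1), L k = 0 := by
      intro c
      have h1 := isSolution_div_iff (P := C c) hb0 hL (one_ne_zero (α := K[X]))
      rw [map_one, div_one] at h1
      rw [h1]
      have : ∀ k ∈ Finset.range (r + 1), clearedTerm b r L (C c) 1 k = L k * C c := by
        intro k _
        simp [clearedTerm]
      rw [Finset.sum_congr rfl this, ← Finset.sum_mul, mul_eq_zero, C_eq_zero, or_comm]
    have hform : ∀ y, IsSolution b l y → ∃ c : K, y = algebraMap K[X] (RatFunc K) (C c) := by
      intro y hy
      have hq := isDenomBound_one (r := r) hb hLr ((hdeg r le_rfl).trans_lt hcase)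
      obtain ⟨p, hp, hyp⟩ := exists_numerator hb hr1 hL hLr hdeg one_ne_zero hq hy
      have hv : δ / (b ^ r - b ^ (r - 1)) = 0 := Nat.div_eq_of_lt (by omega)
      rw [hv, natDegree_one] at hp
      rw [hv, divLin_apply, pow_zero, mul_one, map_one, div_one] at hyp
      refine ⟨p.coeff 0, ?_⟩
      rw [hyp]
      congr 1
      refine eq_C_of_natDegree_eq_zero ?_
      rw [natDegree_eq_size_sub_one]
      omega
    have hinj := RatFunc.algebraMap_injective K
    by_cases hzero : ∑ k ∈ Finset.range (r + 1), L k = 0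
    · have hsnil : s = [] := hs.eq_nil_iff.mpr hzero
      simp only [hsnil, List.isEmpty_nil, if_true]
      refine ⟨1, fun _ => 1, ?_, ?_, ?_⟩
      · rw [List.ofFn_succ, List.ofFn_zero]
        exact .cons ⟨1, 1, holdsPoly_one hone, holdsPoly_one hone, one_ne_zero, by simp⟩ .nil
      · rw [linearIndependent_unique_iff]
        exact one_ne_zero
      · ext y
        rw [Set.range_const, SetLike.mem_coe, Submodule.mem_span_singleton, Set.mem_ofPred_eq]
        have hC : ∀ c : K, c • (1 : RatFunc K) = algebraMap K[X] (RatFunc K) (C c) := by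
          intro c
          rw [← mul_one (C c), ← smul_eq_C_mul, ← map_one (algebraMap K[X] (RatFunc K))]
          rw [Algebra.algebraMap_eq_smul_one, Algebra.algebraMap_eq_smul_one, one_smul, smul_assoc,
            one_smul]
        constructor
        · rintro ⟨c, rfl⟩
          rw [hC, hconst]
          exact Or.inr hzero
        · intro hy
          obtain ⟨c, rfl⟩ := hform y hy
          exact ⟨c, hC c⟩
    · have hsnil : s ≠ [] := fun h => hzero (hs.eq_nil_iff.mp h)
      simp only [List.isEmpty_iff, hsnil, if_false]
      refine ⟨0, Fin.elim0, by simp, linearIndependent_empty_type, ?_⟩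
      rw [Set.range_eq_empty, Submodule.span_empty]
      ext y
      simp only [Submodule.bot_coe, Set.mem_singleton_iff, Set.mem_ofPred_eq]
      constructor
      · rintro rfl
        exact isSolution_zero l
      · intro hy
        obtain ⟨c, rfl⟩ := hform y hy
        rw [hconst] at hy
        rw [hy.resolve_right hzero, C_0, map_zero]
  · rw [not_lt] at hcase
    have hG : ∀ u : K[X], u ≠ 0 → graeffe b u ≠ 0 ∧ (graeffe b u).natDegree ≤ u.natDegree :=
      fun u hu => graeffe_ne_zero_and_natDegree b hu
    have hget : (List.ofFn a).getD r [] = a (Fin.last r) := by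
      rw [List.getD_eq_getElem?_getD, List.getElem?_ofFn, dif_pos (Nat.lt_succ_self r)]
      rfl
    have hlastP : HoldsPoly m ((List.ofFn a).getD r []) (L r) := by
      rw [hget]
      have := ha (Fin.last r)
      rwa [← hL, Fin.val_last] at this
    -- the size of the slices of a polynomial of degree `d`
    set k₀ := d / b ^ (r - 1) + 1 with hk₀
    have hk₀' : d + 1 ≤ b ^ (r - 1) * k₀ := by
      have := Nat.lt_mul_div_succ d hpow1
      rw [hk₀]
      omega
    have hk₀'' : b ^ (r - 1) * k₀ ≤ 2 * d := by
      rw [hk₀, mul_add, mul_one]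
      have := Nat.mul_div_le d (b ^ (r - 1))
      omega
    have hden := spec_denomBound (φ := φ) (N := d + 1) hS hb hG hk₀' hV0 hV hV' hLr hlastP
      ((hsize r le_rfl).trans (by omega))
    have hdV : (L r).natDegree / V ≤ d / V := Nat.div_le_div_right ((hdeg r le_rfl).trans hδd)
    have hdV1 : 1 ≤ d / V := (Nat.one_le_div_iff hV0).mpr (hV'.trans hbd)
    set A := d / V with hA
    set U₁ := U (2 * b * d) with hU₁
    have hk₀U : b ^ r * (k₀ + U k₀) ≤ 2 * U₁ := by
      have h1 := hU.le k₀
      have h2 := hU.mul_le (b ^ r) k₀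
      have h3 : b ^ r * k₀ ≤ 2 * b * d := by
        rw [hbr, mul_assoc]
        calc b * (b ^ (r - 1) * k₀) ≤ b * (2 * d) := Nat.mul_le_mul_left _ hk₀''
          _ = 2 * b * d := by ring
      have h4 := hU.mono h3
      calc b ^ r * (k₀ + U k₀) ≤ b ^ r * (2 * U k₀) := Nat.mul_le_mul_left _ (by omega)
        _ = 2 * (b ^ r * U k₀) := by ring
        _ ≤ 2 * U₁ := by omega
    have hdU : U (d + 1) ≤ U₁ := by
      refine hU.mono ?_
      have : 2 * d ≤ 2 * b * d := Nat.mul_le_mul_right d (by omega)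
      omega
    -- the cost of the denominator bound; the other parts are bounded by multiples of the same `Y`
    have hcost₁ : ((L r).natDegree / V + 1) * (passCost U b r (d + 1) k₀ + U (d + 1)) +
        (b ^ (r - 1) * (k₀ + U k₀) + G b * U (d + 1)) ≤ 20 * (R ^ 3 * T) := by
      have h1 : passCost U b r (d + 1) k₀ + U (d + 1) ≤ 5 * R * U₁ := by
        have h2 : (3 * r + 2) * U (d + 1) ≤ (3 * r + 2) * U₁ := Nat.mul_le_mul_left _ hdU
        have h3 : 5 * R * U₁ = 2 * U₁ + (3 * r + 2) * U₁ + U₁ + (2 * r) * U₁ := by rw [hRdef]; ring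
        rw [passCost]
        omega
      have h4 : b ^ (r - 1) * (k₀ + U k₀) ≤ 2 * U₁ :=
        (Nat.mul_le_mul_right _ (Nat.pow_le_pow_right hb0 (Nat.sub_le r 1))).trans hk₀U
      have h5 : A * U₁ + G b * U₁ ≤ T := by
        rw [hT, ← add_mul]
        omega
      have h6 : U₁ ≤ A * U₁ := Nat.le_mul_of_pos_left _ hdV1
      have h7 : T ≤ R ^ 3 * T := Nat.le_mul_of_pos_left _ hR
      have h8 : R * (A * U₁) ≤ R ^ 3 * T := Nat.mul_le_mul hRR (by omega)
      calc ((L r).natDegree / V + 1) * (passCost U b r (d + 1) k₀ + U (d + 1)) +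
            (b ^ (r - 1) * (k₀ + U k₀) + G b * U (d + 1))
          ≤ (2 * A) * (5 * R * U₁) + (2 * U₁ + G b * U₁) :=
            Nat.add_le_add (Nat.mul_le_mul (by omega) h1)
              (Nat.add_le_add h4 (Nat.mul_le_mul_left _ hdU))
        _ = 10 * (R * (A * U₁)) + (2 * U₁ + G b * U₁) := by ring
        _ ≤ 20 * (R ^ 3 * T) := by omega
    set Y := R ^ 3 * T with hY
    rw [show 700 * R ^ 3 * T = 700 * Y by rw [hY, mul_assoc]]
    refine Spec.bind_le (B₁ := 20 * Y) (B₂ := 680 * Y) (hden.le hcost₁) ?_ (by omega)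
    rintro c m₁ h₁ ⟨q, hc, hq⟩
    obtain ⟨hq0, hqV⟩ := hq.bounds hb0 hG hLr hV hV'
    have hqA : q.natDegree ≤ A := by
      rw [hA, Nat.le_div_iff_mul_le hV0, mul_comm]
      exact hqV.trans ((hdeg r le_rfl).trans hδd)
    -- the largest dilate of the denominator bound has degree at most `W * d`
    have hqW : b ^ r * q.natDegree ≤ W * d := by
      rw [hVW, mul_comm V, mul_assoc]
      exact Nat.mul_le_mul_left _ (hqV.trans ((hdeg r le_rfl).trans hδd))
    set v := δ / (b ^ r - b ^ (r - 1)) with hv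
    set e := b * δ / (b - 1) with he
    have hvA : v ≤ A := by
      rw [hv, hA]
      exact (Nat.div_le_div_right hδd).trans (Nat.div_le_div_left (hV'.trans hgap) hV0)
    -- the exponents `e - b ^ k * v` are not truncated
    have hve : b ^ r * v ≤ e := by
      rw [he, Nat.le_div_iff_mul_le (by omega)]
      have h1 := Nat.mul_div_le δ (b ^ r - b ^ (r - 1))
      rw [← hv] at h1
      have h2 : b ^ r - b ^ (r - 1) = (b - 1) * b ^ (r - 1) := by rw [hbr, Nat.sub_mul, one_mul]
      rw [h2] at h1
      calc b ^ r * v * (b - 1) = b * ((b - 1) * b ^ (r - 1) * v) := by rw [hbr]; ring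
        _ ≤ b * δ := Nat.mul_le_mul_left _ h1
    have hek : ∀ k ≤ r, b ^ k * v ≤ e := fun k hk =>
      (Nat.mul_le_mul_right _ (Nat.pow_le_pow_right hb0 hk)).trans hve
    have he2 : e ≤ 2 * δ := by
      rw [he]
      refine Nat.div_le_of_le_mul ?_
      calc b * δ ≤ ((b - 1) * 2) * δ := Nat.mul_le_mul_right _ (by omega)
        _ = (b - 1) * (2 * δ) := mul_assoc _ _ _
    have hδ1 : 1 ≤ δ := hpow1.trans hcase
    -- sizes
    have hexp : ∀ j ≤ r, size (expand K (b ^ j) q) ≤ N := by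
      intro j hj
      rw [size_of_ne_zero (expand_ne_zero' hb0 j hq0), natDegree_expand, mul_comm]
      have := Nat.mul_le_mul_right q.natDegree (Nat.pow_le_pow_right hb0 hj)
      omega
    have hprodsize : ∀ k ≤ r, L k ≠ 0 →
        (L k * ∏ j ∈ (Finset.range (r + 1)).erase k, expand K (b ^ j) q).natDegree ≤
          d + 2 * (W * d) := by
      intro k hk hk0
      refine natDegree_mul_le.trans (Nat.add_le_add ((hdeg k hk).trans hδd) ?_)
      refine (natDegree_prod_le _ _).trans ?_
      refine (Finset.sum_le_sum_of_subset (Finset.erase_subset _ _)).trans ?_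
      simp only [natDegree_expand]
      rw [← Finset.mul_sum, Finset.sum_range_succ, mul_comm]
      have h1 := Nat.mul_le_mul_right q.natDegree (sum_range_pow_lt hb r).le
      rw [add_mul]
      omega
    have hcoef : ∀ k ≤ r, size (numerCoeff b r e v L q k) ≤ N := by
      intro k hk
      by_cases hk0 : L k = 0
      · rw [numerCoeff, hk0, zero_mul, mul_zero, size_zero]
        exact Nat.zero_le _
      · have hne : L k * ∏ j ∈ (Finset.range (r + 1)).erase k, expand K (b ^ j) q ≠ 0 :=
          mul_ne_zero hk0 (Finset.prod_ne_zero_iff.mpr fun j _ => expand_ne_zero' hb0 j hq0)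
        rw [numerCoeff, size_X_pow_mul hne, size_of_ne_zero hne]
        have := hprodsize k hk hk0
        omega
    have hmap := Spec.mapM_le (φ := φ) (m := m₁) (B := R * U N)
      (f := fun x : List ℕ × ℕ => do
        let c ← ((List.range (r + 1)).filter fun i => decide (i ≠ x.2)).foldlM
          (fun acc i => do S.mul acc (← dilate (b ^ i) c)) x.1
        shift (e - b ^ x.2 * v) c)
      (R := fun x s m' => HoldsPoly m' s (numerCoeff b r e v L q x.2)) (List.ofFn a).zipIdx
      (fun _ _ _ _ hm h => h.mono hm) (by
        rintro ⟨x, k⟩ hx m₂ h₂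
        have hx' := List.mem_zipIdx_iff_getElem?.mp hx
        have hk : k ≤ r := by
          have := (List.getElem?_eq_some_iff.mp hx').1
          rw [hl.length_eq] at this
          dsimp only at this
          omega
        rw [hRdef]
        refine spec_numerCoeff hS hb0 ((hl.holdsPoly hx').mono (h₁.trans h₂)) (hc.mono h₂) hq0
          hexp fun hk0 => ?_
        have hne : L k * ∏ j ∈ (Finset.range (r + 1)).erase k, expand K (b ^ j) q ≠ 0 :=
          mul_ne_zero hk0 (Finset.prod_ne_zero_iff.mpr fun j _ => expand_ne_zero' hb0 j hq0)
        rw [size_of_ne_zero hne]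
        have := hprodsize k hk hk0
        omega)
    rw [List.length_zipIdx, List.length_ofFn] at hmap
    refine Spec.bind_le (B₁ := Y) (B₂ := 679 * Y) (hmap.le ?_) ?_ (by omega)
    · rw [← hRdef, ← mul_assoc]
      exact Nat.mul_le_mul hRR2 (by omega)
    intro l' m₂ h₂ hl'
    have hop : HoldsOp m₂ r l' (numerCoeff b r e v L q) := by
      rw [HoldsOp, List.forall₂_iff_get]
      rw [List.forall₂_iff_get] at hl'
      have hlen : l'.length = r + 1 := by rw [← hl'.1]; simp
      refine ⟨by simp [hlen], fun j hj₁ hj₂ => ?_⟩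
      have := hl'.2 j (by simpa using (by omega : j < r + 1)) hj₁
      simpa only [List.get_eq_getElem, List.getElem_zipIdx, zero_add, List.getElem_map,
        List.getElem_range] using this
    have hcl : c.length - 1 = q.natDegree := by
      rw [hc.length_eq, natDegree_eq_size_sub_one]
    rw [hcl]
    set w := q.natDegree + 2 * v + 1 with hw
    have hwA : w ≤ 4 * A := by omega
    have hpoly := spec_polySolutions (N := N) (w := w) hS hU.le hb hop (by
        rw [numerCoeff]
        exact mul_ne_zero (pow_ne_zero _ X_ne_zero) (mul_ne_zero hL0
          (Finset.prod_ne_zero_iff.mpr fun j _ => expand_ne_zero' hb0 j hq0)))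
      (by omega) hcoef (by
        have h1 : (w - 1) * b ^ r = b ^ r * q.natDegree + 2 * (b ^ r * v) := by
          rw [hw, Nat.add_sub_cancel]; ring
        rw [h1]
        omega)
    refine Spec.bind_le (B₁ := 679 * Y) (B₂ := 0) (hpoly.le ?_) ?_ le_rfl
    · have h1 : w ^ 2 ≤ 16 * A ^ 2 := by
        calc w ^ 2 ≤ (4 * A) ^ 2 := Nat.pow_le_pow_left hwA 2
          _ = 16 * A ^ 2 := by ring
      calc 40 * (r + 1) ^ 3 * (U N + w ^ 2) ≤ 40 * R ^ 3 * (16 * T) := by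
            rw [← hRdef]
            refine Nat.mul_le_mul_left _ ?_
            omega
        _ = 640 * Y := by rw [hY]; ring
        _ ≤ 679 * Y := Nat.mul_le_mul_right _ (by norm_num)
    rintro ps m₃ h₃ ⟨n, y, hps, hind, hspan⟩
    refine Spec.bind (B₁ := 0) (B₂ := 0) (spec_shift (hc.mono (h₂.trans h₃)) v)
      fun den m₄ h₄ hden => Spec.pure ?_
    have hQ0 : X ^ v * q ≠ 0 := mul_ne_zero (pow_ne_zero _ X_ne_zero) hq0
    refine ⟨n, divLin (X ^ v * q) ∘ y, ?_, ?_, ?_⟩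
    · rw [List.forall₂_map_left_iff, ← List.map_ofFn, List.forall₂_map_right_iff]
      refine hps.imp fun p f hp => ⟨f, X ^ v * q, hp.mono h₄, hden, hQ0, ?_⟩
      rw [divLin_apply]
    · exact hind.map' _ (LinearMap.ker_eq_bot.mpr (divLin_injective hQ0))
    · ext f
      rw [Set.range_comp, ← Submodule.map_span, SetLike.mem_coe, Set.mem_ofPred_eq]
      constructor
      · rintro ⟨p, hp, rfl⟩
        rw [divLin_apply, isSolution_iff_mahlerOp hb0 hL hq0 hek]
        exact ((hspan p).mp hp).2
      · intro hf
        obtain ⟨p, hp, rfl⟩ := exists_numerator hb hr1 hL hLr hdeg hq0 hq hf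
        rw [divLin_apply, isSolution_iff_mahlerOp hb0 hL hq0 hek] at hf
        exact ⟨p, (hspan p).mpr ⟨hp, hf⟩, rfl⟩

end RatSolutions

/-! ### Multiplication in blocks -/

section ZeroOps

variable {K : Type*} [Field K] [DecidableEq K]

open Polynomial

/-- A program that runs without any operation does not depend on the contents of the memory. -/
theorem Prog.run_of_zero_ops {α : Type} {P : Prog K α} {m₀ m m' : List K} {x : α}
    (h : P.run m = some (x, m', 0)) (hm : m₀.length = m.length) :
    ∃ s, m' = m ++ s ∧ P.run m₀ = some (x, m₀ ++ s, 0) := by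
  induction P generalizing m m₀ with
  | ret a =>
    simp only [Prog.run, Option.some.injEq, Prod.mk.injEq] at h
    exact ⟨[], by simp [h.2.1.symm], by simp [Prog.run, h.1]⟩
  | fail => simp [Prog.run] at h
  | const c k ih =>
    simp only [Prog.run] at h
    obtain ⟨s, hs, hr⟩ := ih _ (m₀ := m₀ ++ [c]) h (by simp [hm])
    refine ⟨c :: s, by simpa using hs, ?_⟩
    simp only [Prog.run]
    rw [hm]
    simpa using hr
  | arith o i j k ih =>
    simp only [Prog.run, Option.bind_eq_some_iff, Option.map_eq_some_iff] at h
    obtain ⟨_, -, _, -, _, -, s, -, h⟩ := h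
    simp at h
  | isZero i k ih =>
    simp only [Prog.run, Option.bind_eq_some_iff, Option.map_eq_some_iff] at h
    obtain ⟨_, -, s, -, h⟩ := h
    simp at h

/-- Squaring a constant takes at least one operation. -/
theorem MultipliesIn.one_le [CharZero K] {mul : List ℕ → List ℕ → Prog K (List ℕ)} {M : ℕ → ℝ}
    (h : MultipliesIn mul M) (n : ℕ) : 1 ≤ M n := by
  by_contra hlt
  rw [not_le] at hlt
  have hrun : ∀ x : K, x ≠ 0 → ∃ s m', (mul [0] [0]).run [x] = some (s, m', 0) ∧
      HoldsPoly m' s (C x * C x) := by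
    intro x hx
    have hx' : HoldsPoly [x] [0] (C x) := holdsPoly_C hx (by simp)
    obtain ⟨s, m', c, hr, hs, hc⟩ := h n (C x) (C x) [x] [0] [0] (by simp) (by simp) hx' hx'
    have : c = 0 := by
      have : (c : ℝ) < 1 := lt_of_le_of_lt hc hlt
      exact Nat.lt_one_iff.mp (by exact_mod_cast this)
    exact ⟨s, m', this ▸ hr, hs⟩
  -- the runs on `1` and on `2` return the same register; it holds the input, which is not `2 * 2`
  -- in the second run, or else a common constant, which cannot be `1` and `4`
  obtain ⟨s₁, m₁, h₁, hs₁⟩ := hrun 1 one_ne_zero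
  obtain ⟨s₂, m₂, h₂, hs₂⟩ := hrun 2 two_ne_zero
  obtain ⟨e, rfl, h₃⟩ := Prog.run_of_zero_ops (m₀ := [2]) h₁ rfl
  rw [h₃] at h₂
  simp only [Option.some.injEq, Prod.mk.injEq, and_true] at h₂
  obtain ⟨rfl, rfl⟩ := h₂
  rw [← C_mul] at hs₁ hs₂
  have hl : s₁.length = 1 := by
    rw [hs₁.length_eq, size_of_ne_zero (by simp)]
    simp
  obtain ⟨i, rfl⟩ := List.length_eq_one_iff.mp hl
  have g₁ := hs₁.getElem? (n := 0) rfl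
  have g₂ := hs₂.getElem? (n := 0) rfl
  rw [coeff_C_zero] at g₁ g₂
  rcases i with _ | i
  · simp only [List.cons_append, List.nil_append, List.getElem?_cons_zero, Option.some.injEq] at g₂
    norm_num at g₂
  · simp only [List.cons_append, List.nil_append, List.getElem?_cons_succ] at g₁ g₂
    rw [g₁] at g₂
    norm_num at g₂

end ZeroOps

section Normalization

/-- The least integral upper bound of `M n / n`. -/
noncomputable def unitCost (M : ℕ → ℝ) (n : ℕ) : ℕ := ⌈M n / n⌉₊

/-- The number of blocks of length `n` that cover `N` coefficients. -/
def numBlocks (N n : ℕ) : ℕ := (N + n - 1) / n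

theorem numBlocks_mono {N N' n : ℕ} (h : N ≤ N') : numBlocks N n ≤ numBlocks N' n :=
  Nat.div_le_div_right (by omega)

theorem le_numBlocks_mul {N n : ℕ} (hn : 0 < n) : N ≤ numBlocks N n * n := by
  have := Nat.lt_div_mul_add (a := N + n - 1) hn
  rw [numBlocks]
  omega

theorem numBlocks_le {N n c : ℕ} (hn : 0 < n) (h : N ≤ c * n) : numBlocks N n ≤ c := by
  rw [numBlocks]
  refine Nat.lt_succ_iff.mp ((Nat.div_lt_iff_lt_mul hn).mpr ?_)
  rw [Nat.succ_mul]
  omega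

theorem one_le_numBlocks {N n : ℕ} (hN : 1 ≤ N) (hn : 0 < n) : 1 ≤ numBlocks N n := by
  have := le_numBlocks_mul (N := N) hn
  by_contra h
  have h0 : numBlocks N n = 0 := by omega
  rw [h0] at this
  omega

theorem exists_blockLen (M : ℕ → ℝ) (N : ℕ) : ∃ n, 0 < n ∧ ∀ n', 0 < n' →
    numBlocks N n ^ 2 * unitCost M n ≤ numBlocks N n' ^ 2 * unitCost M n' := by
  classical
  have hex : ∃ v n, 0 < n ∧ numBlocks N n ^ 2 * unitCost M n = v := ⟨_, 1, one_pos, rfl⟩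
  obtain ⟨n, hn, hv⟩ := Nat.find_spec hex
  refine ⟨n, hn, fun n' hn' => ?_⟩
  rw [hv]
  exact Nat.find_min' hex ⟨n', hn', rfl⟩

/-- The block length that minimizes the cost of the multiplication of polynomials of size `N`. -/
noncomputable def blockLen (M : ℕ → ℝ) (N : ℕ) : ℕ := (exists_blockLen M N).choose

theorem blockLen_pos (M : ℕ → ℝ) (N : ℕ) : 0 < blockLen M N :=
  (exists_blockLen M N).choose_spec.1

/-- The cost per coefficient of multiplication in blocks.  Contrary to `M n / n`, it is at most
multiplied by a constant when its argument is doubled. -/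
noncomputable def blockCost (M : ℕ → ℝ) (N : ℕ) : ℕ :=
  numBlocks N (blockLen M N) ^ 2 * unitCost M (blockLen M N)

theorem blockCost_le (M : ℕ → ℝ) {N n : ℕ} (hn : 0 < n) :
    blockCost M N ≤ numBlocks N n ^ 2 * unitCost M n :=
  (exists_blockLen M N).choose_spec.2 n hn

theorem blockCost_mono (M : ℕ → ℝ) : Monotone (blockCost M) := fun _ N' h =>
  (blockCost_le M (blockLen_pos M N')).trans
    (Nat.mul_le_mul_right _ (Nat.pow_le_pow_left (numBlocks_mono h) 2))

/-- The block length that is best for `N` is good enough for `2 N`, with at most twice as many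
blocks. -/
theorem blockCost_double (M : ℕ → ℝ) (N : ℕ) : blockCost M (2 * N) ≤ 4 * blockCost M N := by
  refine (blockCost_le M (blockLen_pos M N)).trans ?_
  rw [blockCost, ← mul_assoc]
  refine Nat.mul_le_mul_right _ ?_
  have h : numBlocks (2 * N) (blockLen M N) ≤ 2 * numBlocks N (blockLen M N) := by
    refine numBlocks_le (blockLen_pos M N) ?_
    have := le_numBlocks_mul (N := N) (blockLen_pos M N)
    rw [mul_assoc]
    omega
  calc numBlocks (2 * N) (blockLen M N) ^ 2 ≤ (2 * numBlocks N (blockLen M N)) ^ 2 :=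
        Nat.pow_le_pow_left h 2
    _ = 4 * numBlocks N (blockLen M N) ^ 2 := by ring

variable {M : ℕ → ℝ} (h1 : ∀ n, 1 ≤ M n)
  (hM : ∀ n n' : ℕ, 1 ≤ n → n ≤ n' → M n / n ≤ M n' / n')
include h1 hM

theorem one_le_div {n : ℕ} (hn : 1 ≤ n) : 1 ≤ M n / n := by
  have := hM 1 n le_rfl hn
  rw [Nat.cast_one, div_one] at this
  exact (h1 1).trans this

theorem one_le_unitCost {n : ℕ} (hn : 1 ≤ n) : 1 ≤ unitCost M n :=
  Nat.one_le_ceil_iff.mpr (lt_of_lt_of_le one_pos (one_le_div h1 hM hn))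

theorem one_le_blockCost {N : ℕ} (hN : 1 ≤ N) : 1 ≤ blockCost M N := by
  have h2 := one_le_numBlocks hN (blockLen_pos M N)
  have h3 := one_le_unitCost h1 hM (blockLen_pos M N)
  exact Nat.mul_pos (pow_pos h2 2) h3

/-- A single block of length `N` is one of the choices. -/
theorem mul_blockCost_le {N : ℕ} (hN : 1 ≤ N) : (N : ℝ) * blockCost M N ≤ 2 * M N := by
  have h2 : blockCost M N ≤ unitCost M N := by
    refine (blockCost_le M hN).trans ?_
    have : numBlocks N N ≤ 1 := numBlocks_le hN (by simp)
    calc numBlocks N N ^ 2 * unitCost M N ≤ 1 ^ 2 * unitCost M N :=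
          Nat.mul_le_mul_right _ (Nat.pow_le_pow_left this 2)
      _ = unitCost M N := by simp
  have h3 := one_le_div h1 hM hN
  have h4 : (unitCost M N : ℝ) ≤ 2 * (M N / N) := by
    have := (Nat.ceil_lt_add_one (a := M N / N) (by linarith)).le
    rw [unitCost]
    linarith
  have hN' : (0 : ℝ) < N := by exact_mod_cast hN
  calc (N : ℝ) * blockCost M N ≤ N * (2 * (M N / N)) := by
        refine mul_le_mul_of_nonneg_left ?_ hN'.le
        exact le_trans (by exact_mod_cast h2) h4
    _ = 2 * M N := by field_simp

omit h1 in
theorem le_mul_unitCost {k n : ℕ} (hk : 1 ≤ k) (hkn : k ≤ n) : M k ≤ (k * unitCost M n : ℕ) := by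
  have hk' : (0 : ℝ) < k := by exact_mod_cast hk
  have h2 : M k / k ≤ unitCost M n := (hM k n hk hkn).trans (Nat.le_ceil _)
  rw [div_le_iff₀ hk'] at h2
  push_cast
  linarith

end Normalization

/-- The monotonicity of `t` makes `n * t n` superadditive. -/
theorem isCost_mul {t : ℕ → ℕ} (hmono : Monotone t) (h1 : ∀ n, 1 ≤ n → 1 ≤ t n) {c : ℕ}
    (hc : ∀ n, t (2 * n) ≤ c * t n) : IsCost fun n => n * t n where
  add_le a b := by
    rw [add_mul]
    exact Nat.add_le_add (Nat.mul_le_mul_left _ (hmono (Nat.le_add_right _ _)))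
      (Nat.mul_le_mul_left _ (hmono (Nat.le_add_left _ _)))
  le n := by
    rcases Nat.eq_zero_or_pos n with rfl | hn
    · simp
    · exact Nat.le_mul_of_pos_right n (h1 n hn)
  double := ⟨2 * c, fun n => by
    calc 2 * n * t (2 * n) ≤ 2 * n * (c * t n) := Nat.mul_le_mul_left _ (hc n)
      _ = 2 * c * (n * t n) := by ring⟩

section BlockMul

variable {K : Type*} [Field K] [DecidableEq K]

open Polynomial

/-- Multiplication by cutting the factors into blocks of length `n`. -/
def blockMul (mul : List ℕ → List ℕ → Prog K (List ℕ)) (len : ℕ → ℕ) (a b : List ℕ) :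
    Prog K (List ℕ) := do
  let N := max a.length b.length
  let n := len N
  let as ← (List.range (numBlocks N n)).mapM fun i => trim ((a.drop (i * n)).take n)
  let bs ← (List.range (numBlocks N n)).mapM fun i => trim ((b.drop (i * n)).take n)
  let cs ← (as.zipIdx ×ˢ bs.zipIdx).mapM fun e => do
    shift ((e.1.2 + e.2.2) * n) (← mul e.1.1 e.2.1)
  sumPoly cs

/-- The block of index `i` of length `n` of a polynomial. -/
noncomputable def block (n i : ℕ) (p : K[X]) : K[X] := low n (high (i * n) p)

theorem coeff_block (n i j : ℕ) (p : K[X]) :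
    (block n i p).coeff j = if j < n then p.coeff (j + i * n) else 0 := by
  rw [block, coeff_low, coeff_high]

theorem sum_block {n c : ℕ} {p : K[X]} (hp : size p ≤ c * n) :
    ∑ i ∈ Finset.range c, X ^ (i * n) * block n i p = p := by
  induction c generalizing p with
  | zero =>
    rw [zero_mul, Nat.le_zero, size_eq_zero] at hp
    simp [hp]
  | succ c ih =>
    have h : p = low (c * n) p + X ^ (c * n) * block n c p := by
      ext j
      rw [coeff_add, coeff_low, coeff_X_pow_mul', coeff_block]
      by_cases hj : j < c * n
      · simp [hj, not_le.mpr hj]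
      · have hj' : c * n ≤ j := not_lt.mp hj
        by_cases hj2 : j - c * n < n
        · simp [hj, hj', hj2]
        · rw [if_neg hj, if_pos hj', if_neg hj2]
          rw [size_le_iff] at hp
          rw [hp j (by rw [add_mul]; omega), add_zero]
    have h2 : ∀ i ∈ Finset.range c, X ^ (i * n) * block n i p =
        X ^ (i * n) * block n i (low (c * n) p) := by
      intro i hi
      congr 1
      ext j
      rw [coeff_block, coeff_block, coeff_low]
      have hi : i < c := Finset.mem_range.mp hi
      split_ifs with h3 h4
      · rfl
      · have := Nat.mul_le_mul_right n (Nat.succ_le_of_lt hi)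
        rw [Nat.succ_mul] at this
        omega
      · rfl
    rw [Finset.sum_range_succ, Finset.sum_congr rfl h2, ih (size_low_le _ _), ← h]

theorem size_X_pow_mul_block {n i N : ℕ} {p : K[X]} (hp : size p ≤ N) :
    size (X ^ (i * n) * block n i p) ≤ N := by
  rw [size_le_iff] at hp ⊢
  intro j hj
  rw [coeff_X_pow_mul', coeff_block]
  split_ifs with h1 h2
  · exact hp _ (by omega)
  · rfl
  · rfl

theorem size_block_le {n i N : ℕ} {p : K[X]} (hp : size p ≤ N) : size (block n i p) ≤ min n N := by
  rw [le_min_iff]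
  refine ⟨size_low_le _ _, ?_⟩
  rw [size_le_iff] at hp ⊢
  intro j hj
  rw [coeff_block]
  split_ifs
  · exact hp _ (by omega)
  · rfl

theorem forall₂_product {α β γ δ : Type*} {R : α → γ → Prop} {T : β → δ → Prop} {as : List α}
    {bs : List β} {cs : List γ} {ds : List δ} (h : List.Forall₂ R as cs)
    (h' : List.Forall₂ T bs ds) :
    List.Forall₂ (fun x y => R x.1 y.1 ∧ T x.2 y.2) (as ×ˢ bs) (cs ×ˢ ds) := by
  induction h with
  | nil => exact .nil
  | @cons a c as cs hac _ ih =>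
    simp only [List.product_cons]
    refine List.rel_append ?_ ih
    rw [List.forall₂_map_left_iff, List.forall₂_map_right_iff]
    exact h'.imp fun _ _ h => ⟨hac, h⟩

theorem sum_map_product {α β : Type*} {R : Type*} [CommSemiring R] (as : List α) (bs : List β)
    (f : α → R) (g : β → R) :
    ((as ×ˢ bs).map fun x => f x.1 * g x.2).sum = (as.map f).sum * (bs.map g).sum := by
  induction as with
  | nil => simp
  | cons a as ih =>
    rw [List.product_cons, List.map_append, List.sum_append, ih, List.map_map, List.map_cons,
      List.sum_cons, add_mul]
    congr 1
    rw [← List.sum_map_mul_left]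
    rfl

/-- The products of blocks have the cost for which the block length was chosen; the additions are at
most as expensive, because `M n ≥ n`. -/
theorem spec_blockMul [CharZero K] {mul : List ℕ → List ℕ → Prog K (List ℕ)} {M : ℕ → ℝ}
    (hmul : MultipliesIn mul M) (hM : ∀ n n' : ℕ, 1 ≤ n → n ≤ n' → M n / n ≤ M n' / n')
    {m : List K} {a b : List ℕ} {p q : K[X]} {N : ℕ} (ha : HoldsPoly m a p) (hb : HoldsPoly m b q)
    (hp : size p ≤ N) (hq : size q ≤ N) :
    Spec True (blockMul mul (blockLen M) a b) m (N * (8 * blockCost M N)) fun s m' =>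
      HoldsPoly m' s (p * q) := by
  have h1 := hmul.one_le
  set N₀ := max a.length b.length with hN₀
  have hN₀N : N₀ ≤ N := by
    rw [hN₀, ha.length_eq, hb.length_eq]
    exact max_le hp hq
  refine Spec.le (B := N₀ * (8 * blockCost M N₀)) ?_
    (Nat.mul_le_mul hN₀N (Nat.mul_le_mul_left _ (blockCost_mono M hN₀N)))
  have hpN : size p ≤ N₀ := by rw [← ha.length_eq]; exact le_max_left _ _
  have hqN : size q ≤ N₀ := by rw [← hb.length_eq]; exact le_max_right _ _
  unfold blockMul
  dsimp only
  rw [← hN₀]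
  set n := blockLen M N₀ with hn
  have hn0 : 0 < n := blockLen_pos M N₀
  set c := numBlocks N₀ n with hc
  set t := blockCost M N₀ with ht
  rcases Nat.eq_zero_or_pos N₀ with h0 | hN1
  · have hc0 : c = 0 := by
      have := numBlocks_le (N := N₀) (n := n) (c := 0) hn0 (by omega)
      omega
    have hp0 : p = 0 := size_eq_zero.mp (by omega)
    rw [hc0]
    have hrun : ∀ f : List (List ℕ) → List (List ℕ) → Prog K (List (List ℕ)), f [] [] = Pure.pure [] →
      (do
        let as ← (List.range 0).mapM fun i => (trim ((a.drop (i * n)).take n) : Prog K _)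
        let bs ← (List.range 0).mapM fun i => (trim ((b.drop (i * n)).take n) : Prog K _)
        let cs ← f as bs
        sumPoly cs) = (sumPoly [] : Prog K _) := by
      intro f hf
      simp [hf]
    rw [hrun (fun as bs => (as.zipIdx ×ˢ bs.zipIdx).mapM fun e => do
      shift ((e.1.2 + e.2.2) * n) (← mul e.1.1 e.2.1)) (by simp)]
    have := spec_sumPoly (φ := True) (m := m) (as := []) (ps := []) (n := 0) .nil (by simp)
    refine this.mono (by simp) fun s m' _ hs => ?_
    simpa [hp0] using hs
  have hc1 : 1 ≤ c := one_le_numBlocks hN1 hn0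
  have hρ := one_le_unitCost h1 hM hn0
  have hcc : c ≤ c ^ 2 := Nat.le_self_pow (by norm_num) c
  -- linear time operations are covered by `N₀ * t`, since the unit cost is at least one
  have hct : c ^ 2 ≤ t := Nat.le_mul_of_pos_right _ hρ
  have hblock : ∀ {m' : List K} {d : List ℕ} {u : K[X]}, HoldsPoly m' d u → size u ≤ N₀ →
      Spec True ((List.range c).mapM fun i => trim ((d.drop (i * n)).take n)) m' (c * N₀)
        fun s m'' => List.Forall₂ (fun i x => HoldsPoly m'' x (block n i u)) (List.range c) s := by
    intro m' d u hd hu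
    have := Spec.mapM_le (φ := True) (m := m') (f := fun i => trim ((d.drop (i * n)).take n))
      (B := N₀) (R := fun i x m'' => HoldsPoly m'' x (block n i u)) (List.range c)
      (fun _ _ _ _ hm h => h.mono hm) (by
        intro i _ m₁ h₁
        refine (spec_trim (((hd.mono h₁).holds.drop (i * n)).take n)).le ?_
        have := hd.length_eq
        simp only [List.length_take, List.length_drop]
        omega)
    rwa [List.length_range] at this
  refine Spec.bind_le (B₁ := N₀ * t) (B₂ := N₀ * (7 * t)) ((hblock ha hpN).le ?_) ?_
    (by rw [← mul_add]; exact Nat.mul_le_mul_left _ (by omega))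
  · rw [mul_comm]
    exact Nat.mul_le_mul_left _ (hcc.trans hct)
  intro as m₁ h₁ has
  refine Spec.bind_le (B₁ := N₀ * t) (B₂ := N₀ * (6 * t)) ((hblock (hb.mono h₁) hqN).le ?_) ?_
    (by rw [← mul_add]; exact Nat.mul_le_mul_left _ (by omega))
  · rw [mul_comm]
    exact Nat.mul_le_mul_left _ (hcc.trans hct)
  intro bs m₂ h₂ hbs
  have hidx : ∀ {m' : List K} {ds : List (List ℕ)} {u : K[X]},
      List.Forall₂ (fun i x => HoldsPoly m' x (block n i u)) (List.range c) ds →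
      List.Forall₂ (fun x i => x.2 = i ∧ HoldsPoly m' x.1 (block n i u)) ds.zipIdx (List.range c) := by
    intro m' ds u h
    rw [List.forall₂_iff_get] at h ⊢
    refine ⟨by simp [← h.1], fun j h₁ h₂ => ?_⟩
    have hj : j < c := by simpa using h₂
    have := h.2 j h₂ (by simpa using h₁)
    simpa using this
  have hpairs := forall₂_product (hidx (forall₂_mono (R := fun m i x => HoldsPoly m x (block n i p))
    (fun _ _ _ _ hm h => h.mono hm) has h₂)) (hidx hbs)
  set pairs := as.zipIdx ×ˢ bs.zipIdx with hpairs'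
  have hlen : pairs.length = c ^ 2 := by
    rw [hpairs.length_eq, List.length_product, List.length_range, pow_two]
  set k := min n N₀ with hk
  have hk1 : 1 ≤ k := by omega
  have hprod := Spec.mapM_le (φ := True) (m := m₂) (f := fun e : (List ℕ × ℕ) × List ℕ × ℕ => do
      shift ((e.1.2 + e.2.2) * n) (← mul e.1.1 e.2.1)) (B := k * unitCost M n)
    (R := fun e s m' => HoldsPoly m' s
      ((X ^ (e.1.2 * n) * block n e.1.2 p) * (X ^ (e.2.2 * n) * block n e.2.2 q))) pairs
    (fun _ _ _ _ hm h => h.mono hm) (by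
      intro e he m₃ h₃
      obtain ⟨j, hj, rfl⟩ := List.getElem_of_mem he
      have hget := List.Forall₂.get hpairs hj (by rw [← hpairs.length_eq]; exact hj)
      simp only [List.get_eq_getElem] at hget
      obtain ⟨⟨hi1, hx⟩, hi2, hy⟩ := hget
      rw [← hi1] at hx
      rw [← hi2] at hy
      have hdx : (block n pairs[j].1.2 p).natDegree ≤ k := by
        have := size_block_le (n := n) (i := pairs[j].1.2) hpN
        rw [natDegree_eq_size_sub_one]
        omega
      have hdy : (block n pairs[j].2.2 q).natDegree ≤ k := by
        have := size_block_le (n := n) (i := pairs[j].2.2) hqN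
        rw [natDegree_eq_size_sub_one]
        omega
      have hm := (hmul k _ _ m₃ _ _ hdx hdy (hx.mono h₃) (hy.mono h₃)).spec (φ := True)
        (Q' := fun s m' => HoldsPoly m' s (block n pairs[j].1.2 p * block n pairs[j].2.2 q))
        (B := k * unitCost M n) (fun _ _ _ h => ⟨h.1, fun _ => by
          exact_mod_cast h.2.trans (le_mul_unitCost hM hk1 (min_le_left n N₀))⟩)
      refine Spec.bind_le (B₂ := 0) hm (fun s m₄ h₄ hs => ?_) le_rfl
      refine (spec_shift hs _).imp fun s' m₅ _ hs' => ?_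
      convert hs' using 1
      rw [add_mul, pow_add]
      ring)
  rw [hlen] at hprod
  refine Spec.bind_le (B₁ := N₀ * t) (B₂ := N₀ * (5 * t)) (hprod.le ?_) ?_
    (by rw [← mul_add]; exact Nat.mul_le_mul_left _ (by omega))
  · calc c ^ 2 * (k * unitCost M n) = k * t := by rw [ht, blockCost, ← hn, ← hc]; ring
      _ ≤ N₀ * t := Nat.mul_le_mul_right _ (min_le_right _ _)
  intro cs m₃ h₃ hcs
  have hsum := spec_sumPoly (φ := True) (m := m₃) (as := cs) (n := 2 * N₀)
    (ps := pairs.map fun e =>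
      (X ^ (e.1.2 * n) * block n e.1.2 p) * (X ^ (e.2.2 * n) * block n e.2.2 q))
    (by
      rw [List.forall₂_map_right_iff]
      exact hcs.flip.imp fun _ _ h => HoldsPoly.holds h) (by
      intro x hx
      obtain ⟨j, hj, rfl⟩ := List.getElem_of_mem hx
      have hget := List.Forall₂.get hcs (by rw [hcs.length_eq]; exact hj) hj
      simp only [List.get_eq_getElem] at hget
      rw [hget.length_eq]
      refine (size_mul_le _ _).trans ?_
      have h4 := size_X_pow_mul_block (n := n) (i := (pairs[j]'(by rw [hcs.length_eq]; exact hj)).1.2)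
        hpN
      have h5 := size_X_pow_mul_block (n := n) (i := (pairs[j]'(by rw [hcs.length_eq]; exact hj)).2.2)
        hqN
      omega)
  refine hsum.mono ?_ fun s m₄ _ hs => ?_
  · rw [← hcs.length_eq, hlen]
    calc (c ^ 2 + 1) * (2 * N₀) ≤ (2 * t) * (2 * N₀) := Nat.mul_le_mul_right _ (by omega)
      _ = N₀ * (4 * t) := by ring
      _ ≤ N₀ * (5 * t) := Nat.mul_le_mul_left _ (by omega)
  · rw [hpairs', sum_map_product as.zipIdx bs.zipIdx
      (fun e => X ^ (e.2 * n) * block n e.2 p) (fun e => X ^ (e.2 * n) * block n e.2 q),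
      sum_zipIdx as fun i => X ^ (i * n) * block n i p,
      sum_zipIdx bs fun i => X ^ (i * n) * block n i q, ← has.length_eq, ← hbs.length_eq,
      List.length_range] at hs
    have hcn : N₀ ≤ c * n := le_numBlocks_mul hn0
    rwa [sum_block (hpN.trans hcn), sum_block (hqN.trans hcn)] at hs

end BlockMul

/-! ### Exact division by Newton iteration -/

section Division

variable {K : Type*} [Field K] [DecidableEq K]

open Polynomial

/-- The program `mul` multiplies polynomials of size at most `n`, in at most `U n` ops if `φ`
holds. -/
def MulSpec (φ : Prop) (mul : List ℕ → List ℕ → Prog K (List ℕ)) (U : ℕ → ℕ) : Prop :=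
  ∀ {p q : K[X]} {m : List K} {a b : List ℕ} {n : ℕ}, HoldsPoly m a p → HoldsPoly m b q →
    size p ≤ n → size q ≤ n → Spec φ (mul a b) m (U n) fun s m' => HoldsPoly m' s (p * q)

theorem X_pow_dvd_low_sub (n : ℕ) (p : K[X]) : X ^ n ∣ low n p - p := by
  rw [X_pow_dvd_iff]
  intro i hi
  simp [coeff_low, hi]

theorem low_eq_of_dvd {n : ℕ} {p q : K[X]} (hp : size p ≤ n) (h : X ^ n ∣ q - p) : low n q = p := by
  ext i
  rw [coeff_low]
  split_ifs with hi
  · have := X_pow_dvd_iff.mp h i hi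
    rwa [coeff_sub, sub_eq_zero] at this
  · exact (size_le_iff.mp hp i (not_lt.mp hi)).symm

theorem size_C_le (c : K) : size (C c) ≤ 1 := by
  rw [size_le_iff]
  intro i hi
  rw [coeff_C, if_neg (by omega)]

/-- The inverse of a polynomial modulo `x ^ (2 ^ k)`. -/
def powInv (mul : List ℕ → List ℕ → Prog K (List ℕ)) (b : List ℕ) : ℕ → Prog K (List ℕ)
  | 0 =>
    match b with
    | [] => Prog.fail
    | c :: _ => do return [← Prog.op .div (← Prog.lit 1) c]
  | k + 1 => do
    let g ← powInv mul b k
    let h ← trim (b.take (2 ^ (k + 1)))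
    let e ← mul [← Prog.lit (-1)] (← mul h g)
    let s ← sumPoly [[← Prog.lit 2], e]
    let s ← trim (s.take (2 ^ (k + 1)))
    let g ← mul g s
    trim (g.take (2 ^ (k + 1)))

/-- Exact division. -/
def exactDiv (mul : List ℕ → List ℕ → Prog K (List ℕ)) (a b : List ℕ) : Prog K (List ℕ) := do
  if a.isEmpty then return []
  else
    match ← valuation b with
    | none => Prog.fail
    | some v =>
      let n := a.length - b.length + 1
      let g ← powInv mul (b.drop v) (Nat.clog 2 n)
      let c ← trim ((a.drop v).take n)
      let e ← mul c g
      trim (e.take n)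

variable {φ : Prop} {m : List K} {mul : List ℕ → List ℕ → Prog K (List ℕ)} {U : ℕ → ℕ}

theorem spec_truncPoly {a : List ℕ} {p : K[X]} (h : HoldsPoly m a p) (n : ℕ) :
    Spec φ (trim (a.take n)) m n fun s m' => HoldsPoly m' s (low n p) :=
  (spec_trim (h.holds.take n)).le (by simp)

/-- Newton iteration: if `h g = 1` modulo `x ^ n`, then `h g (2 - h g) = 1` modulo `x ^ (2 n)`. -/
theorem spec_powInv [CharZero K] (hmul : MulSpec φ mul U) (hU : IsCost U) {b : List ℕ} {h : K[X]}
    (hb : HoldsPoly m b h) (h0 : h.coeff 0 ≠ 0) (k : ℕ) :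
    Spec φ (powInv mul b k) m (8 * U (2 ^ (k + 2))) fun s m' =>
      ∃ g, HoldsPoly m' s g ∧ size g ≤ 2 ^ k ∧ X ^ 2 ^ k ∣ h * g - 1 := by
  induction k with
  | zero =>
    have hle := hU.le (2 ^ (0 + 2))
    rcases b with _ | ⟨c, b⟩
    · rw [hb.holds.eq_zero] at h0
      simp at h0
    · have hc : m[c]? = some (h.coeff 0) := hb.getElem? rfl
      refine Spec.bind_le (B₁ := 0) (B₂ := 1) (Spec.lit 1) (fun one m₁ h₁ hone => ?_) (by omega)
      refine Spec.map ((Spec.op hone (getElem?_of_prefix h₁ hc)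
        (z := 1 / h.coeff 0) (by simp [Arith.eval, h0])).imp fun i m₂ _ hi => ?_)
      refine ⟨C (1 / h.coeff 0), holdsPoly_C (one_div_ne_zero h0) hi, size_C_le _, ?_⟩
      rw [pow_zero, pow_one, X_dvd_iff, coeff_sub, mul_coeff_zero, coeff_C_zero, coeff_one_zero,
        mul_one_div_cancel h0, sub_self]
  | succ k ih =>
    set n := 2 ^ (k + 1) with hn
    have hn2 : 2 ^ (k + 2) = 2 * n := by rw [hn]; ring
    have hn4 : 2 ^ (k + 1 + 2) = 2 * n + 2 * n := by rw [hn]; ring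
    have hnk : n = 2 ^ k + 2 ^ k := by rw [hn]; ring
    have hn1 : 1 ≤ n := Nat.one_le_two_pow
    set Z := U (2 * n) with hZ
    have hZn : 2 * n ≤ Z := hU.le _
    have hUn : U n ≤ Z := hU.mono (by omega)
    rw [hn2] at ih
    rw [hn4]
    refine Spec.bind_le (B₂ := 8 * Z) ih ?_ (by have := hU.add_le (2 * n) (2 * n); omega)
    rintro gs m₁ h₁ ⟨g, hg, hgs, hdvd⟩
    have hgn : size g ≤ n := by omega
    refine Spec.bind_le (B₁ := n) (B₂ := 7 * Z) (spec_truncPoly (hb.mono h₁) n) ?_ (by omega)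
    intro hs m₂ h₂ hhs
    refine Spec.bind_le (B₁ := 0) (B₂ := 7 * Z) (Spec.lit (-1)) ?_ (by omega)
    intro i m₃ h₃ hi
    refine Spec.bind_le (B₁ := Z) (B₂ := 6 * Z) ((hmul (hhs.mono h₃) (hg.mono (h₂.trans h₃))
      (size_low_le n h) hgn).le hUn) ?_ (by omega)
    intro es m₄ h₄ hes
    have he2 : size (low n h * g) ≤ 2 * n := by
      have := size_mul_le (low n h) g
      have := size_low_le n h
      omega
    refine Spec.bind_le (B₁ := Z) (B₂ := 5 * Z) (hmul (n := 2 * n) (holdsPoly_C (by norm_num)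
      (getElem?_of_prefix h₄ hi)) hes ((size_C_le _).trans (by omega)) he2) ?_ (by omega)
    intro es' m₅ h₅ hes'
    refine Spec.bind_le (B₁ := 0) (B₂ := 5 * Z) (Spec.lit 2) ?_ (by omega)
    intro j m₆ h₆ hj
    have he2' : size (C (-1) * (low n h * g)) ≤ 2 * n := by
      have := size_mul_le (C (-1)) (low n h * g)
      have := size_C_le (-1 : K)
      omega
    refine Spec.bind_le (B₁ := 3 * (2 * n)) (B₂ := 2 * Z) (spec_sumPoly_pair
      (holdsPoly_C (two_ne_zero (α := K)) hj) (hes'.mono h₆) ((size_C_le _).trans (by omega)) he2') ?_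
      (by omega)
    intro ss m₇ h₇ hss
    refine Spec.bind_le (B₁ := n) (B₂ := Z + n) (spec_truncPoly hss n) ?_ (by omega)
    intro ts m₈ h₈ hts
    have hm₈ := h₂.trans (h₃.trans (h₄.trans (h₅.trans (h₆.trans (h₇.trans h₈)))))
    refine Spec.bind_le (B₁ := Z) (B₂ := n) ((hmul (hg.mono hm₈) hts hgn (size_low_le n _)).le hUn)
      ?_ le_rfl
    intro gs' m₉ h₉ hgs'
    refine (spec_truncPoly hgs' n).imp fun s m' _ hs => ⟨_, hs, size_low_le _ _, ?_⟩
    set u := C 2 + C (-1) * (low n h * g) with hu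
    have d1 := X_pow_dvd_low_sub n (g * low n u)
    have d2 := X_pow_dvd_low_sub n u
    have d3 := X_pow_dvd_low_sub n h
    have d4 : X ^ n ∣ (h * g - 1) * (h * g - 1) := by
      rw [hnk, pow_add]
      exact mul_dvd_mul hdvd hdvd
    have hdec : h * low n (g * low n u) - 1 = h * (low n (g * low n u) - g * low n u) +
        h * g * (low n u - u) - h * g * g * (low n h - h) - (h * g - 1) * (h * g - 1) := by
      rw [hu, C_neg, C_1, C_ofNat]
      ring
    rw [hdec]
    exact dvd_sub (dvd_sub (dvd_add (d1.mul_left _) (d2.mul_left _)) (d3.mul_left _)) d4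

theorem two_pow_clog_le {n : ℕ} (hn : 1 ≤ n) : 2 ^ Nat.clog 2 n ≤ 2 * n := by
  rcases hn.eq_or_lt with rfl | hn
  · simp
  · have h1 := Nat.pow_pred_clog_lt_self one_lt_two hn
    have h2 : 0 < Nat.clog 2 n := Nat.clog_pos one_lt_two hn
    have h3 : 2 ^ Nat.clog 2 n = 2 * 2 ^ (Nat.clog 2 n).pred := by
      rw [← pow_succ', Nat.pred_eq_sub_one, Nat.sub_add_cancel h2]
    omega

/-- After division by a power of `x`, the divisor is invertible modulo `x ^ n`, and the quotient, of
size `n`, is determined by its residue class. -/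
theorem spec_exactDiv [CharZero K] (hmul : MulSpec φ mul U) (hU : IsCost U) {a b : List ℕ}
    {p q : K[X]} {N : ℕ} (hq : q ≠ 0) (ha : HoldsPoly m a (p * q)) (hb : HoldsPoly m b q)
    (hN : size (p * q) ≤ N) :
    Spec φ (exactDiv mul a b) m (12 * U (8 * N)) fun s m' => HoldsPoly m' s p := by
  unfold exactDiv
  by_cases hp : p = 0
  · have : a = [] := ha.eq_nil_iff.mpr (by rw [hp, zero_mul])
    rw [hp]
    simp only [this, List.isEmpty_nil, if_true]
    exact Spec.le (Spec.pure (K := K) holdsPoly_zero) (Nat.zero_le _)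
  have hpq := mul_ne_zero hp hq
  have hane : a ≠ [] := fun h => hpq (ha.eq_nil_iff.mp h)
  simp only [List.isEmpty_iff, hane, if_false]
  have hsz := size_mul hp hq
  have hq1 := size_of_ne_zero hq
  have hp1 := size_of_ne_zero hp
  set Z := U (8 * N) with hZ
  have hNZ : 8 * N ≤ Z := hU.le _
  refine Spec.bind_le (B₂ := 11 * Z) (spec_valuation hb.holds) ?_ (by rw [hb.length_eq]; omega)
  intro o m₁ h₁ ho
  rcases o with _ | v
  · exact absurd ho hq
  obtain ⟨hv1, hv2⟩ := ho
  dsimp only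
  set n := a.length - b.length + 1 with hn
  have hnp : n = size p := by rw [hn, ha.length_eq, hb.length_eq]; omega
  have hn1 : 1 ≤ n := by omega
  have hdq : X ^ v ∣ q := X_pow_dvd_iff.mpr hv2
  obtain ⟨h, rfl⟩ := hdq
  have hh0 : h.coeff 0 ≠ 0 := by
    have := coeff_X_pow_mul h v 0
    rw [zero_add] at this
    rwa [this] at hv1
  have hbd := (hb.mono h₁).drop v
  rw [high_X_pow_mul] at hbd
  have had := (ha.mono h₁).drop v
  rw [mul_left_comm, high_X_pow_mul] at had
  set k := Nat.clog 2 n with hk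
  have hk1 : n ≤ 2 ^ k := Nat.le_pow_clog one_lt_two n
  have hk2 : 2 ^ k ≤ 2 * n := two_pow_clog_le hn1
  have hk3 : 2 ^ (k + 2) ≤ 8 * N := by
    rw [pow_add]
    omega
  refine Spec.bind_le (B₁ := 8 * Z) (B₂ := 3 * Z) ((spec_powInv hmul hU hbd hh0 k).le
    (Nat.mul_le_mul_left _ (hU.mono hk3))) ?_ (by omega)
  rintro gs m₂ h₂ ⟨g, hg, hgs, hdvd⟩
  refine Spec.bind_le (B₁ := n) (B₂ := Z + n) (spec_truncPoly (had.mono h₂) n) ?_ (by omega)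
  intro cs m₃ h₃ hcs
  refine Spec.bind_le (B₁ := Z) (B₂ := n) ((hmul (n := 2 * n) hcs (hg.mono h₃)
    ((size_low_le _ _).trans (by omega)) (by omega)).le (hU.mono (by omega))) ?_ le_rfl
  intro es m₄ h₄ hes
  refine (spec_truncPoly hes n).imp fun s m' _ hs => ?_
  rwa [low_eq_of_dvd (p := p) hnp.ge] at hs
  have d1 := X_pow_dvd_low_sub n (p * h)
  have d2 : X ^ n ∣ h * g - 1 := (pow_dvd_pow X hk1).trans hdvd
  have hdec : low n (p * h) * g - p = (low n (p * h) - p * h) * g + p * (h * g - 1) := by ring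
  rw [hdec]
  exact dvd_add (d1.mul_right _) (d2.mul_left _)

end Division

/-! ### Division steps -/

section DivisionSteps

variable {K : Type*} [Field K] [DecidableEq K]

open Polynomial

/-- Two by two matrices `[a, b; c, d]`, of polynomials or of lists of registers. -/
structure Mat2 (α : Type*) where
  a : α
  b : α
  c : α
  d : α

/-- The product of matrices. -/
noncomputable def Mat2.mul (Q P : Mat2 K[X]) : Mat2 K[X] :=
  ⟨Q.a * P.a + Q.b * P.c, Q.a * P.b + Q.b * P.d, Q.c * P.a + Q.d * P.c, Q.c * P.b + Q.d * P.d⟩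

/-- The transition of `2 ^ k` division steps.  One step sends `(δ, f, g)`, where `f 0 ≠ 0`, to
`(1 - δ, g, (g 0 * f - f 0 * g) / x)` if `0 < δ` and `g 0 ≠ 0`, and to
`(δ + 1, f, (f 0 * g - g 0 * f) / x)` otherwise.  The matrix sends `(f, g)` to the final polynomials
multiplied by `x ^ (2 ^ k)`. -/
noncomputable def divSteps : ℕ → ℤ → K[X] → K[X] → ℤ × Mat2 K[X]
  | 0, δ, f, g =>
    if 0 < δ ∧ g.coeff 0 ≠ 0 then (1 - δ, ⟨0, X, C (g.coeff 0), C (-f.coeff 0)⟩)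
    else (δ + 1, ⟨X, 0, C (-g.coeff 0), C (f.coeff 0)⟩)
  | k + 1, δ, f, g =>
    let s := divSteps k δ f g
    let t := divSteps k s.1 (high (2 ^ k) (s.2.a * f + s.2.b * g))
      (high (2 ^ k) (s.2.c * f + s.2.d * g))
    (t.1, t.2.mul s.2)

theorem high_sub (n : ℕ) (p q : K[X]) : high n (p - q) = high n p - high n q := by
  ext i
  simp [coeff_high]

/-- The first `n` division steps only depend on the coefficients of degree less than `n`. -/
theorem divSteps_congr (k : ℕ) (δ : ℤ) {f f' g g' : K[X]} (hf : X ^ 2 ^ k ∣ f' - f)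
    (hg : X ^ 2 ^ k ∣ g' - g) : divSteps k δ f' g' = divSteps k δ f g := by
  induction k generalizing δ f f' g g' with
  | zero =>
    rw [pow_zero, pow_one, X_dvd_iff, coeff_sub, sub_eq_zero] at hf hg
    simp only [divSteps, hf, hg]
  | succ k ih =>
    have h2 : 2 ^ (k + 1) = 2 ^ k + 2 ^ k := by ring
    rw [h2, pow_add] at hf hg
    have e := ih δ (dvd_of_mul_left_dvd hf) (dvd_of_mul_left_dvd hg)
    have key : ∀ u v : K[X], X ^ 2 ^ k ∣
        high (2 ^ k) (u * f' + v * g') - high (2 ^ k) (u * f + v * g) := by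
      intro u v
      obtain ⟨p, hp⟩ := hf
      obtain ⟨q, hq⟩ := hg
      rw [← high_sub, show u * f' + v * g' - (u * f + v * g) =
        X ^ 2 ^ k * (X ^ 2 ^ k * (u * p + v * q)) by linear_combination u * hp + v * hq,
        high_X_pow_mul]
      exact dvd_mul_right _ _
    simp only [divSteps, e, ih _ (key _ _) (key _ _)]

/-- The relation between the polynomials `f`, `g` and the polynomials `f'`, `g'` that `N` division
steps with transition matrix `P` make of them. -/
structure IsTransition (N : ℕ) (δ δ' : ℤ) (P : Mat2 K[X]) (f g f' g' : K[X]) : Prop where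
  row₁ : P.a * f + P.b * g = X ^ N * f'
  row₂ : P.c * f + P.d * g = X ^ N * g'
  coeff_ne : f'.coeff 0 ≠ 0
  dvd_iff : ∀ h, h ∣ f' ∧ h ∣ g' ↔ h ∣ f ∧ h ∣ g
  /-- The numbers `A + δ` and `A - δ` bound twice the sizes of `f` and `g`; every step lowers `A` by
  one, while `δ` keeps track of the difference. -/
  size_le : ∀ A : ℤ, 2 * (size f : ℤ) ≤ A + δ → (g ≠ 0 → 2 * (size g : ℤ) ≤ A - δ) →
    2 * (size f' : ℤ) ≤ A - N + δ' ∧ (g' ≠ 0 → 2 * (size g' : ℤ) ≤ A - N - δ')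

theorem IsTransition.trans {N N' : ℕ} {δ δ' δ'' : ℤ} {P Q : Mat2 K[X]} {f g f' g' f'' g'' : K[X]}
    (h : IsTransition N δ δ' P f g f' g') (h' : IsTransition N' δ' δ'' Q f' g' f'' g'') :
    IsTransition (N + N') δ δ'' (Q.mul P) f g f'' g'' where
  row₁ := by
    simp only [Mat2.mul]
    linear_combination Q.a * h.row₁ + Q.b * h.row₂ + X ^ N * h'.row₁
  row₂ := by
    simp only [Mat2.mul]
    linear_combination Q.c * h.row₁ + Q.d * h.row₂ + X ^ N * h'.row₂
  coeff_ne := h'.coeff_ne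
  dvd_iff u := (h'.dvd_iff u).trans (h.dvd_iff u)
  size_le A h1 h2 := by
    obtain ⟨h3, h4⟩ := h.size_le A h1 h2
    have := h'.size_le (A - N) h3 h4
    push_cast
    rwa [← sub_sub]

theorem dvd_of_dvd_X_mul {f g h : K[X]} (hf : f.coeff 0 ≠ 0) (h1 : h ∣ f) (h2 : h ∣ X * g) :
    h ∣ g := by
  refine IsCoprime.dvd_of_dvd_mul_left ?_ h2
  refine ((irreducible_X.coprime_iff_not_dvd).mpr fun hx => hf ?_).symm
  exact X_dvd_iff.mp (hx.trans h1)

theorem size_X_mul_add_one {g : K[X]} (hg : g ≠ 0) : size (X * g) = 1 + size g := by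
  have := size_X_pow_mul hg 1
  rwa [pow_one] at this

theorem size_C_mul_le (c : K) (p : K[X]) : size (C c * p) ≤ size p := by
  rw [size_le_iff]
  intro i hi
  rw [coeff_C_mul, size_le_iff.mp le_rfl i hi, mul_zero]

theorem size_neg (p : K[X]) : size (-p) = size p := by simp [size]

/-- One division step. -/
theorem isTransition_divSteps_zero (δ : ℤ) {f : K[X]} (g : K[X]) (hf : f.coeff 0 ≠ 0) :
    ∃ f' g', IsTransition 1 δ (divSteps 0 δ f g).1 (divSteps 0 δ f g).2 f g f' g' := by
  have hdvd : X ∣ C (f.coeff 0) * g - C (g.coeff 0) * f := by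
    rw [X_dvd_iff]
    simp [mul_comm]
  obtain ⟨u, hu⟩ := hdvd
  have h2 : ∀ h : K[X], h ∣ f → (h ∣ u ↔ h ∣ g) := by
    intro h hf'
    constructor
    · intro hu'
      have : h ∣ C (f.coeff 0) * g := by
        rw [show C (f.coeff 0) * g = X * u + C (g.coeff 0) * f by linear_combination hu]
        exact dvd_add (hu'.mul_left _) (hf'.mul_left _)
      exact (dvd_C_mul hf).mp this
    · intro hg
      refine dvd_of_dvd_X_mul hf hf' ?_
      rw [← hu]
      exact dvd_sub (hg.mul_left _) (hf'.mul_left _)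
  have hsize : ∀ B : ℕ, size (C (f.coeff 0) * g) ≤ B → size (C (g.coeff 0) * f) ≤ B → u ≠ 0 →
      size u + 1 ≤ B := by
    intro B hB₁ hB₂ hu0
    rw [add_comm, ← size_X_mul_add_one hu0, ← hu, sub_eq_add_neg]
    exact size_add_le hB₁ (by rwa [size_neg])
  -- either the polynomials are exchanged, or `f` remains the first one
  by_cases hc : 0 < δ ∧ g.coeff 0 ≠ 0
  · refine ⟨g, -u, ?_⟩
    have hg0 : g ≠ 0 := fun h => hc.2 (by simp [h])
    simp only [divSteps, if_pos hc]
    refine ⟨by ring, by simp only [C_neg]; linear_combination -hu, hc.2, fun h => ?_, ?_⟩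
    · rw [dvd_neg]
      constructor
      · rintro ⟨hg, hu'⟩
        have : h ∣ C (g.coeff 0) * f := by
          rw [show C (g.coeff 0) * f = C (f.coeff 0) * g - X * u by linear_combination -hu]
          exact dvd_sub (hg.mul_left _) (hu'.mul_left _)
        exact ⟨(dvd_C_mul hc.2).mp this, hg⟩
      · rintro ⟨hf', hg⟩
        exact ⟨hg, (h2 h hf').mpr hg⟩
    · intro A hA hA'
      have hA' := hA' hg0
      refine ⟨by push_cast; linarith, fun hu0 => ?_⟩
      rw [size_neg]
      have := hsize (max (size f) (size g)) ((size_C_mul_le _ _).trans (le_max_right _ _))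
        ((size_C_mul_le _ _).trans (le_max_left _ _)) (by simpa using hu0)
      have hδ := hc.1
      rcases le_total (size f) (size g) with hm | hm
      · rw [max_eq_right hm] at this
        push_cast
        omega
      · rw [max_eq_left hm] at this
        push_cast
        omega
  · refine ⟨f, u, ?_⟩
    simp only [divSteps, if_neg hc]
    refine ⟨by ring, by simp only [C_neg]; linear_combination hu, hf, fun h => ?_, ?_⟩
    · constructor
      · rintro ⟨hf', hu'⟩
        exact ⟨hf', (h2 h hf').mp hu'⟩
      · rintro ⟨hf', hg⟩
        exact ⟨hf', (h2 h hf').mpr hg⟩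
    · intro A hA hA'
      refine ⟨by push_cast; linarith, fun hu0 => ?_⟩
      have hg0 : g ≠ 0 := by
        rintro rfl
        simp only [coeff_zero, map_zero, mul_zero, zero_mul, sub_zero] at hu
        exact hu0 ((mul_eq_zero.mp hu.symm).resolve_left X_ne_zero)
      have hA' := hA' hg0
      push_cast
      by_cases hg : g.coeff 0 = 0
      · have := hsize (size g) (size_C_mul_le _ _) (by simp [hg, size_zero]) hu0
        omega
      · have hδ : δ ≤ 0 := by
          by_contra h
          exact hc ⟨not_le.mp h, hg⟩
        have := hsize (max (size f) (size g)) ((size_C_mul_le _ _).trans (le_max_right _ _))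
          ((size_C_mul_le _ _).trans (le_max_left _ _)) hu0
        rcases le_total (size f) (size g) with hm | hm
        · rw [max_eq_right hm] at this
          omega
        · rw [max_eq_left hm] at this
          omega

/-- The matrix of `2 ^ (k + 1)` steps is the product of the matrices of the first and of the last
`2 ^ k` steps. -/
theorem isTransition_divSteps (k : ℕ) (δ : ℤ) {f : K[X]} (g : K[X]) (hf : f.coeff 0 ≠ 0) :
    ∃ f' g', IsTransition (2 ^ k) δ (divSteps k δ f g).1 (divSteps k δ f g).2 f g f' g' := by
  induction k generalizing δ f g with
  | zero => exact isTransition_divSteps_zero δ g hf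
  | succ k ih =>
    obtain ⟨f', g', h⟩ := ih δ g hf
    obtain ⟨f'', g'', h'⟩ := ih (divSteps k δ f g).1 g' h.coeff_ne
    refine ⟨f'', g'', ?_⟩
    have := h.trans h'
    simp only [divSteps, h.row₁, h.row₂, high_X_pow_mul]
    rwa [show 2 ^ (k + 1) = 2 ^ k + 2 ^ k by ring]

/-- The gcd of `f` and `g` after sufficiently many division steps. -/
theorem IsTransition.dvd_iff_of_le {N n : ℕ} {δ' : ℤ} {P : Mat2 K[X]} {f g f' g' : K[X]}
    (h : IsTransition N 0 δ' P f g f' g') (hf : size f ≤ n) (hg : size g ≤ n) (hN : 2 * n ≤ N)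
    (u : K[X]) : u ∣ f' ↔ u ∣ f ∧ u ∣ g := by
  have hg' : g' = 0 := by
    by_contra hg0
    -- the bounds for the sizes of the two polynomials add up to at most zero
    obtain ⟨h1, h2⟩ := h.size_le (2 * n) (by omega) (by intro; omega)
    have h2 := h2 hg0
    have hf0 : f' ≠ 0 := fun h0 => h.coeff_ne (by simp [h0])
    rw [size_of_ne_zero hf0] at h1
    rw [size_of_ne_zero hg0] at h2
    omega
  rw [← h.dvd_iff, hg']
  simp

theorem size_mul_add_mul_le {n n' : ℕ} {p q p' q' : K[X]} (hp : size p ≤ n) (hq : size q ≤ n')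
    (hp' : size p' ≤ n) (hq' : size q' ≤ n') : size (p * q + p' * q') ≤ n + n' - 1 := by
  have h1 := size_mul_le p q
  have h2 := size_mul_le p' q'
  exact size_add_le (by omega) (by omega)

/-- The entries of the transition matrix of `N` steps have degree at most `N`. -/
theorem size_divSteps_le (k : ℕ) (δ : ℤ) (f g : K[X]) :
    size (divSteps k δ f g).2.a ≤ 2 ^ k + 1 ∧ size (divSteps k δ f g).2.b ≤ 2 ^ k + 1 ∧
      size (divSteps k δ f g).2.c ≤ 2 ^ k + 1 ∧ size (divSteps k δ f g).2.d ≤ 2 ^ k + 1 := by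
  induction k generalizing δ f g with
  | zero =>
    have hX : size (X : K[X]) ≤ 2 := by rw [size_of_ne_zero X_ne_zero, natDegree_X]
    have hC : ∀ c : K, size (C c) ≤ 2 := fun c => (size_C_le c).trans one_le_two
    simp only [divSteps]
    split_ifs
    · exact ⟨by simp [size_zero], hX, hC _, hC _⟩
    · exact ⟨hX, by simp [size_zero], hC _, hC _⟩
  | succ k ih =>
    simp only [divSteps, Mat2.mul]
    have h2 : 2 ^ (k + 1) + 1 = 2 ^ k + 1 + (2 ^ k + 1) - 1 := by
      rw [pow_succ]
      omega
    rw [h2]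
    obtain ⟨h1, h2, h3, h4⟩ := ih δ f g
    obtain ⟨h5, h6, h7, h8⟩ := ih (divSteps k δ f g).1
      (high (2 ^ k) ((divSteps k δ f g).2.a * f + (divSteps k δ f g).2.b * g))
      (high (2 ^ k) ((divSteps k δ f g).2.c * f + (divSteps k δ f g).2.d * g))
    exact ⟨size_mul_add_mul_le h5 h1 h6 h3, size_mul_add_mul_le h5 h2 h6 h4,
      size_mul_add_mul_le h7 h1 h8 h3, size_mul_add_mul_le h7 h2 h8 h4⟩

end DivisionSteps

/-! ### Fast gcd -/

section FastGcd

variable {K : Type*} [Field K] [DecidableEq K]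

open Polynomial

/-- The polynomial `p * q + p' * q'`. -/
def mulAdd (mul : List ℕ → List ℕ → Prog K (List ℕ)) (a b a' b' : List ℕ) : Prog K (List ℕ) := do
  let c ← mul a b
  let c' ← mul a' b'
  sumPoly [c, c']

/-- The transition of `2 ^ k` division steps, by divide and conquer. -/
def divStepsProg (mul : List ℕ → List ℕ → Prog K (List ℕ)) :
    ℕ → ℤ → List ℕ → List ℕ → Prog K (ℤ × Mat2 (List ℕ))
  | 0, δ, a, b => do
    let z ← Prog.lit 0
    let one ← Prog.lit 1
    match a, b with
    | [], _ => Prog.fail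
    | i :: _, [] => return (δ + 1, ⟨[z, one], [], [], [i]⟩)
    | i :: _, j :: _ =>
      if ← Prog.test j then return (δ + 1, ⟨[z, one], [], [], [i]⟩)
      else if 0 < δ then
        let i' ← Prog.op .sub z i
        return (1 - δ, ⟨[], [z, one], [j], [i']⟩)
      else
        let j' ← Prog.op .sub z j
        return (δ + 1, ⟨[z, one], [], [j'], [i]⟩)
  | k + 1, δ, a, b => do
    let a ← trim (a.take (2 ^ (k + 1)))
    let b ← trim (b.take (2 ^ (k + 1)))
    let s ← divStepsProg mul k δ a b
    let a' ← mulAdd mul s.2.a a s.2.b b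
    let b' ← mulAdd mul s.2.c a s.2.d b
    let t ← divStepsProg mul k s.1 (a'.drop (2 ^ k)) (b'.drop (2 ^ k))
    let x ← mulAdd mul t.2.a s.2.a t.2.b s.2.c
    let y ← mulAdd mul t.2.a s.2.b t.2.b s.2.d
    let z ← mulAdd mul t.2.c s.2.a t.2.d s.2.c
    let w ← mulAdd mul t.2.c s.2.b t.2.d s.2.d
    return (t.1, ⟨x, y, z, w⟩)

/-- The registers in `L` hold the entries of `P`. -/
structure HoldsMat (m : List K) (L : Mat2 (List ℕ)) (P : Mat2 K[X]) : Prop where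
  a : HoldsPoly m L.a P.a
  b : HoldsPoly m L.b P.b
  c : HoldsPoly m L.c P.c
  d : HoldsPoly m L.d P.d

variable {φ : Prop} {m m' : List K} {mul : List ℕ → List ℕ → Prog K (List ℕ)} {U : ℕ → ℕ}

theorem HoldsMat.mono {L : Mat2 (List ℕ)} {P : Mat2 K[X]} (h : HoldsMat m L P) (hm : m <+: m') :
    HoldsMat m' L P := ⟨h.a.mono hm, h.b.mono hm, h.c.mono hm, h.d.mono hm⟩

theorem spec_mulAdd (hmul : MulSpec φ mul U) (hU : IsCost U) {a b a' b' : List ℕ}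
    {p q p' q' : K[X]} {n : ℕ} (ha : HoldsPoly m a p) (hb : HoldsPoly m b q)
    (ha' : HoldsPoly m a' p') (hb' : HoldsPoly m b' q') (hp : size p ≤ n) (hq : size q ≤ n)
    (hp' : size p' ≤ n) (hq' : size q' ≤ n) :
    Spec φ (mulAdd mul a b a' b') m (8 * U n) fun s m' => HoldsPoly m' s (p * q + p' * q') := by
  have hn := hU.le n
  refine Spec.bind_le (B₁ := U n) (B₂ := 7 * U n) (hmul ha hb hp hq) ?_ (by omega)
  intro c m₁ h₁ hc
  refine Spec.bind_le (B₁ := U n) (B₂ := 6 * U n) (hmul (ha'.mono h₁) (hb'.mono h₁) hp' hq') ?_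
    (by omega)
  intro c' m₂ h₂ hc'
  have h1 := size_mul_le p q
  have h2 := size_mul_le p' q'
  exact (spec_sumPoly_pair (n := 2 * n) (hc.mono h₂) hc' (by omega) (by omega)).le (by omega)

theorem holdsPoly_X {z one : ℕ} (hz : m[z]? = some (0 : K)) (h1 : m[one]? = some (1 : K)) :
    HoldsPoly m [z, one] (X : K[X]) := by
  rw [holdsPoly_iff, size_of_ne_zero X_ne_zero, natDegree_X]
  simpa [List.range_succ, coeff_X] using (HoldsVec.nil.cons h1).cons hz

/-- Only the coefficients of degree less than the number of steps are used, which makes divide and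
conquer possible. -/
theorem spec_divStepsProg (hmul : MulSpec φ mul U) (hU : IsCost U) (k : ℕ) (δ : ℤ) {a b : List ℕ}
    {f g : K[X]} (ha : HoldsPoly m a f) (hb : HoldsPoly m b g) (hf : f.coeff 0 ≠ 0) :
    Spec φ (divStepsProg mul k δ a b) m ((50 * k + 2) * U (2 ^ k)) fun s m' =>
      s.1 = (divSteps k δ f g).1 ∧ HoldsMat m' s.2 (divSteps k δ f g).2 := by
  induction k generalizing δ a b f g m with
  | zero =>
    have hU1 := hU.le 1
    rw [divStepsProg]
    refine Spec.bind_le (B₁ := 0) (B₂ := 2) (Spec.lit 0) ?_ (by simpa using hU1)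
    intro z m₁ h₁ hz
    refine Spec.bind_le (B₁ := 0) (B₂ := 2) (Spec.lit 1) ?_ (by simp)
    intro one m₂ h₂ hone
    have hz := getElem?_of_prefix h₂ hz
    have ha := ha.mono (h₁.trans h₂)
    have hb := hb.mono (h₁.trans h₂)
    rcases a with _ | ⟨i, a⟩
    · rw [ha.holds.eq_zero] at hf
      simp at hf
    have hi : m₂[i]? = some (f.coeff 0) := ha.getElem? rfl
    have h0 : ∀ {m₃ : List K}, m₂ <+: m₃ → g.coeff 0 = 0 → δ + 1 = (divSteps 0 δ f g).1 ∧
        HoldsMat m₃ ⟨[z, one], [], [], [i]⟩ (divSteps 0 δ f g).2 := by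
      intro m₃ h₃ hg
      rw [divSteps, if_neg (by simp [hg])]
      refine ⟨rfl, (holdsPoly_X hz hone).mono h₃, holdsPoly_zero, ?_,
        (holdsPoly_C hf hi).mono h₃⟩
      simp [hg, holdsPoly_zero]
    rcases b with _ | ⟨j, b⟩
    · dsimp only
      refine Spec.le (Spec.pure (K := K) (h0 List.prefix_rfl ?_)) (Nat.zero_le _)
      rw [hb.holds.eq_zero, coeff_zero]
    have hj : m₂[j]? = some (g.coeff 0) := hb.getElem? rfl
    dsimp only
    refine Spec.le (B := 1 + 1) (Spec.ite_test hj (fun hg m₃ h₃ => ?_) (fun hg m₃ h₃ => ?_)) le_rfl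
    · exact Spec.le (Spec.pure (K := K) (h0 h₃ hg)) (Nat.zero_le _)
    · have hz := getElem?_of_prefix h₃ hz
      split_ifs with hδ
      · refine Spec.map ((Spec.op (z := -f.coeff 0) hz (getElem?_of_prefix h₃ hi)
          (by simp [Arith.eval])).imp fun l m₄ h₄ hl => ?_)
        rw [divSteps, if_pos ⟨hδ, hg⟩]
        exact ⟨rfl, holdsPoly_zero, (holdsPoly_X hz (getElem?_of_prefix h₃ hone)).mono h₄,
          (holdsPoly_C hg hj).mono (h₃.trans h₄), holdsPoly_C (neg_ne_zero.mpr hf) hl⟩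
      · refine Spec.map ((Spec.op (z := -g.coeff 0) hz (getElem?_of_prefix h₃ hj)
          (by simp [Arith.eval])).imp fun l m₄ h₄ hl => ?_)
        rw [divSteps, if_neg (fun h => hδ h.1)]
        exact ⟨rfl, (holdsPoly_X hz (getElem?_of_prefix h₃ hone)).mono h₄, holdsPoly_zero,
          holdsPoly_C (neg_ne_zero.mpr hg) hl, (holdsPoly_C hf hi).mono (h₃.trans h₄)⟩
  | succ k ih =>
    set N := 2 ^ k with hN
    have hN1 : 1 ≤ N := Nat.one_le_two_pow
    have hN2 : 2 ^ (k + 1) = 2 * N := by rw [hN]; ring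
    set Z := U (2 * N) with hZ
    have hZN : 2 * N ≤ Z := hU.le _
    have hrec : (50 * k + 2) * U N + (50 * k + 2) * U N ≤ (50 * k + 2) * Z := by
      rw [← mul_add]
      have := hU.add_le N N
      rw [← two_mul N] at this
      exact Nat.mul_le_mul_left _ this
    have hdvd : ∀ p : K[X], X ^ N ∣ low (2 * N) p - p := fun p =>
      (pow_dvd_pow X (by omega)).trans (X_pow_dvd_low_sub (2 * N) p)
    have hcoeff : (low (2 * N) f).coeff 0 ≠ 0 := by
      rw [coeff_low, if_pos (by omega)]
      exact hf
    set f₀ := low (2 * N) f with hf₀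
    set g₀ := low (2 * N) g with hg₀
    have hsz := size_divSteps_le k δ f₀ g₀
    have hsz2 := size_low_le (2 * N) f
    have hsz3 := size_low_le (2 * N) g
    -- truncation does not change the transition
    have hdiv : divSteps (k + 1) δ f₀ g₀ = divSteps (k + 1) δ f g :=
      divSteps_congr _ _ (by rw [hN2]; exact X_pow_dvd_low_sub _ _)
        (by rw [hN2]; exact X_pow_dvd_low_sub _ _)
    rw [← hdiv]
    obtain ⟨f', g', htr⟩ := isTransition_divSteps k δ g₀ hcoeff
    simp only [divSteps, htr.row₁, htr.row₂, high_X_pow_mul, Mat2.mul]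
    rw [← hN] at hsz
    obtain ⟨e1, e2, e3, e4⟩ := hsz
    rw [divStepsProg, hN2]
    set R := (50 * k + 2) * U N with hR
    refine Spec.bind_le (B₁ := 2 * N) (B₂ := 2 * N + R + 48 * Z + R) (spec_truncPoly ha _) ?_
      (by rw [show (50 * (k + 1) + 2) * Z = (50 * k + 2) * Z + 50 * Z by ring]; omega)
    intro a₀ m₁ h₁ ha₀
    rw [← hf₀] at ha₀
    refine Spec.bind_le (B₁ := 2 * N) (B₂ := R + 48 * Z + R) (spec_truncPoly (hb.mono h₁) _) ?_
      (by omega)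
    intro b₀ m₂ h₂ hb₀
    rw [← hg₀] at hb₀
    refine Spec.bind_le (B₁ := R) (B₂ := 48 * Z + R) (ih δ (ha₀.mono h₂) hb₀ hcoeff) ?_ (by omega)
    rintro ⟨δ', L⟩ m₃ h₃ ⟨rfl, hL⟩
    dsimp only at hL ⊢
    have ha₀ := ha₀.mono (h₂.trans h₃)
    have hb₀ := hb₀.mono h₃
    refine Spec.bind_le (B₁ := 8 * Z) (B₂ := 40 * Z + R) (spec_mulAdd hmul hU hL.a ha₀ hL.b hb₀
      (n := 2 * N) (by omega) hsz2 (by omega) hsz3) ?_ (by omega)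
    intro a₁ m₄ h₄ ha₁
    refine Spec.bind_le (B₁ := 8 * Z) (B₂ := 32 * Z + R) (spec_mulAdd hmul hU (hL.c.mono h₄)
      (ha₀.mono h₄) (hL.d.mono h₄) (hb₀.mono h₄) (n := 2 * N) (by omega) hsz2 (by omega) hsz3) ?_
      (by omega)
    intro b₁ m₅ h₅ hb₁
    rw [htr.row₁] at ha₁
    rw [htr.row₂] at hb₁
    have ha₂ := (ha₁.mono h₅).drop N
    have hb₂ := hb₁.drop N
    rw [high_X_pow_mul] at ha₂ hb₂
    obtain ⟨e5, e6, e7, e8⟩ := size_divSteps_le k (divSteps k δ f₀ g₀).1 f' g'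
    rw [← hN] at e5 e6 e7 e8
    refine Spec.bind_le (B₁ := R) (B₂ := 32 * Z) (ih (divSteps k δ f₀ g₀).1 ha₂ hb₂ htr.coeff_ne) ?_
      (by omega)
    rintro ⟨δ'', L'⟩ m₆ h₆ ⟨rfl, hL'⟩
    dsimp only at hL' ⊢
    have hL := hL.mono (h₄.trans (h₅.trans h₆))
    refine Spec.bind_le (B₁ := 8 * Z) (B₂ := 24 * Z) (spec_mulAdd hmul hU hL'.a hL.a hL'.b hL.c
      (n := 2 * N) (by omega) (by omega) (by omega) (by omega)) ?_ (by omega)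
    intro x m₇ h₇ hx
    have hL := hL.mono h₇
    have hL' := hL'.mono h₇
    refine Spec.bind_le (B₁ := 8 * Z) (B₂ := 16 * Z) (spec_mulAdd hmul hU hL'.a hL.b hL'.b hL.d
      (n := 2 * N) (by omega) (by omega) (by omega) (by omega)) ?_ (by omega)
    intro y m₈ h₈ hy
    have hL := hL.mono h₈
    have hL' := hL'.mono h₈
    refine Spec.bind_le (B₁ := 8 * Z) (B₂ := 8 * Z) (spec_mulAdd hmul hU hL'.c hL.a hL'.d hL.c
      (n := 2 * N) (by omega) (by omega) (by omega) (by omega)) ?_ (by omega)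
    intro z m₉ h₉ hz
    have hL := hL.mono h₉
    have hL' := hL'.mono h₉
    refine Spec.map ((spec_mulAdd hmul hU hL'.c hL.b hL'.d hL.d
      (n := 2 * N) (by omega) (by omega) (by omega) (by omega)).imp fun w m₁₀ h₁₀ hw => ?_)
    exact ⟨rfl, hx.mono (h₈.trans (h₉.trans h₁₀)), hy.mono (h₉.trans h₁₀), hz.mono h₁₀, hw⟩

/-- The gcd of two polynomials: the power of `x` is split off, and the division steps do the
rest. -/
def fastGcd (mul : List ℕ → List ℕ → Prog K (List ℕ)) (a b : List ℕ) : Prog K (List ℕ) := do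
  let i ← valuation a
  let j ← valuation b
  match i, j with
  | none, _ => return b
  | some _, none => return a
  | some i, some j =>
    let v := min i j
    let s := if i ≤ j then (a.drop v, b.drop v) else (b.drop v, a.drop v)
    let k := Nat.clog 2 (2 * max a.length b.length)
    let t ← divStepsProg mul k 0 s.1 s.2
    let h ← mulAdd mul t.2.a s.1 t.2.b s.2
    shift v (h.drop (2 ^ k))

theorem dvd_X_pow_mul_iff {f g c : K[X]} (hc : ∀ u, u ∣ c ↔ u ∣ f ∧ u ∣ g) (v : ℕ) (u : K[X]) :
    u ∣ X ^ v * c ↔ u ∣ X ^ v * f ∧ u ∣ X ^ v * g := by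
  have h1 := (hc c).mp dvd_rfl
  refine ⟨fun h => ⟨h.trans (mul_dvd_mul_left _ h1.1), h.trans (mul_dvd_mul_left _ h1.2)⟩, ?_⟩
  rintro ⟨h2, h3⟩
  have h4 : EuclideanDomain.gcd f g ∣ c :=
    (hc _).mpr ⟨EuclideanDomain.gcd_dvd_left f g, EuclideanDomain.gcd_dvd_right f g⟩
  refine dvd_trans ?_ (mul_dvd_mul_left _ h4)
  rw [EuclideanDomain.gcd_eq_gcd_ab f g, mul_add, ← mul_assoc, ← mul_assoc]
  exact dvd_add (h2.mul_right _) (h3.mul_right _)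

/-- Division steps require that one of the polynomials does not vanish at `0`; this is achieved by
dividing both by a power of `x`, and an exchange. -/
theorem spec_fastGcd (hmul : MulSpec φ mul U) (hU : IsCost U) {a b : List ℕ} {p q : K[X]} {n : ℕ}
    (ha : HoldsPoly m a p) (hb : HoldsPoly m b q) (hp : size p ≤ n) (hq : size q ≤ n) :
    Spec φ (fastGcd mul a b) m ((50 * Nat.clog 2 (2 * n) + 20) * U (8 * n)) fun s m' =>
      ∃ g, HoldsPoly m' s g ∧ ∀ h, h ∣ g ↔ h ∣ p ∧ h ∣ q := by
  have hla := ha.length_eq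
  have hlb := hb.length_eq
  have hUn := hU.le (8 * n)
  have hmain : ∀ c : ℕ, (50 * c + 20) * U (8 * n) = (50 * c + 2) * U (8 * n) + 18 * U (8 * n) :=
    fun c => by ring
  rw [hmain]
  set Z := U (8 * n) with hZ
  refine Spec.bind_le (B₁ := n) (B₂ := n + (50 * Nat.clog 2 (2 * n) + 2) * Z + 8 * Z)
    ((spec_valuation ha.holds).le (by omega)) ?_ (by omega)
  intro i m₁ h₁ hi
  refine Spec.bind_le (B₁ := n) (B₂ := (50 * Nat.clog 2 (2 * n) + 2) * Z + 8 * Z)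
    ((spec_valuation (hb.mono h₁).holds).le (by omega)) ?_ (by omega)
  intro j m₂ h₂ hj
  have ha := ha.mono (h₁.trans h₂)
  have hb := hb.mono (h₁.trans h₂)
  rcases i with _ | i
  · have hp0 : p = 0 := hi
    refine Spec.le (Spec.pure (K := K) ⟨q, hb, fun h => by simp [hp0]⟩) (Nat.zero_le _)
  rcases j with _ | j
  · have hq0 : q = 0 := hj
    refine Spec.le (Spec.pure (K := K) ⟨p, ha, fun h => by simp [hq0]⟩) (Nat.zero_le _)
  dsimp only
  obtain ⟨hi1, hi2⟩ := hi
  obtain ⟨hj1, hj2⟩ := hj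
  set v := min i j with hv
  obtain ⟨f, rfl⟩ : X ^ v ∣ p := X_pow_dvd_iff.mpr fun d hd => hi2 d (by omega)
  obtain ⟨g, rfl⟩ : X ^ v ∣ q := X_pow_dvd_iff.mpr fun d hd => hj2 d (by omega)
  have hf0 : f ≠ 0 := by rintro rfl; simp at hi1
  have hg0 : g ≠ 0 := by rintro rfl; simp at hj1
  rw [size_X_pow_mul hf0] at hp hla
  rw [size_X_pow_mul hg0] at hq hlb
  have hsf : 1 ≤ size f := Nat.one_le_iff_ne_zero.mpr fun h => hf0 (size_eq_zero.mp h)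
  have hsg : 1 ≤ size g := Nat.one_le_iff_ne_zero.mpr fun h => hg0 (size_eq_zero.mp h)
  have hda := ha.drop v
  have hdb := hb.drop v
  rw [high_X_pow_mul] at hda hdb
  set n' := max a.length b.length with hn'
  have hn'n : n' ≤ n := max_le (by omega) (by omega)
  have ha' : a.length ≤ n' := le_max_left _ _
  have hb' : b.length ≤ n' := le_max_right _ _
  set k := Nat.clog 2 (2 * n') with hk
  have hk1 : 2 * n' ≤ 2 ^ k := Nat.le_pow_clog one_lt_two _
  have hk2 : 2 ^ k ≤ 2 * (2 * n') := two_pow_clog_le (by omega)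
  have hk3 : k ≤ Nat.clog 2 (2 * n) := Nat.clog_mono_right 2 (by omega)
  obtain ⟨F, G, hs1, hs2, hF0, hFs, hGs, hdvd⟩ : ∃ F G : K[X],
      HoldsPoly m₂ (if i ≤ j then (a.drop v, b.drop v) else (b.drop v, a.drop v)).1 F ∧
      HoldsPoly m₂ (if i ≤ j then (a.drop v, b.drop v) else (b.drop v, a.drop v)).2 G ∧
      F.coeff 0 ≠ 0 ∧ size F ≤ n' ∧ size G ≤ n' ∧
      ∀ u, (u ∣ F ∧ u ∣ G) ↔ (u ∣ f ∧ u ∣ g) := by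
    by_cases hij : i ≤ j
    · refine ⟨f, g, by simpa [hij] using hda, by simpa [hij] using hdb, ?_, by omega, by omega,
        fun u => Iff.rfl⟩
      have hvi : i = 0 + v := by omega
      rwa [hvi, coeff_X_pow_mul] at hi1
    · refine ⟨g, f, by simpa [hij] using hdb, by simpa [hij] using hda, ?_, by omega, by omega,
        fun u => and_comm⟩
      have hvj : j = 0 + v := by omega
      rwa [hvj, coeff_X_pow_mul] at hj1
  set s := if i ≤ j then (a.drop v, b.drop v) else (b.drop v, a.drop v) with hs
  refine Spec.bind_le (B₁ := (50 * Nat.clog 2 (2 * n) + 2) * Z) (B₂ := 8 * Z)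
    ((spec_divStepsProg hmul hU k 0 hs1 hs2 hF0).le (Nat.mul_le_mul (by omega)
      (hU.mono (by omega)))) ?_ le_rfl
  rintro ⟨δ', L⟩ m₃ h₃ ⟨-, hL⟩
  obtain ⟨F', G', htr⟩ := isTransition_divSteps k 0 G hF0
  obtain ⟨e1, e2, -, -⟩ := size_divSteps_le k 0 F G
  refine Spec.bind_le (B₁ := 8 * Z) (B₂ := 0) (spec_mulAdd hmul hU hL.a (hs1.mono h₃) hL.b
    (hs2.mono h₃) (n := 8 * n) (by omega) (by omega) (by omega) (by omega)) ?_ le_rfl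
  intro h m₄ h₄ hh
  rw [htr.row₁] at hh
  have hh := hh.drop (2 ^ k)
  rw [high_X_pow_mul] at hh
  refine (spec_shift hh v).imp fun t m₅ _ ht => ⟨_, ht, dvd_X_pow_mul_iff (fun u => ?_) v⟩
  rw [htr.dvd_iff_of_le hFs hGs hk1, hdvd]

end FastGcd

/-! ### The Graeffe operator, as a determinant -/

section GraeffeProgram

variable {K : Type*} [Field K] [DecidableEq K]

open Polynomial

/-- The Graeffe operator: the Leibniz expansion of the determinant of `graeffeMatrix b p`. -/
noncomputable def graeffeProg (mul : List ℕ → List ℕ → Prog K (List ℕ)) (b : ℕ) (a : List ℕ) :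
    Prog K (List ℕ) := do
  let ts ← (Finset.univ : Finset (Equiv.Perm (Fin b))).toList.mapM fun (σ : Equiv.Perm (Fin b)) => do
    (List.finRange b).foldlM (fun acc (j : Fin b) => do
      let e ← slice b (if j ≤ σ j then (σ j : ℕ) - j else b + σ j - j) a
      let e ← shift (if j ≤ σ j then 0 else 1) e
      mul acc e) [← Prog.lit ((Equiv.Perm.sign σ : ℤ) : K)]
  sumPoly ts

variable {φ : Prop} {m : List K} {mul : List ℕ → List ℕ → Prog K (List ℕ)} {U : ℕ → ℕ}

theorem size_X_pow_mul_le (p : K[X]) (e : ℕ) : size (X ^ e * p) ≤ e + size p := by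
  rw [size_le_iff]
  intro i hi
  rw [coeff_X_pow_mul']
  split_ifs
  · exact size_le_iff.mp le_rfl _ (by omega)
  · rfl

theorem spec_graeffeMatrix_entry {b : ℕ} {a : List ℕ} {p : K[X]} {n : ℕ} (ha : HoldsPoly m a p)
    (hp : size p ≤ n) (i j : Fin b) :
    Spec φ (do
      let e ← slice b (if j ≤ i then (i : ℕ) - j else b + i - j) a
      shift (if j ≤ i then 0 else 1) e : Prog K (List ℕ)) m n fun s m' =>
        HoldsPoly m' s (graeffeMatrix b p i j) ∧ size (graeffeMatrix b p i j) ≤ n + 1 := by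
  have hb : 1 ≤ b := by have := i.isLt; omega
  have hlt : (if j ≤ i then (i : ℕ) - j else b + i - j) < b := by
    have := i.isLt
    have := j.isLt
    split_ifs with h
    · omega
    · rw [not_le, Fin.lt_def] at h
      omega
  have hk : size p ≤ b * n := hp.trans (Nat.le_mul_of_pos_left n hb)
  refine Spec.bind_le (B₂ := 0) (spec_slice ha hlt hk) ?_ le_rfl
  rintro e m₁ h₁ ⟨he, hs⟩
  have hm : graeffeMatrix b p i j = X ^ (if j ≤ i then 0 else 1) *
      slicePoly b (if j ≤ i then (i : ℕ) - j else b + i - j) p := by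
    rw [graeffeMatrix, Matrix.of_apply]
    split_ifs <;> simp
  rw [hm]
  refine (spec_shift he _).imp fun s m₂ _ hs' => ⟨hs', (size_X_pow_mul_le _ _).trans ?_⟩
  split_ifs at hs ⊢ <;> omega

/-- For fixed `b`, the determinant is a sum of `b !` products of `b` polynomials of size at most
`n + 1`. -/
theorem spec_graeffeProg (hmul : MulSpec φ mul U) (hU : IsCost U) {b : ℕ} (hb : 2 ≤ b) {a : List ℕ}
    {p : K[X]} {n : ℕ} (hp0 : p ≠ 0) (ha : HoldsPoly m a p) (hp : size p ≤ n) :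
    Spec φ (graeffeProg mul b a) m ((b.factorial * (2 * b + 1) + 1) * U ((2 * b + 1) * n))
      fun s m' => HoldsPoly m' s (graeffe b p) := by
  have hn : 1 ≤ n := by
    have := size_of_ne_zero hp0
    omega
  set N := (2 * b + 1) * n with hN
  have hNU := hU.le N
  have hnN : n ≤ N := Nat.le_mul_of_pos_left n (by omega)
  have hcard : (Finset.univ : Finset (Equiv.Perm (Fin b))).toList.length = b.factorial := by
    rw [Finset.length_toList, Finset.card_univ, Fintype.card_perm, Fintype.card_fin]
  have hbnd : ∀ k ≤ b, 1 + k * (n + 1) ≤ N := by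
    intro k hk
    have h1 : k * (n + 1) ≤ b * (2 * n) := Nat.mul_le_mul hk (by omega)
    have h2 : N = b * (2 * n) + n := by rw [hN]; ring
    omega
  have hprod : ∀ σ : Equiv.Perm (Fin b), ∀ m', m <+: m' → Spec φ (do
      (List.finRange b).foldlM (fun acc (j : Fin b) => do
        let e ← slice b (if j ≤ σ j then (σ j : ℕ) - j else b + σ j - j) a
        let e ← shift (if j ≤ σ j then 0 else 1) e
        mul acc e) [← Prog.lit ((Equiv.Perm.sign σ : ℤ) : K)] : Prog K (List ℕ)) m'
      (b * (2 * U N)) fun s m'' =>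
        HoldsPoly m'' s (C ((Equiv.Perm.sign σ : ℤ) : K) * ∏ j, graeffeMatrix b p (σ j) j) ∧
        size (C ((Equiv.Perm.sign σ : ℤ) : K) * ∏ j, graeffeMatrix b p (σ j) j) ≤ N := by
    intro σ m₁ h₁
    refine Spec.bind_le (B₁ := 0) (B₂ := b * (2 * U N)) (Spec.lit _) ?_ (by omega)
    intro i m₂ h₂ hi
    have hs0 : ((Equiv.Perm.sign σ : ℤ) : K) ≠ 0 := by
      rcases Int.units_eq_one_or (Equiv.Perm.sign σ) with h | h <;> simp [h]
    have key := Spec.foldlM_le (φ := φ) (m := m₂) (B := 2 * U N)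
      (f := fun acc (j : Fin b) => (do
        let e ← slice b (if j ≤ σ j then (σ j : ℕ) - j else b + σ j - j) a
        let e ← shift (if j ≤ σ j then 0 else 1) e
        mul acc e : Prog K (List ℕ)))
      (fun l₁ s m' =>
        HoldsPoly m' s (C ((Equiv.Perm.sign σ : ℤ) : K) *
          (l₁.map fun j => graeffeMatrix b p (σ j) j).prod) ∧
        size (C ((Equiv.Perm.sign σ : ℤ) : K) *
          (l₁.map fun j => graeffeMatrix b p (σ j) j).prod) ≤ 1 + l₁.length * (n + 1))
      (List.finRange b) [i] (by
        refine ⟨?_, ?_⟩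
        · simpa using holdsPoly_C hs0 hi
        · simpa using size_C_le ((Equiv.Perm.sign σ : ℤ) : K)) (by
        rintro l₁ j l₂ hl s m₃ h₃ ⟨hs, hsz⟩
        have hlen : l₁.length + 1 ≤ b := by
          have := congrArg List.length hl
          simp at this
          omega
        rw [← bind_assoc]
        refine Spec.bind_le (B₂ := U N) (spec_graeffeMatrix_entry (ha.mono (h₁.trans (h₂.trans h₃)))
          hp (σ j) j) ?_ (by omega)
        rintro e m₄ h₄ ⟨he, hes⟩
        have hb1 := hbnd l₁.length (by omega)
        refine (hmul (hs.mono h₄) he (hsz.trans hb1) (hes.trans (by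
          have := hbnd 1 (by omega); omega))).imp fun s' m₅ _ hs' => ?_
        rw [List.map_append, List.prod_append, List.map_singleton, List.prod_singleton, ← mul_assoc]
        refine ⟨hs', (size_mul_le _ _).trans ?_⟩
        rw [List.length_append, List.length_singleton, add_mul]
        omega)
    rw [List.length_finRange] at key
    refine key.imp fun s m₃ _ hs => ?_
    rw [Fin.prod_univ_def]
    exact ⟨hs.1, hs.2.trans (hbnd _ (by simp))⟩
  refine Spec.bind_le (B₁ := b.factorial * (b * (2 * U N))) (B₂ := (b.factorial + 1) * N) ?_ ?_ ?_
    (Q₁ := fun ts m' => List.Forall₂ (fun σ s =>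
      HoldsPoly m' s (C ((Equiv.Perm.sign σ : ℤ) : K) * ∏ j, graeffeMatrix b p (σ j) j) ∧
      size (C ((Equiv.Perm.sign σ : ℤ) : K) * ∏ j, graeffeMatrix b p (σ j) j) ≤ N)
      (Finset.univ : Finset (Equiv.Perm (Fin b))).toList ts)
  · rw [← hcard]
    exact Spec.mapM_le _ (fun _ _ _ _ hm h => ⟨h.1.mono hm, h.2⟩) fun σ _ m' hm => hprod σ m' hm
  · intro ts m₁ h₁ hts
    have hsum := spec_sumPoly (φ := φ) (m := m₁) (as := ts) (n := N)
      (ps := (Finset.univ : Finset (Equiv.Perm (Fin b))).toList.map fun σ =>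
        C ((Equiv.Perm.sign σ : ℤ) : K) * ∏ j, graeffeMatrix b p (σ j) j)
      (by
        rw [List.forall₂_map_right_iff]
        exact hts.flip.imp fun _ _ h => HoldsPoly.holds h.1) (by
        intro x hx
        obtain ⟨j, hj, rfl⟩ := List.getElem_of_mem hx
        have hget := List.Forall₂.get hts (by rw [hts.length_eq]; exact hj) hj
        simp only [List.get_eq_getElem] at hget
        rw [hget.1.length_eq]
        exact hget.2)
    rw [← hts.length_eq, hcard] at hsum
    refine hsum.imp fun s m₂ _ hs => ?_
    rw [Finset.sum_map_toList] at hs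
    rw [← det_graeffeMatrix hb hp0, Matrix.det_apply]
    convert hs using 1
    refine Finset.sum_congr rfl fun σ _ => ?_
    rcases Int.units_eq_one_or (Equiv.Perm.sign σ) with h | h <;> simp [h]
  · calc b.factorial * (b * (2 * U N)) + (b.factorial + 1) * N
        ≤ b.factorial * (b * (2 * U N)) + (b.factorial + 1) * U N :=
          Nat.add_le_add_left (Nat.mul_le_mul_left _ hNU) _
      _ = (b.factorial * (2 * b + 1) + 1) * U N := by ring

end GraeffeProgram

/-! ### Kernels of matrices -/

section KernelProgram

variable {K : Type*} [Field K] [DecidableEq K]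

/-- The dot product of two vectors. -/
def dotVec : List ℕ → List ℕ → Prog K ℕ
  | i :: a, j :: b => do
    let s ← dotVec a b
    Prog.op .add s (← Prog.op .mul i j)
  | _, _ => Prog.lit 0

/-- A basis of the kernel of the matrix with given columns: starting from the standard basis, the
equations given by the rows are imposed one after the other. -/
def kernelProg (a : List (List ℕ)) : Prog K (List (List ℕ)) := do
  let z ← Prog.lit 0
  let one ← Prog.lit 1
  let n := a.length
  (List.range (a.headD []).length).foldlM (fun G i => do
    let vals ← G.mapM (dotVec (a.map fun c => c.getD i 0))
    eliminate (G.zip vals))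
    ((List.range n).map fun j => (List.range n).map fun i => if i = j then one else z)

variable {φ : Prop} {m : List K}

theorem spec_dotVec {a b : List ℕ} {u v : List K} (ha : HoldsVec m a u) (hb : HoldsVec m b v) :
    Spec φ (dotVec a b) m (2 * b.length) fun i m' =>
      m'[i]? = some (List.zipWith (· * ·) u v).sum := by
  induction a generalizing b u v m with
  | nil =>
    have hu : u = [] := by simpa using ha.length_eq.symm
    rw [dotVec.eq_2 _ _ (by simp)]
    exact (Spec.lit (0 : K)).mono (Nat.zero_le _) fun i m' _ h => by simpa [hu] using h
  | cons i a ih =>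
    rcases b with _ | ⟨j, b⟩
    · have hv : v = [] := by simpa using hb.length_eq.symm
      rw [dotVec.eq_2 _ _ (by simp)]
      exact (Spec.lit (0 : K)).mono (Nat.zero_le _) fun i m' _ h => by simpa [hv] using h
    rw [holdsVec_iff, List.forall₂_cons_left_iff] at ha hb
    obtain ⟨x, u, hx, ha, rfl⟩ := ha
    obtain ⟨y, v, hy, hb, rfl⟩ := hb
    rw [dotVec]
    refine Spec.bind_le (B₁ := 2 * b.length) (B₂ := 2) (ih (holdsVec_iff.mpr ha)
      (holdsVec_iff.mpr hb)) ?_ (by rw [List.length_cons]; omega)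
    intro s m₁ h₁ hs
    refine Spec.bind_le (B₁ := 1) (B₂ := 1) (Spec.op (getElem?_of_prefix h₁ hx)
      (getElem?_of_prefix h₁ hy) rfl) ?_ le_rfl
    intro t m₂ h₂ ht
    refine (Spec.op (getElem?_of_prefix h₂ hs) ht rfl).imp fun l m₃ _ hl => ?_
    rw [hl, List.zipWith_cons_cons, List.sum_cons, add_comm]

/-- The linear form of the coordinate of index `j`, or zero if there is none. -/
def coordForm (K : Type*) [Field K] (n j : ℕ) : (Fin n → K) →ₗ[K] K :=
  if h : j < n then LinearMap.proj ⟨j, h⟩ else 0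

theorem coords_coordForm {n : ℕ} (p : Fin n → K) : coords (coordForm K n) 0 n p = List.ofFn p := by
  apply List.ext_getElem
  · simp [coords]
  · intro i h₁ h₂
    have hi : i < n := by simpa using h₂
    simp [coords, coordForm, hi]

theorem ListIndep.length_le {n : ℕ} {ps : List (Fin n → K)} (h : ListIndep K ps) :
    ps.length ≤ n := by
  rw [listIndep_iff_get] at h
  simpa using h.fintype_card_le_finrank

/-- The list of vectors is a basis of the space of solutions of the equations treated so far, hence
has length at most `n`. -/
theorem spec_kernelProg {h n : ℕ} {A : Matrix (Fin h) (Fin n) K} {a : List (List ℕ)}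
    (ha : List.Forall₂ (HoldsVec m) a (List.ofFn fun j => List.ofFn fun i => A i j)) :
    Spec φ (kernelProg a) m (8 * (h + 1) * (n + 1) ^ 2) fun s m' =>
      ∃ (k : ℕ) (v : Fin k → Fin n → K),
        List.Forall₂ (HoldsVec m') s (List.ofFn fun j => List.ofFn (v j)) ∧
        LinearIndependent K v ∧ Submodule.span K (Set.range v) = LinearMap.ker A.mulVecLin := by
  have hlen : a.length = n := by simpa using ha.length_eq
  have hcol : ∀ (j : Fin n) (hj : (j : ℕ) < a.length), HoldsVec m a[(j : ℕ)]
      (List.ofFn fun i => A i j) := by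
    intro j hj
    have := List.Forall₂.get ha hj (by simp)
    simpa only [List.get_eq_getElem, List.getElem_ofFn] using this
  refine Spec.bind_le (B₁ := 0) (B₂ := 8 * (h + 1) * (n + 1) ^ 2) (Spec.lit 0) ?_ (by omega)
  intro z m₁ h₁ hz
  refine Spec.bind_le (B₁ := 0) (B₂ := 8 * (h + 1) * (n + 1) ^ 2) (Spec.lit 1) ?_ (by omega)
  intro one m₂ h₂ hone
  have hz := getElem?_of_prefix h₂ hz
  dsimp only
  rw [hlen]
  -- a matrix without columns does not reveal the number of its rows, which then does not matter
  obtain ⟨h', hh', hh'h, hker⟩ : ∃ h', (a.headD []).length = h' ∧ h' ≤ h ∧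
      ∀ p : Fin n → K, (∀ i : Fin h, (i : ℕ) < h' → A.mulVec p i = 0) → A.mulVec p = 0 := by
    refine ⟨_, rfl, ?_⟩
    rcases a with _ | ⟨c, a⟩
    · refine ⟨by simp, fun p _ => ?_⟩
      have hn : n = 0 := by simpa using hlen.symm
      subst hn
      simp
    · have hn : 0 < n := by rw [← hlen]; simp
      have := (hcol ⟨0, hn⟩ (by simp)).length_eq
      simp only [List.getElem_cons_zero, List.length_ofFn] at this
      rw [List.headD_cons, this]
      exact ⟨le_rfl, fun p hp => funext fun i => hp i i.isLt⟩
  rw [hh']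
  have hbasis : (fun j : Fin n => (Pi.single j 1 : Fin n → K)) = Pi.basisFun K (Fin n) := by
    ext j
    simp
  have key := Spec.foldlM_le (φ := φ) (m := m₂) (B := n * (2 * n) + n * (2 + 2 * n))
    (f := fun G i => (do
      let vals ← G.mapM (dotVec (a.map fun c => c.getD i 0))
      eliminate (G.zip vals) : Prog K (List (List ℕ))))
    (fun l₁ G m' => ∃ ps : List (Fin n → K),
      List.Forall₂ (fun g p => HoldsVec m' g (List.ofFn p)) G ps ∧ ListIndep K ps ∧
      ∀ p, p ∈ listSpan K ps ↔ ∀ i : Fin h, (i : ℕ) < l₁.length → A.mulVec p i = 0)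
    (List.range h')
    ((List.range n).map fun j => (List.range n).map fun i => if i = j then one else z) (by
      refine ⟨List.ofFn fun j : Fin n => Pi.single j 1, ?_, ?_, ?_⟩
      · rw [List.forall₂_iff_get]
        refine ⟨by simp, fun j hj₁ hj₂ => ?_⟩
        have hj : j < n := by simpa using hj₁
        rw [holdsVec_iff, List.forall₂_iff_get]
        refine ⟨by simp, fun i hi₁ hi₂ => ?_⟩
        have hi : i < n := by simpa using hi₂
        simp only [List.get_eq_getElem, List.getElem_map, List.getElem_range, List.getElem_ofFn,
          Pi.single_apply, Fin.mk.injEq]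
        split_ifs
        · exact hone
        · exact hz
      · rw [listIndep_ofFn]
        rw [hbasis]
        exact (Pi.basisFun K (Fin n)).linearIndependent
      · intro p
        rw [listSpan_ofFn]
        rw [hbasis, (Pi.basisFun K (Fin n)).span_eq]
        simp) (by
      rintro l₁ i l₂ hl G m₃ h₃ ⟨ps, hG, hps, hspan⟩
      have hi : i = l₁.length := by
        have : (List.range h')[l₁.length]? = some i := by rw [hl]; simp
        rw [List.getElem?_range] at this
        · simpa using this.symm
        · have := congrArg List.length hl
          simp at this
          omega
      have hih' : i < h' := by
        have : i ∈ List.range h' := by rw [hl]; simp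
        simpa using this
      have hih : i < h := by omega
      have hm₃ := h₁.trans (h₂.trans h₃)
      have hrow : HoldsVec m₃ (a.map fun c => c.getD i 0) (List.ofFn fun j => A ⟨i, hih⟩ j) := by
        rw [holdsVec_iff, List.forall₂_iff_get]
        refine ⟨by simp [hlen], fun j hj₁ hj₂ => ?_⟩
        have hj : j < n := by simpa using hj₂
        have hc := (hcol ⟨j, hj⟩ (by rw [hlen]; exact hj)).mono hm₃
        have hil : i < (a[j]'(by rw [hlen]; exact hj)).length := by
          rw [hc.length_eq]
          simpa using hih
        rw [holdsVec_iff] at hc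
        have := List.Forall₂.get hc hil (by simpa using hih)
        simpa [hil] using this
      set f : (Fin n → K) →ₗ[K] K := (LinearMap.proj ⟨i, hih⟩).comp A.mulVecLin with hf
      have hfp : ∀ p : Fin n → K, f p = A.mulVec p ⟨i, hih⟩ := fun p => rfl
      have hGlen : G.length ≤ n := by rw [hG.length_eq]; exact hps.length_le
      have hdot := Spec.mapM_le (φ := φ) (m := m₃) (f := dotVec (a.map fun c => c.getD i 0))
        (B := 2 * n) (R := fun g l m' => ∀ p : Fin n → K, HoldsVec m₃ g (List.ofFn p) →
          m'[l]? = some (f p)) G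
        (fun _ _ _ _ hm h p hp => getElem?_of_prefix hm (h p hp)) (by
          intro g hg m₄ h₄
          obtain ⟨j, hj, rfl⟩ := List.getElem_of_mem hg
          have hgp := List.Forall₂.get hG hj (by rw [← hG.length_eq]; exact hj)
          simp only [List.get_eq_getElem] at hgp
          refine (spec_dotVec (hrow.mono h₄) (hgp.mono h₄)).mono ?_ fun l m₅ _ hl p hp => ?_
          · rw [hgp.length_eq, List.length_ofFn]
          · have hpe : List.ofFn (ps[j]'(by rw [← hG.length_eq]; exact hj)) = List.ofFn p :=
              List.map_injective_iff.mpr (Option.some_injective K) (hgp.symm.trans hp)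
            rw [hl, hpe, hfp, Matrix.mulVec, dotProduct, ← List.sum_ofFn]
            congr 2
            apply List.ext_getElem
            · simp
            · intro k _ _
              simp)
      refine Spec.bind_le (B₂ := n * (2 + 2 * n)) (hdot.le (Nat.mul_le_mul_right _ hGlen)) ?_ le_rfl
      intro vals m₄ h₄ hvals
      have hzip : List.Forall₂ (fun g p => HoldsVec m₄ g.1 (coords (coordForm K n) 0 n p) ∧
          m₄[g.2]? = some (f p)) (G.zip vals) ps := by
        rw [List.forall₂_iff_get] at hG hvals ⊢
        refine ⟨by rw [List.length_zip, ← hvals.1, ← hG.1, min_self], fun j hj₁ hj₂ => ?_⟩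
        have hj : j < G.length := by rw [hG.1]; exact hj₂
        have e1 := hG.2 j hj hj₂
        have e2 := hvals.2 j hj (by rw [← hvals.1]; exact hj) _ e1
        rw [coords_coordForm]
        simp only [List.get_eq_getElem, List.getElem_zip] at e1 e2 ⊢
        exact ⟨e1.mono h₄, e2⟩
      refine (spec_eliminate (coordForm K n) 0 n f hzip).mono ?_ fun s m₅ _ hs => ?_
      · rw [List.length_zip]
        exact Nat.mul_le_mul_right _ ((min_le_left _ _).trans hGlen)
      · obtain ⟨h5, h6⟩ := elimList_spec f hps
        simp only [coords_coordForm] at hs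
        refine ⟨elimList f ps, hs, h5, fun p => ?_⟩
        rw [h6, Submodule.mem_inf, LinearMap.mem_ker, hspan, hfp, List.length_append,
          List.length_singleton]
        constructor
        · rintro ⟨h7, h8⟩ i' hi'
          by_cases hc : (i' : ℕ) < l₁.length
          · exact h7 i' hc
          · have : i' = ⟨i, hih⟩ := Fin.ext (by simp only; omega)
            rw [this, h8]
        · intro h7
          exact ⟨fun i' hi' => h7 i' (by omega), h7 _ (by simp [hi])⟩)
  rw [List.length_range] at key
  refine key.mono ?_ ?_
  · calc h' * (n * (2 * n) + n * (2 + 2 * n)) ≤ h * (n * (2 * n) + n * (2 + 2 * n)) :=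
        Nat.mul_le_mul_right _ hh'h
      _ ≤ 8 * (h + 1) * (n + 1) ^ 2 := by ring_nf; omega
  · rintro s m₃ - ⟨ps, hs, hps, hspan⟩
    refine ⟨ps.length, fun j => ps[j], ?_, (listIndep_iff_get ps).mp hps, ?_⟩
    · rw [List.forall₂_iff_get] at hs ⊢
      refine ⟨by simpa using hs.1, fun j h4 h5 => ?_⟩
      simpa only [List.get_eq_getElem, List.getElem_ofFn, Fin.getElem_fin] using
        hs.2 j h4 (by rw [← hs.1]; exact h4)
    · rw [← listSpan_eq_range]
      ext p
      rw [hspan, LinearMap.mem_ker, Matrix.mulVecLin_apply]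
      exact ⟨hker p, fun h i _ => by rw [h]; rfl⟩

end KernelProgram

/-! ### Fast subroutines from a fast multiplication -/

section FastSubroutines

variable {K : Type*} [Field K] [DecidableEq K] [CharZero K]

/-- The cost of the fast subroutines on inputs of size `n`, up to a constant factor. -/
noncomputable def fastCost (M : ℕ → ℝ) (c n : ℕ) : ℕ :=
  n * (c * (Nat.log 2 n + 1) * blockCost M n)

theorem isCost_fastCost {M : ℕ → ℝ} (h1 : ∀ n, 1 ≤ M n)
    (hM : ∀ n n' : ℕ, 1 ≤ n → n ≤ n' → M n / n ≤ M n' / n') {c : ℕ} (hc : 1 ≤ c) :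
    IsCost (fastCost M c) := by
  refine isCost_mul (t := fun n => c * (Nat.log 2 n + 1) * blockCost M n) (c := 8) ?_ ?_ ?_
  · intro n n' h
    exact Nat.mul_le_mul (Nat.mul_le_mul_left _ (Nat.succ_le_succ (Nat.log_mono_right h)))
      (blockCost_mono M h)
  · intro n hn
    exact Nat.mul_pos (Nat.mul_pos hc (Nat.succ_pos _)) (one_le_blockCost h1 hM hn)
  · intro n
    have h2 : Nat.log 2 (2 * n) + 1 ≤ 2 * (Nat.log 2 n + 1) := by
      rcases Nat.eq_zero_or_pos n with rfl | hn
      · simp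
      · rw [mul_comm 2 n, Nat.log_mul_base one_lt_two hn.ne']
        omega
    calc c * (Nat.log 2 (2 * n) + 1) * blockCost M (2 * n)
        ≤ c * (2 * (Nat.log 2 n + 1)) * (4 * blockCost M n) :=
          Nat.mul_le_mul (Nat.mul_le_mul_left _ h2) (blockCost_double M n)
      _ = 8 * (c * (Nat.log 2 n + 1) * blockCost M n) := by ring

/-- Exact division and, for a fixed radix, the Graeffe operator cost a constant number of
multiplications, the gcd a logarithmic number. -/
theorem exists_fast_subroutines {mul : List ℕ → List ℕ → Prog K (List ℕ)} {M : ℕ → ℝ}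
    (hmul : MultipliesIn mul M) (hM : ∀ n n' : ℕ, 1 ≤ n → n ≤ n' → M n / n ≤ M n' / n') :
    ∃ (S : Subroutines K) (c : ℕ) (G : ℕ → ℕ), 1 ≤ c ∧ SubSpec True S (fastCost M c) G := by
  have h1 := hmul.one_le
  set u : ℕ → ℕ := fun n => n * (8 * blockCost M n) with hu
  have hcost : IsCost u := isCost_mul (fun n n' h => Nat.mul_le_mul_left 8 (blockCost_mono M h))
    (fun n hn => by have := one_le_blockCost h1 hM hn; omega) (c := 4)
    (fun n => by have := blockCost_double M n; omega)
  obtain ⟨c, hc⟩ := hcost.exists_mul_le 8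
  have hex := fun b => hcost.exists_mul_le (2 * b + 1)
  choose G hG using hex
  set mulB := blockMul mul (blockLen M) with hmulB
  have hmulB' : MulSpec True mulB u := fun ha hb hp hq => spec_blockMul hmul hM ha hb hp hq
  have hle : ∀ k n, k ≤ 120 * (c + 1) * (Nat.log 2 n + 1) →
      k * u n ≤ fastCost M (960 * (c + 1)) n := by
    intro k n hk
    calc k * u n ≤ 120 * (c + 1) * (Nat.log 2 n + 1) * u n := Nat.mul_le_mul_right _ hk
      _ = fastCost M (960 * (c + 1)) n := by rw [hu, fastCost]; ring
  have hlog : ∀ n, 1 ≤ Nat.log 2 n + 1 := fun n => Nat.succ_pos _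
  have hle1 : ∀ n, u n ≤ fastCost M (960 * (c + 1)) n := by
    intro n
    have := hle 1 n (Nat.mul_pos (Nat.mul_pos (by norm_num) (Nat.succ_pos c)) (Nat.succ_pos _))
    rwa [one_mul] at this
  refine ⟨⟨mulB, fastGcd mulB, exactDiv mulB, graeffeProg mulB, kernelProg⟩, 960 * (c + 1),
    fun b => (b.factorial * (2 * b + 1) + 1) * G b, by omega, ⟨?_, ?_, ?_, ?_, ?_⟩⟩
  · intro p q m a b n ha hb hp hq
    exact (hmulB' ha hb hp hq).le (hle1 n)
  · intro p q m a b n ha hb hp hq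
    refine (spec_fastGcd hmulB' hcost ha hb hp hq).le ?_
    rcases Nat.eq_zero_or_pos n with rfl | hn
    · simp [hu]
    · have hclog : Nat.clog 2 (2 * n) ≤ Nat.log 2 n + 2 := by
        refine Nat.clog_le_of_le_pow ?_
        have := (Nat.lt_pow_succ_log_self one_lt_two n).le
        rw [pow_succ]
        omega
      calc (50 * Nat.clog 2 (2 * n) + 20) * u (8 * n)
          ≤ 120 * (Nat.log 2 n + 1) * (c * u n) := Nat.mul_le_mul (by omega) (hc n)
        _ = (120 * (Nat.log 2 n + 1) * c) * u n := by ring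
        _ ≤ _ := hle _ _ (by
          rw [mul_right_comm]
          exact Nat.mul_le_mul_right _ (Nat.mul_le_mul_left _ (Nat.le_succ c)))
  · intro p q m a b n hq ha hb hn
    refine (spec_exactDiv hmulB' hcost hq ha hb hn).le ?_
    calc 12 * u (8 * n) ≤ 12 * (c * u n) := Nat.mul_le_mul_left _ (hc n)
      _ = (12 * c) * u n := by ring
      _ ≤ _ := hle _ _ ((show 12 * c ≤ 120 * (c + 1) by omega).trans
          (Nat.le_mul_of_pos_right _ (hlog n)))
  · intro b p m a n hb hp0 ha hp
    refine (spec_graeffeProg hmulB' hcost hb hp0 ha hp).le ?_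
    rw [mul_assoc]
    exact Nat.mul_le_mul_left _ ((hG b n).trans (Nat.mul_le_mul_left _ (hle1 n)))
  · intro h n A m a ha
    exact spec_kernelProg ha

/-- The cost of the fast subroutines is that of a multiplication, up to logarithms. -/
theorem fastCost_le {M : ℕ → ℝ} (h1 : ∀ n, 1 ≤ M n)
    (hM : ∀ n n' : ℕ, 1 ≤ n → n ≤ n' → M n / n ≤ M n' / n') (c : ℕ) {n : ℕ} (hn : 1 ≤ n) :
    (fastCost M c n : ℝ) ≤ 2 * c * (Nat.log 2 n + 1 : ℕ) * M n := by
  have := mul_blockCost_le h1 hM hn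
  rw [fastCost]
  calc ((n * (c * (Nat.log 2 n + 1) * blockCost M n) : ℕ) : ℝ)
      = c * (Nat.log 2 n + 1 : ℕ) * (n * blockCost M n) := by push_cast; ring
    _ ≤ c * (Nat.log 2 n + 1 : ℕ) * (2 * M n) := by gcongr
    _ = _ := by ring

end FastSubroutines

/-! ### Bounds up to logarithms -/

section Soft

theorem one_le_log {x : ℝ} (hx : 0 ≤ x) : 1 ≤ Real.log (3 + x) := by
  rw [Real.le_log_iff_exp_le (by linarith)]
  have := Real.exp_one_lt_d9
  linarith

/-- The integral binary logarithm and the one in the definition of soft bounds are equivalent. -/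
theorem natLog_le (d : ℕ) : ((Nat.log 2 d + 1 : ℕ) : ℝ) ≤ 3 * Real.log (3 + d) := by
  have h1 := one_le_log (Nat.cast_nonneg (α := ℝ) d)
  rcases Nat.eq_zero_or_pos d with rfl | hd
  · rw [Nat.log_zero_right]
    push_cast at h1 ⊢
    linarith
  have h2 : (2 : ℝ) ^ Nat.log 2 d ≤ 3 + d := by
    have : ((2 ^ Nat.log 2 d : ℕ) : ℝ) ≤ d := by exact_mod_cast Nat.pow_log_le_self 2 hd.ne'
    push_cast at this
    linarith
  have h3 := Real.log_le_log (by positivity) h2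
  rw [Real.log_pow] at h3
  have h4 := Real.log_two_gt_d9
  have h5 : (Nat.log 2 d : ℝ) * (1 / 2) ≤ Nat.log 2 d * Real.log 2 := by
    gcongr
    linarith
  push_cast
  linarith

theorem log_le_mul_log {B x y : ℝ} (hB : 1 ≤ B) (hx : 0 ≤ x) (hy : 0 ≤ y) (h : x ≤ B * y) :
    Real.log (3 + x) ≤ (1 + Real.log B) * Real.log (3 + y) := by
  have h1 := one_le_log hy
  have h2 := Real.log_nonneg hB
  have h3 : Real.log (3 + x) ≤ Real.log (B * (3 + y)) := by
    refine Real.log_le_log (by linarith) ?_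
    nlinarith
  rw [Real.log_mul (by linarith) (by linarith)] at h3
  nlinarith

theorem soft_le_abs (C : ℝ) (e : ℕ) {x : ℝ} (hx : 0 ≤ x) : soft C e x ≤ soft |C| e x := by
  have h := one_le_log hx
  unfold soft
  gcongr
  exact le_abs_self C

/-- Soft bounds compose. -/
theorem exists_soft_soft (C A : ℝ) (e f : ℕ) : ∃ (C' : ℝ) (e' : ℕ), ∀ x y : ℝ, 0 ≤ x → 0 ≤ y →
    x ≤ soft A f y → soft C e x ≤ soft C' e' y := by
  -- the logarithm of `A * y * log (3 + y) ^ f` is at most `D * log (3 + y)`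
  set D : ℝ := Real.log (3 + |A|) + (f + 1) with hD
  have hD0 : 0 ≤ D := by
    have := one_le_log (abs_nonneg A)
    positivity
  refine ⟨|C| * |A| * D ^ e, f + e, fun x y hx hy h => (soft_le_abs C e hx).trans ?_⟩
  have h1 := one_le_log hy
  have h2 : x ≤ soft |A| f y := h.trans (soft_le_abs A f hy)
  have h3 : Real.log (3 + y) ≤ 3 + y := Real.log_le_self (by linarith)
  have h4 : 3 + x ≤ (3 + |A|) * (3 + y) ^ (f + 1) := by
    have h5 : soft |A| f y ≤ |A| * (3 + y) ^ (f + 1) := by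
      unfold soft
      rw [pow_succ', ← mul_assoc]
      gcongr
      linarith
    have h6 : (1 : ℝ) ≤ (3 + y) ^ (f + 1) := one_le_pow₀ (by linarith)
    rw [add_mul]
    linarith
  have h7 : Real.log (3 + x) ≤ D * Real.log (3 + y) := by
    have h8 := Real.log_le_log (by linarith) h4
    rw [Real.log_mul (by positivity) (by positivity), Real.log_pow] at h8
    have h9 := one_le_log (abs_nonneg A)
    have h10 : Real.log (3 + |A|) ≤ Real.log (3 + |A|) * Real.log (3 + y) :=
      le_mul_of_one_le_right (by linarith) h1
    rw [hD, add_mul]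
    push_cast at h8
    linarith
  have h11 := one_le_log hx
  have h12 := hx.trans h2
  calc soft |C| e x = |C| * x * Real.log (3 + x) ^ e := rfl
    _ ≤ |C| * soft |A| f y * (D * Real.log (3 + y)) ^ e := by gcongr
    _ = soft (|C| * |A| * D ^ e) (f + e) y := by
      unfold soft
      rw [mul_pow, pow_add]
      ring

variable {K : Type*} [Field K] [DecidableEq K]

/-- A soft bound may be replaced by a softly larger one; these only have to be compared where
`b ^ (r - 1) ≤ d`. -/
theorem RunsInSoftO.trans {S : Subroutines K} {b : ℕ} {g g' : ℕ → ℕ → ℝ} (h : RunsInSoftO S b g)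
    (A : ℝ) (f : ℕ) (hg : ∀ r d, 1 ≤ r → b ^ (r - 1) ≤ d →
      0 ≤ g r d ∧ 0 ≤ g' r d ∧ g r d ≤ soft A f (g' r d)) : RunsInSoftO S b g' := by
  obtain ⟨C, e, h⟩ := h
  obtain ⟨C', e', hC⟩ := exists_soft_soft C A e f
  refine ⟨C', e', fun r d l m a hr h0 hl hd hbd ha => ?_⟩
  obtain ⟨h1, h2, h3⟩ := hg r d hr hbd
  exact (h r d l m a hr h0 hl hd hbd ha).imp fun _ _ _ hc => hc.trans (hC _ _ h1 h2 h3)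

/-- A cost bound up to a power of the logarithm of `d` is a soft bound, as soon as `d` is at most a
multiple of the main term. -/
theorem runsInSoftO_of_spec {S : Subroutines K} {b : ℕ} {g : ℕ → ℕ → ℝ} {C B : ℝ} (e : ℕ)
    (hC : 0 ≤ C) (hB : 1 ≤ B)
    (h : ∀ r d : ℕ, 1 ≤ r → b ^ (r - 1) ≤ d → 0 ≤ g r d ∧ (d : ℝ) ≤ B * g r d ∧
      ∃ N : ℕ, (N : ℝ) ≤ C * g r d * ((Nat.log 2 d + 1 : ℕ) : ℝ) ^ e ∧
      ∀ (l : Fin (r + 1) → K[X]) (m : List K) (a : Fin (r + 1) → List ℕ), l 0 ≠ 0 →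
        l (Fin.last r) ≠ 0 → (∀ k, (l k).natDegree ≤ d) → (∀ k, HoldsPoly m (a k) (l k)) →
        Spec True (ratSolutions S b r (List.ofFn a)) m N fun _ _ => True) :
    RunsInSoftO S b g := by
  refine ⟨C * (3 * (1 + Real.log B)) ^ e, e, fun r d l m a hr h0 hl hd hbd ha => ?_⟩
  obtain ⟨hg0, hdg, N, hN, hs⟩ := h r d hr hbd
  refine (hs l m a h0 hl hd ha).yields.imp fun _ _ c hc => ?_
  have h1 := natLog_le d
  have h2 := log_le_mul_log hB (Nat.cast_nonneg d) hg0 hdg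
  have h3 : ((Nat.log 2 d + 1 : ℕ) : ℝ) ≤ 3 * (1 + Real.log B) * Real.log (3 + g r d) := by
    linarith
  calc (c : ℝ) ≤ N := by exact_mod_cast hc.2 trivial
    _ ≤ C * g r d * ((Nat.log 2 d + 1 : ℕ) : ℝ) ^ e := hN
    _ ≤ C * g r d * (3 * (1 + Real.log B) * Real.log (3 + g r d)) ^ e := by gcongr
    _ = soft (C * (3 * (1 + Real.log B)) ^ e) e (g r d) := by
      unfold soft
      rw [mul_pow]
      ring

end Soft

/-! ### The complexity of the algorithm -/

section Complexity

variable {K : Type*} [Field K] [DecidableEq K] [CharZero K]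

/-- The order of the equation is at most logarithmic in its degree. -/
theorem le_of_pow_pred_le {b r d : ℕ} (hb : 2 ≤ b) (h : b ^ (r - 1) ≤ d) :
    r ≤ Nat.log 2 d + 1 := by
  have h1 : 2 ^ (r - 1) ≤ d := (Nat.pow_le_pow_left hb _).trans h
  have h2 := Nat.le_log_of_pow_le one_lt_two h1
  omega

theorem le_cost {M : ℕ → ℝ} (h1 : ∀ n, 1 ≤ M n)
    (hM : ∀ n n' : ℕ, 1 ≤ n → n ≤ n' → M n / n ≤ M n' / n') {n : ℕ} (hn : 1 ≤ n) :
    (n : ℝ) ≤ M n := by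
  have h := one_le_div h1 hM hn
  rwa [one_le_div₀ (by exact_mod_cast hn)] at h

/-- The factor `(r + 1) ^ 3` is at most polylogarithmic. -/
theorem succ_pow_three_le {b r d : ℕ} (hb : 2 ≤ b) (h : b ^ (r - 1) ≤ d) :
    (((r + 1) ^ 3 : ℕ) : ℝ) ≤ 8 * ((Nat.log 2 d + 1 : ℕ) : ℝ) ^ 3 := by
  have h1 := le_of_pow_pred_le hb h
  have h2 : (r + 1) ^ 3 ≤ (2 * (Nat.log 2 d + 1)) ^ 3 := Nat.pow_le_pow_left (by omega) 3
  calc (((r + 1) ^ 3 : ℕ) : ℝ) ≤ ((2 * (Nat.log 2 d + 1)) ^ 3 : ℕ) := by exact_mod_cast h2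
    _ = _ := by push_cast; ring

/-- For `b = 2` the degree is only known to drop by one in each pass through the loop, so that
`b ^ r` is split as `V * W` with `V = 1` and `W = 2 ^ r`. -/
theorem runsInSoftO_two {S : Subroutines K} {M : ℕ → ℝ} {c : ℕ} {G : ℕ → ℕ} (h1 : ∀ n, 1 ≤ M n)
    (hM : ∀ n n' : ℕ, 1 ≤ n → n ≤ n' → M n / n ≤ M n' / n') (hc : 1 ≤ c)
    (hS : SubSpec True S (fastCost M c) G) :
    RunsInSoftO S 2 fun r d => d * M d + 2 ^ r * (d : ℝ) ^ 2 + M (2 ^ r * d) := by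
  have hU := isCost_fastCost h1 hM hc
  obtain ⟨c₁, hc₁⟩ := hU.exists_mul_le 4
  obtain ⟨c₂, hc₂⟩ := hU.exists_mul_le 6
  refine runsInSoftO_of_spec 4 (C := 5600 * ((1 + G 2) * (2 * c₁ * c) + 4 * c₂ * c + 1)) (B := 1)
    (by positivity) le_rfl fun r d hr hbd => ?_
  have hd1 : 1 ≤ d := (Nat.one_le_two_pow).trans hbd
  have hd1' : (1 : ℝ) ≤ d := by exact_mod_cast hd1
  have hMd := h1 d
  have hMr := h1 (2 ^ r * d)
  have h2r : (1 : ℝ) ≤ 2 ^ r := one_le_pow₀ (by norm_num)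
  set g : ℝ := d * M d + 2 ^ r * (d : ℝ) ^ 2 + M (2 ^ r * d) with hg
  have hdd : (d : ℝ) ^ 2 ≤ 2 ^ r * (d : ℝ) ^ 2 := le_mul_of_one_le_left (by positivity) h2r
  have hg1 : d * M d ≤ g := by
    have : 0 ≤ (d : ℝ) ^ 2 := by positivity
    linarith
  have hg2 : (d : ℝ) ^ 2 ≤ g := by
    have : 0 ≤ d * M d := by positivity
    linarith
  have hg3 : M (2 ^ r * d) ≤ g := by
    have : 0 ≤ d * M d := by positivity
    have : 0 ≤ (d : ℝ) ^ 2 := by positivity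
    linarith
  have hg0 : 0 ≤ g := by linarith
  refine ⟨hg0, by nlinarith, 700 * (r + 1) ^ 3 * ((d / 1 + G 2) * fastCost M c (2 * 2 * d) +
    fastCost M c (6 * 2 ^ r * d) + (d / 1) ^ 2), ?_, fun l m a h0 hl hd ha =>
      (spec_ratSolutions hS hU le_rfl hr one_pos ?_ Nat.one_le_two_pow (one_mul _).symm h0 hl hd hbd
        ha).imp fun _ _ _ _ => trivial⟩
  · rw [Nat.div_one]
    have hr3 := succ_pow_three_le le_rfl hbd
    set L := Nat.log 2 d + 1 with hL
    have hL1 : (1 : ℝ) ≤ (L : ℝ) := by exact_mod_cast Nat.succ_pos _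
    have e1 : (fastCost M c (2 * 2 * d) : ℝ) ≤ 2 * c₁ * c * L * M d := by
      calc (fastCost M c (2 * 2 * d) : ℝ) ≤ c₁ * fastCost M c d := by exact_mod_cast hc₁ d
        _ ≤ c₁ * (2 * c * L * M d) := by
          gcongr
          exact fastCost_le h1 hM c hd1
        _ = _ := by ring
    have e2 : (fastCost M c (6 * 2 ^ r * d) : ℝ) ≤ 4 * c₂ * c * L * M (2 ^ r * d) := by
      have hn : 1 ≤ 2 ^ r * d := Nat.mul_pos (by positivity) hd1
      have hlog : Nat.log 2 (2 ^ r * d) + 1 ≤ 2 * L := by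
        have h2 := le_of_pow_pred_le le_rfl hbd
        refine Nat.log_lt_of_lt_pow (by omega) ?_
        calc 2 ^ r * d < 2 ^ r * 2 ^ L :=
              Nat.mul_lt_mul_of_pos_left (Nat.lt_pow_succ_log_self one_lt_two d) (by positivity)
          _ ≤ 2 ^ L * 2 ^ L := Nat.mul_le_mul_right _ (Nat.pow_le_pow_right two_pos h2)
          _ = 2 ^ (2 * L) := by rw [← pow_add, two_mul]
      calc (fastCost M c (6 * 2 ^ r * d) : ℝ) ≤ c₂ * fastCost M c (2 ^ r * d) := by
            rw [mul_assoc]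
            exact_mod_cast hc₂ _
        _ ≤ c₂ * (2 * c * (Nat.log 2 (2 ^ r * d) + 1 : ℕ) * M (2 ^ r * d)) := by
          gcongr
          exact fastCost_le h1 hM c hn
        _ ≤ c₂ * (2 * c * (2 * L : ℕ) * M (2 ^ r * d)) := by gcongr
        _ = _ := by push_cast; ring
    -- the cost of the Graeffe operator occurs once, and is absorbed into the constant
    have e3 : ((d : ℝ) + G 2) ≤ (1 + G 2) * d := by
      have : (G 2 : ℝ) ≤ G 2 * d := le_mul_of_one_le_right (by positivity) hd1'
      linarith
    push_cast at hr3 ⊢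
    calc 700 * ((r : ℝ) + 1) ^ 3 * ((d + G 2) * fastCost M c (2 * 2 * d) +
          fastCost M c (6 * 2 ^ r * d) + d ^ 2)
        ≤ 700 * (8 * (L : ℝ) ^ 3) * ((1 + G 2) * d * (2 * c₁ * c * L * M d) +
          4 * c₂ * c * L * M (2 ^ r * d) + d ^ 2) := by gcongr
      _ = 700 * (8 * (L : ℝ) ^ 3) * ((1 + G 2) * (2 * c₁ * c) * L * (d * M d) +
          4 * c₂ * c * L * M (2 ^ r * d) + d ^ 2) := by ring
      _ ≤ 700 * (8 * (L : ℝ) ^ 3) * ((1 + G 2) * (2 * c₁ * c) * L * g +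
          4 * c₂ * c * L * g + L * g) := by
        have : (d : ℝ) ^ 2 ≤ L * g := hg2.trans (le_mul_of_one_le_left hg0 hL1)
        gcongr
      _ = _ := by ring
  · have := sum_range_pow_lt le_rfl r
    omega

/-- For `b ≥ 3` the degree drops by at least `b ^ (r - 1)` in each pass through the loop, so that
`b ^ r` is split as `V * W` with `V = b ^ (r - 1)` and `W = b`. -/
theorem runsInSoftO_of_three_le {S : Subroutines K} {M : ℕ → ℝ} {c : ℕ} {G : ℕ → ℕ}
    (h1 : ∀ n, 1 ≤ M n) (hM : ∀ n n' : ℕ, 1 ≤ n → n ≤ n' → M n / n ≤ M n' / n') (hc : 1 ≤ c)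
    (hS : SubSpec True S (fastCost M c) G) {b : ℕ} (hb : 3 ≤ b) :
    RunsInSoftO S b fun r d => d * M d / (b : ℝ) ^ r := by
  have hU := isCost_fastCost h1 hM hc
  have hb2 : 2 ≤ b := by omega
  have hb0 : (0 : ℝ) < b := by exact_mod_cast (by omega : 0 < b)
  obtain ⟨c₁, hc₁⟩ := hU.exists_mul_le (2 * b)
  obtain ⟨c₂, hc₂⟩ := hU.exists_mul_le (6 * b)
  refine runsInSoftO_of_spec 4
    (C := 5600 * ((1 + G b) * b * (2 * c₁ * c) + b * (2 * c₂ * c) + b ^ 2)) (B := b)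
    (by positivity) (by exact_mod_cast (by omega : 1 ≤ b)) fun r d hr hbd => ?_
  obtain ⟨s, rfl⟩ : ∃ s, r = s + 1 := ⟨r - 1, by omega⟩
  rw [Nat.add_sub_cancel] at hbd
  have hV0 : 0 < b ^ s := by positivity
  have hd1 : 1 ≤ d := hV0.trans_le hbd
  have hMd := le_cost h1 hM hd1
  have hMd1 := h1 d
  have hd0 : (0 : ℝ) ≤ d := Nat.cast_nonneg d
  set D : ℝ := d / (b : ℝ) ^ s with hD
  have hD1 : 1 ≤ D := by
    rw [hD, one_le_div₀ (by positivity)]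
    exact_mod_cast hbd
  have hDd : D ≤ d := by
    refine div_le_self hd0 (one_le_pow₀ ?_)
    exact_mod_cast (by omega : 1 ≤ b)
  set g : ℝ := d * M d / (b : ℝ) ^ (s + 1) with hg
  have hgD : b * g = D * M d := by
    rw [hg, hD, pow_succ]
    field_simp
  have hg0 : 0 ≤ g := by positivity
  have hMg : M d ≤ b * g := by
    rw [hgD]
    exact le_mul_of_one_le_left (by linarith) hD1
  refine ⟨hg0, hMd.trans hMg, 700 * (s + 1 + 1) ^ 3 * ((d / b ^ s + G b) *
    fastCost M c (2 * b * d) + fastCost M c (6 * b * d) + (d / b ^ s) ^ 2), ?_,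
      fun l m a h0 hl hd ha =>
      (spec_ratSolutions hS hU hb2 hr hV0 ?_ le_rfl (pow_succ b s) h0 hl hd hbd
        ha).imp fun _ _ _ _ => trivial⟩
  · have hr3 := succ_pow_three_le (r := s + 1) hb2 hbd
    set L := Nat.log 2 d + 1 with hL
    have hL1 : (1 : ℝ) ≤ (L : ℝ) := by exact_mod_cast Nat.succ_pos _
    have key : ∀ {k c' : ℕ}, (∀ n, fastCost M c (k * n) ≤ c' * fastCost M c n) →
        (fastCost M c (k * d) : ℝ) ≤ 2 * c' * c * L * M d := by
      intro k c' h
      calc (fastCost M c (k * d) : ℝ) ≤ c' * fastCost M c d := by exact_mod_cast h d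
        _ ≤ c' * (2 * c * L * M d) := by
          gcongr
          exact fastCost_le h1 hM c hd1
        _ = _ := by ring
    have e1 := key hc₁
    have e2 := key hc₂
    have e3 : ((d / b ^ s : ℕ) : ℝ) ≤ D := by
      refine Nat.cast_div_le.trans ?_
      push_cast
      exact le_rfl
    have e4 : ((d / b ^ s : ℕ) : ℝ) + G b ≤ (1 + G b) * D := by
      have : (G b : ℝ) ≤ G b * D := le_mul_of_one_le_right (by positivity) hD1
      linarith
    have e5 : D ^ 2 ≤ b * g := by
      rw [hgD, pow_two]
      exact mul_le_mul_of_nonneg_left (hDd.trans hMd) (by linarith)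
    set q : ℕ := d / b ^ s with hq
    push_cast at hr3 ⊢
    calc 700 * ((s : ℝ) + 1 + 1) ^ 3 * ((q + G b) * fastCost M c (2 * b * d) +
          fastCost M c (6 * b * d) + q ^ 2)
        ≤ 700 * (8 * (L : ℝ) ^ 3) * ((1 + G b) * D * (2 * c₁ * c * L * M d) +
          2 * c₂ * c * L * M d + D ^ 2) := by gcongr
      _ = 700 * (8 * (L : ℝ) ^ 3) * ((1 + G b) * (2 * c₁ * c) * L * (D * M d) +
          2 * c₂ * c * L * M d + D ^ 2) := by ring
      _ ≤ 700 * (8 * (L : ℝ) ^ 3) * ((1 + G b) * (2 * c₁ * c) * L * (b * g) +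
          2 * c₂ * c * L * (b * g) + L * (b ^ 2 * g)) := by
        have h6 : b * g ≤ (b : ℝ) ^ 2 * g := by
          have : (1 : ℝ) ≤ b := by exact_mod_cast (by omega : 1 ≤ b)
          have := mul_le_mul_of_nonneg_right this (by positivity : 0 ≤ b * g)
          linarith
        have h7 : D ^ 2 ≤ L * (b ^ 2 * g) :=
          (e5.trans h6).trans (le_mul_of_one_le_left (by positivity) hL1)
        rw [← hgD]
        gcongr
      _ = _ := by ring
  · have h2 := sum_range_pow_lt hb2 s
    rw [Finset.sum_range_succ, pow_succ]
    have h3 := Nat.mul_le_mul_left (b ^ s) hb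
    omega

/-- Consequence for a quasi-linear multiplication, in radix two. -/
theorem RunsInSoftO.of_softLinear_two {S : Subroutines K} {M : ℕ → ℝ} (h1 : ∀ n, 1 ≤ M n)
    {C : ℝ} {e : ℕ} (hC : ∀ n : ℕ, 1 ≤ n → M n ≤ soft C e n)
    (h : RunsInSoftO S 2 fun r d => d * M d + 2 ^ r * (d : ℝ) ^ 2 + M (2 ^ r * d)) :
    RunsInSoftO S 2 fun r d => 2 ^ r * (d : ℝ) ^ 2 := by
  refine h.trans (2 * |C| + 1) e fun r d hr hbd => ?_
  have hd1 : 1 ≤ d := (Nat.one_le_two_pow).trans hbd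
  have hd1' : (1 : ℝ) ≤ d := by exact_mod_cast hd1
  have h2r : (1 : ℝ) ≤ 2 ^ r := one_le_pow₀ (by norm_num)
  have hMd := h1 d
  have hMr := h1 (2 ^ r * d)
  set g : ℝ := 2 ^ r * (d : ℝ) ^ 2 with hg
  have hg0 : 0 ≤ g := by positivity
  have hrd : 2 ^ r * (d : ℝ) ≤ g := by
    rw [hg, pow_two, ← mul_assoc]
    exact le_mul_of_one_le_right (by positivity) hd1'
  have hdr : (d : ℝ) ≤ 2 ^ r * d := le_mul_of_one_le_left (by positivity) h2r
  have hdd : (d : ℝ) * d ≤ g := by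
    rw [hg, pow_two]
    exact le_mul_of_one_le_left (by positivity) h2r
  refine ⟨by positivity, hg0, ?_⟩
  have hl := one_le_log hg0
  have hl1 : ∀ n : ℕ, (n : ℝ) ≤ g → 1 ≤ n → M n ≤ |C| * n * Real.log (3 + g) ^ e := by
    intro n hn hn1
    refine ((hC n hn1).trans (soft_le_abs C e (Nat.cast_nonneg n))).trans ?_
    have := one_le_log (Nat.cast_nonneg (α := ℝ) n)
    unfold soft
    gcongr
  have e1 := hl1 d (hdr.trans hrd) hd1
  have e2 := hl1 (2 ^ r * d) (by push_cast; exact hrd) (Nat.mul_pos (by positivity) hd1)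
  push_cast at e2
  have e3 : (1 : ℝ) ≤ Real.log (3 + g) ^ e := one_le_pow₀ hl
  set P := Real.log (3 + g) ^ e with hP
  calc d * M d + g + M (2 ^ r * d) ≤ d * (|C| * d * P) + g * P + |C| * (2 ^ r * d) * P := by
        gcongr
        exact le_mul_of_one_le_right hg0 e3
    _ = |C| * (d * d) * P + g * P + |C| * (2 ^ r * d) * P := by ring
    _ ≤ |C| * g * P + g * P + |C| * g * P := by gcongr
    _ = soft (2 * |C| + 1) e g := by
      unfold soft
      ring

/-- Since `2 ^ r ≤ 2 * d`. -/
theorem RunsInSoftO.cubic {S : Subroutines K}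
    (h : RunsInSoftO S 2 fun r d => 2 ^ r * (d : ℝ) ^ 2) :
    RunsInSoftO S 2 fun _ d => (d : ℝ) ^ 3 := by
  refine h.trans 2 0 fun r d hr hbd => ⟨by positivity, by positivity, ?_⟩
  have h2 : (2 : ℝ) ^ r ≤ 2 * d := by
    obtain ⟨s, rfl⟩ : ∃ s, r = s + 1 := ⟨r - 1, by omega⟩
    have : (2 : ℝ) ^ s ≤ d := by exact_mod_cast hbd
    rw [pow_succ]
    linarith
  calc (2 : ℝ) ^ r * (d : ℝ) ^ 2 ≤ 2 * d * (d : ℝ) ^ 2 := by gcongr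
    _ = soft 2 0 ((d : ℝ) ^ 3) := by
      unfold soft
      ring

/-- Consequence for a quasi-linear multiplication, in radix at least three. -/
theorem RunsInSoftO.of_softLinear_three_le {S : Subroutines K} {M : ℕ → ℝ} (h1 : ∀ n, 1 ≤ M n)
    {C : ℝ} {e : ℕ} (hC : ∀ n : ℕ, 1 ≤ n → M n ≤ soft C e n) {b : ℕ} (hb : 3 ≤ b)
    (h : RunsInSoftO S b fun r d => d * M d / (b : ℝ) ^ r) :
    RunsInSoftO S b fun r d => (d : ℝ) ^ 2 / (b : ℝ) ^ r := by
  have hb1 : (1 : ℝ) ≤ b := by exact_mod_cast (by omega : 1 ≤ b)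
  refine h.trans (|C| * (1 + Real.log b) ^ e) e fun r d hr hbd => ?_
  obtain ⟨s, rfl⟩ : ∃ s, r = s + 1 := ⟨r - 1, by omega⟩
  rw [Nat.add_sub_cancel] at hbd
  have hd1 : 1 ≤ d := (Nat.pow_pos (by omega : 0 < b)).trans_le hbd
  have hMd := h1 d
  set g : ℝ := (d : ℝ) ^ 2 / (b : ℝ) ^ (s + 1) with hg
  have hg0 : 0 ≤ g := by positivity
  have hdg : (d : ℝ) ≤ b * g := by
    have h2 : (b : ℝ) ^ s ≤ d := by exact_mod_cast hbd
    have h3 : b * g = d * (d / (b : ℝ) ^ s) := by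
      rw [hg, pow_succ]
      field_simp
      ring
    rw [h3]
    refine le_mul_of_one_le_right (by positivity) ?_
    rwa [one_le_div₀ (by positivity)]
  refine ⟨by positivity, hg0, ?_⟩
  have hl := log_le_mul_log hb1 (Nat.cast_nonneg d) hg0 hdg
  have hl1 := one_le_log (Nat.cast_nonneg (α := ℝ) d)
  calc d * M d / (b : ℝ) ^ (s + 1)
      ≤ d * (|C| * d * ((1 + Real.log b) * Real.log (3 + g)) ^ e) / (b : ℝ) ^ (s + 1) := by
        have : M d ≤ |C| * d * ((1 + Real.log b) * Real.log (3 + g)) ^ e := by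
          refine ((hC d hd1).trans (soft_le_abs C e (Nat.cast_nonneg d))).trans ?_
          unfold soft
          gcongr
        gcongr
    _ = soft (|C| * (1 + Real.log b) ^ e) e g := by
      unfold soft
      rw [hg, mul_pow]
      ring

end Complexity

/-! ### Correctness -/

/-- Here the bound for the cost is void, so that the parameters `d`, `V`, `W` only have to satisfy
the hypotheses of `spec_ratSolutions`. -/
theorem ratSolutions_correct {K : Type*} [Field K] [CharZero K] [DecidableEq K] {S : Subroutines K}
    (hS : S.Correct) {b r : ℕ} {l : Fin (r + 1) → K[X]} {m : List K} {a : Fin (r + 1) → List ℕ}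
    (hb : 2 ≤ b) (hr : 1 ≤ r) (h0 : l 0 ≠ 0) (hl : l (Fin.last r) ≠ 0)
    (ha : ∀ k, HoldsPoly m (a k) (l k)) :
    (ratSolutions S b r (List.ofFn a)).Yields m fun out m' _ => HoldsSolutionBasis b l m' out := by
  have hU : IsCost fun n => n := ⟨fun _ _ => le_rfl, fun _ => le_rfl, 2, fun _ => le_rfl⟩
  set d := b ^ (r - 1) + ∑ k, (l k).natDegree with hd
  have hV : 1 + ∑ i ∈ Finset.range r, b ^ i ≤ b ^ r := by
    have := sum_range_pow_lt hb r
    omega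
  have hdk : ∀ k, (l k).natDegree ≤ d := fun k =>
    (Finset.single_le_sum (f := fun k => (l k).natDegree) (fun _ _ => Nat.zero_le _)
      (Finset.mem_univ k)).trans (Nat.le_add_left _ _)
  exact (spec_ratSolutions (hS.subSpec _ fun _ => 0) hU hb hr one_pos hV
    (Nat.one_le_pow _ _ (by omega)) (one_mul _).symm h0 hl hdk (Nat.le_add_right _ _)
    ha).yields.imp fun _ _ _ h => h.1

end MahlerEq

theorem mainTheorem1 {K : Type*} [Field K] [CharZero K] [DecidableEq K] :
    -- correctness, whatever the subroutines
    (∀ S : MahlerEq.Subroutines K, S.Correct →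
      ∀ (b r : ℕ) (l : Fin (r + 1) → K[X]) (m : List K) (a : Fin (r + 1) → List ℕ),
        2 ≤ b → 1 ≤ r → l 0 ≠ 0 → l (Fin.last r) ≠ 0 →
        (∀ k, MahlerEq.HoldsPoly m (a k) (l k)) →
        (MahlerEq.ratSolutions S b r (List.ofFn a)).Yields m
          fun out m' _ => MahlerEq.HoldsSolutionBasis b l m' out) ∧
    -- complexity, relative to a multiplication algorithm of cost `M`
    (∀ (mul : List ℕ → List ℕ → MahlerEq.Prog K (List ℕ)) (M : ℕ → ℝ),
      MahlerEq.MultipliesIn mul M →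
      M =O[Filter.atTop] (fun n => (n : ℝ) ^ 2) →
      (∀ n n' : ℕ, 1 ≤ n → n ≤ n' → M n / n ≤ M n' / n') →
      ∃ S : MahlerEq.Subroutines K, S.Correct ∧
        MahlerEq.RunsInSoftO S 2
          (fun r d => d * M d + 2 ^ r * (d : ℝ) ^ 2 + M (2 ^ r * d)) ∧
        (∀ b : ℕ, 3 ≤ b → MahlerEq.RunsInSoftO S b (fun r d => d * M d / (b : ℝ) ^ r)) ∧
        ((∃ (C : ℝ) (e : ℕ), ∀ n : ℕ, 1 ≤ n → M n ≤ MahlerEq.soft C e n) →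
          MahlerEq.RunsInSoftO S 2 (fun r d => 2 ^ r * (d : ℝ) ^ 2) ∧
          MahlerEq.RunsInSoftO S 2 (fun _ d => (d : ℝ) ^ 3) ∧
          ∀ b : ℕ, 3 ≤ b → MahlerEq.RunsInSoftO S b (fun r d => (d : ℝ) ^ 2 / (b : ℝ) ^ r))) := by
  refine ⟨fun S hS b r l m a hb hr h0 hl ha => MahlerEq.ratSolutions_correct hS hb hr h0 hl ha,
    fun mul M hmul _ hM => ?_⟩
  have h1 := hmul.one_le
  obtain ⟨S, c, G, hc, hS⟩ := MahlerEq.exists_fast_subroutines hmul hM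
  have h2 := MahlerEq.runsInSoftO_two h1 hM hc hS
  have h3 := fun (b : ℕ) (hb : 3 ≤ b) => MahlerEq.runsInSoftO_of_three_le h1 hM hc hS hb
  refine ⟨S, hS.correct, h2, h3, ?_⟩
  rintro ⟨C, e, hC⟩
  have h4 := h2.of_softLinear_two h1 hC
  exact ⟨h4, h4.cubic, fun b hb => (h3 b hb).of_softLinear_three_le h1 hC hb⟩
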